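/- Notation. $x\in\mathbb R^2$, $\langle a\rangle=(1+|a|^2)^{1/2}$, $\langle\nabla\rangle=(1-\Delta_x)^{1/2}$, $H^s=\langle\nabla\rangle^{-s}L^2(\mathbb R^2)$. Greek indices run over $0,1,2$, $\partial_0=\partial_t$, repeated indices are summed, indices are raised with $\mathrm{diag}(1,-1,-1)$, and $\epsilon_{\mu\nu\rho}$ is skew-symmetric with $\epsilon_{012}=1$. For a sign $\pm$ and $s,b\in\mathbb R$, $X_\pm^{s,b}$ is the completion of the Schwartz space on $\mathbb R^{1+2}$ in the norm $\|\langle\xi\rangle^s\langle-\tau\pm|\xi|\rangle^b\,\widetilde u(\tau,\xi)\|_{L^2_{\tau,\xi}}$, where $\widetilde u$ is the space-time Fourier transform, and $X_\pm^{s,b}(I)$ is the space of restrictions to $I\times\mathbb R^2$ of elements of $X_\pm^{s,b}$. Let $\kappa\ne0$ be a real constant, $V$ a real polynomial and $I\subset\mathbb R$ a bounded interval; $C(I;H^s)$ denotes the space of bounded continuous functions $I\to H^s$ (boundedness is automatic if $I$ is compact). Given $\phi_\pm,A_{\mu,\pm}$ put $$A_\mu=A_{\mu,+}+A_{\mu,-},\qquad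 \phi=\phi_++\phi_-,\qquad \partial_t\phi=i\langle\nabla\rangle(\phi_+-\phi_-),$$ $$M_\mu=\tfrac1\kappa\left(-\epsilon_{\mu\nu\rho}\,\mathrm{Im}\left(\partial^\nu\overline\phi\,\partial^\rho\phi-\partial^\rho\overline\phi\,\partial^\nu\phi\right)+2\epsilon_{\mu\nu\rho}\,\partial^\nu(A^\rho|\phi|^2)\right)+A_\mu,$$ $$N=2iA_\mu\partial^\mu\phi+A_\mu A^\mu\phi-\phi V'(|\phi|^2)+\phi .$$ Proposition. There is an absolute constant $\varepsilon_0>0$ such that the following holds for all $\kappa,V,I$ as above. Suppose that $\phi_\pm\in C(I;H^1)$ and $A_{\mu,\pm}\in C(I;H^{1/2})$ solve, in the sense of distributions on $I\times\mathbb R^2$, the half-wave form of the Chern–Simons–Higgs system in the Lorenz gauge, $$(i\partial_t\pm\langle\nabla\rangle)A_{\mu,\pm}=\pm\tfrac12\langle\nabla\rangle^{-1}M_\mu,\qquad (i\partial_t\pm\langle\nabla\rangle)\phi_\pm=\pm\tfrac12\langle\nabla\rangle^{-1}N,\qquad \partial^\mu A_\mu=0 .$$ Then, for every $0<\varepsilon<\varepsilon_0$,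 $$\phi_\pm\in X_\pm^{3/4+\varepsilon,\,3/4-\varepsilon}(I)\quad\text{and}\quad A_{\mu,\pm}\in X_\pm^{1/4+\varepsilon,\,3/4-\varepsilon}(I)\qquad(\mu=0,1,2).$$ -/

import Mathlib

open MeasureTheory FourierTransform LineDeriv
open scoped SchwartzMap ComplexConjugate

noncomputable section

namespace ChernSimonsHiggs

/-- Physical space `ℝ²` (and its frequency space). -/
abbrev Plane : Type := EuclideanSpace ℝ (Fin 2)

/-- Space-time `ℝ^{1+2}` (and its frequency space); coordinate `0` is time (or time frequency),
coordinates `1, 2` are space (or space frequency). -/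
abbrev Spacetime : Type := EuclideanSpace ℝ (Fin 3)

/-- Complex-valued `L²(ℝ²)`. -/
abbrev L2 : Type := Lp ℂ 2 (volume : Measure Plane)

/-- The space-time point `(t, x)`. -/
def point (t : ℝ) (x : Plane) : Spacetime := !₂[t, x 0, x 1]

/-- The space part `(y₁, y₂)` of `y = (y₀, y₁, y₂)`. -/
def spacePart (y : Spacetime) : Plane := !₂[y 1, y 2]

/-- `⟨a⟩ ^ r`, where `⟨a⟩ = (1 + a²)^{1/2}`. -/
def bracketPow (a r : ℝ) : ℝ := (1 + a ^ 2) ^ (r / 2)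

/-- The symbol `⟨ξ⟩^r` of `⟨∇⟩^r = (1 - Δ)^{r/2}`. Mathlib's Fourier transform has the kernel
`exp(-2πi x·ξ)`, so the classical frequency is `2π` times Mathlib's frequency variable. -/
def japaneseSymbol (r : ℝ) (ξ : Plane) : ℂ := (bracketPow (2 * Real.pi * ‖ξ‖) r : ℝ)

/-- The symbol of the partial derivative `∂_j` on `ℝ²`. -/
def derivSymbol (j : Fin 2) (ξ : Plane) : ℂ := 2 * Real.pi * Complex.I * (ξ j : ℝ)

/-- `u ∈ L²` is in the domain of the Fourier multiplier with symbol `m`. -/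
def InDomain (m : Plane → ℂ) (u : L2) : Prop :=
  MemLp (fun ξ => m ξ * (𝓕 u : L2) ξ) 2 volume

open Classical in
/-- The Fourier multiplier with symbol `m`, as an unbounded operator on `L²(ℝ²)`
(with the value `0` outside its domain). -/
def multiplier (m : Plane → ℂ) (u : L2) : L2 :=
  if h : InDomain m u then 𝓕⁻ (h.toLp _ : L2) else 0

/-- `u ∈ C(I; H^s)`, `s ≥ 0`, with `sup_{t ∈ I} ‖u(t)‖_{H^s} < ∞` (automatic if `I` is compact);
the norm of `H^s` is `‖⟨∇⟩^s u‖_{L²}`. -/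
def IsContSobolev (s : ℝ) (I : Set ℝ) (u : ℝ → L2) : Prop :=
  (∀ t ∈ I, InDomain (japaneseSymbol s) (u t)) ∧
  ContinuousOn (fun t => multiplier (japaneseSymbol s) (u t)) I ∧
  ∃ C : ℝ, ∀ t ∈ I, ‖multiplier (japaneseSymbol s) (u t)‖ ≤ C

/-- Test functions on `I × ℝ²`: Schwartz functions on `ℝ^{1+2}` that vanish unless the time is in
some compact subset of the interior of `I`. (Compact support in space is not asked for, so that
`⟨∇⟩^r` maps test functions to test functions.) -/
def IsTest (I : Set ℝ) (θ : 𝓢(Spacetime, ℂ)) : Prop :=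
  ∃ K : Set ℝ, IsCompact K ∧ K ⊆ interior I ∧ ∀ y : Spacetime, y 0 ∉ K → θ y = 0

/-- The partial derivative `∂_μ θ` of a Schwartz function, `μ = 0, 1, 2`, with `∂_0 = ∂_t`. -/
def partialDeriv (μ : Fin 3) (θ : 𝓢(Spacetime, ℂ)) : 𝓢(Spacetime, ℂ) :=
  ∂_{(EuclideanSpace.single μ (1 : ℝ) : Spacetime)} θ

/-- The symbol of `⟨∇⟩^r` on space-time, which only depends on the space frequency. -/
def spacetimeSymbol (r : ℝ) (y : Spacetime) : ℂ := japaneseSymbol r (spacePart y)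

/-- `⟨∇⟩^r θ` for a Schwartz function `θ` of `(t, x)`, where `⟨∇⟩ = (1 - Δ_x)^{1/2}`. -/
def japanese (r : ℝ) (θ : 𝓢(Spacetime, ℂ)) : 𝓢(Spacetime, ℂ) :=
  SchwartzMap.fourierMultiplierCLM ℂ (spacetimeSymbol r) θ

/-- The symbol is smooth of temperate growth, so `japanese` really is the Fourier multiplier. -/
theorem spacetimeSymbol_hasTemperateGrowth (r : ℝ) :
    (spacetimeSymbol r).HasTemperateGrowth := by
  let L : Spacetime →L[ℝ] Plane :=
    LinearMap.toContinuousLinearMap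
      { toFun := fun y => (2 * Real.pi) • spacePart y
        map_add' := by
          intro a b; ext i; fin_cases i <;> simp [spacePart] <;> ring
        map_smul' := by
          intro c a; ext i; fin_cases i <;> simp [spacePart] <;> ring }
  have h := (Function.hasTemperateGrowth_one_add_norm_sq_rpow Plane (r / 2)).comp
    L.hasTemperateGrowth
  have h2 : spacetimeSymbol r =
      (fun a : ℝ => (a : ℂ)) ∘ ((fun x : Plane => (1 + ‖x‖ ^ 2) ^ (r / 2)) ∘ L) := by
    ext y
    have hL : ‖L y‖ = 2 * Real.pi * ‖spacePart y‖ := by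
      change ‖(2 * Real.pi) • spacePart y‖ = _
      rw [norm_smul, Real.norm_of_nonneg (by positivity)]
    simp [spacetimeSymbol, japaneseSymbol, bracketPow, hL]
  rw [h2]
  exact Complex.ofRealCLM.hasTemperateGrowth.comp h

/-- The diagonal of the Minkowski metric `diag(1, -1, -1)`: `∂^μ = metric μ ∂_μ` and
`A^μ = metric μ A_μ`. -/
def metric (μ : Fin 3) : ℝ := ![1, -1, -1] μ

/-- The skew-symmetric symbol `ε_{μνρ}` with `ε_{012} = 1`. -/
def leviCivita (μ ν ρ : Fin 3) : ℝ :=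
  ((ν : ℝ) - (μ : ℝ)) * ((ρ : ℝ) - (μ : ℝ)) * ((ρ : ℝ) - (ν : ℝ)) / 2

/-- `u = u_+ + u_-`; the two signs are the elements `1` and `-1` of `ℤˣ`. -/
def total (u : ℤˣ → ℝ → L2) (t : ℝ) : L2 := u 1 t + u (-1) t

/-- `∂_μ φ` in terms of `φ_±`: `∂_t φ = i⟨∇⟩(φ_+ - φ_-)` and `∂_j φ = ∂_j (φ_+ + φ_-)`. -/
def fieldDeriv (φ : ℤˣ → ℝ → L2) (μ : Fin 3) (t : ℝ) : L2 :=
  ![Complex.I • multiplier (japaneseSymbol 1) (φ 1 t - φ (-1) t),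
    multiplier (derivSymbol 0) (total φ t),
    multiplier (derivSymbol 1) (total φ t)] μ

/-- The null form `Q^{νρ}(φ̄, φ) = ∂^ν φ̄ ∂^ρ φ - ∂^ρ φ̄ ∂^ν φ` at time `t`. -/
def nullForm (φ : ℤˣ → ℝ → L2) (ν ρ : Fin 3) (t : ℝ) (x : Plane) : ℂ :=
  metric ν * metric ρ *
    (conj (fieldDeriv φ ν t x) * fieldDeriv φ ρ t x
      - conj (fieldDeriv φ ρ t x) * fieldDeriv φ ν t x)

/-- The pairing of the distribution
`M_μ = κ⁻¹ (-ε_{μνρ} Im Q^{νρ}(φ̄, φ) + 2 ε_{μνρ} ∂^ν (A^ρ |φ|²)) + A_μ` on `I × ℝ²` with a test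
function `θ`; the outer derivative `∂^ν` is moved to `θ`. -/
def pairM (κ : ℝ) (I : Set ℝ) (φ : ℤˣ → ℝ → L2) (A : Fin 3 → ℤˣ → ℝ → L2) (μ : Fin 3)
    (θ : 𝓢(Spacetime, ℂ)) : ℂ :=
  ∫ t in I, ∫ x : Plane,
    ((κ⁻¹ : ℝ) *
      ((-∑ ν, ∑ ρ, (leviCivita μ ν ρ : ℂ) * ((nullForm φ ν ρ t x).im : ℂ)) * θ (point t x)
        - 2 * ∑ ν, ∑ ρ, (leviCivita μ ν ρ : ℂ) *
            ((metric ρ * total (A ρ) t x * (‖total φ t x‖ ^ 2 : ℝ)) *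
              (metric ν * partialDeriv ν θ (point t x))))
      + total (A μ) t x * θ (point t x))

/-- The function `N = 2i A_μ ∂^μ φ + A_μ A^μ φ - φ V'(|φ|²) + φ` at time `t`. -/
def sourceN (V : Polynomial ℝ) (φ : ℤˣ → ℝ → L2) (A : Fin 3 → ℤˣ → ℝ → L2)
    (t : ℝ) (x : Plane) : ℂ :=
  2 * Complex.I * ∑ μ, total (A μ) t x * (metric μ * fieldDeriv φ μ t x)
    + (∑ μ, total (A μ) t x * (metric μ * total (A μ) t x)) * total φ t x
    - total φ t x * (V.derivative.eval (‖total φ t x‖ ^ 2) : ℝ)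
    + total φ t x

/-- The pairing of a function `u(t, x)` on `I × ℝ²` with a test function. -/
def pairing (I : Set ℝ) (u : ℝ → Plane → ℂ) (θ : 𝓢(Spacetime, ℂ)) : ℂ :=
  ∫ t in I, ∫ x : Plane, u t x * θ (point t x)

/-- The half-wave operator `i∂_t + σ⟨∇⟩`, `σ = ±1`, applied to `u` in the sense of distributions
on `I × ℝ²`, paired with `θ`: the transpose of `i∂_t` is `-i∂_t`, and `⟨∇⟩` is its own
transpose because its symbol is even. -/
def pairHalfWave (σ : ℤˣ) (I : Set ℝ) (u : ℝ → L2) (θ : 𝓢(Spacetime, ℂ)) : ℂ :=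
  pairing I (fun t x => u t x) (-(Complex.I • partialDeriv 0 θ) + ((σ : ℤ) : ℂ) • japanese 1 θ)

/-- `(φ_±, A_{μ,±})` solves, on `I × ℝ²` in the sense of distributions, the half-wave form
`(i∂_t ± ⟨∇⟩) A_{μ,±} = ±½ ⟨∇⟩⁻¹ M_μ`, `(i∂_t ± ⟨∇⟩) φ_± = ±½ ⟨∇⟩⁻¹ N`
of the Chern-Simons-Higgs system in the Lorenz gauge `∂^μ A_μ = 0`. -/
structure IsSolution (κ : ℝ) (V : Polynomial ℝ) (I : Set ℝ)
    (φ : ℤˣ → ℝ → L2) (A : Fin 3 → ℤˣ → ℝ → L2) : Prop where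
  potential_eq : ∀ (μ : Fin 3) (σ : ℤˣ) (θ : 𝓢(Spacetime, ℂ)), IsTest I θ →
    pairHalfWave σ I (A μ σ) θ = ((σ : ℤ) : ℂ) * (1 / 2) * pairM κ I φ A μ (japanese (-1) θ)
  higgs_eq : ∀ (σ : ℤˣ) (θ : 𝓢(Spacetime, ℂ)), IsTest I θ →
    pairHalfWave σ I (φ σ) θ =
      ((σ : ℤ) : ℂ) * (1 / 2) * pairing I (sourceN V φ A) (japanese (-1) θ)
  lorenz : ∀ θ : 𝓢(Spacetime, ℂ), IsTest I θ →
    ∑ μ, (metric μ : ℂ) * pairing I (fun t x => total (A μ) t x) (partialDeriv μ θ) = 0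

/-- The weight `⟨ξ⟩^s ⟨-τ + σ|ξ|⟩^b` at the classical frequency `(τ, ξ) = 2π y`. -/
def bourgainWeight (σ : ℤˣ) (s b : ℝ) (y : Spacetime) : ℝ :=
  bracketPow (2 * Real.pi * ‖spacePart y‖) s *
    bracketPow (-(2 * Real.pi * y 0) + ((σ : ℤ) : ℝ) * (2 * Real.pi * ‖spacePart y‖)) b

/-- `v ∈ X_σ^{s,b}(ℝ^{1+2})`: the space-time Fourier transform of the tempered distribution `v` is
a function `g` with `⟨ξ⟩^s ⟨-τ + σ|ξ|⟩^b g ∈ L²`. As the weight and its inverse are polynomially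
bounded, this is the completion of the Schwartz space in the `X_σ^{s,b}` norm. -/
def MemBourgain (σ : ℤˣ) (s b : ℝ) (v : 𝓢'(Spacetime, ℂ)) : Prop :=
  ∃ g : Spacetime → ℂ,
    MemLp (fun y => (bourgainWeight σ s b y : ℂ) * g y) 2 volume ∧
    ∀ ψ : 𝓢(Spacetime, ℂ), (𝓕 v) ψ = ∫ y, g y * ψ y

/-- `u ∈ X_σ^{s,b}(I)`: some `v ∈ X_σ^{s,b}` agrees with `u` on `I × ℝ²`. -/
def MemBourgainOn (σ : ℤˣ) (s b : ℝ) (I : Set ℝ) (u : ℝ → L2) : Prop :=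
  ∃ v : 𝓢'(Spacetime, ℂ), MemBourgain σ s b v ∧
    ∀ θ : 𝓢(Spacetime, ℂ), IsTest I θ → v θ = pairing I (fun t x => u t x) θ

end ChernSimonsHiggs

end

open MeasureTheory FourierTransform LineDeriv
open scoped SchwartzMap ComplexConjugate

noncomputable section

namespace ChernSimonsHiggs

open Set Filter Topology
open scoped ENNReal NNReal ContDiff

/-! The bridge from Sobolev to Bourgain regularity is interpolation. Suppose w is bounded in time
with values in H^α and its forcing, the defect in the half-wave equation, lies in L²(I; H^β). After
a time cutoff w lies in both X^{α,0} and X^{β,1}, hence in X^{s,b} whenever s ≤ (1-b)α + bβ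
(`isBourgain_of_halfWave`). For s and b near 3/4 and α = 1 this asks for β > 2/3, that is N in
H^{-1/3+}; for the potential, with s near 1/4 and α = 1/2, it asks for β > 1/6, that is M in
H^{-5/6+}. Sobolev multiplication (`product_law`) only puts N in H^{-1/2-} and M in H^{-1-}. In both
equations one sixth of a derivative is missing, and null structure supplies it.

In M the null forms are explicit. In N they come from the gauge condition. Put B_{jμ} = ⟨∇⟩⁻²∂_j
A_μ, so that A_μ = ⟨∇⟩⁻²A_μ - Σ_j ∂_j B_{jμ}. The Lorenz condition gives ∂^μ B_{jμ} = 0, and A_μ∂^μφ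
becomes a smoother term plus null forms of B in H^{3/2} and φ in H^1 (`derivN_eq`).

All estimates are made on the spatial Fourier side, where for almost every frequency a field is a
primitive in time. Let ξ be the output frequency and η, ξ-η the input frequencies. A parameter p ≤ 1
separates two regions.

In the region ⟨η⟩ ≤ 8⟨ξ⟩^{1/p}, free oscillation is removed from the half-waves (`exists_profile`).
The output at a fixed ξ is then an oscillatory integral in η with phase t f(η), f = σ|η| + σ'|ξ-η|,
and an amplitude that varies slowly in t. Plancherel in time and Cauchy-Schwarz in η
(`oscillatory_lintegral_le`) reduce the bound to integrals of the squared symbol over neighbourhoods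
of width L of the level sets of f. The squared null symbol is essentially |η|²|ξ-η|² times the angle
defect (`enorm_nullSym_sq_le`), and the angle defect is, up to sign, exactly the radial derivative
of f. A substitution along rays therefore gives at most πL (`lintegral_resonance_ray`). Here L is
the κ-th power of a bound for the input frequencies, where κ is the number of derivatives by which
the forcing is worse than the field. The outcome is `bilinear_low`.

In the complementary region both inputs are large, comparable, and interact to a small output. There
a null form can move a derivative to the output: Q_{jk} has symbol proportional to η_j ξ_k - η_k
ξ_j, and Q_{0k}(u,v) = ∂_t(u ∂_k v) - ∂_k(u ∂_t v). The total time derivative ∂_t Z is not estimated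
as forcing. It is removed by subtracting a multiple of ⟨∇⟩⁻¹Z from the solution, and this correction
lies in the Bourgain space by itself (`isBourgain_of_splits`). The dichotomy is recorded by
`Splits`, and `nullBil_splits` combines both regions.

The argument is a bootstrap in two passes. The crude product bounds give the loss κ = 51/100. The
null form estimate for N then yields N in L²H^{-3/8}, so that the loss for φ drops to κ = 3/8, which
is small enough for the null forms in M. The numerical choices are in `nullExp_higgs`,
`nullExp_current`, `splitExp_higgs` and `splitExp_potential`. -/

/-! ### The Japanese bracket -/

/-- `⟨2πη⟩`. -/
def jb (η : Plane) : ℝ := Real.sqrt (1 + (2 * Real.pi * ‖η‖) ^ 2)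

theorem jb_sq (η : Plane) : jb η ^ 2 = 1 + (2 * Real.pi * ‖η‖) ^ 2 :=
  Real.sq_sqrt (by positivity)

theorem one_le_jb (η : Plane) : 1 ≤ jb η :=
  Real.one_le_sqrt.2 (by nlinarith [sq_nonneg (2 * Real.pi * ‖η‖)])

theorem jb_pos (η : Plane) : 0 < jb η := lt_of_lt_of_le one_pos (one_le_jb η)

theorem two_pi_norm_le_jb (η : Plane) : 2 * Real.pi * ‖η‖ ≤ jb η :=
  Real.le_sqrt_of_sq_le (by linarith)

theorem norm_le_jb (η : Plane) : ‖η‖ ≤ jb η := by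
  have h := two_pi_norm_le_jb η
  nlinarith [Real.pi_gt_three, norm_nonneg η]

@[simp] theorem jb_neg (η : Plane) : jb (-η) = jb η := by simp [jb]

theorem jb_sub_le (η ζ : Plane) : jb (η - ζ) ≤ jb η + jb ζ := by
  have h1 := norm_sub_le η ζ
  have ha := two_pi_norm_le_jb η
  have hb := two_pi_norm_le_jb ζ
  have hp := Real.pi_pos
  refine Real.sqrt_le_iff.2 ⟨by linarith [jb_pos η, jb_pos ζ], ?_⟩
  have h2 : (2 * Real.pi * ‖η - ζ‖) ^ 2 ≤ (2 * Real.pi * ‖η‖ + 2 * Real.pi * ‖ζ‖) ^ 2 := by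
    apply pow_le_pow_left₀ (by positivity)
    nlinarith
  have h3 : (2 * Real.pi * ‖η‖) * (2 * Real.pi * ‖ζ‖) ≤ jb η * jb ζ :=
    mul_le_mul ha hb (by positivity) (jb_pos η).le
  nlinarith [jb_sq η, jb_sq ζ]

theorem jb_le_add_sub (ξ η : Plane) : jb ξ ≤ jb η + jb (ξ - η) := by
  have := jb_sub_le η (η - ξ)
  rw [← jb_neg (ξ - η)]
  simpa using this

theorem jb_le_add_sub' (ξ η : Plane) : jb η ≤ jb ξ + jb (ξ - η) := by
  have := jb_sub_le ξ (ξ - η)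
  simpa using this

@[fun_prop] theorem continuous_jb : Continuous jb := by
  unfold jb; fun_prop

@[fun_prop] theorem measurable_jb : Measurable jb := continuous_jb.measurable

theorem bracketPow_eq (η : Plane) (r : ℝ) : bracketPow (2 * Real.pi * ‖η‖) r = jb η ^ r := by
  rw [bracketPow, jb, Real.sqrt_eq_rpow, ← Real.rpow_mul (by positivity)]
  congr 1; ring

/-- `⟨2πη⟩ ^ s` with values in `ℝ≥0∞`. -/
def jw (s : ℝ) (η : Plane) : ℝ≥0∞ := ENNReal.ofReal (jb η ^ s)

@[fun_prop] theorem measurable_jw (s : ℝ) : Measurable (jw s) := by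
  unfold jw; fun_prop

theorem jw_add (s t : ℝ) (η : Plane) : jw (s + t) η = jw s η * jw t η := by
  rw [jw, jw, jw, ← ENNReal.ofReal_mul (Real.rpow_nonneg (jb_pos η).le _),
    ← Real.rpow_add (jb_pos η)]

@[simp] theorem jw_zero (η : Plane) : jw 0 η = 1 := by simp [jw]

theorem jw_neg_mul (s : ℝ) (η : Plane) : jw (-s) η * jw s η = 1 := by
  rw [← jw_add]; simp

theorem jw_mul_neg (s : ℝ) (η : Plane) : jw s η * jw (-s) η = 1 := by
  rw [← jw_add]; simp

theorem jw_mono {s t : ℝ} (h : s ≤ t) (η : Plane) : jw s η ≤ jw t η :=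
  ENNReal.ofReal_le_ofReal (Real.rpow_le_rpow_of_exponent_le (one_le_jb η) h)

theorem jw_ne_top (s : ℝ) (η : Plane) : jw s η ≠ ⊤ := ENNReal.ofReal_ne_top

theorem jw_sq (s : ℝ) (η : Plane) : jw s η ^ 2 = jw (2 * s) η := by
  rw [sq, ← jw_add, two_mul]

/-- The threshold is the dimension of the plane. As q is negative, the factor 2π in the bracket only
makes the weight smaller. -/
theorem lintegral_jw_lt_top {q : ℝ} (hq : q < -2) : ∫⁻ η, jw q η < ⊤ := by
  have h := integrable_rpow_neg_one_add_norm_sq (E := Plane) (μ := volume) (r := -q)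
    (by simp; linarith)
  refine lt_of_le_of_lt (lintegral_mono fun η => ?_) h.lintegral_lt_top
  apply ENNReal.ofReal_le_ofReal
  have h1 : (1 + ‖η‖ ^ 2) ^ (-(-q) / 2) = (Real.sqrt (1 + ‖η‖ ^ 2)) ^ q := by
    rw [Real.sqrt_eq_rpow, ← Real.rpow_mul (by positivity)]; congr 1; ring
  rw [h1]
  apply Real.rpow_le_rpow_of_nonpos (by positivity) _ (by linarith)
  apply Real.sqrt_le_sqrt
  rw [mul_pow]
  have h2 : 1 ≤ (2 * Real.pi) ^ 2 := by nlinarith [Real.pi_gt_three]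
  nlinarith [sq_nonneg ‖η‖]

/-! ### Bilinear Cauchy-Schwarz estimates -/

theorem lintegral_mul_sq_le {α : Type*} [MeasurableSpace α] (μ : Measure α) {f g : α → ℝ≥0∞}
    (hf : AEMeasurable f μ) (hg : AEMeasurable g μ) :
    (∫⁻ a, f a * g a ∂μ) ^ 2 ≤ (∫⁻ a, f a ^ 2 ∂μ) * ∫⁻ a, g a ^ 2 ∂μ := by
  have h := ENNReal.lintegral_mul_le_Lp_mul_Lq μ (Real.HolderConjugate.two_two) hf hg
  have h2 := pow_le_pow_left' h 2
  simp only [Pi.mul_apply] at h2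
  refine h2.trans (le_of_eq ?_)
  rw [mul_pow, ← ENNReal.rpow_natCast, ← ENNReal.rpow_natCast, ← ENNReal.rpow_mul,
    ← ENNReal.rpow_mul]
  norm_num

/-- The bilinear integral with kernel `k`. -/
def lbil (k : Plane → Plane → ℝ≥0∞) (f g : Plane → ℝ≥0∞) (ξ : Plane) : ℝ≥0∞ :=
  ∫⁻ η, k ξ η * f η * g (ξ - η)

theorem measurable_lbil {k : Plane → Plane → ℝ≥0∞} (hk : Measurable (Function.uncurry k))
    {f g : Plane → ℝ≥0∞} (hf : Measurable f) (hg : Measurable g) : Measurable (lbil k f g) := by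
  unfold lbil
  refine Measurable.lintegral_prod_right' (f := fun p : Plane × Plane =>
    k p.1 p.2 * f p.2 * g (p.1 - p.2)) ?_
  have : Measurable fun p : Plane × Plane => k p.1 p.2 := hk
  fun_prop

/-- Cauchy-Schwarz in η isolates the kernel; what remains, f(η) g(ξ-η), has a squared integral that
factors by translation. This form suits kernels that decay in an input variable. -/
theorem lintegral_lbil_sq_le_of_fst {k : Plane → Plane → ℝ≥0∞}
    (hk : Measurable (Function.uncurry k)) {f g : Plane → ℝ≥0∞} (hf : Measurable f)
    (hg : Measurable g) {C : ℝ≥0∞} (hC : ∀ ξ, ∫⁻ η, k ξ η ^ 2 ≤ C) :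
    ∫⁻ ξ, lbil k f g ξ ^ 2 ≤ C * (∫⁻ η, f η ^ 2) * ∫⁻ η, g η ^ 2 := by
  have hk' : Measurable fun p : Plane × Plane => k p.1 p.2 := hk
  have h1 : ∀ ξ, lbil k f g ξ ^ 2 ≤ C * ∫⁻ η, (f η * g (ξ - η)) ^ 2 := by
    intro ξ
    have hkx : Measurable (k ξ) := hk'.comp (measurable_const.prodMk measurable_id)
    calc lbil k f g ξ ^ 2 = (∫⁻ η, k ξ η * (f η * g (ξ - η))) ^ 2 := by
          simp only [lbil, mul_assoc]
      _ ≤ _ := lintegral_mul_sq_le _ hkx.aemeasurable (by fun_prop)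
      _ ≤ _ := by gcongr; exact hC ξ
  calc ∫⁻ ξ, lbil k f g ξ ^ 2 ≤ ∫⁻ ξ, C * ∫⁻ η, (f η * g (ξ - η)) ^ 2 := lintegral_mono h1
    _ = C * ∫⁻ ξ, ∫⁻ η, (f η * g (ξ - η)) ^ 2 := by
        rw [lintegral_const_mul]
        refine Measurable.lintegral_prod_right' (f := fun p : Plane × Plane =>
          (f p.2 * g (p.1 - p.2)) ^ 2) (by fun_prop)
    _ = C * ∫⁻ η, ∫⁻ ξ, (f η * g (ξ - η)) ^ 2 := by
        rw [lintegral_lintegral_swap]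
        exact Measurable.aemeasurable (f := fun p : Plane × Plane =>
          (f p.2 * g (p.1 - p.2)) ^ 2) (by fun_prop)
    _ = C * ∫⁻ η, f η ^ 2 * ∫⁻ ξ, g ξ ^ 2 := by
        congr 1; apply lintegral_congr; intro η
        simp_rw [mul_pow]
        rw [lintegral_const_mul _ (by fun_prop),
          lintegral_sub_right_eq_self (fun ξ => g ξ ^ 2) η]
    _ = _ := by rw [lintegral_mul_const _ (by fun_prop), mul_assoc]

/-- Here Cauchy-Schwarz keeps the kernel together with f and isolates g, so that the kernel needs to
be square integrable only in the output variable. -/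
theorem lintegral_lbil_sq_le_of_snd {k : Plane → Plane → ℝ≥0∞}
    (hk : Measurable (Function.uncurry k)) {f g : Plane → ℝ≥0∞} (hf : Measurable f)
    (hg : Measurable g) {C : ℝ≥0∞} (hC : ∀ η, ∫⁻ ξ, k ξ η ^ 2 ≤ C) :
    ∫⁻ ξ, lbil k f g ξ ^ 2 ≤ C * (∫⁻ η, f η ^ 2) * ∫⁻ η, g η ^ 2 := by
  have hk' : Measurable fun p : Plane × Plane => k p.1 p.2 := hk
  have h1 : ∀ ξ, lbil k f g ξ ^ 2 ≤ (∫⁻ η, (k ξ η * f η) ^ 2) * ∫⁻ η, g η ^ 2 := by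
    intro ξ
    have hkx : Measurable (k ξ) := hk'.comp (measurable_const.prodMk measurable_id)
    refine (lintegral_mul_sq_le _ (hkx.mul hf).aemeasurable (by fun_prop)).trans (le_of_eq ?_)
    rw [lintegral_sub_left_eq_self (fun η => g η ^ 2) ξ]; rfl
  calc ∫⁻ ξ, lbil k f g ξ ^ 2 ≤ ∫⁻ ξ, (∫⁻ η, (k ξ η * f η) ^ 2) * ∫⁻ η, g η ^ 2 :=
        lintegral_mono h1
    _ = (∫⁻ ξ, ∫⁻ η, (k ξ η * f η) ^ 2) * ∫⁻ η, g η ^ 2 := by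
        rw [lintegral_mul_const]
        exact Measurable.lintegral_prod_right' (f := fun p : Plane × Plane =>
          (k p.1 p.2 * f p.2) ^ 2) (by fun_prop)
    _ = (∫⁻ η, ∫⁻ ξ, (k ξ η * f η) ^ 2) * ∫⁻ η, g η ^ 2 := by
        rw [lintegral_lintegral_swap]
        exact Measurable.aemeasurable (f := fun p : Plane × Plane =>
          (k p.1 p.2 * f p.2) ^ 2) (by fun_prop)
    _ ≤ (∫⁻ η, C * f η ^ 2) * ∫⁻ η, g η ^ 2 := by
        gcongr with η
        simp_rw [mul_pow]
        rw [lintegral_mul_const _ (by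
          have := hk'.comp (measurable_id.prodMk (measurable_const (a := η)))
          exact this.pow_const 2)]
        gcongr
        exact hC η
    _ = _ := by rw [lintegral_const_mul _ (by fun_prop)]

/-! ### Sobolev energies and the product law -/

/-- The square of the `H^s` norm of the function with Fourier transform of modulus `f`. -/
def energy (s : ℝ) (f : Plane → ℝ≥0∞) : ℝ≥0∞ := ∫⁻ η, (jw s η * f η) ^ 2

theorem energy_mono {s t : ℝ} (h : s ≤ t) {f g : Plane → ℝ≥0∞} (hfg : ∀ η, f η ≤ g η) :
    energy s f ≤ energy t g := by
  unfold energy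
  gcongr with η
  · exact jw_mono h η
  · exact hfg η

theorem add_sq_le (a b : ℝ≥0∞) : (a + b) ^ 2 ≤ 2 * (a ^ 2 + b ^ 2) := by
  have := ENNReal.rpow_add_le_mul_rpow_add_rpow a b (p := 2) (by norm_num)
  norm_num at this
  exact this

theorem energy_add_le (s : ℝ) {f g : Plane → ℝ≥0∞} (hf : Measurable f) :
    energy s (fun η => f η + g η) ≤ 2 * (energy s f + energy s g) := by
  unfold energy
  rw [← lintegral_add_left (by fun_prop), ← lintegral_const_mul' _ _ (by simp)]
  gcongr with η
  rw [mul_add]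
  exact add_sq_le _ _

theorem energy_const_mul (s : ℝ) {c : ℝ≥0∞} (hc : c ≠ ⊤) (f : Plane → ℝ≥0∞) :
    energy s (fun η => c * f η) = c ^ 2 * energy s f := by
  unfold energy
  rw [← lintegral_const_mul' _ _ (by simp [hc])]
  congr 1; funext η; ring

theorem energy_jw_mul (s t : ℝ) (f : Plane → ℝ≥0∞) :
    energy s (fun η => jw t η * f η) = energy (s + t) f := by
  unfold energy
  congr 1; funext η; rw [jw_add, mul_assoc]

theorem energy_zero (f : Plane → ℝ≥0∞) : energy 0 f = ∫⁻ η, f η ^ 2 := by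
  simp [energy]

/-- A bilinear operator whose kernel is bounded by `k₀`, measured in Sobolev energies. -/
theorem energy_lbil_le_aux {s₀ s₁ s₂ : ℝ} {k k' : Plane → Plane → ℝ≥0∞}
    (hkk : ∀ ξ η, jw s₀ ξ * k ξ η ≤ k' ξ η * jw s₁ η * jw s₂ (ξ - η))
    (f g : Plane → ℝ≥0∞) :
    energy s₀ (lbil k f g) ≤
      ∫⁻ ξ, lbil k' (fun η => jw s₁ η * f η) (fun η => jw s₂ η * g η) ξ ^ 2 := by
  refine lintegral_mono fun ξ => pow_le_pow_left' ?_ 2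
  unfold lbil
  rw [← lintegral_const_mul' _ _ (jw_ne_top _ _)]
  refine lintegral_mono fun η => ?_
  calc jw s₀ ξ * (k ξ η * f η * g (ξ - η)) = (jw s₀ ξ * k ξ η) * (f η * g (ξ - η)) := by ring
    _ ≤ (k' ξ η * jw s₁ η * jw s₂ (ξ - η)) * (f η * g (ξ - η)) := mul_le_mul_left (hkk ξ η) _
    _ = _ := by ring

theorem energy_lbil_le_of_snd {s₀ s₁ s₂ : ℝ} {k k' : Plane → Plane → ℝ≥0∞}
    (hk' : Measurable (Function.uncurry k'))
    (hkk : ∀ ξ η, jw s₀ ξ * k ξ η ≤ k' ξ η * jw s₁ η * jw s₂ (ξ - η))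
    {C : ℝ≥0∞} (hC : ∀ η, ∫⁻ ξ, k' ξ η ^ 2 ≤ C)
    {f g : Plane → ℝ≥0∞} (hf : Measurable f) (hg : Measurable g) :
    energy s₀ (lbil k f g) ≤ C * energy s₁ f * energy s₂ g :=
  (energy_lbil_le_aux hkk f g).trans
    (lintegral_lbil_sq_le_of_snd hk' (by fun_prop) (by fun_prop) hC)

/-- The convolution of nonnegative functions. -/
def lconv (f g : Plane → ℝ≥0∞) : Plane → ℝ≥0∞ := lbil (fun _ _ => 1) f g

theorem rpow_le_of_comparable {y z u : ℝ} (hy : 1 ≤ y) (hz : 1 ≤ z) (h1 : y ≤ 2 * z)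
    (h2 : z ≤ 2 * y) : z ^ (-u) ≤ 2 ^ |u| * y ^ (-u) := by
  have hy0 : 0 < y := by linarith
  have hz0 : 0 < z := by linarith
  rcases le_total 0 u with hu | hu
  · rw [abs_of_nonneg hu, Real.rpow_neg hz0.le, Real.rpow_neg hy0.le, ← div_eq_mul_inv,
      le_div_iff₀ (by positivity), inv_mul_le_iff₀ (by positivity), mul_comm,
      ← Real.mul_rpow (by norm_num) hz0.le]
    exact Real.rpow_le_rpow hy0.le h1 hu
  · rw [abs_of_nonpos hu, ← Real.mul_rpow (by norm_num) hy0.le]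
    exact Real.rpow_le_rpow hz0.le h2 (by linarith)

/-- The two longer sides of a triangle are comparable, so their powers merge into one of exponent
-(t+u); as t+u is nonnegative, its base may then be lowered to the shortest side. -/
theorem rpow_triple_le_of_min {x y z s t u : ℝ} (hx : 1 ≤ x) (hxy : x ≤ y) (hxz : x ≤ z)
    (h1 : y ≤ x + z) (h2 : z ≤ x + y) (htu : 0 ≤ t + u) :
    x ^ (-s) * y ^ (-t) * z ^ (-u) ≤ 2 ^ |u| * x ^ (-(s + t + u)) := by
  have hx0 : 0 < x := by linarith
  have hy0 : 0 < y := by linarith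
  have h := rpow_le_of_comparable (u := u) (hx.trans hxy) (hx.trans hxz) (by linarith)
    (by linarith)
  calc x ^ (-s) * y ^ (-t) * z ^ (-u) ≤ x ^ (-s) * y ^ (-t) * (2 ^ |u| * y ^ (-u)) := by gcongr
    _ = 2 ^ |u| * (x ^ (-s) * y ^ (-(t + u))) := by
        rw [neg_add, Real.rpow_add hy0]; ring
    _ ≤ 2 ^ |u| * (x ^ (-s) * x ^ (-(t + u))) := by
        gcongr 2 ^ |u| * (x ^ (-s) * ?_)
        exact Real.rpow_le_rpow_of_nonpos hx0 hxy (by linarith)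
    _ = _ := by rw [← Real.rpow_add hx0]; congr 2; ring

/-- The sum on the right covers the three possibilities for the shortest side. Each of its terms
involves a single frequency, as the Cauchy-Schwarz bounds above require. -/
theorem rpow_triple_le {x y z s t u : ℝ} (hx : 1 ≤ x) (hy : 1 ≤ y) (hz : 1 ≤ z)
    (h1 : x ≤ y + z) (h2 : y ≤ x + z) (h3 : z ≤ x + y) (hst : 0 ≤ s + t) (hsu : 0 ≤ s + u)
    (htu : 0 ≤ t + u) :
    x ^ (-s) * y ^ (-t) * z ^ (-u) ≤ 2 ^ (|t| + |u|) *
      (x ^ (-(s + t + u)) + y ^ (-(s + t + u)) + z ^ (-(s + t + u))) := by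
  have p1 : (0:ℝ) ≤ x ^ (-(s + t + u)) := by positivity
  have p2 : (0:ℝ) ≤ y ^ (-(s + t + u)) := by positivity
  have p3 : (0:ℝ) ≤ z ^ (-(s + t + u)) := by positivity
  have q1 : (2:ℝ) ^ |t| ≤ 2 ^ (|t| + |u|) :=
    Real.rpow_le_rpow_of_exponent_le (by norm_num) (by linarith [abs_nonneg u])
  have q2 : (2:ℝ) ^ |u| ≤ 2 ^ (|t| + |u|) :=
    Real.rpow_le_rpow_of_exponent_le (by norm_num) (by linarith [abs_nonneg t])
  have q3 : (0:ℝ) ≤ 2 ^ (|t| + |u|) := by positivity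
  by_cases c1 : x ≤ y ∧ x ≤ z
  · have h := rpow_triple_le_of_min (s := s) (t := t) (u := u) hx c1.1 c1.2 h2 h3 htu
    refine h.trans ?_
    gcongr
    linarith
  · by_cases c2 : y ≤ x ∧ y ≤ z
    · have h := rpow_triple_le_of_min (s := t) (t := s) (u := u) hy c2.1 c2.2 h1
        (by linarith) hsu
      rw [show t + s + u = s + t + u by ring] at h
      calc _ = y ^ (-t) * x ^ (-s) * z ^ (-u) := by ring
        _ ≤ _ := h
        _ ≤ _ := by gcongr; linarith
    · have hzx : z ≤ x := by by_contra hh; push Not at *; grind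
      have hzy : z ≤ y := by by_contra hh; push Not at *; grind
      have h := rpow_triple_le_of_min (s := u) (t := s) (u := t) hz hzx hzy (by linarith)
        (by linarith) hst
      rw [show u + s + t = s + t + u by ring] at h
      calc _ = z ^ (-u) * x ^ (-s) * y ^ (-t) := by ring
        _ ≤ _ := h
        _ ≤ _ := by gcongr; linarith

theorem lbil_add_kernel {k k' : Plane → Plane → ℝ≥0∞} (hk : Measurable (Function.uncurry k))
    {f g : Plane → ℝ≥0∞} (hf : Measurable f) (hg : Measurable g) (ξ : Plane) :
    lbil (fun ξ η => k ξ η + k' ξ η) f g ξ = lbil k f g ξ + lbil k' f g ξ := by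
  unfold lbil
  have hkx : Measurable (k ξ) := hk.comp (measurable_const.prodMk measurable_id)
  rw [← lintegral_add_left (by fun_prop)]
  congr 1; funext η; ring

/-- Sobolev product law `H^{s₁} · H^{s₂} → H^{-s₀}` on the plane. -/
theorem product_law {s₀ s₁ s₂ : ℝ} (h01 : 0 ≤ s₀ + s₁) (h02 : 0 ≤ s₀ + s₂) (h12 : 0 ≤ s₁ + s₂)
    (h : 1 < s₀ + s₁ + s₂) :
    ∃ C : ℝ≥0∞, C ≠ ⊤ ∧ ∀ f g : Plane → ℝ≥0∞, Measurable f → Measurable g →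
      energy (-s₀) (lconv f g) ≤ C * energy s₁ f * energy s₂ g := by
  set S := s₀ + s₁ + s₂ with hS
  set B : ℝ≥0∞ := ENNReal.ofReal (2 ^ (|s₁| + |s₂|)) with hB
  set A := ∫⁻ η, jw (-(2 * S)) η with hA
  -- This is where S > 1 enters: the exponent -2S lies below -2.
  have hAtop : A ≠ ⊤ := (lintegral_jw_lt_top (by linarith)).ne
  -- One kernel for each frequency that may be the smallest: the output for `k1`, one of the inputs
  -- for `k2` and `k3`.
  let k1 : Plane → Plane → ℝ≥0∞ := fun ξ _ => B * jw (-S) ξ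
  let k2 : Plane → Plane → ℝ≥0∞ := fun _ η => B * jw (-S) η
  let k3 : Plane → Plane → ℝ≥0∞ := fun ξ η => B * jw (-S) (ξ - η)
  have m1 : Measurable (Function.uncurry k1) := by
    simp only [k1, Function.uncurry_def]; fun_prop
  have m2 : Measurable (Function.uncurry k2) := by
    simp only [k2, Function.uncurry_def]; fun_prop
  have m3 : Measurable (Function.uncurry k3) := by
    simp only [k3, Function.uncurry_def]; fun_prop
  have hsq : ∀ η, (B * jw (-S) η) ^ 2 = B ^ 2 * jw (-(2 * S)) η := by
    intro η; rw [mul_pow, jw_sq]; congr 2; ring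
  have hBtop : B ^ 2 ≠ ⊤ := by simp [hB]
  have i1 : ∀ η, ∫⁻ ξ, k1 ξ η ^ 2 ≤ B ^ 2 * A := by
    intro η; simp only [k1, hsq]; rw [lintegral_const_mul' _ _ hBtop]
  have i2 : ∀ ξ, ∫⁻ η, k2 ξ η ^ 2 ≤ B ^ 2 * A := by
    intro η; simp only [k2, hsq]; rw [lintegral_const_mul' _ _ hBtop]
  have i3 : ∀ ξ, ∫⁻ η, k3 ξ η ^ 2 ≤ B ^ 2 * A := by
    intro ξ; simp only [k3, hsq]; rw [lintegral_const_mul' _ _ hBtop,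
      lintegral_sub_left_eq_self (fun η => jw (-(2 * S)) η) ξ]
  -- The constant is 2 + 4 + 4, from squaring a sum of three terms by two uses of `add_sq_le`.
  refine ⟨10 * (B ^ 2 * A), by finiteness, fun f g hf hg => ?_⟩
  have hpt : ∀ ξ η, jw (-s₀) ξ * 1 ≤
      (k1 ξ η + (k2 ξ η + k3 ξ η)) * jw s₁ η * jw s₂ (ξ - η) := by
    intro ξ η
    have hr := rpow_triple_le (s := s₀) (t := s₁) (u := s₂) (one_le_jb ξ) (one_le_jb η)
      (one_le_jb (ξ - η)) (jb_le_add_sub ξ η) (jb_le_add_sub' ξ η)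
      (by have := jb_sub_le ξ η; linarith) h01 h02 h12
    have he := ENNReal.ofReal_le_ofReal hr
    have pos : ∀ (r : ℝ) (ζ : Plane), 0 ≤ jb ζ ^ r := fun r ζ => Real.rpow_nonneg (jb_pos ζ).le r
    rw [ENNReal.ofReal_mul (mul_nonneg (pos _ _) (pos _ _)), ENNReal.ofReal_mul (pos _ _),
      ENNReal.ofReal_mul (by positivity), ENNReal.ofReal_add (add_nonneg (pos _ _) (pos _ _))
      (pos _ _), ENNReal.ofReal_add (pos _ _) (pos _ _)] at he
    calc jw (-s₀) ξ * 1 = (jw (-s₀) ξ * jw (-s₁) η * jw (-s₂) (ξ - η)) *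
          (jw s₁ η * jw s₂ (ξ - η)) := by
          rw [show jw (-s₀) ξ * jw (-s₁) η * jw (-s₂) (ξ - η) * (jw s₁ η * jw s₂ (ξ - η)) =
            jw (-s₀) ξ * (jw (-s₁) η * jw s₁ η) * (jw (-s₂) (ξ - η) * jw s₂ (ξ - η)) by ring,
            jw_neg_mul, jw_neg_mul]; ring
      _ ≤ _ := mul_le_mul_left he _
      _ = _ := by simp only [k1, k2, k3, hB, jw, hS]; ring
  refine (energy_lbil_le_aux (k := fun _ _ => 1) hpt f g).trans ?_
  set F := fun η => jw s₁ η * f η with hF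
  set G := fun η => jw s₂ η * g η with hG
  have mF : Measurable F := by fun_prop
  have mG : Measurable G := by fun_prop
  have e1 := lintegral_lbil_sq_le_of_snd m1 mF mG i1
  have e2 := lintegral_lbil_sq_le_of_fst m2 mF mG i2
  have e3 := lintegral_lbil_sq_le_of_fst m3 mF mG i3
  have l1 := measurable_lbil m1 mF mG
  have l2 := measurable_lbil m2 mF mG
  have l3 := measurable_lbil m3 mF mG
  calc ∫⁻ ξ, lbil (fun ξ η => k1 ξ η + (k2 ξ η + k3 ξ η)) F G ξ ^ 2
      ≤ ∫⁻ ξ, (2 * lbil k1 F G ξ ^ 2 + (4 * lbil k2 F G ξ ^ 2 + 4 * lbil k3 F G ξ ^ 2)) := by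
        gcongr with ξ
        rw [lbil_add_kernel m1 mF mG, lbil_add_kernel m2 mF mG]
        refine (add_sq_le _ _).trans ?_
        rw [mul_add]
        gcongr
        calc 2 * (lbil k2 F G ξ + lbil k3 F G ξ) ^ 2
            ≤ 2 * (2 * (lbil k2 F G ξ ^ 2 + lbil k3 F G ξ ^ 2)) := by
              gcongr; exact add_sq_le _ _
          _ = _ := by ring
    _ = 2 * (∫⁻ ξ, lbil k1 F G ξ ^ 2) + (4 * (∫⁻ ξ, lbil k2 F G ξ ^ 2) +
          4 * ∫⁻ ξ, lbil k3 F G ξ ^ 2) := by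
        rw [lintegral_add_left (by fun_prop), lintegral_add_left (by fun_prop),
          lintegral_const_mul _ (by fun_prop), lintegral_const_mul _ (by fun_prop),
          lintegral_const_mul _ (by fun_prop)]
    _ ≤ 2 * (B ^ 2 * A * (∫⁻ η, F η ^ 2) * ∫⁻ η, G η ^ 2) +
          (4 * (B ^ 2 * A * (∫⁻ η, F η ^ 2) * ∫⁻ η, G η ^ 2) +
          4 * (B ^ 2 * A * (∫⁻ η, F η ^ 2) * ∫⁻ η, G η ^ 2)) := by gcongr
    _ ≤ _ := by
        apply le_of_eq
        change _ = 10 * (B ^ 2 * A) * (∫⁻ η, F η ^ 2) * ∫⁻ η, G η ^ 2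
        ring

/-! ### The Fourier transform of integrable and of square integrable functions -/

section Fourier

variable {E : Type*} [NormedAddCommGroup E] [InnerProductSpace ℝ E] [FiniteDimensional ℝ E]
  [MeasurableSpace E] [BorelSpace E]

theorem integral_fourier_Lp_mul (u : Lp ℂ 2 (volume : Measure E)) (ψ : 𝓢(E, ℂ)) :
    ∫ η, (𝓕 u : Lp ℂ 2 (volume : Measure E)) η * ψ η = ∫ x, u x * 𝓕 (ψ : E → ℂ) x := by
  have h := congrArg (fun T => T ψ) (Lp.fourier_toTemperedDistribution_eq u)
  simp only [TemperedDistribution.fourier_apply, Lp.toTemperedDistribution_apply,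
    smul_eq_mul] at h
  rw [← SchwartzMap.fourier_coe]
  simpa only [mul_comm] using h.symm

theorem integral_fourier_mul {h : E → ℂ} (hh : Integrable h) {g : E → ℂ} (hg : Integrable g) :
    ∫ η, 𝓕 h η * g η = ∫ x, h x * 𝓕 g x := by
  have := VectorFourier.integral_fourierIntegral_smul_eq_flip (L := innerₗ E)
    Real.continuous_fourierChar continuous_inner hh hg
  simpa using! this

theorem ae_eq_of_integral_mul_schwartz {f g : E → ℂ} (hf : LocallyIntegrable f)
    (hg : LocallyIntegrable g) (h : ∀ ψ : 𝓢(E, ℂ), HasCompactSupport ψ →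
      ∫ x, f x * ψ x = ∫ x, g x * ψ x) : f =ᵐ[volume] g := by
  refine ae_eq_of_integral_contDiff_smul_eq hf hg fun χ h1 h2 => ?_
  have hg₁ : HasCompactSupport (Complex.ofRealCLM ∘ χ) := h2.comp_left rfl
  have hg₂ : ContDiff ℝ ∞ (Complex.ofRealCLM ∘ χ) := by fun_prop
  have := h (hg₁.toSchwartzMap hg₂) hg₁
  simpa [mul_comm] using this

/-- The transform on L² is an extension by continuity, the other one an integral; both satisfy the
multiplication formula against Schwartz functions, which identifies them. -/
theorem fourier_toLp_ae_eq {h : E → ℂ} (h1 : Integrable h) (h2 : MemLp h 2) :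
    (𝓕 (h2.toLp h) : Lp ℂ 2 (volume : Measure E)) =ᵐ[volume] 𝓕 h := by
  refine ae_eq_of_integral_mul_schwartz ((Lp.memLp _).locallyIntegrable (by norm_num))
    (Continuous.locallyIntegrable
      (VectorFourier.fourierIntegral_continuous Real.continuous_fourierChar continuous_inner h1))
    fun ψ _ => ?_
  rw [integral_fourier_Lp_mul, integral_fourier_mul h1 ψ.integrable]
  refine integral_congr_ae ?_
  filter_upwards [h2.coeFn_toLp] with x hx
  rw [hx]

theorem lintegral_enorm_sq_eq_norm_sq (u : Lp ℂ 2 (volume : Measure E)) :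
    ∫⁻ x, ‖u x‖ₑ ^ 2 = ‖u‖ₑ ^ 2 := by
  rw [Lp.enorm_def, eLpNorm_eq_lintegral_rpow_enorm_toReal (by norm_num) (by norm_num)]
  simp only [ENNReal.toReal_ofNat, ENNReal.rpow_ofNat, one_div]
  rw [← ENNReal.rpow_natCast, ← ENNReal.rpow_mul]
  norm_num

theorem lintegral_fourier_Lp_sq (u : Lp ℂ 2 (volume : Measure E)) :
    ∫⁻ x, ‖(𝓕 u : Lp ℂ 2 (volume : Measure E)) x‖ₑ ^ 2 = ∫⁻ x, ‖u x‖ₑ ^ 2 := by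
  rw [lintegral_enorm_sq_eq_norm_sq, lintegral_enorm_sq_eq_norm_sq]
  simp only [enorm_eq_nnnorm, ← norm_toNNReal, Lp.norm_fourier_eq]

theorem lintegral_fourier_sq {h : E → ℂ} (h1 : Integrable h) (h2 : MemLp h 2) :
    ∫⁻ x, ‖𝓕 h x‖ₑ ^ 2 = ∫⁻ x, ‖h x‖ₑ ^ 2 := by
  calc _ = ∫⁻ x, ‖(𝓕 (h2.toLp h) : Lp ℂ 2 (volume : Measure E)) x‖ₑ ^ 2 := by
        refine lintegral_congr_ae ?_
        filter_upwards [fourier_toLp_ae_eq h1 h2] with x hx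
        rw [hx]
    _ = ∫⁻ x, ‖h2.toLp h x‖ₑ ^ 2 := lintegral_fourier_Lp_sq _
    _ = _ := by
        refine lintegral_congr_ae ?_
        filter_upwards [h2.coeFn_toLp] with x hx
        rw [hx]

theorem memLp_two_iff_lintegral {f : E → ℂ} (hf : AEStronglyMeasurable f volume) :
    MemLp f 2 ↔ ∫⁻ x, ‖f x‖ₑ ^ 2 < ⊤ := by
  have h : MemLp f 2 ↔ eLpNorm f 2 volume < ⊤ := ⟨fun h => h.2, fun h => ⟨hf, h⟩⟩
  rw [h, eLpNorm_eq_lintegral_rpow_enorm_toReal (by norm_num) (by norm_num)]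
  simp only [ENNReal.toReal_ofNat, ENNReal.rpow_ofNat]
  rw [ENNReal.rpow_lt_top_iff_of_pos (by norm_num)]

/-- An integrable function whose Fourier transform is square integrable is square integrable. -/
theorem memLp_two_of_fourier {h : E → ℂ} (h1 : Integrable h) (h2 : MemLp (𝓕 h) 2) :
    MemLp h 2 := by
  set w : Lp ℂ 2 (volume : Measure E) := 𝓕⁻ (h2.toLp _) with hw
  have hw' : (𝓕 w : Lp ℂ 2 (volume : Measure E)) = h2.toLp _ :=
    FourierTransform.fourier_fourierInv_eq _
  have : h =ᵐ[volume] w := by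
    refine ae_eq_of_integral_mul_schwartz h1.locallyIntegrable
      ((Lp.memLp _).locallyIntegrable (by norm_num)) fun ψ _ => ?_
    -- Writing the test function as a Fourier transform moves the comparison of `h` and `w` to the
    -- frequency side, where they agree by construction.
    have e : ∀ x, ψ x = 𝓕 ((𝓕⁻ ψ : 𝓢(E, ℂ)) : E → ℂ) x := by
      intro x
      rw [← SchwartzMap.fourier_coe, FourierTransform.fourier_fourierInv_eq]
    simp_rw [e]
    rw [← integral_fourier_Lp_mul, ← integral_fourier_mul h1 (SchwartzMap.integrable _), hw']
    refine integral_congr_ae ?_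
    filter_upwards [h2.coeFn_toLp] with x hx
    rw [hx]
  exact (memLp_congr_ae this).2 (Lp.memLp w)

theorem integral_mul_Lp_eq (u v : Lp ℂ 2 (volume : Measure E)) :
    ∫ x, u x * v x = inner ℂ (star u) v := by
  rw [L2.inner_def]
  refine integral_congr_ae ?_
  filter_upwards [Lp.coeFn_star u] with x hx
  simp [hx, mul_comm]

theorem continuous_integral_mul_Lp (v : Lp ℂ 2 (volume : Measure E)) :
    Continuous fun u : Lp ℂ 2 (volume : Measure E) => ∫ x, u x * v x := by
  have : ∀ u : Lp ℂ 2 (volume : Measure E), ∫ x, u x * v x = inner ℂ (star v) u := by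
    intro u
    rw [← integral_mul_Lp_eq]
    simp only [mul_comm]
  simp_rw [this]
  fun_prop

/-- The Fourier transform of a product of square integrable functions is a convolution. -/
theorem fourier_mul_Lp (u v : Lp ℂ 2 (volume : Measure E)) (ξ : E) :
    𝓕 (fun x => u x * v x) ξ = ∫ η, (𝓕 u : Lp ℂ 2 (volume : Measure E)) η *
      (𝓕 v : Lp ℂ 2 (volume : Measure E)) (ξ - η) := by
  have hmod : MemLp (fun x => 𝐞 (-inner ℝ x ξ) • v x) 2 := by
    refine (Lp.memLp v).of_le ?_ (ae_of_all _ fun x => by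
      rw [Circle.smul_def, norm_smul, Circle.norm_coe, one_mul])
    refine AEStronglyMeasurable.smul (f := fun x => 𝐞 (-inner ℝ x ξ)) ?_
      (Lp.aestronglyMeasurable v)
    exact (Real.continuous_fourierChar.comp (by fun_prop)).aestronglyMeasurable
  have hrev : MemLp (fun η => (𝓕 v : Lp ℂ 2 (volume : Measure E)) (ξ - η)) 2 :=
    (Lp.memLp (𝓕 v : Lp ℂ 2 (volume : Measure E))).comp_measurePreserving
      (Measure.measurePreserving_sub_left volume ξ)
  have hL : ∀ u : Lp ℂ 2 (volume : Measure E),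
      𝓕 (fun x => u x * v x) ξ = ∫ x, u x * (hmod.toLp _ : Lp ℂ 2 (volume : Measure E)) x := by
    intro u
    rw [Real.fourier_eq]
    refine integral_congr_ae ?_
    filter_upwards [hmod.coeFn_toLp] with x hx
    rw [hx]
    simp only [Circle.smul_def, smul_eq_mul]; ring
  have hR : ∀ u : Lp ℂ 2 (volume : Measure E),
      ∫ η, (𝓕 u : Lp ℂ 2 (volume : Measure E)) η * (𝓕 v : Lp ℂ 2 (volume : Measure E)) (ξ - η) =
      ∫ η, (𝓕 u : Lp ℂ 2 (volume : Measure E)) η *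
        (hrev.toLp _ : Lp ℂ 2 (volume : Measure E)) η := by
    intro u
    refine integral_congr_ae ?_
    filter_upwards [hrev.coeFn_toLp] with x hx
    rw [hx]
  rw [hL, hR]
  -- For fixed v and ξ both sides are continuous in u with respect to the L² norm, so Schwartz
  -- functions u suffice.
  refine DenseRange.induction_on
    (p := fun u => ∫ x, u x * (hmod.toLp _ : Lp ℂ 2 (volume : Measure E)) x =
      ∫ η, (𝓕 u : Lp ℂ 2 (volume : Measure E)) η *
        (hrev.toLp _ : Lp ℂ 2 (volume : Measure E)) η)
    (SchwartzMap.denseRange_toLpCLM (p := 2) (μ := (volume : Measure E)) ENNReal.ofNat_ne_top)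
    u ?_ ?_
  · exact isClosed_eq (continuous_integral_mul_Lp _)
      ((continuous_integral_mul_Lp _).comp (Lp.fourierTransformₗᵢ E ℂ).continuous)
  · intro ψ
    rw [← hR, ← hL]
    simp only [SchwartzMap.toLpCLM_apply, SchwartzMap.toLp_fourier_eq]
    -- The transform of this translate is ψ times the character at ξ, so the left side becomes a
    -- pairing of v with a Fourier transform.
    set ψ' : 𝓢(E, ℂ) := SchwartzMap.compSubConstCLM ℂ ξ (𝓕⁻ ψ) with hψ'
    have e1 : ∀ x, 𝓕 (ψ' : E → ℂ) x = 𝐞 (-inner ℝ x ξ) • ψ x := by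
      intro x
      have e2 : (ψ' : E → ℂ) = fun y => (𝓕⁻ ψ : 𝓢(E, ℂ)) (y - ξ) := rfl
      have e3 : ψ x = 𝓕 ((𝓕⁻ ψ : 𝓢(E, ℂ)) : E → ℂ) x := by
        rw [← SchwartzMap.fourier_coe, FourierTransform.fourier_fourierInv_eq]
      rw [e2, e3, Real.fourier_eq, Real.fourier_eq, ← integral_add_right_eq_self _ ξ]
      simp only [add_sub_cancel_right, inner_add_left, neg_add, AddChar.map_add_eq_mul]
      rw [Circle.smul_def, ← integral_smul]
      refine integral_congr_ae (ae_of_all _ fun y => ?_)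
      simp only [Circle.smul_def, Circle.coe_mul, smul_eq_mul]
      rw [real_inner_comm ξ x]; ring
    have e5 : 𝓕 (fun x => (ψ.toLp 2 : Lp ℂ 2 (volume : Measure E)) x * v x) ξ
        = ∫ x, v x * 𝓕 (ψ' : E → ℂ) x := by
      rw [Real.fourier_eq]
      refine integral_congr_ae ?_
      filter_upwards [ψ.coeFn_toLp 2 volume] with x hx
      rw [hx, e1]
      simp only [Circle.smul_def, smul_eq_mul]; ring
    rw [e5, ← integral_fourier_Lp_mul v ψ', ← integral_sub_left_eq_self _ volume ξ]
    refine integral_congr_ae ?_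
    filter_upwards [(𝓕 ψ : 𝓢(E, ℂ)).coeFn_toLp 2 volume] with x hx
    rw [hx, mul_comm]
    congr 1
    change (𝓕⁻ ψ : 𝓢(E, ℂ)) (ξ - x - ξ) = _
    rw [SchwartzMap.fourierInv_coe, SchwartzMap.fourier_coe, Real.fourierInv_eq_fourier_neg,
      show -(ξ - x - ξ) = x by abel]

end Fourier

/-! ### Primitives of integrable functions -/

/-- `f` is a primitive on `I` of the function `f'`, which is integrable on `I`. -/
def Prim (I : Set ℝ) (f f' : ℝ → ℂ) : Prop :=
  IntegrableOn f' I ∧ ∀ s ∈ I, ∀ t ∈ I, f t - f s = ∫ τ in s..t, f' τ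

theorem intervalIntegral_indicator {I : Set ℝ} (hI : I.OrdConnected) (f : ℝ → ℂ) {s t : ℝ}
    (hs : s ∈ I) (ht : t ∈ I) : ∫ τ in s..t, I.indicator f τ = ∫ τ in s..t, f τ := by
  refine intervalIntegral.integral_congr fun τ hτ => ?_
  rw [indicator_of_mem (hI.uIcc_subset hs ht hτ)]

theorem Prim.integrable_indicator {I : Set ℝ} (hI : I.OrdConnected) {f f' : ℝ → ℂ}
    (h : Prim I f f') : Integrable (I.indicator f') :=
  h.1.integrable_indicator hI.measurableSet

theorem Prim.eq_extension {I : Set ℝ} (hI : I.OrdConnected) {f f' : ℝ → ℂ} (h : Prim I f f')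
    {t₀ t : ℝ} (h₀ : t₀ ∈ I) (ht : t ∈ I) :
    f t = f t₀ + ∫ τ in t₀..t, I.indicator f' τ := by
  rw [intervalIntegral_indicator hI f' h₀ ht, ← h.2 _ h₀ _ ht]; ring

theorem prim_univ_extension {f' : ℝ → ℂ} (hf : Integrable f') (c : ℂ) (t₀ : ℝ) :
    Prim univ (fun t => c + ∫ τ in t₀..t, f' τ) f' := by
  refine ⟨hf.integrableOn, fun s _ t _ => ?_⟩
  rw [add_sub_add_left_eq_sub, intervalIntegral.integral_interval_sub_left] <;>
    exact hf.intervalIntegrable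

theorem Prim.continuous {f f' : ℝ → ℂ} (h : Prim univ f f') : Continuous f := by
  have : f = fun t => f 0 + ∫ τ in (0 : ℝ)..t, f' τ := by
    ext t; rw [← h.2 0 (mem_univ _) t (mem_univ _)]; ring
  rw [this]
  exact continuous_const.add (intervalIntegral.continuous_primitive
    (fun a b => (integrableOn_univ.1 h.1).intervalIntegrable) 0)

theorem Prim.bounded {f f' : ℝ → ℂ} (h : Prim univ f f') : ∃ C, ∀ t, ‖f t‖ ≤ C := by
  refine ⟨‖f 0‖ + ∫ τ, ‖f' τ‖, fun t => ?_⟩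
  have h1 : f t = f 0 + ∫ τ in (0 : ℝ)..t, f' τ := by
    rw [← h.2 0 (mem_univ _) t (mem_univ _)]; ring
  rw [h1]
  refine (norm_add_le _ _).trans (add_le_add_right ?_ _)
  refine intervalIntegral.norm_integral_le_integral_norm_uIoc.trans ?_
  exact setIntegral_le_integral (integrableOn_univ.1 h.1).norm (ae_of_all _ fun _ => norm_nonneg _)

theorem Prim.mono {I J : Set ℝ} {f f' : ℝ → ℂ} (h : Prim I f f') (hJ : J ⊆ I) : Prim J f f' :=
  ⟨h.1.mono_set hJ, fun s hs t ht => h.2 s (hJ hs) t (hJ ht)⟩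

theorem Prim.congr {I : Set ℝ} (hI : I.OrdConnected) {f f' g g' : ℝ → ℂ} (h : Prim I f f')
    (hf : EqOn f g I) (hf' : f' =ᵐ[volume.restrict I] g') : Prim I g g' := by
  refine ⟨h.1.congr hf', fun s hs t ht => ?_⟩
  rw [← hf hs, ← hf ht, h.2 s hs t ht]
  refine intervalIntegral.integral_congr_ae ?_
  rw [Filter.EventuallyEq, ae_restrict_iff' hI.measurableSet] at hf'
  filter_upwards [hf'] with x hx h2
  exact hx (hI.uIcc_subset hs ht (uIoc_subset_uIcc h2))

theorem IntegrableOn.intervalIntegrable_of_mem {I : Set ℝ} (hI : I.OrdConnected) {f : ℝ → ℂ}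
    (h : IntegrableOn f I) {s t : ℝ} (hs : s ∈ I) (ht : t ∈ I) :
    IntervalIntegrable f volume s t :=
  (h.mono_set (hI.uIcc_subset hs ht)).intervalIntegrable

theorem Prim.add {I : Set ℝ} (hI : I.OrdConnected) {f f' g g' : ℝ → ℂ} (hf : Prim I f f')
    (hg : Prim I g g') : Prim I (f + g) (f' + g') := by
  refine ⟨hf.1.add hg.1, fun s hs t ht => ?_⟩
  simp only [Pi.add_apply]
  rw [intervalIntegral.integral_add (IntegrableOn.intervalIntegrable_of_mem hI hf.1 hs ht)
    (IntegrableOn.intervalIntegrable_of_mem hI hg.1 hs ht), ← hf.2 s hs t ht, ← hg.2 s hs t ht]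
  ring

theorem Prim.const_mul {I : Set ℝ} {f f' : ℝ → ℂ} (hf : Prim I f f') (c : ℂ) :
    Prim I (fun t => c * f t) (fun t => c * f' t) := by
  refine ⟨hf.1.const_mul c, fun s hs t ht => ?_⟩
  rw [intervalIntegral.integral_const_mul, ← hf.2 s hs t ht, mul_sub]

theorem prim_of_hasDerivAt {I : Set ℝ} (hI : I.OrdConnected) {f f' : ℝ → ℂ}
    (hf : ∀ t, HasDerivAt f (f' t) t) (h : IntegrableOn f' I) : Prim I f f' :=
  ⟨h, fun _ hs _ ht => (intervalIntegral.integral_eq_sub_of_hasDerivAt (fun τ _ => hf τ)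
    (IntegrableOn.intervalIntegrable_of_mem hI h hs ht)).symm⟩

/-- Fubini on a square cut along its diagonal. This is integration by parts for primitives of merely
integrable functions. -/
theorem integral_mul_integral_triangle {f g : ℝ → ℂ} (hf : Integrable f) (hg : Integrable g)
    {s t : ℝ} (hst : s ≤ t) :
    (∫ τ in s..t, f τ) * (∫ τ in s..t, g τ) =
      (∫ x in s..t, f x * ∫ y in s..x, g y) + ∫ y in s..t, g y * ∫ x in s..y, f x := by
  set μ := (volume : Measure ℝ).restrict (Ioc s t) with hμ
  have hP : Integrable (fun z : ℝ × ℝ => f z.1 * g z.2) (μ.prod μ) :=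
    hf.restrict.mul_prod hg.restrict
  have hm : MeasurableSet {z : ℝ × ℝ | z.2 ≤ z.1} := measurableSet_le measurable_snd measurable_fst
  rw [intervalIntegral.integral_of_le hst, intervalIntegral.integral_of_le hst,
    intervalIntegral.integral_of_le hst, intervalIntegral.integral_of_le hst,
    ← integral_prod_mul, ← integral_add_compl hm hP]
  congr 1
  · rw [← integral_indicator hm, integral_prod _ (hP.indicator hm)]
    refine setIntegral_congr_fun measurableSet_Ioc fun x hx => ?_
    rw [intervalIntegral.integral_of_le hx.1.le, ← integral_const_mul]
    have : ∀ y, {z : ℝ × ℝ | z.2 ≤ z.1}.indicator (fun z : ℝ × ℝ => f z.1 * g z.2) (x, y) =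
        (Iic x).indicator (fun y => f x * g y) y := by
      intro y; simp [indicator]
    simp_rw [this]
    rw [integral_indicator measurableSet_Iic, hμ, Measure.restrict_restrict measurableSet_Iic]
    congr 2
    ext y; simp only [mem_inter_iff, mem_Iic, mem_Ioc]
    exact ⟨fun h => ⟨h.2.1, h.1⟩, fun h => ⟨h.2, h.1, h.2.trans hx.2⟩⟩
  · rw [← integral_indicator hm.compl, integral_prod_symm _ (hP.indicator hm.compl)]
    refine setIntegral_congr_fun measurableSet_Ioc fun y hy => ?_
    rw [intervalIntegral.integral_of_le hy.1.le, ← integral_const_mul]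
    have : ∀ x, {z : ℝ × ℝ | z.2 ≤ z.1}ᶜ.indicator (fun z : ℝ × ℝ => f z.1 * g z.2) (x, y) =
        (Iio y).indicator (fun x => g y * f x) x := by
      intro x; simp [indicator, mul_comm]
    simp_rw [this]
    rw [integral_indicator measurableSet_Iio, hμ, Measure.restrict_restrict measurableSet_Iio,
      integral_Ioc_eq_integral_Ioo]
    congr 2
    ext x; simp only [mem_inter_iff, mem_Iio, mem_Ioc, mem_Ioo]
    exact ⟨fun h => ⟨h.2.1, h.1⟩, fun h => ⟨h.2, h.1, h.2.le.trans hy.2⟩⟩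

/-- The triangle identity applied to the increments of f and g from a fixed time; the terms with the
values at that time cancel. No pointwise differentiability is used. -/
theorem Prim.mul_univ {f f' g g' : ℝ → ℂ} (hf : Prim univ f f') (hg : Prim univ g g') :
    Prim univ (fun t => f t * g t) (fun t => f' t * g t + f t * g' t) := by
  have hf1 := integrableOn_univ.1 hf.1
  have hg1 := integrableOn_univ.1 hg.1
  obtain ⟨C, hC⟩ := hf.bounded
  obtain ⟨D, hD⟩ := hg.bounded
  have i1 : Integrable (fun t => f' t * g t) :=
    hf1.mul_bdd hg.continuous.aestronglyMeasurable (ae_of_all _ hD)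
  have i2 : Integrable (fun t => f t * g' t) :=
    hg1.bdd_mul hf.continuous.aestronglyMeasurable (ae_of_all _ hC)
  refine ⟨(i1.add i2).integrableOn, ?_⟩
  have key : ∀ s t : ℝ, s ≤ t →
      f t * g t - f s * g s = ∫ τ in s..t, (f' τ * g τ + f τ * g' τ) := by
    intro s t hst
    have e := integral_mul_integral_triangle hf1 hg1 hst
    have ef : ∀ x, ∫ τ in s..x, f' τ = f x - f s := fun x =>
      (hf.2 s (mem_univ _) x (mem_univ _)).symm
    have eg : ∀ x, ∫ τ in s..x, g' τ = g x - g s := fun x =>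
      (hg.2 s (mem_univ _) x (mem_univ _)).symm
    simp only [ef, eg, mul_sub] at e
    rw [intervalIntegral.integral_sub i1.intervalIntegrable
        (hf1.mul_const _).intervalIntegrable,
      intervalIntegral.integral_sub (by simpa only [mul_comm] using i2.intervalIntegrable)
        (hg1.mul_const _).intervalIntegrable, intervalIntegral.integral_mul_const,
      intervalIntegral.integral_mul_const, ef, eg] at e
    rw [intervalIntegral.integral_add i1.intervalIntegrable i2.intervalIntegrable]
    have e2 : ∫ τ in s..t, f τ * g' τ = ∫ τ in s..t, g' τ * f τ := by simp only [mul_comm]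
    rw [e2]
    linear_combination e
  intro s _ t _
  rcases le_total s t with h | h
  · exact key s t h
  · rw [intervalIntegral.integral_symm, ← key t s h]; ring

theorem Prim.mul {I : Set ℝ} (hI : I.OrdConnected) {f f' g g' : ℝ → ℂ} (hf : Prim I f f')
    (hg : Prim I g g') :
    Prim I (fun t => f t * g t) (fun t => f' t * g t + f t * g' t) := by
  rcases I.eq_empty_or_nonempty with rfl | ⟨t₀, h₀⟩
  · exact ⟨by simp, by simp⟩
  have h := (prim_univ_extension (hf.integrable_indicator hI) (f t₀) t₀).mul_univ
    (prim_univ_extension (hg.integrable_indicator hI) (g t₀) t₀)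
  refine (h.mono (subset_univ I)).congr hI (fun t ht => ?_) ?_
  · simp only
    rw [← hf.eq_extension hI h₀ ht, ← hg.eq_extension hI h₀ ht]
  · filter_upwards [ae_restrict_mem hI.measurableSet] with t ht
    rw [← hf.eq_extension hI h₀ ht, ← hg.eq_extension hI h₀ ht, indicator_of_mem ht,
      indicator_of_mem ht]

/-- The product rule for h times an exponential, integrated over [-T, T], where the boundary terms
vanish. -/
theorem Prim.fourier_deriv {h h' : ℝ → ℂ} (H : Prim univ h h') {T : ℝ} (hT : 0 ≤ T)
    (hs : ∀ t, t ∉ Ioc (-T) T → h t = 0) (hs' : ∀ t, t ∉ Ioc (-T) T → h' t = 0) (l : ℝ) :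
    𝓕 h' l = 2 * Real.pi * Complex.I * l * 𝓕 h l := by
  set e : ℝ → ℂ := fun t => Complex.exp (-(2 * Real.pi * Complex.I * l) * t) with he
  have hd : ∀ t, HasDerivAt e (-(2 * Real.pi * Complex.I * l) * e t) t := by
    intro t
    have := ((Complex.ofRealCLM.hasDerivAt (x := t)).const_mul
      (-(2 * Real.pi * Complex.I * l : ℂ))).cexp
    simp only [Complex.ofRealCLM_apply, Complex.ofReal_one, mul_one] at this
    simpa only [he, mul_comm] using this
  have hec : Continuous e := by fun_prop
  have hJ : (Icc (-T) T).OrdConnected := ordConnected_Icc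
  have P := (H.mono (subset_univ (Icc (-T) T))).mul hJ (prim_of_hasDerivAt hJ hd
    ((continuous_const.mul hec).continuousOn.integrableOn_Icc))
  have hTT : -T ≤ T := by linarith
  have e1 := P.2 (-T) (left_mem_Icc.2 hTT) T (right_mem_Icc.2 hTT)
  have hc := H.continuous
  have hz : h (-T) = 0 := hs _ (by simp)
  -- The point T belongs to the half-open interval, so h vanishes there only by continuity from the
  -- right.
  have hz2 : h T = 0 := by
    have : Tendsto h (𝓝[>] T) (𝓝 (h T)) := hc.continuousAt.tendsto.mono_left nhdsWithin_le_nhds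
    refine tendsto_nhds_unique this (tendsto_const_nhds.congr' ?_)
    filter_upwards [self_mem_nhdsWithin] with t ht
    exact (hs t (by simp only [mem_Ioc, not_and, not_le]; intro; exact ht)).symm
  beta_reduce at e1
  rw [hz, hz2, zero_mul, zero_mul, sub_zero, intervalIntegral.integral_of_le hTT] at e1
  have hi : Integrable h' := integrableOn_univ.1 H.1
  have key : ∀ g : ℝ → ℂ, (∀ t, t ∉ Ioc (-T) T → g t = 0) →
      𝓕 g l = ∫ t in Ioc (-T) T, g t * e t := by
    intro g hg
    rw [Real.fourier_real_eq_integral_exp_smul,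
      setIntegral_eq_integral_of_forall_compl_eq_zero (fun t ht => by rw [hg t ht, zero_mul])]
    refine integral_congr_ae (ae_of_all _ fun t => ?_)
    simp only [he, smul_eq_mul]
    rw [mul_comm]; congr 2; push_cast; ring
  rw [key h' hs', key h hs, ← integral_const_mul]
  rw [integral_add] at e1
  · rw [eq_comm, ← sub_eq_zero, ← neg_eq_zero, neg_sub, sub_eq_add_neg, ← integral_neg, e1]
    congr 1
    refine integral_congr_ae (ae_of_all _ fun t => ?_)
    simp only; ring
  · exact (hi.mul_bdd (c := 1) hec.aestronglyMeasurable (ae_of_all _ fun t => by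
      simp [he, Complex.norm_exp])).integrableOn
  · exact ((hc.mul (continuous_const.mul hec)).continuousOn.integrableOn_Icc).mono_set
      Ioc_subset_Icc_self

/-- Plancherel for h and for h'. The factor (2π)² produced by the derivative exceeds 1 and is
dropped. -/
theorem lintegral_fourier_weight_le {h h' : ℝ → ℂ} (H : Prim univ h h') {T : ℝ} (hT : 0 ≤ T)
    (hs : ∀ t, t ∉ Ioc (-T) T → h t = 0) (hs' : ∀ t, t ∉ Ioc (-T) T → h' t = 0) :
    ∫⁻ l, ‖𝓕 h l‖ₑ ^ 2 ≤ ∫⁻ t, ‖h t‖ₑ ^ 2 ∧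
    ∫⁻ l, ENNReal.ofReal (l ^ 2) * ‖𝓕 h l‖ₑ ^ 2 ≤ ∫⁻ t, ‖h' t‖ₑ ^ 2 := by
  have hc := H.continuous
  have hcs : HasCompactSupport h :=
    HasCompactSupport.intro isCompact_Icc fun t ht => hs t fun h => ht (Ioc_subset_Icc_self h)
  have h1 : Integrable h := hc.integrable_of_hasCompactSupport hcs
  have h2 : MemLp h 2 := hc.memLp_of_hasCompactSupport hcs
  refine ⟨(lintegral_fourier_sq h1 h2).le, ?_⟩
  rcases eq_or_ne (∫⁻ t, ‖h' t‖ₑ ^ 2) ⊤ with h3 | h3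
  · rw [h3]; exact le_top
  have hi : Integrable h' := integrableOn_univ.1 H.1
  have h4 : MemLp h' 2 := (memLp_two_iff_lintegral hi.1).2 (lt_top_iff_ne_top.2 h3)
  rw [← lintegral_fourier_sq hi h4]
  refine lintegral_mono fun l => ?_
  rw [H.fourier_deriv hT hs hs', enorm_mul, mul_pow]
  gcongr
  rw [← ofReal_norm, ← ENNReal.ofReal_pow (norm_nonneg _)]
  refine ENNReal.ofReal_le_ofReal ?_
  simp only [norm_mul, Complex.norm_I, Complex.norm_real, Complex.norm_ofNat, mul_one, mul_pow,
    Real.norm_eq_abs, sq_abs]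
  nlinarith [Real.pi_gt_three, sq_nonneg l, sq_nonneg (l * (Real.pi - 1))]

theorem measurable_comp₂ {α β γ δ : Type*} [MeasurableSpace α] [MeasurableSpace β]
    [MeasurableSpace γ] [MeasurableSpace δ] {h : β → γ → δ} (hm : Measurable (Function.uncurry h))
    {f : α → β} {g : α → γ} (hf : Measurable f) (hg : Measurable g) :
    Measurable fun x => h (f x) (g x) :=
  Measurable.comp (g := Function.uncurry h) hm (hf.prodMk hg)

/-! ### Bilinear oscillatory integrals -/

theorem enorm_exp_mul_I (x : ℝ) : ‖Complex.exp (x * Complex.I)‖ₑ = 1 := by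
  rw [← ofReal_norm, Complex.norm_exp_ofReal_mul_I, ENNReal.ofReal_one]

-- By Plancherel the left side is the squared L² norm of l ↦ ∫ K(η) H(l - f(η), η) dη, where H is
-- the transform of h in time. Cauchy-Schwarz with the weight 1 + ((l-f)/L)² gives K the inverse
-- weight, whose integral is at most J, and leaves a weighted norm of H. There the translation in l
-- removes the phase, and the weight turns into h and L⁻¹h'. Thus 1/L is the time scale on which the
-- amplitude may vary.
set_option maxHeartbeats 400000 in
theorem oscillatory_lintegral_le {K : Plane → ℂ} (hK : Measurable K) {f : Plane → ℝ}
    (hf : Measurable f) (hK2 : ∫⁻ η, ‖K η‖ₑ ^ 2 < ⊤) {h h' : ℝ → Plane → ℂ}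
    (hm : Measurable (Function.uncurry h))
    {T : ℝ} (hT : 0 ≤ T) (hs : ∀ t, t ∉ Ioc (-T) T → ∀ η, h t η = 0)
    (hs' : ∀ t, t ∉ Ioc (-T) T → ∀ η, h' t η = 0)
    (hP : ∀ᵐ η, Prim univ (fun t => h t η) (fun t => h' t η)) {L : ℝ} {J : ℝ≥0∞} (hJ0 : J ≠ 0)
    (hJt : J ≠ ⊤)
    (hJ : ∀ l, ∫⁻ η, ‖K η‖ₑ ^ 2 * ENNReal.ofReal (1 / (1 + ((l - f η) / L) ^ 2)) ≤ J) :
    ∫⁻ t, ‖∫ η, K η * Complex.exp ((2 * Real.pi * t * f η : ℝ) * Complex.I) * h t η‖ₑ ^ 2 ≤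
      J * ∫⁻ η, ((∫⁻ t, ‖h t η‖ₑ ^ 2) + ENNReal.ofReal ((L⁻¹) ^ 2) * ∫⁻ t, ‖h' t η‖ₑ ^ 2) := by
  have hm1 : Measurable fun p : ℝ × Plane => h p.1 p.2 := hm
  set X := ∫⁻ η, ((∫⁻ t, ‖h t η‖ₑ ^ 2) + ENNReal.ofReal ((L⁻¹) ^ 2) * ∫⁻ t, ‖h' t η‖ₑ ^ 2)
    with hX
  -- If X is infinite the bound is empty, as J is nonzero. Otherwise X also controls the
  -- integrability needed for Fubini.
  rcases eq_or_ne X ⊤ with hXt | hXt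
  · rw [hXt, ENNReal.mul_top hJ0]; exact le_top
  set G : ℝ → Plane → ℂ := fun t η =>
    K η * Complex.exp ((2 * Real.pi * t * f η : ℝ) * Complex.I) * h t η with hG
  have hGm : Measurable (Function.uncurry G) := by
    simp only [hG, Function.uncurry_def]
    fun_prop
  have hGi : Integrable (Function.uncurry G) (volume.prod volume) := by
    refine ⟨hGm.aestronglyMeasurable, ?_⟩
    rw [hasFiniteIntegral_iff_enorm, lintegral_prod_symm' _ hGm.enorm]
    have h1 : ∀ η, ∫⁻ t, ‖Function.uncurry G (t, η)‖ₑ ≤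
        ENNReal.ofReal (2 * T) * ‖K η‖ₑ ^ 2 + ∫⁻ t, ‖h t η‖ₑ ^ 2 := by
      intro η
      have h2 : ∀ t, ‖Function.uncurry G (t, η)‖ₑ ≤
          (Ioc (-T) T).indicator (fun _ => ‖K η‖ₑ ^ 2) t + ‖h t η‖ₑ ^ 2 := by
        intro t
        by_cases ht : t ∈ Ioc (-T) T
        · rw [indicator_of_mem ht]
          simp only [Function.uncurry_apply_pair, hG, enorm_mul, enorm_exp_mul_I, mul_one]
          rcases le_total ‖K η‖ₑ ‖h t η‖ₑ with h3 | h3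
          · exact le_add_left (by rw [sq]; gcongr)
          · exact le_add_right (by rw [sq]; gcongr)
        · simp [hG, hs t ht η]
      refine (lintegral_mono h2).trans (le_of_eq ?_)
      rw [lintegral_add_left (measurable_const.indicator measurableSet_Ioc),
        lintegral_indicator_const measurableSet_Ioc, Real.volume_Ioc, mul_comm]
      congr 3; ring
    refine lt_of_le_of_lt (lintegral_mono h1) ?_
    rw [lintegral_add_left (by fun_prop), lintegral_const_mul _ (by fun_prop)]
    refine ENNReal.add_lt_top.2 ⟨ENNReal.mul_lt_top ENNReal.ofReal_lt_top hK2, ?_⟩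
    refine lt_of_le_of_lt (lintegral_mono fun η => ?_) (lt_top_iff_ne_top.2 hXt)
    exact le_self_add
  set Φ : ℝ → ℂ := fun t => ∫ η, G t η with hΦ
  have hΦi : Integrable Φ := hGi.integral_prod_left
  set H : ℝ → Plane → ℂ := fun l η => 𝓕 (fun t => h t η) l with hH
  have hHm : Measurable (Function.uncurry H) := by
    have : Function.uncurry H = fun p : ℝ × Plane => ∫ t,
        Complex.exp ((-2 * Real.pi * t * p.1 : ℝ) * Complex.I) • h t p.2 := by
      funext p
      exact Real.fourier_real_eq_integral_exp_smul _ _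
    rw [this]
    refine (StronglyMeasurable.integral_prod_right (f := fun (p : ℝ × Plane) (t : ℝ) =>
      Complex.exp ((-2 * Real.pi * t * p.1 : ℝ) * Complex.I) • h t p.2) ?_).measurable
    refine Measurable.stronglyMeasurable ?_
    have : Measurable fun q : (ℝ × Plane) × ℝ => h q.2 q.1.2 :=
      measurable_comp₂ hm (f := fun q : (ℝ × Plane) × ℝ => q.2) (g := fun q => q.1.2)
        (by fun_prop) (by fun_prop)
    simp only [Function.uncurry_def]
    fun_prop
  have hHm1 : Measurable fun p : ℝ × Plane => H p.1 p.2 := hHm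
  have hΦF : ∀ l, 𝓕 Φ l = ∫ η, K η * H (l - f η) η := by
    intro l
    rw [Real.fourier_real_eq_integral_exp_smul]
    simp only [hΦ, ← integral_const_mul, smul_eq_mul]
    rw [integral_integral_swap]
    · refine integral_congr_ae (ae_of_all _ fun η => ?_)
      simp only [hH, Real.fourier_real_eq_integral_exp_smul, ← integral_const_mul, smul_eq_mul]
      refine integral_congr_ae (ae_of_all _ fun t => ?_)
      simp only [hG]
      have : Complex.exp ((-2 * Real.pi * t * (l - f η) : ℝ) * Complex.I) =
          Complex.exp ((-2 * Real.pi * t * l : ℝ) * Complex.I) *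
          Complex.exp ((2 * Real.pi * t * f η : ℝ) * Complex.I) := by
        rw [← Complex.exp_add]; congr 1; push_cast; ring
      rw [this]; ring
    · have : Continuous fun p : ℝ × Plane =>
          Complex.exp ((-2 * Real.pi * p.1 * l : ℝ) * Complex.I) := by fun_prop
      exact hGi.bdd_mul (c := 1) this.aestronglyMeasurable
        (ae_of_all _ fun p => by rw [Complex.norm_exp_ofReal_mul_I])
  set w : ℝ → ℝ := fun x => 1 + (x / L) ^ 2 with hw
  have hw0 : ∀ x, 0 < w x := fun x => by positivity
  have hwm : Measurable w := by fun_prop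
  have hpt : ∀ l, ‖𝓕 Φ l‖ₑ ^ 2 ≤
      J * ∫⁻ η, ENNReal.ofReal (w (l - f η)) * ‖H (l - f η) η‖ₑ ^ 2 := by
    intro l
    have hHl : Measurable fun η => H (l - f η) η :=
      measurable_comp₂ hHm (f := fun η => l - f η) (g := fun η => η) (by fun_prop) (by fun_prop)
    set a : Plane → ℝ≥0∞ := fun η => ‖K η‖ₑ * ENNReal.ofReal (Real.sqrt (1 / w (l - f η)))
    set b : Plane → ℝ≥0∞ := fun η => ENNReal.ofReal (Real.sqrt (w (l - f η))) * ‖H (l - f η) η‖ₑ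
    have hab : ∀ η, ‖K η * H (l - f η) η‖ₑ = a η * b η := by
      intro η
      have : ENNReal.ofReal (Real.sqrt (1 / w (l - f η))) *
          ENNReal.ofReal (Real.sqrt (w (l - f η))) = 1 := by
        rw [← ENNReal.ofReal_mul (Real.sqrt_nonneg _), ← Real.sqrt_mul (by positivity),
          one_div_mul_cancel (hw0 _).ne']; simp
      simp only [a, b, enorm_mul]
      calc _ = ‖K η‖ₑ * 1 * ‖H (l - f η) η‖ₑ := by rw [mul_one]
        _ = _ := by rw [← this]; ring
    have ha2 : ∫⁻ η, a η ^ 2 ≤ J := by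
      refine le_trans (le_of_eq (lintegral_congr fun η => ?_)) (hJ l)
      simp only [a, mul_pow, hw]
      rw [← ENNReal.ofReal_pow (Real.sqrt_nonneg _), Real.sq_sqrt (by positivity)]
    have hb2 : ∫⁻ η, b η ^ 2 =
        ∫⁻ η, ENNReal.ofReal (w (l - f η)) * ‖H (l - f η) η‖ₑ ^ 2 := by
      refine lintegral_congr fun η => ?_
      simp only [b, mul_pow]
      rw [← ENNReal.ofReal_pow (Real.sqrt_nonneg _), Real.sq_sqrt (hw0 _).le]
    calc ‖𝓕 Φ l‖ₑ ^ 2 ≤ (∫⁻ η, a η * b η) ^ 2 := by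
          rw [hΦF]
          gcongr
          refine (enorm_integral_le_lintegral_enorm _).trans (le_of_eq ?_)
          simp only [hab]
      _ ≤ (∫⁻ η, a η ^ 2) * ∫⁻ η, b η ^ 2 :=
          lintegral_mul_sq_le _ (by fun_prop) (by fun_prop)
      _ ≤ _ := by
          rw [hb2]
          exact mul_le_mul_left ha2 _
  have hfin : ∫⁻ l, ‖𝓕 Φ l‖ₑ ^ 2 ≤ J * X := by
    refine (lintegral_mono hpt).trans ?_
    have hm3 : Measurable fun p : ℝ × Plane =>
        ENNReal.ofReal (w (p.1 - f p.2)) * ‖H (p.1 - f p.2) p.2‖ₑ ^ 2 := by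
      have : Measurable fun p : ℝ × Plane => H (p.1 - f p.2) p.2 :=
        measurable_comp₂ hHm (f := fun p : ℝ × Plane => p.1 - f p.2) (g := fun p => p.2)
          (by fun_prop) (by fun_prop)
      fun_prop
    rw [lintegral_const_mul _ hm3.lintegral_prod_right', lintegral_lintegral_swap hm3.aemeasurable]
    gcongr
    refine lintegral_mono_ae ?_
    filter_upwards [hP] with η hη
    rw [lintegral_sub_right_eq_self
      (fun l => ENNReal.ofReal (w l) * ‖H l η‖ₑ ^ 2) (f η)]
    obtain ⟨e1, e2⟩ := lintegral_fourier_weight_le hη hT (fun t ht => hs t ht η)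
      (fun t ht => hs' t ht η)
    have hHη : Measurable fun l => H l η := measurable_comp₂ hHm (f := fun l => l)
      (g := fun _ => η) (by fun_prop) (by fun_prop)
    calc ∫⁻ l, ENNReal.ofReal (w l) * ‖H l η‖ₑ ^ 2
        = ∫⁻ l, (‖H l η‖ₑ ^ 2 + ENNReal.ofReal ((L⁻¹) ^ 2) *
            (ENNReal.ofReal (l ^ 2) * ‖H l η‖ₑ ^ 2)) := by
          refine lintegral_congr fun l => ?_
          rw [hw, ENNReal.ofReal_add (by norm_num) (by positivity), add_mul, ENNReal.ofReal_one,
            one_mul, div_eq_mul_inv, mul_pow, ENNReal.ofReal_mul (by positivity)]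
          ring
      _ = (∫⁻ l, ‖H l η‖ₑ ^ 2) + ENNReal.ofReal ((L⁻¹) ^ 2) *
            ∫⁻ l, ENNReal.ofReal (l ^ 2) * ‖H l η‖ₑ ^ 2 := by
          rw [lintegral_add_left (by fun_prop), lintegral_const_mul _ (by fun_prop)]
      _ ≤ _ := add_le_add e1 (mul_le_mul_right e2 _)
  -- So far Φ is only known to be integrable; its square integrability is read off from its
  -- transform.
  have hmem : MemLp (𝓕 Φ) 2 := by
    refine (memLp_two_iff_lintegral ?_).2 (lt_of_le_of_lt hfin (ENNReal.mul_lt_top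
      (lt_top_iff_ne_top.2 hJt) (lt_top_iff_ne_top.2 hXt)))
    exact (VectorFourier.fourierIntegral_continuous Real.continuous_fourierChar
      continuous_inner hΦi).aestronglyMeasurable
  calc _ = ∫⁻ l, ‖𝓕 Φ l‖ₑ ^ 2 := (lintegral_fourier_sq hΦi (memLp_two_of_fourier hΦi hmem)).symm
    _ ≤ _ := hfin

/-! ### Polar coordinates and the resonance function -/

theorem lintegral_polar (F : Plane → ℝ≥0∞) (hF : Measurable F) :
    ∫⁻ η, F η = ∫⁻ e, ∫⁻ r in Ioi (0 : ℝ), ENNReal.ofReal r * F (r • (e : Plane))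
      ∂volume ∂(volume : Measure Plane).toSphere := by
  have h0 : ∫⁻ η, F η = ∫⁻ η : ({0}ᶜ : Set Plane), F η ∂(Measure.comap Subtype.val volume) := by
    rw [lintegral_subtype_comap (measurableSet_singleton _).compl,
      restrict_compl_singleton]
  have hp := Measure.measurePreserving_homeomorphUnitSphereProd (volume : Measure Plane)
  have h1 : ∀ η : ({0}ᶜ : Set Plane), F η =
      (fun p : Metric.sphere (0 : Plane) 1 × Ioi (0 : ℝ) => F ((p.2 : ℝ) • (p.1 : Plane)))
        (homeomorphUnitSphereProd Plane η) := by
    intro η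
    have : ‖(η : Plane)‖ ≠ 0 := norm_ne_zero_iff.2 η.2
    simp [smul_smul, this]
  have hm : Measurable fun p : Metric.sphere (0 : Plane) 1 × Ioi (0 : ℝ) =>
      F ((p.2 : ℝ) • (p.1 : Plane)) := by fun_prop
  simp_rw [h0, h1]
  rw [hp.lintegral_comp hm, lintegral_prod _ hm.aemeasurable]
  refine lintegral_congr fun e => ?_
  simp only [Measure.volumeIoiPow, finrank_euclideanSpace, Fintype.card_fin, Nat.add_one_sub_one,
    pow_one]
  rw [lintegral_withDensity_eq_lintegral_mul _ (by fun_prop) (by fun_prop),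
    ← lintegral_subtype_comap measurableSet_Ioi]
  rfl

/-- `1 - σσ' cos ∠(η, ζ)`. -/
def angleDefect (σ σ' : ℝ) (η ζ : Plane) : ℝ := 1 - σ * σ' * (inner ℝ η ζ / (‖η‖ * ‖ζ‖))

theorem measurable_angleDefect (σ σ' : ℝ) :
    Measurable (Function.uncurry (angleDefect σ σ')) := by
  simp only [Function.uncurry_def]
  unfold angleDefect; fun_prop

theorem abs_inner_div_le (η ζ : Plane) : |inner ℝ η ζ / (‖η‖ * ‖ζ‖)| ≤ 1 :=
  abs_real_inner_div_norm_mul_norm_le_one η ζ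

theorem abs_sign_mul_sign {σ σ' : ℝ} (hσ : σ ^ 2 = 1) (hσ' : σ' ^ 2 = 1) : |σ * σ'| = 1 := by
  rw [← sq_eq_sq₀ (abs_nonneg _) zero_le_one, sq_abs, mul_pow, hσ, hσ']; norm_num

theorem angleDefect_mem {σ σ' : ℝ} (hσ : σ ^ 2 = 1) (hσ' : σ' ^ 2 = 1) (η ζ : Plane) :
    0 ≤ angleDefect σ σ' η ζ ∧ angleDefect σ σ' η ζ ≤ 2 := by
  have h : |σ * σ' * (inner ℝ η ζ / (‖η‖ * ‖ζ‖))| ≤ 1 := by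
    rw [abs_mul, abs_sign_mul_sign hσ hσ', one_mul]
    exact abs_inner_div_le η ζ
  have := abs_le.1 h
  unfold angleDefect
  constructor <;> linarith

theorem hasDerivAt_norm_sub_smul {e ξ : Plane} {r : ℝ} (h : ξ - r • e ≠ 0) :
    HasDerivAt (fun r : ℝ => ‖ξ - r • e‖) (-(inner ℝ e (ξ - r • e) / ‖ξ - r • e‖)) r := by
  have h1 : HasDerivAt (fun r : ℝ => ξ - r • e) (-e) r := by
    simpa using ((hasDerivAt_id r).smul_const e).const_sub ξ
  have h2 := (h1.norm_sq).sqrt (by simpa using h)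
  have h3 : (fun r : ℝ => ‖ξ - r • e‖) = fun r : ℝ => Real.sqrt (‖ξ - r • e‖ ^ 2) := by
    funext r; rw [Real.sqrt_sq (norm_nonneg _)]
  rw [h3]
  convert h2 using 1
  rw [Real.sqrt_sq (norm_nonneg _), inner_neg_right, real_inner_comm]
  have : ‖ξ - r • e‖ ≠ 0 := norm_ne_zero_iff.2 h
  field_simp

/-- Along a ray the phase σr + σ'|ξ - re| has derivative σ times the angle defect, because σ² = 1.
The integrand is thus the exact derivative of σL arctan((phase - l)/L), and increments of L arctan
are at most πL. The degeneracy of the phase where the defect vanishes costs nothing. -/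
theorem lintegral_resonance_ray {σ σ' : ℝ} (hσ : σ ^ 2 = 1) (hσ' : σ' ^ 2 = 1) {e ξ : Plane}
    (he : ‖e‖ = 1) {L : ℝ} (hL : 0 < L) (l : ℝ) :
    ∫⁻ r in Ioi (0 : ℝ), ENNReal.ofReal (angleDefect σ σ' (r • e) (ξ - r • e) *
      (1 / (1 + ((l - (σ * ‖r • e‖ + σ' * ‖ξ - r • e‖)) / L) ^ 2))) ≤
      ENNReal.ofReal (Real.pi * L) := by
  set d : ℝ → ℝ := fun r => angleDefect σ σ' (r • e) (ξ - r • e) *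
      (1 / (1 + ((l - (σ * ‖r • e‖ + σ' * ‖ξ - r • e‖)) / L) ^ 2)) with hd
  have hdm : Measurable d := by
    have : Measurable fun r : ℝ => angleDefect σ σ' (r • e) (ξ - r • e) :=
      measurable_comp₂ (measurable_angleDefect σ σ') (f := fun r : ℝ => r • e)
        (g := fun r : ℝ => ξ - r • e) (by fun_prop) (by fun_prop)
    fun_prop
  have hd0 : ∀ r, 0 ≤ d r := fun r =>
    mul_nonneg (angleDefect_mem hσ hσ' _ _).1 (by positivity)
  have hd2 : ∀ r, d r ≤ 2 := by
    intro r
    have h1 : 1 / (1 + ((l - (σ * ‖r • e‖ + σ' * ‖ξ - r • e‖)) / L) ^ 2) ≤ 1 :=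
      div_le_one_of_le₀ (by nlinarith [sq_nonneg ((l - (σ * ‖r • e‖ + σ' * ‖ξ - r • e‖)) / L)])
        (by positivity)
    have h2 := angleDefect_mem hσ hσ' (r • e) (ξ - r • e)
    calc d r ≤ 2 * 1 := mul_le_mul h2.2 h1 (by positivity) (by norm_num)
      _ = 2 := by norm_num
  -- Exhaustion by bounded intervals, so that the fundamental theorem of calculus applies; the bound
  -- does not depend on n.
  have hset : Ioi (0 : ℝ) = ⋃ n : ℕ, Ioc 0 (n : ℝ) := by
    ext r
    simp only [mem_Ioi, mem_iUnion, mem_Ioc]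
    exact ⟨fun h => (exists_nat_ge r).imp fun n hn => ⟨h, hn⟩, fun ⟨n, h, _⟩ => h⟩
  rw [hset, setLIntegral_iUnion_of_directed]
  swap
  · exact Monotone.directed_le fun m n h => Ioc_subset_Ioc_right (by exact_mod_cast h)
  refine iSup_le fun n => ?_
  have hn : (0 : ℝ) ≤ n := n.cast_nonneg
  set F : ℝ → ℝ := fun r => σ * L * Real.arctan ((σ * r + σ' * ‖ξ - r • e‖ - l) / L) with hF
  have hFc : Continuous F := by fun_prop
  have hFd : ∀ r ∈ Ioo (0 : ℝ) n \ {r | ξ - r • e = 0}, HasDerivAt F (d r) r := by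
    rintro r ⟨hr, hr2⟩
    have h1 : HasDerivAt (fun r : ℝ => (σ * r + σ' * ‖ξ - r • e‖ - l) / L)
        ((σ + σ' * (-(inner ℝ e (ξ - r • e) / ‖ξ - r • e‖))) / L) r := by
      have := ((((hasDerivAt_id r).const_mul σ).add
        ((hasDerivAt_norm_sub_smul hr2).const_mul σ')).sub_const l).div_const L
      simpa using this
    have h2 := (h1.arctan).const_mul (σ * L)
    refine h2.congr_deriv (Eq.symm ?_)
    have hr1 : ‖r • e‖ = r := by rw [norm_smul, he, mul_one, Real.norm_of_nonneg hr.1.le]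
    have h3 : ‖ξ - r • e‖ ≠ 0 := norm_ne_zero_iff.2 hr2
    simp only [hd, angleDefect, hr1, inner_smul_left, RCLike.conj_to_real]
    have h4 : ((l - (σ * r + σ' * ‖ξ - r • e‖)) / L) ^ 2 =
      ((σ * r + σ' * ‖ξ - r • e‖ - l) / L) ^ 2 := by ring
    rw [h4]
    have h5 : r * inner ℝ e (ξ - r • e) / (r * ‖ξ - r • e‖) =
        inner ℝ e (ξ - r • e) / ‖ξ - r • e‖ := mul_div_mul_left _ _ hr.1.ne'
    rw [h5]
    set q := inner ℝ e (ξ - r • e) / ‖ξ - r • e‖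
    set p := 1 / (1 + ((σ * r + σ' * ‖ξ - r • e‖ - l) / L) ^ 2)
    have h6 : σ * L * (p * ((σ + σ' * -q) / L)) = p * (σ ^ 2 - σ * σ' * q) := by
      field_simp; ring
    rw [h6, hσ]; ring
  -- The phase can fail to be differentiable only where the ray passes through ξ, which is at most
  -- one point.
  have hcount : {r : ℝ | ξ - r • e = 0}.Countable := by
    refine Set.Subsingleton.countable fun r hr s hs => ?_
    have : (r - s) • e = 0 := by
      rw [sub_smul, ← sub_eq_zero.1 hr, ← sub_eq_zero.1 hs, sub_self]
    rcases smul_eq_zero.1 this with h | h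
    · linarith
    · rw [h, norm_zero] at he; norm_num at he
  have hi : IntervalIntegrable d volume 0 n := by
    rw [intervalIntegrable_iff]
    refine Measure.integrableOn_of_bounded (M := 2) (by simp) hdm.aestronglyMeasurable
      (ae_of_all _ fun r => ?_)
    rw [Real.norm_of_nonneg (hd0 r)]; exact hd2 r
  have h := integral_eq_of_hasDerivAt_off_countable_of_le F d hn hcount hFc.continuousOn hFd hi
  rw [← ofReal_integral_eq_lintegral_ofReal ((intervalIntegrable_iff_integrableOn_Ioc_of_le hn).1 hi)
    (ae_of_all _ hd0), ← intervalIntegral.integral_of_le hn, h]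
  refine ENNReal.ofReal_le_ofReal ?_
  have habs : ∀ x y : ℝ, |x| < Real.pi / 2 → |y| < Real.pi / 2 →
      σ * L * x - σ * L * y ≤ Real.pi * L := by
    intro x y hx hy
    have h1 : |σ| = 1 := by
      rw [← sq_eq_sq₀ (abs_nonneg _) zero_le_one, sq_abs, hσ]; norm_num
    have h2 : σ * (x - y) ≤ Real.pi := by
      calc σ * (x - y) ≤ |σ * (x - y)| := le_abs_self _
        _ = |x - y| := by rw [abs_mul, h1, one_mul]
        _ ≤ |x| + |y| := abs_sub x y
        _ ≤ Real.pi := by linarith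
    nlinarith
  exact habs _ _ (abs_lt.2 ⟨Real.neg_pi_div_two_lt_arctan _, Real.arctan_lt_pi_div_two _⟩)
    (abs_lt.2 ⟨Real.neg_pi_div_two_lt_arctan _, Real.arctan_lt_pi_div_two _⟩)

/-- Integrals of the angular defect along the level sets of the resonance function
`σ|η| + σ'|ξ - η|`, in the region `⟨η⟩ ≤ R`. -/
theorem lintegral_resonance_le {σ σ' : ℝ} (hσ : σ ^ 2 = 1) (hσ' : σ' ^ 2 = 1) {s : ℝ}
    (hs : s ≤ 1 / 2) {L R : ℝ} (hL : 0 < L) (hR : 1 ≤ R) (ξ : Plane) (l : ℝ) :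
    ∫⁻ η, {η | jb η ≤ R}.indicator (fun η => jw (-(2 * s)) η *
      ENNReal.ofReal (angleDefect σ σ' η (ξ - η) *
        (1 / (1 + ((l - (σ * ‖η‖ + σ' * ‖ξ - η‖)) / L) ^ 2)))) η ≤
      (volume : Measure Plane).toSphere univ *
        ENNReal.ofReal (Real.pi * (R ^ (1 - 2 * s) * L)) := by
  have hms : MeasurableSet {η : Plane | jb η ≤ R} := measurableSet_le measurable_jb measurable_const
  have hma : Measurable fun η : Plane => angleDefect σ σ' η (ξ - η) :=
    measurable_comp₂ (measurable_angleDefect σ σ') (f := fun η => η) (g := fun η => ξ - η)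
      (by fun_prop) (by fun_prop)
  rw [lintegral_polar _ (Measurable.indicator (by fun_prop) hms)]
  rw [mul_comm (Measure.toSphere volume univ), ← lintegral_const]
  refine lintegral_mono fun e => ?_
  have he : ‖(e : Plane)‖ = 1 := by simp
  have hpt : ∀ r ∈ Ioi (0 : ℝ), ENNReal.ofReal r *
      {η | jb η ≤ R}.indicator (fun η => jw (-(2 * s)) η *
      ENNReal.ofReal (angleDefect σ σ' η (ξ - η) *
        (1 / (1 + ((l - (σ * ‖η‖ + σ' * ‖ξ - η‖)) / L) ^ 2)))) (r • (e : Plane)) ≤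
      ENNReal.ofReal (R ^ (1 - 2 * s)) * ENNReal.ofReal (angleDefect σ σ' (r • (e : Plane))
        (ξ - r • (e : Plane)) * (1 / (1 + ((l - (σ * ‖r • (e : Plane)‖ +
          σ' * ‖ξ - r • (e : Plane)‖)) / L) ^ 2))) := by
    intro r hr
    by_cases h : jb (r • (e : Plane)) ≤ R
    · rw [indicator_of_mem (by exact h), ← mul_assoc]
      gcongr
      rw [jw, ← ENNReal.ofReal_mul (mem_Ioi.1 hr).le]
      refine ENNReal.ofReal_le_ofReal ?_
      have h1 : r ≤ jb (r • (e : Plane)) := by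
        refine le_trans (le_of_eq ?_) (norm_le_jb _)
        rw [norm_smul, he, mul_one, Real.norm_of_nonneg (mem_Ioi.1 hr).le]
      -- The polar density r raises the exponent to 1 - 2s, which is nonnegative as s ≤ 1/2, so the
      -- bracket may be replaced by its bound R.
      calc r * jb (r • (e : Plane)) ^ (-(2 * s))
          ≤ jb (r • (e : Plane)) ^ (1 : ℝ) * jb (r • (e : Plane)) ^ (-(2 * s)) := by
            rw [Real.rpow_one]
            exact mul_le_mul_of_nonneg_right h1 (Real.rpow_nonneg (jb_pos _).le _)
        _ = jb (r • (e : Plane)) ^ (1 - 2 * s) := by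
            rw [← Real.rpow_add (jb_pos _)]; congr 1
        _ ≤ _ := Real.rpow_le_rpow (jb_pos _).le h (by linarith)
    · rw [indicator_of_notMem (by exact h), mul_zero]; exact zero_le
  refine (setLIntegral_mono' measurableSet_Ioi hpt).trans ?_
  rw [lintegral_const_mul' _ _ ENNReal.ofReal_ne_top]
  refine (mul_le_mul_right (lintegral_resonance_ray hσ hσ' he hL l) _).trans (le_of_eq ?_)
  rw [← ENNReal.ofReal_mul (by positivity)]
  congr 1; ring

/-! ### Time dependent Sobolev classes on the Fourier side -/

/-- `F t` is bounded in the weighted space `L²(⟨η⟩^{2s})` for `t ∈ I`. -/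
def EnSup (I : Set ℝ) (s : ℝ) (F : ℝ → Plane → ℂ) : Prop :=
  Measurable (Function.uncurry F) ∧
    ∃ C : ℝ≥0∞, C ≠ ⊤ ∧ ∀ t ∈ I, energy s (fun η => ‖F t η‖ₑ) ≤ C

/-- `F` is square integrable on `I` with values in the weighted space `L²(⟨η⟩^{2s})`. -/
def EnInt (I : Set ℝ) (s : ℝ) (F : ℝ → Plane → ℂ) : Prop :=
  Measurable (Function.uncurry F) ∧ ∫⁻ t in I, energy s (fun η => ‖F t η‖ₑ) < ⊤

/-- `u(·, η)` is a primitive of `u'(·, η)` on `I` for almost every `η`. -/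
def PrimAE (I : Set ℝ) (u u' : ℝ → Plane → ℂ) : Prop :=
  ∀ᵐ η, Prim I (fun t => u t η) (fun t => u' t η)

theorem measurable_slice {F : ℝ → Plane → ℂ} (h : Measurable (Function.uncurry F)) (t : ℝ) :
    Measurable (F t) :=
  measurable_comp₂ h (f := fun _ => t) (g := fun η => η) (by fun_prop) (by fun_prop)

theorem measurable_energy {F : ℝ → Plane → ℂ} (h : Measurable (Function.uncurry F)) (s : ℝ) :
    Measurable fun t => energy s (fun η => ‖F t η‖ₑ) := by
  have : Measurable fun p : ℝ × Plane => F p.1 p.2 := h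
  exact Measurable.lintegral_prod_right' (f := fun p : ℝ × Plane => (jw s p.2 * ‖F p.1 p.2‖ₑ) ^ 2)
    (by fun_prop)

theorem EnSup.mono_exp {I : Set ℝ} {s t : ℝ} {F : ℝ → Plane → ℂ} (h : EnSup I t F)
    (hst : s ≤ t) : EnSup I s F := by
  obtain ⟨hm, C, hC, h⟩ := h
  exact ⟨hm, C, hC, fun t ht => (energy_mono hst fun _ => le_rfl).trans (h t ht)⟩

theorem EnInt.mono_exp {I : Set ℝ} {s t : ℝ} {F : ℝ → Plane → ℂ} (h : EnInt I t F)
    (hst : s ≤ t) : EnInt I s F :=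
  ⟨h.1, lt_of_le_of_lt (lintegral_mono fun _ => energy_mono hst fun _ => le_rfl) h.2⟩

theorem EnSup.enInt {I : Set ℝ} (hI : volume I < ⊤) (hIm : MeasurableSet I) {s : ℝ}
    {F : ℝ → Plane → ℂ} (h : EnSup I s F) : EnInt I s F := by
  obtain ⟨hm, C, hC, h⟩ := h
  refine ⟨hm, lt_of_le_of_lt (setLIntegral_mono' hIm h) ?_⟩
  rw [lintegral_const, Measure.restrict_apply_univ]
  exact ENNReal.mul_lt_top (lt_top_iff_ne_top.2 hC) hI

theorem energy_enorm_add_le (s : ℝ) {f g : Plane → ℂ} (hf : Measurable f) :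
    energy s (fun η => ‖f η + g η‖ₑ) ≤
      2 * (energy s (fun η => ‖f η‖ₑ) + energy s (fun η => ‖g η‖ₑ)) :=
  (energy_mono le_rfl fun _ => enorm_add_le _ _).trans (energy_add_le s hf.enorm)

theorem EnSup.add {I : Set ℝ} {s : ℝ} {F G : ℝ → Plane → ℂ} (hF : EnSup I s F)
    (hG : EnSup I s G) : EnSup I s (fun t η => F t η + G t η) := by
  obtain ⟨hm, C, hC, hF⟩ := hF
  obtain ⟨hm', C', hC', hG⟩ := hG
  refine ⟨hm.add hm', 2 * (C + C'), by finiteness, fun t ht => ?_⟩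
  refine (energy_enorm_add_le s (measurable_slice hm t)).trans ?_
  gcongr
  · exact hF t ht
  · exact hG t ht

theorem EnInt.add {I : Set ℝ} {s : ℝ} {F G : ℝ → Plane → ℂ} (hF : EnInt I s F)
    (hG : EnInt I s G) : EnInt I s (fun t η => F t η + G t η) := by
  refine ⟨hF.1.add hG.1, lt_of_le_of_lt (lintegral_mono fun t =>
    energy_enorm_add_le s (measurable_slice hF.1 t)) ?_⟩
  rw [lintegral_const_mul' _ _ (by simp), lintegral_add_left (measurable_energy hF.1 s)]
  exact ENNReal.mul_lt_top (by simp) (ENNReal.add_lt_top.2 ⟨hF.2, hG.2⟩)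

theorem energy_enorm_mul_le {s r : ℝ} {m : Plane → ℂ} {c : ℝ≥0∞} (hc : c ≠ ⊤)
    (hm : ∀ η, ‖m η‖ₑ ≤ c * jw r η) (f : Plane → ℂ) :
    energy (s - r) (fun η => ‖m η * f η‖ₑ) ≤ c ^ 2 * energy s (fun η => ‖f η‖ₑ) := by
  have h1 : energy (s - r) (fun η => ‖m η * f η‖ₑ) ≤
      energy (s - r) (fun η => c * (jw r η * ‖f η‖ₑ)) := by
    refine energy_mono le_rfl fun η => ?_
    rw [enorm_mul, ← mul_assoc]
    gcongr
    exact hm η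
  refine h1.trans (le_of_eq ?_)
  rw [energy_const_mul _ hc, energy_jw_mul, sub_add_cancel]

theorem EnSup.mul {I : Set ℝ} {s r : ℝ} {F : ℝ → Plane → ℂ} (hF : EnSup I s F) {m : Plane → ℂ}
    (hmm : Measurable m) {c : ℝ≥0∞} (hc : c ≠ ⊤) (hm : ∀ η, ‖m η‖ₑ ≤ c * jw r η) :
    EnSup I (s - r) (fun t η => m η * F t η) := by
  obtain ⟨hFm, C, hC, hF⟩ := hF
  refine ⟨(hmm.comp measurable_snd).mul hFm, c ^ 2 * C, by finiteness, fun t ht => ?_⟩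
  exact (energy_enorm_mul_le hc hm _).trans (mul_le_mul_right (hF t ht) _)

theorem EnInt.mul {I : Set ℝ} {s r : ℝ} {F : ℝ → Plane → ℂ} (hF : EnInt I s F) {m : Plane → ℂ}
    (hmm : Measurable m) {c : ℝ≥0∞} (hc : c ≠ ⊤) (hm : ∀ η, ‖m η‖ₑ ≤ c * jw r η) :
    EnInt I (s - r) (fun t η => m η * F t η) := by
  refine ⟨(hmm.comp measurable_snd).mul hF.1,
    lt_of_le_of_lt (lintegral_mono fun t => energy_enorm_mul_le hc hm _) ?_⟩
  rw [lintegral_const_mul' _ _ (by finiteness)]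
  exact ENNReal.mul_lt_top (by finiteness) hF.2

theorem EnSup.const_mul {I : Set ℝ} {s : ℝ} {F : ℝ → Plane → ℂ} (hF : EnSup I s F) (c : ℂ) :
    EnSup I s (fun t η => c * F t η) := by
  simpa using hF.mul (r := 0) (m := fun _ => c) measurable_const (c := ‖c‖ₑ) enorm_ne_top
    (by simp)

theorem EnInt.const_mul {I : Set ℝ} {s : ℝ} {F : ℝ → Plane → ℂ} (hF : EnInt I s F) (c : ℂ) :
    EnInt I s (fun t η => c * F t η) := by
  simpa using hF.mul (r := 0) (m := fun _ => c) measurable_const (c := ‖c‖ₑ) enorm_ne_top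
    (by simp)

theorem EnInt.of_enorm_le {I : Set ℝ} {s : ℝ} {F G : ℝ → Plane → ℂ} (hF : EnInt I s F)
    (hG : Measurable (Function.uncurry G)) (h : ∀ t η, ‖G t η‖ₑ ≤ ‖F t η‖ₑ) : EnInt I s G :=
  ⟨hG, lt_of_le_of_lt (lintegral_mono fun t => energy_mono le_rfl (h t)) hF.2⟩

theorem EnSup.of_enorm_le {I : Set ℝ} {s : ℝ} {F G : ℝ → Plane → ℂ} (hF : EnSup I s F)
    (hG : Measurable (Function.uncurry G)) (h : ∀ t η, ‖G t η‖ₑ ≤ ‖F t η‖ₑ) : EnSup I s G := by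
  obtain ⟨_, C, hC, hF⟩ := hF
  exact ⟨hG, C, hC, fun t ht => (energy_mono le_rfl (h t)).trans (hF t ht)⟩

theorem energy_congr_ae {s : ℝ} {f g : Plane → ℝ≥0∞} (h : f =ᵐ[volume] g) :
    energy s f = energy s g := by
  refine lintegral_congr_ae ?_
  filter_upwards [h] with η hη
  rw [hη]

theorem EnInt.congr {I : Set ℝ} {s : ℝ} {F G : ℝ → Plane → ℂ} (hF : EnInt I s F)
    (hG : Measurable (Function.uncurry G))
    (h : ∀ᵐ t ∂(volume.restrict I), ∀ᵐ η, F t η = G t η) : EnInt I s G := by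
  refine ⟨hG, lt_of_le_of_lt (le_of_eq (lintegral_congr_ae ?_)) hF.2⟩
  filter_upwards [h] with t ht
  refine energy_congr_ae ?_
  filter_upwards [ht] with η hη
  rw [hη]

theorem EnSup.congr {I : Set ℝ} {s : ℝ} {F G : ℝ → Plane → ℂ} (hF : EnSup I s F)
    (hG : Measurable (Function.uncurry G)) (h : ∀ t ∈ I, ∀ᵐ η, F t η = G t η) : EnSup I s G := by
  obtain ⟨_, C, hC, hF⟩ := hF
  refine ⟨hG, C, hC, fun t ht => le_trans (le_of_eq (energy_congr_ae ?_)) (hF t ht)⟩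
  filter_upwards [h t ht] with η hη
  rw [hη]

theorem PrimAE.add {I : Set ℝ} (hI : I.OrdConnected) {u u' v v' : ℝ → Plane → ℂ}
    (hu : PrimAE I u u') (hv : PrimAE I v v') :
    PrimAE I (fun t η => u t η + v t η) (fun t η => u' t η + v' t η) := by
  filter_upwards [hu, hv] with η h1 h2
  exact h1.add hI h2

theorem PrimAE.mul {I : Set ℝ} {u u' : ℝ → Plane → ℂ} (hu : PrimAE I u u') (m : Plane → ℂ) :
    PrimAE I (fun t η => m η * u t η) (fun t η => m η * u' t η) := by
  filter_upwards [hu] with η h1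
  exact h1.const_mul (m η)

/-- Joint measurability of the primitive of a jointly measurable function. -/
theorem measurable_primitive {d : ℝ → Plane → ℂ} (hd : Measurable (Function.uncurry d)) (t₀ : ℝ) :
    Measurable (Function.uncurry fun t η => ∫ τ in t₀..t, d τ η) := by
  -- An oriented integral is a difference of two integrals over the whole line, with jointly
  -- measurable indicators that depend on the endpoint.
  have h1 : (Function.uncurry fun t η => ∫ τ in t₀..t, d τ η) = fun p : ℝ × Plane =>
      ∫ τ, ({q : (ℝ × Plane) × ℝ | t₀ < q.2 ∧ q.2 ≤ q.1.1}.indicator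
        (fun q => d q.2 q.1.2) (p, τ) - {q : (ℝ × Plane) × ℝ | q.1.1 < q.2 ∧ q.2 ≤ t₀}.indicator
        (fun q => d q.2 q.1.2) (p, τ)) := by
    funext ⟨t, η⟩
    simp only [Function.uncurry_apply_pair]
    rcases le_total t₀ t with h | h
    · rw [intervalIntegral.integral_of_le h, ← integral_indicator measurableSet_Ioc]
      congr 1; funext τ
      have h2 : ¬ (t < τ ∧ τ ≤ t₀) := fun h3 => by linarith [h3.1, h3.2]
      simp [indicator, h2]
    · rw [intervalIntegral.integral_of_ge h, ← integral_indicator measurableSet_Ioc,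
        ← integral_neg]
      congr 1; funext τ
      have h2 : ¬ (t₀ < τ ∧ τ ≤ t) := fun h3 => by linarith [h3.1, h3.2]
      simp [indicator, h2]
  rw [h1]
  refine (StronglyMeasurable.integral_prod_right (f := fun (p : ℝ × Plane) (τ : ℝ) =>
    ({q : (ℝ × Plane) × ℝ | t₀ < q.2 ∧ q.2 ≤ q.1.1}.indicator
        (fun q => d q.2 q.1.2) (p, τ) - {q : (ℝ × Plane) × ℝ | q.1.1 < q.2 ∧ q.2 ≤ t₀}.indicator
        (fun q => d q.2 q.1.2) (p, τ))) ?_).measurable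
  have hm : Measurable fun q : (ℝ × Plane) × ℝ => d q.2 q.1.2 :=
    measurable_comp₂ hd (f := fun q : (ℝ × Plane) × ℝ => q.2) (g := fun q => q.1.2)
      (by fun_prop) (by fun_prop)
  refine Measurable.stronglyMeasurable ?_
  refine (hm.indicator ?_).sub (hm.indicator ?_)
  · exact (measurableSet_lt measurable_const measurable_snd).inter
      (measurableSet_le measurable_snd (measurable_fst.comp measurable_fst))
  · exact (measurableSet_lt (measurable_fst.comp measurable_fst) measurable_snd).inter
      (measurableSet_le measurable_snd measurable_const)

/-! ### Extension in time, half-wave profiles and cutoffs -/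

theorem norm_jb_sub_le (η : Plane) : |jb η - 2 * Real.pi * ‖η‖| ≤ 1 := by
  have h1 := two_pi_norm_le_jb η
  rw [abs_of_nonneg (by linarith)]
  have h2 : jb η ≤ 1 + 2 * Real.pi * ‖η‖ := by
    refine Real.sqrt_le_iff.2 ⟨by positivity, ?_⟩
    nlinarith [show 0 ≤ 2 * Real.pi * ‖η‖ by positivity]
  linarith

/-- The extension of `u` from `I` to `ℝ` that is constant outside `I`. -/
theorem exists_extension {a b : ℝ} (hab : a < b) {α β : ℝ} {u u' : ℝ → Plane → ℂ}
    (hP : PrimAE (Ioo a b) u u') (hu : EnSup (Ioo a b) α u) (hu' : EnInt (Ioo a b) β u') :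
    ∃ P P' : ℝ → Plane → ℂ, PrimAE univ P P' ∧ EnSup univ α P ∧ EnInt univ β P' ∧
      ∀ᵐ η, ∀ t ∈ Ioo a b, u t η = P t η := by
  have hI : (Ioo a b).OrdConnected := ordConnected_Ioo
  set t₀ := (a + b) / 2 with ht₀
  have h₀ : t₀ ∈ Ioo a b := ⟨by linarith, by linarith⟩
  set P' : ℝ → Plane → ℂ := fun t η => (Ioo a b).indicator (fun t => u' t η) t with hP'
  set P : ℝ → Plane → ℂ := fun t η => u t₀ η + ∫ τ in t₀..t, P' τ η with hPd
  have hP'm : Measurable (Function.uncurry P') := by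
    have : Function.uncurry P' = (Prod.fst ⁻¹' Ioo a b).indicator (Function.uncurry u') := by
      funext ⟨t, η⟩; simp [hP', indicator]
    rw [this]
    exact hu'.1.indicator (measurable_fst measurableSet_Ioo)
  have hPm : Measurable (Function.uncurry P) :=
    ((measurable_slice hu.1 t₀).comp measurable_snd).add (measurable_primitive hP'm t₀)
  have hprim : PrimAE univ P P' := by
    filter_upwards [hP] with η hη
    exact prim_univ_extension (hη.integrable_indicator hI) _ t₀
  have heq : ∀ᵐ η, ∀ t ∈ Ioo a b, u t η = P t η := by
    filter_upwards [hP] with η hη t ht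
    exact hη.eq_extension hI h₀ ht
  refine ⟨P, P', hprim, ?_, ⟨hP'm, ?_⟩, heq⟩
  · obtain ⟨_, C, hC, hu⟩ := hu
    refine ⟨hPm, C, hC, fun t _ => ?_⟩
    -- The point of [a, b] nearest to t; the extension is constant between c and t.
    set c := max a (min b t) with hc
    have hcm : c ∈ closure (Ioo a b) := by
      rw [closure_Ioo hab.ne]
      exact ⟨le_max_left _ _, max_le hab.le (min_le_left _ _)⟩
    obtain ⟨x, hx, hxc⟩ := mem_closure_iff_seq_limit.1 hcm
    have hPc : ∀ᵐ η, P t η = P c η := by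
      filter_upwards [hprim] with η hη
      rw [← sub_eq_zero, hη.2 c (mem_univ _) t (mem_univ _)]
      refine intervalIntegral.integral_zero_ae (ae_of_all _ fun τ hτ => ?_)
      refine indicator_of_notMem (fun h => ?_) _
      rcases le_total t a with h1 | h1
      · have hca : c = a := by rw [hc, min_eq_right (h1.trans hab.le), max_eq_left h1]
        rw [hca, uIoc_of_ge h1] at hτ
        linarith [h.1, hτ.2]
      · rcases le_total t b with h2 | h2
        · have hct : c = t := by rw [hc, min_eq_right h2, max_eq_right h1]
          rw [hct] at hτ
          simp at hτ
        · have hcb : c = b := by rw [hc, min_eq_left h2, max_eq_right hab.le]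
          rw [hcb, uIoc_of_le h2] at hτ
          linarith [h.2, hτ.1]
    have hlim : ∀ᵐ η, Tendsto (fun n => ‖P (x n) η‖ₑ) atTop (𝓝 ‖P t η‖ₑ) := by
      filter_upwards [hPc, hprim] with η h1 h2
      rw [h1]
      exact ((h2.continuous.tendsto c).comp hxc).enorm
    -- The energy bound is given only inside the open interval. Fatou's lemma along a sequence of
    -- interior times carries it to the endpoints.
    calc energy α (fun η => ‖P t η‖ₑ)
        = ∫⁻ η, liminf (fun n => (jw α η * ‖P (x n) η‖ₑ) ^ 2) atTop := by
          refine lintegral_congr_ae ?_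
          filter_upwards [hlim] with η hη
          refine (Tendsto.liminf_eq ?_).symm
          exact ((ENNReal.continuous_pow 2).tendsto _).comp
            (ENNReal.Tendsto.const_mul hη (Or.inr (jw_ne_top _ _)))
      _ ≤ liminf (fun n => energy α (fun η => ‖P (x n) η‖ₑ)) atTop := by
          refine lintegral_liminf_le fun n => ?_
          have := measurable_slice hPm (x n)
          fun_prop
      _ ≤ C := by
          refine liminf_le_of_le (by isBoundedDefault) fun z hz => ?_
          obtain ⟨n, hn⟩ := hz.exists
          refine hn.trans (le_trans (le_of_eq (energy_congr_ae ?_)) (hu (x n) (hx n)))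
          filter_upwards [heq] with η hη
          rw [hη _ (hx n)]
  · refine lt_of_le_of_lt (le_of_eq ?_) hu'.2
    rw [Measure.restrict_univ, ← lintegral_indicator measurableSet_Ioo]
    refine lintegral_congr fun t => ?_
    by_cases ht : t ∈ Ioo a b <;> simp [hP', ht, energy]

/-- The profile `e^{-2πiσt|η|} u` of a solution of a half-wave equation, extended to `ℝ`. -/
theorem exists_profile {a b : ℝ} (hab : a < b) {α β σ : ℝ} (hσ : σ ^ 2 = 1) (hβ : β ≤ α)
    {u E : ℝ → Plane → ℂ}
    (hP : PrimAE (Ioo a b) u (fun t η => Complex.I * σ * jb η * u t η + E t η))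
    (hu : EnSup (Ioo a b) α u) (hE : EnInt (Ioo a b) β E) :
    ∃ P P' : ℝ → Plane → ℂ, PrimAE univ P P' ∧ EnSup univ α P ∧ EnInt univ β P' ∧
      ∀ᵐ η, ∀ t ∈ Ioo a b,
        u t η = Complex.exp ((2 * Real.pi * t * (σ * ‖η‖) : ℝ) * Complex.I) * P t η := by
  set e : ℝ → Plane → ℂ :=
    fun t η => Complex.exp ((-(2 * Real.pi * t * (σ * ‖η‖)) : ℝ) * Complex.I) with he
  have hem : Measurable (Function.uncurry e) := by
    simp only [he, Function.uncurry_def]; fun_prop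
  have he1 : ∀ t η, ‖e t η‖ₑ = 1 := fun t η => enorm_exp_mul_I _
  have hed : ∀ η t, HasDerivAt (fun t => e t η)
      (-(2 * Real.pi * σ * ‖η‖ : ℝ) * Complex.I * e t η) t := by
    intro η t
    have := ((Complex.ofRealCLM.hasDerivAt (x := t)).const_mul
      (-(2 * Real.pi * σ * ‖η‖ : ℝ) * Complex.I : ℂ)).cexp
    simp only [Complex.ofRealCLM_apply, Complex.ofReal_one, mul_one] at this
    refine (this.congr_deriv (mul_comm _ _)).congr_deriv ?_ |>.congr_of_eventuallyEq ?_
    · simp only [he]; congr 2; push_cast; ring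
    · refine Eventually.of_forall fun t => ?_
      simp only [he]; congr 1; push_cast; ring
  set w : ℝ → Plane → ℂ := fun t η => e t η * u t η with hw
  -- The equation propagates by ⟨∇⟩ while the profile removes |∇|. The difference is a bounded
  -- multiplier, so the discrepancy joins the forcing without loss of derivatives.
  set g : ℝ → Plane → ℂ := fun t η => (Complex.I * σ * (jb η - 2 * Real.pi * ‖η‖ : ℝ)) * u t η
    with hg
  set w' : ℝ → Plane → ℂ := fun t η => e t η * (g t η + E t η) with hw'
  have hσ1 : ‖(σ : ℂ)‖ = 1 := by
    rw [Complex.norm_real, Real.norm_eq_abs, ← sq_eq_sq₀ (abs_nonneg _) zero_le_one, sq_abs, hσ]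
    norm_num
  have hPw : PrimAE (Ioo a b) w w' := by
    filter_upwards [hP] with η hη
    have hcont : Continuous fun t => -(2 * Real.pi * σ * ‖η‖ : ℝ) * Complex.I * e t η := by
      simp only [he]; fun_prop
    have h1 := (prim_of_hasDerivAt ordConnected_Ioo (hed η)
      ((hcont.continuousOn.integrableOn_Icc (a := a) (b := b)).mono_set Ioo_subset_Icc_self)).mul
        ordConnected_Ioo hη
    refine h1.congr ordConnected_Ioo (fun t _ => rfl) (ae_of_all _ fun t => ?_)
    simp only [hw', hg]; push_cast; ring
  have hwS : EnSup (Ioo a b) α w :=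
    hu.of_enorm_le (hem.mul hu.1) fun t η => by simp [hw, enorm_mul, he1]
  have hgS : EnSup (Ioo a b) α g := by
    have := hu.mul (r := 0) (c := 1) (m := fun η => Complex.I * σ * (jb η - 2 * Real.pi * ‖η‖ : ℝ))
      (by fun_prop) (by simp) (fun η => by
        rw [jw_zero, mul_one, ← ofReal_norm, ← ENNReal.ofReal_one]
        refine ENNReal.ofReal_le_ofReal ?_
        rw [norm_mul, norm_mul, Complex.norm_I, hσ1, one_mul, one_mul, Complex.norm_real]
        exact norm_jb_sub_le η)
    rw [sub_zero] at this
    exact this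
  have hgI : EnInt (Ioo a b) β g :=
    (hgS.enInt (by simp) measurableSet_Ioo).mono_exp hβ
  have hw'I : EnInt (Ioo a b) β w' :=
    (hgI.add hE).of_enorm_le (hem.mul (hgI.1.add hE.1)) fun t η => by
      simp [hw', enorm_mul, he1]
  obtain ⟨P, P', h1, h2, h3, h4⟩ := exists_extension hab hPw hwS hw'I
  refine ⟨P, P', h1, h2, h3, ?_⟩
  filter_upwards [h4] with η hη t ht
  rw [← hη t ht]
  simp only [hw, he, ← mul_assoc, ← Complex.exp_add]
  rw [Complex.ofReal_neg, neg_mul, add_neg_cancel, Complex.exp_zero, one_mul]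

theorem exists_cutoff (a b : ℝ) : ∃ (T : ℝ) (χ χ' : ℝ → ℂ) (C : ℝ≥0∞), 0 ≤ T ∧ C ≠ ⊤ ∧
    Prim univ χ χ' ∧ Continuous χ ∧ Continuous χ' ∧ (∀ t ∈ Ioo a b, χ t = 1) ∧
    (∀ t, t ∉ Ioc (-T) T → χ t = 0) ∧ (∀ t, t ∉ Ioc (-T) T → χ' t = 0) ∧
    (∀ t, ‖χ t‖ₑ ≤ C) ∧ (∀ t, ‖χ' t‖ₑ ≤ C) := by
  set r := |a| + |b| + 1 with hr
  have hr0 : 0 < r := by positivity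
  let f : ContDiffBump (0 : ℝ) := ⟨r, r + 1, hr0, by linarith⟩
  set χ : ℝ → ℂ := fun t => (f t : ℂ) with hχ
  have hcd : ContDiff ℝ 1 χ := Complex.ofRealCLM.contDiff.comp f.contDiff
  have hsupp : ∀ t, t ∉ Metric.ball (0 : ℝ) (r + 1) → χ t = 0 := by
    intro t ht
    have := f.support_eq
    have h2 : t ∉ Function.support f := by rw [this]; exact ht
    simp [hχ, Function.notMem_support.1 h2]
  have hcs : HasCompactSupport χ := f.hasCompactSupport.comp_left (g := fun x : ℝ => (x : ℂ)) rfl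
  have hcd' : Continuous (deriv χ) := hcd.continuous_deriv le_rfl
  have hcs' : HasCompactSupport (deriv χ) := hcs.deriv
  obtain ⟨C1, hC1⟩ := hcs.exists_bound_of_continuous hcd.continuous
  obtain ⟨C2, hC2⟩ := hcs'.exists_bound_of_continuous hcd'
  have hts : ∀ t, t ∉ Ioc (-(r + 2)) (r + 2) → t ∉ tsupport χ := by
    intro t ht h
    have h1 : tsupport χ ⊆ Metric.closedBall 0 (r + 1) := by
      refine closure_minimal (fun x hx => ?_) Metric.isClosed_closedBall
      by_contra h2
      exact hx (hsupp x fun h3 => h2 (Metric.ball_subset_closedBall h3))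
    have h2 := h1 h
    rw [Metric.mem_closedBall, dist_zero_right, Real.norm_eq_abs, abs_le] at h2
    exact ht ⟨by linarith, by linarith⟩
  -- The closed support lies in a ball of radius r + 1; the extra unit keeps it away from the
  -- excluded endpoint -T.
  refine ⟨r + 2, χ, deriv χ, ENNReal.ofReal C1 + ENNReal.ofReal C2, by positivity, by simp,
    prim_of_hasDerivAt ordConnected_univ
      (fun t => ((hcd.differentiable one_ne_zero) t).hasDerivAt)
      (hcd'.integrable_of_hasCompactSupport hcs').integrableOn,
    hcd.continuous, hcd', ?_, fun t ht => image_eq_zero_of_notMem_tsupport (hts t ht),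
    fun t ht => ?_, fun t => ?_, fun t => ?_⟩
  · intro t ht
    have : t ∈ Metric.closedBall (0 : ℝ) f.rIn := by
      rw [Metric.mem_closedBall, dist_zero_right, Real.norm_eq_abs, abs_le]
      change -r ≤ t ∧ t ≤ r
      constructor <;> cases abs_cases a <;> cases abs_cases b <;> linarith [ht.1, ht.2]
    simp [hχ, f.one_of_mem_closedBall this]
  · exact image_eq_zero_of_notMem_tsupport fun h => hts t ht (tsupport_deriv_subset h)
  · rw [← ofReal_norm]; exact (ENNReal.ofReal_le_ofReal (hC1 t)).trans le_self_add
  · rw [← ofReal_norm]; exact (ENNReal.ofReal_le_ofReal (hC2 t)).trans le_add_self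

/-! ### Bilinear Fourier multipliers -/

/-- The bilinear operator with kernel `K` on the Fourier side. -/
def bil (K : Plane → Plane → ℂ) (f g : Plane → ℂ) (ξ : Plane) : ℂ :=
  ∫ η, K ξ η * (f η * g (ξ - η))

theorem enorm_bil_le (K : Plane → Plane → ℂ) (f g : Plane → ℂ) (ξ : Plane) :
    ‖bil K f g ξ‖ₑ ≤ lbil (fun ξ η => ‖K ξ η‖ₑ) (fun η => ‖f η‖ₑ) (fun η => ‖g η‖ₑ) ξ := by
  refine (enorm_integral_le_lintegral_enorm _).trans (le_of_eq ?_)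
  simp only [enorm_mul, lbil, mul_assoc]

theorem measurable_bil {K : Plane → Plane → ℂ} (hK : Measurable (Function.uncurry K))
    {u v : ℝ → Plane → ℂ} (hu : Measurable (Function.uncurry u))
    (hv : Measurable (Function.uncurry v)) :
    Measurable (Function.uncurry fun t => bil K (u t) (v t)) := by
  refine (StronglyMeasurable.integral_prod_right (f := fun (p : ℝ × Plane) (η : Plane) =>
    K p.2 η * (u p.1 η * v p.1 (p.2 - η))) ?_).measurable
  refine Measurable.stronglyMeasurable ?_
  refine (measurable_comp₂ hK (f := fun q : (ℝ × Plane) × Plane => q.1.2) (g := fun q => q.2)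
    (by fun_prop) (by fun_prop)).mul ((measurable_comp₂ hu
    (f := fun q : (ℝ × Plane) × Plane => q.1.1) (g := fun q => q.2) (by fun_prop)
    (by fun_prop)).mul (measurable_comp₂ hv (f := fun q : (ℝ × Plane) × Plane => q.1.1)
    (g := fun q => q.1.2 - q.2) (by fun_prop) (by fun_prop)))

theorem ae_comp_sub {p : Plane → Prop} (h : ∀ᵐ η, p η) (ξ : Plane) : ∀ᵐ η, p (ξ - η) :=
  (Measure.measurePreserving_sub_left volume ξ).quasiMeasurePreserving.ae h

theorem lintegral_lintegral_mul_sub {f g : Plane → ℝ≥0∞} (hf : Measurable f) (hg : Measurable g) :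
    ∫⁻ ξ, ∫⁻ η, f η * g (ξ - η) = (∫⁻ η, f η) * ∫⁻ η, g η := by
  rw [lintegral_lintegral_swap (f := fun ξ η => f η * g (ξ - η))
    (Measurable.aemeasurable (by simp only [Function.uncurry_def]; fun_prop))]
  have h1 : ∀ η, ∫⁻ ξ, f η * g (ξ - η) = f η * ∫⁻ ξ, g ξ := fun η => by
    rw [lintegral_const_mul _ (by fun_prop), lintegral_sub_right_eq_self]
  simp_rw [h1]
  rw [lintegral_mul_const _ hf]

theorem lintegral_rotate {F : Plane → Plane → ℝ → ℝ≥0∞}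
    (hF : Measurable fun q : (Plane × Plane) × ℝ => F q.1.1 q.1.2 q.2) :
    ∫⁻ ξ, ∫⁻ η, ∫⁻ t, F ξ η t = ∫⁻ t, ∫⁻ ξ, ∫⁻ η, F ξ η t := by
  have h1 : ∀ ξ, ∫⁻ η, ∫⁻ t, F ξ η t = ∫⁻ t, ∫⁻ η, F ξ η t := fun ξ =>
    lintegral_lintegral_swap (Measurable.aemeasurable
      (hF.comp (by fun_prop : Measurable fun p : Plane × ℝ => ((ξ, p.1), p.2))))
  simp_rw [h1]
  refine lintegral_lintegral_swap (Measurable.aemeasurable ?_)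
  exact Measurable.lintegral_prod_right' (f := fun q : (Plane × ℝ) × Plane => F q.1.1 q.2 q.1.2)
    (hF.comp (by fun_prop : Measurable fun q : (Plane × ℝ) × Plane => ((q.1.1, q.2), q.1.2)))

/-- At each fixed time the double integral over output and input frequency factors by translation.
This sums the estimates made separately for each output frequency. -/
theorem lintegral_energy_prod {f g : ℝ → Plane → ℂ} (hf : Measurable (Function.uncurry f))
    (hg : Measurable (Function.uncurry g)) (s r : ℝ) (c : ℝ → ℝ≥0∞) (hc : Measurable c) :
    ∫⁻ ξ, ∫⁻ η, ∫⁻ t, c t * ((jw s η * ‖f t η‖ₑ) ^ 2 * (jw r (ξ - η) * ‖g t (ξ - η)‖ₑ) ^ 2) =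
      ∫⁻ t, c t * (energy s (fun η => ‖f t η‖ₑ) * energy r (fun η => ‖g t η‖ₑ)) := by
  have h1 : Measurable fun q : (Plane × Plane) × ℝ => f q.2 q.1.2 :=
    measurable_comp₂ hf (f := fun q : (Plane × Plane) × ℝ => q.2) (g := fun q => q.1.2)
      (by fun_prop) (by fun_prop)
  have h2 : Measurable fun q : (Plane × Plane) × ℝ => g q.2 (q.1.1 - q.1.2) :=
    measurable_comp₂ hg (f := fun q : (Plane × Plane) × ℝ => q.2) (g := fun q => q.1.1 - q.1.2)
      (by fun_prop) (by fun_prop)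
  rw [lintegral_rotate (by fun_prop)]
  refine lintegral_congr fun t => ?_
  have hft := measurable_slice hf t
  have hgt := measurable_slice hg t
  simp only [energy]
  rw [← lintegral_lintegral_mul_sub (f := fun η => (jw s η * ‖f t η‖ₑ) ^ 2)
    (g := fun η => (jw r η * ‖g t η‖ₑ) ^ 2) (by fun_prop) (by fun_prop),
    ← lintegral_const_mul]
  · refine lintegral_congr fun ξ => ?_
    rw [lintegral_const_mul _ (by fun_prop)]
  · exact Measurable.lintegral_prod_right' (f := fun p : Plane × Plane =>
      (jw s p.2 * ‖f t p.2‖ₑ) ^ 2 * (jw r (p.1 - p.2) * ‖g t (p.1 - p.2)‖ₑ) ^ 2) (by fun_prop)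

theorem volume_jb_le_lt_top (R : ℝ) : volume {η : Plane | jb η ≤ R} < ⊤ := by
  refine lt_of_le_of_lt (measure_mono (t := Metric.closedBall (0 : Plane) R) fun η hη => ?_)
    measure_closedBall_lt_top
  rw [mem_closedBall_zero_iff]
  exact (norm_le_jb η).trans hη

theorem add_three_sq_le (a b c : ℝ≥0∞) : (a + b + c) ^ 2 ≤ 4 * (a ^ 2 + b ^ 2 + c ^ 2) := by
  calc (a + b + c) ^ 2 ≤ 2 * ((a + b) ^ 2 + c ^ 2) := add_sq_le _ _
    _ ≤ 2 * (2 * (a ^ 2 + b ^ 2) + 2 * c ^ 2) := by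
        gcongr
        · exact add_sq_le _ _
        · exact le_mul_of_one_le_left' (by norm_num)
    _ = _ := by ring

/-! ### The low frequency region: kernel bounds at a fixed output frequency -/

section LowFrequency

variable {s₀ s₁ κ p : ℝ}

/-- The low frequency region. -/
def lowSet (p : ℝ) (ξ : Plane) : Set Plane := {η | jb η ≤ 8 * jb ξ ^ (1 / p)}

theorem measurableSet_lowSet (p : ℝ) (ξ : Plane) : MeasurableSet (lowSet p ξ) :=
  measurableSet_le measurable_jb measurable_const

theorem one_le_low_radius (hp : 0 < p) (ξ : Plane) : 1 ≤ 8 * jb ξ ^ (1 / p) := by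
  have : 1 ≤ jb ξ ^ (1 / p) := Real.one_le_rpow (one_le_jb ξ) (by positivity)
  linarith

/-- Since p ≤ 1, the output bracket is itself at most its power 1/p, so one radius controls both
inputs. -/
theorem jb_sub_le_of_low (hp : 0 < p) (hp1 : p ≤ 1) {ξ η : Plane} (h : η ∈ lowSet p ξ) :
    jb (ξ - η) ≤ 2 * (8 * jb ξ ^ (1 / p)) := by
  have h1 := jb_sub_le ξ η
  have h2 : jb ξ ≤ jb ξ ^ (1 / p) := by
    calc jb ξ = jb ξ ^ (1 : ℝ) := (Real.rpow_one _).symm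
      _ ≤ _ := Real.rpow_le_rpow_of_exponent_le (one_le_jb ξ) (by rw [le_div_iff₀ hp]; linarith)
  have h3 : jb η ≤ 8 * jb ξ ^ (1 / p) := h
  have := jb_pos ξ
  linarith

/-- The modulation scale in the low frequency region. -/
def modScale (κ p : ℝ) (ξ : Plane) : ℝ := (2 * (8 * jb ξ ^ (1 / p))) ^ κ

theorem modScale_pos (κ : ℝ) (hp : 0 < p) (ξ : Plane) : 0 < modScale κ p ξ :=
  Real.rpow_pos_of_pos (by linarith [one_le_low_radius hp ξ]) _

/-- The modulation scale is the κ-th power of a bound for both input frequencies. Dividing by it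
pays for the κ derivatives lost when the time derivative hits either factor. -/
theorem inv_modScale_le (hκ : 0 ≤ κ) {ξ ζ : Plane}
    (h : jb ζ ≤ 2 * (8 * jb ξ ^ (1 / p))) :
    ENNReal.ofReal (modScale κ p ξ)⁻¹ ≤ jw (-κ) ζ := by
  refine ENNReal.ofReal_le_ofReal ?_
  rw [Real.rpow_neg (jb_pos ζ).le]
  exact inv_anti₀ (Real.rpow_pos_of_pos (jb_pos ζ) _) (Real.rpow_le_rpow (jb_pos ζ).le h hκ)

theorem inv_modScale_le_one (hκ : 0 ≤ κ) (hp : 0 < p) (ξ : Plane) :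
    ENNReal.ofReal (modScale κ p ξ)⁻¹ ≤ 1 := by
  rw [← ENNReal.ofReal_one]
  refine ENNReal.ofReal_le_ofReal (inv_le_one_of_one_le₀ ?_)
  exact Real.one_le_rpow (by linarith [one_le_low_radius hp ξ]) hκ

/-- The angle defect contributes R^{1-2s₁}L by `lintegral_resonance_le`. With R of size ⟨ξ⟩^{1/p}
and L of size R^κ this is a power (1-2s₁+κ)/p of ⟨ξ⟩, absorbed by ⟨ξ⟩^{-2s₀}. The terms of exponent
-4 are integrable over the plane and need no modulation weight. -/
theorem exists_low_kernel_bound (hs₁ : 0 ≤ s₁) (hs₁' : s₁ ≤ 1 / 2) (hs₀ : 0 ≤ s₀)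
    (hp : 0 < p) (h : (1 / p) * (1 - 2 * s₁ + κ) ≤ 2 * s₀) :
    ∃ J : ℝ≥0∞, J ≠ ⊤ ∧ ∀ σ σ' : ℝ, σ ^ 2 = 1 → σ' ^ 2 = 1 → ∀ (ξ : Plane) (l : ℝ),
      ∫⁻ η, (lowSet p ξ).indicator (fun η => jw (-(2 * s₀)) ξ * (jw (-(2 * s₁)) η *
        (ENNReal.ofReal (angleDefect σ σ' η (ξ - η)) + jw (-4) η + jw (-4) (ξ - η)))) η *
        ENNReal.ofReal (1 / (1 + ((l - (σ * ‖η‖ + σ' * ‖ξ - η‖)) / modScale κ p ξ) ^ 2)) ≤ J := by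
  set S := (volume : Measure Plane).toSphere univ with hS
  set A := ∫⁻ η, jw (-4) η with hA
  have hA' : A ≠ ⊤ := (lintegral_jw_lt_top (by norm_num)).ne
  set c := ENNReal.ofReal (Real.pi * (2 ^ κ * 8 ^ (1 - 2 * s₁ + κ))) with hc
  refine ⟨S * c + A + A, by finiteness, fun σ σ' hσ hσ' ξ l => ?_⟩
  set R := 8 * jb ξ ^ (1 / p) with hR
  have hR1 : 1 ≤ R := one_le_low_radius hp ξ
  set L := modScale κ p ξ with hL
  have hL0 : 0 < L := modScale_pos κ hp ξ
  set w : Plane → ℝ := fun η => 1 / (1 + ((l - (σ * ‖η‖ + σ' * ‖ξ - η‖)) / L) ^ 2) with hw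
  have hw1 : ∀ η, ENNReal.ofReal (w η) ≤ 1 := by
    intro η
    rw [← ENNReal.ofReal_one]
    refine ENNReal.ofReal_le_ofReal (div_le_one_of_le₀ ?_ (by positivity))
    nlinarith [sq_nonneg ((l - (σ * ‖η‖ + σ' * ‖ξ - η‖)) / L)]
  have hma : Measurable fun η : Plane => angleDefect σ σ' η (ξ - η) :=
    measurable_comp₂ (measurable_angleDefect σ σ') (f := fun η => η) (g := fun η => ξ - η)
      (by fun_prop) (by fun_prop)
  set g : Plane → ℝ≥0∞ := {η | jb η ≤ R}.indicator (fun η => jw (-(2 * s₁)) η *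
      ENNReal.ofReal (angleDefect σ σ' η (ξ - η) * w η)) with hg
  have hgm : Measurable g :=
    Measurable.indicator (by fun_prop) (measurableSet_le measurable_jb measurable_const)
  have hj0 : ∀ {s : ℝ} (hs : 0 ≤ s) (η : Plane), jw (-(2 * s)) η ≤ 1 := fun hs η => by
    simpa using jw_mono (show -(2 * _) ≤ (0 : ℝ) by linarith) η
  have hpt : ∀ η, (lowSet p ξ).indicator (fun η => jw (-(2 * s₀)) ξ * (jw (-(2 * s₁)) η *
        (ENNReal.ofReal (angleDefect σ σ' η (ξ - η)) + jw (-4) η + jw (-4) (ξ - η)))) η *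
        ENNReal.ofReal (w η) ≤ jw (-(2 * s₀)) ξ * g η + jw (-4) η + jw (-4) (ξ - η) := by
    intro η
    by_cases hη : η ∈ lowSet p ξ
    · rw [indicator_of_mem hη, hg, indicator_of_mem (by exact hη),
        ENNReal.ofReal_mul (angleDefect_mem hσ hσ' _ _).1]
      set m := ENNReal.ofReal (angleDefect σ σ' η (ξ - η))
      set W := ENNReal.ofReal (w η)
      have hW : W ≤ 1 := hw1 η
      calc jw (-(2 * s₀)) ξ * (jw (-(2 * s₁)) η * (m + jw (-4) η + jw (-4) (ξ - η))) * W
          = jw (-(2 * s₀)) ξ * (jw (-(2 * s₁)) η * (m * W)) +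
            (jw (-(2 * s₀)) ξ * jw (-(2 * s₁)) η * W) * jw (-4) η +
            (jw (-(2 * s₀)) ξ * jw (-(2 * s₁)) η * W) * jw (-4) (ξ - η) := by ring
        _ ≤ _ := by
          have h1 : jw (-(2 * s₀)) ξ * jw (-(2 * s₁)) η * W ≤ 1 :=
            mul_le_one' (mul_le_one' (hj0 hs₀ ξ) (hj0 hs₁ η)) hW
          refine add_le_add (add_le_add le_rfl ?_) ?_ <;> exact mul_le_of_le_one_left' h1
    · rw [indicator_of_notMem hη, zero_mul]; exact zero_le
  refine (lintegral_mono hpt).trans ?_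
  rw [lintegral_add_right _ (by fun_prop), lintegral_add_right _ (by fun_prop),
    lintegral_const_mul _ hgm, lintegral_sub_left_eq_self (fun η => jw (-4) η) ξ]
  refine add_le_add (add_le_add ?_ le_rfl) le_rfl
  refine (mul_le_mul_right (lintegral_resonance_le hσ hσ' hs₁' hL0 hR1 ξ l) _).trans ?_
  rw [mul_left_comm, jw, ← ENNReal.ofReal_mul (Real.rpow_nonneg (jb_pos _).le _)]
  refine mul_le_mul_right (ENNReal.ofReal_le_ofReal ?_) _
  have hx := jb_pos ξ
  have e1 : R ^ (1 - 2 * s₁) * L = 2 ^ κ * 8 ^ (1 - 2 * s₁ + κ) *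
      jb ξ ^ ((1 / p) * (1 - 2 * s₁ + κ)) := by
    have hLR : L = 2 ^ κ * R ^ κ := by
      rw [hL, modScale, ← hR, Real.mul_rpow (by norm_num) (by linarith)]
    rw [hLR, mul_left_comm, ← Real.rpow_add (by linarith), hR, Real.mul_rpow (by norm_num) (by positivity),
      ← Real.rpow_mul hx.le, mul_assoc]
  rw [e1]
  have e2 : jb ξ ^ (-(2 * s₀)) * jb ξ ^ ((1 / p) * (1 - 2 * s₁ + κ)) ≤ 1 := by
    rw [← Real.rpow_add hx]
    exact Real.rpow_le_one_of_one_le_of_nonpos (one_le_jb ξ) (by linarith)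
  calc _ = Real.pi * (2 ^ κ * 8 ^ (1 - 2 * s₁ + κ)) *
        (jb ξ ^ (-(2 * s₀)) * jb ξ ^ ((1 / p) * (1 - 2 * s₁ + κ))) := by ring
    _ ≤ Real.pi * (2 ^ κ * 8 ^ (1 - 2 * s₁ + κ)) * 1 := by gcongr
    _ = _ := mul_one _

end LowFrequency

theorem lintegral_triple {F : Plane → Plane → ℝ → ℝ≥0∞}
    (hF : Measurable fun q : (Plane × Plane) × ℝ => F q.1.1 q.1.2 q.2) :
    ∫⁻ ξ, ∫⁻ η, ∫⁻ t, F ξ η t =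
      ∫⁻ q : (Plane × Plane) × ℝ, F q.1.1 q.1.2 q.2 ∂((volume.prod volume).prod volume) := by
  rw [lintegral_prod _ hF.aemeasurable, lintegral_prod _ hF.lintegral_prod_right'.aemeasurable]

set_option maxHeartbeats 800000 in
/-- The bilinear estimate for half-waves in the low frequency region. -/
theorem bilinear_low {a b : ℝ} (hab : a < b) {s₀ s₁ κ p σ σ' : ℝ} (hσ : σ ^ 2 = 1)
    (hσ' : σ' ^ 2 = 1) (hs₁ : 0 ≤ s₁) (hs₁' : s₁ ≤ 1 / 2) (hs₀ : 0 ≤ s₀) (hκ : 0 ≤ κ)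
    (hp : 0 < p) (hp1 : p ≤ 1) (h : (1 / p) * (1 - 2 * s₁ + κ) ≤ 2 * s₀)
    {K : Plane → Plane → ℂ} (hKm : Measurable (Function.uncurry K))
    (hK0 : ∀ ξ η, η ∉ lowSet p ξ → K ξ η = 0) {C₀ : ℝ≥0∞} (hC₀ : C₀ ≠ ⊤)
    (hK : ∀ ξ η, ‖K ξ η‖ₑ ^ 2 ≤ C₀ * (jw 2 η * jw 2 (ξ - η) *
      (ENNReal.ofReal (angleDefect σ σ' η (ξ - η)) + jw (-4) η + jw (-4) (ξ - η))))
    {u v E G : ℝ → Plane → ℂ}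
    (hu : PrimAE (Ioo a b) u (fun t η => Complex.I * σ * jb η * u t η + E t η))
    (hus : EnSup (Ioo a b) (1 + s₁) u) (hE : EnInt (Ioo a b) (1 + s₁ - κ) E)
    (hv : PrimAE (Ioo a b) v (fun t η => Complex.I * σ' * jb η * v t η + G t η))
    (hvs : EnSup (Ioo a b) 1 v) (hG : EnInt (Ioo a b) (1 - κ) G) :
    EnInt (Ioo a b) (-s₀) (fun t => bil K (u t) (v t)) := by
  have hbm := measurable_bil hKm hus.1 hvs.1
  refine ⟨hbm, ?_⟩
  obtain ⟨J, hJt, hJ⟩ := exists_low_kernel_bound hs₁ hs₁' hs₀ hp h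
  obtain ⟨P, P', hP, hPs, hP', huP⟩ := exists_profile hab hσ (by linarith) hu hus hE
  obtain ⟨Q, Q', hQ, hQs, hQ', hvQ⟩ := exists_profile hab hσ' (by linarith) hv hvs hG
  obtain ⟨T, χ, χ', C, hT, hC, hχ, hχc, hχc', hχ1, hχ0, hχ0', hχb, hχb'⟩ := exists_cutoff a b
  obtain ⟨hPm, CP, hCP, hPs⟩ := hPs
  obtain ⟨hQm, CQ, hCQ, hQs⟩ := hQs
  obtain ⟨hPm', hPf'⟩ := hP'
  obtain ⟨hQm', hQf'⟩ := hQ'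
  set c : ℝ → ℝ≥0∞ := (Ioc (-T) T).indicator (fun _ => 1) with hc
  have hcm : Measurable c := measurable_const.indicator measurableSet_Ioc
  -- A majorant for the squared amplitude and its rescaled time derivative, which may fall on the
  -- cutoff or on either profile. The factor 5 is 1 + 4: the amplitude itself, and the cutoff term
  -- among three squared summands.
  set D : Plane → Plane → ℝ → ℝ≥0∞ := fun ξ η t =>
    5 * C ^ 2 * (c t * ((jw (1 + s₁) η * ‖P t η‖ₑ) ^ 2 * (jw 1 (ξ - η) * ‖Q t (ξ - η)‖ₑ) ^ 2)) +
    4 * C ^ 2 * (1 * ((jw (1 + s₁ - κ) η * ‖P' t η‖ₑ) ^ 2 *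
      (jw 1 (ξ - η) * ‖Q t (ξ - η)‖ₑ) ^ 2)) +
    4 * C ^ 2 * (1 * ((jw (1 + s₁) η * ‖P t η‖ₑ) ^ 2 *
      (jw (1 - κ) (ξ - η) * ‖Q' t (ξ - η)‖ₑ) ^ 2)) with hD
  have m1 : ∀ {f : ℝ → Plane → ℂ}, Measurable (Function.uncurry f) →
      Measurable fun q : (Plane × Plane) × ℝ => f q.2 q.1.2 := fun hf =>
    measurable_comp₂ hf (f := fun q : (Plane × Plane) × ℝ => q.2) (g := fun q => q.1.2)
      (by fun_prop) (by fun_prop)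
  have m2 : ∀ {f : ℝ → Plane → ℂ}, Measurable (Function.uncurry f) →
      Measurable fun q : (Plane × Plane) × ℝ => f q.2 (q.1.1 - q.1.2) := fun hf =>
    measurable_comp₂ hf (f := fun q : (Plane × Plane) × ℝ => q.2) (g := fun q => q.1.1 - q.1.2)
      (by fun_prop) (by fun_prop)
  have n1 : Measurable fun q : (Plane × Plane) × ℝ => P q.2 q.1.2 := m1 hPm
  have n2 : Measurable fun q : (Plane × Plane) × ℝ => P' q.2 q.1.2 := m1 hPm'
  have n3 : Measurable fun q : (Plane × Plane) × ℝ => Q q.2 (q.1.1 - q.1.2) := m2 hQm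
  have n4 : Measurable fun q : (Plane × Plane) × ℝ => Q' q.2 (q.1.1 - q.1.2) := m2 hQm'
  have hDm : Measurable fun q : (Plane × Plane) × ℝ => D q.1.1 q.1.2 q.2 := by
    simp only [hD]; fun_prop
  have hDfin : ∫⁻ ξ, ∫⁻ η, ∫⁻ t, D ξ η t < ⊤ := by
    rw [lintegral_triple hDm]
    simp only [hD]
    rw [lintegral_add_left (by fun_prop), lintegral_add_left (by fun_prop),
      lintegral_const_mul (5 * C ^ 2) (by fun_prop), lintegral_const_mul (4 * C ^ 2) (by fun_prop),
      lintegral_const_mul (4 * C ^ 2) (by fun_prop),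
      ← lintegral_triple (F := fun ξ η t => c t * ((jw (1 + s₁) η * ‖P t η‖ₑ) ^ 2 *
        (jw 1 (ξ - η) * ‖Q t (ξ - η)‖ₑ) ^ 2)) (by fun_prop),
      ← lintegral_triple (F := fun ξ η t => 1 * ((jw (1 + s₁ - κ) η * ‖P' t η‖ₑ) ^ 2 *
        (jw 1 (ξ - η) * ‖Q t (ξ - η)‖ₑ) ^ 2)) (by fun_prop),
      ← lintegral_triple (F := fun ξ η t => 1 * ((jw (1 + s₁) η * ‖P t η‖ₑ) ^ 2 *
        (jw (1 - κ) (ξ - η) * ‖Q' t (ξ - η)‖ₑ) ^ 2)) (by fun_prop),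
      lintegral_energy_prod hPm hQm _ _ c hcm,
      lintegral_energy_prod hPm' hQm _ _ (fun _ => 1) measurable_const,
      lintegral_energy_prod hPm hQm' _ _ (fun _ => 1) measurable_const]
    have b1 : ∫⁻ t, c t * (energy (1 + s₁) (fun η => ‖P t η‖ₑ) * energy 1 fun η => ‖Q t η‖ₑ) ≤
        ENNReal.ofReal (T - -T) * (CP * CQ) := by
      calc _ ≤ ∫⁻ t, c t * (CP * CQ) := lintegral_mono fun t => by
            gcongr
            · exact hPs t (mem_univ t)
            · exact hQs t (mem_univ t)
        _ = _ := by
            rw [lintegral_mul_const _ hcm, hc, lintegral_indicator_const measurableSet_Ioc,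
              Real.volume_Ioc, one_mul]
    have b2 : ∫⁻ t, 1 * (energy (1 + s₁ - κ) (fun η => ‖P' t η‖ₑ) *
        energy 1 fun η => ‖Q t η‖ₑ) < ⊤ := by
      refine lt_of_le_of_lt (b := ∫⁻ t, energy (1 + s₁ - κ) (fun η => ‖P' t η‖ₑ) * CQ)
        (lintegral_mono fun t => ?_) ?_
      · rw [one_mul]; exact mul_le_mul_right (hQs t (mem_univ t)) _
      · rw [lintegral_mul_const' _ _ hCQ]
        refine ENNReal.mul_lt_top ?_ (lt_top_iff_ne_top.2 hCQ)
        simpa using hPf'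
    have b3 : ∫⁻ t, 1 * (energy (1 + s₁) (fun η => ‖P t η‖ₑ) *
        energy (1 - κ) fun η => ‖Q' t η‖ₑ) < ⊤ := by
      refine lt_of_le_of_lt (b := ∫⁻ t, CP * energy (1 - κ) (fun η => ‖Q' t η‖ₑ))
        (lintegral_mono fun t => ?_) ?_
      · rw [one_mul]; exact mul_le_mul_left (hPs t (mem_univ t)) _
      · rw [lintegral_const_mul' _ _ hCP]
        refine ENNReal.mul_lt_top (lt_top_iff_ne_top.2 hCP) ?_
        simpa using hQf'
    have b1' := lt_of_le_of_lt b1 (show _ < ⊤ by finiteness)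
    exact ENNReal.add_lt_top.2 ⟨ENNReal.add_lt_top.2 ⟨ENNReal.mul_lt_top (by finiteness) b1',
      ENNReal.mul_lt_top (by finiteness) b2⟩, ENNReal.mul_lt_top (by finiteness) b3⟩
  -- The Sobolev weights of the inputs are divided out of the kernel here and returned to the
  -- profiles through `W`.
  set Kt : Plane → Plane → ℂ := fun ξ η =>
    ((jb ξ ^ (-s₀) * jb η ^ (-(1 + s₁)) * jb (ξ - η) ^ (-1 : ℝ) : ℝ) : ℂ) * K ξ η with hKt
  set W : Plane → Plane → ℂ := fun ξ => (lowSet p ξ).indicator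
    (fun η => ((jb η ^ (1 + s₁) * jb (ξ - η) : ℝ) : ℂ)) with hW
  set f : Plane → Plane → ℝ := fun ξ η => σ * ‖η‖ + σ' * ‖ξ - η‖ with hf
  set H : Plane → ℝ → Plane → ℂ := fun ξ t η => W ξ η * (χ t * (P t η * Q t (ξ - η))) with hH
  set H' : Plane → ℝ → Plane → ℂ := fun ξ t η =>
    W ξ η * (χ' t * (P t η * Q t (ξ - η)) +
      χ t * (P' t η * Q t (ξ - η) + P t η * Q' t (ξ - η))) with hH'
  have hKx : ∀ ξ, Measurable (K ξ) := fun ξ =>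
    measurable_comp₂ hKm (f := fun _ => ξ) (g := fun η => η) (by fun_prop) (by fun_prop)
  have hKtm : ∀ ξ, Measurable (Kt ξ) := fun ξ => by
    have := hKx ξ
    simp only [hKt]; fun_prop
  have hWm : ∀ ξ, Measurable (W ξ) := fun ξ =>
    Measurable.indicator (by fun_prop) (measurableSet_lowSet p ξ)
  have hWn : ∀ ξ η, η ∈ lowSet p ξ → ‖W ξ η‖ₑ = jw (1 + s₁) η * jw 1 (ξ - η) := by
    intro ξ η hη
    simp only [hW]
    rw [indicator_of_mem hη, ← ofReal_norm, Complex.norm_real, Real.norm_of_nonneg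
      (mul_nonneg (Real.rpow_nonneg (jb_pos _).le _) (jb_pos _).le),
      ENNReal.ofReal_mul (Real.rpow_nonneg (jb_pos _).le _), jw, jw, Real.rpow_one]
  have hW0 : ∀ ξ η, η ∉ lowSet p ξ → W ξ η = 0 := fun ξ η hη => indicator_of_notMem hη _
  have hKtn : ∀ ξ η, ‖Kt ξ η‖ₑ ^ 2 ≤ C₀ * (lowSet p ξ).indicator (fun η => jw (-(2 * s₀)) ξ *
      (jw (-(2 * s₁)) η * (ENNReal.ofReal (angleDefect σ σ' η (ξ - η)) + jw (-4) η +
        jw (-4) (ξ - η)))) η := by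
    intro ξ η
    by_cases hη : η ∈ lowSet p ξ
    · rw [indicator_of_mem hη]
      have e1 : ‖Kt ξ η‖ₑ = jw (-s₀) ξ * jw (-(1 + s₁)) η * jw (-1) (ξ - η) * ‖K ξ η‖ₑ := by
        have p1 := Real.rpow_nonneg (jb_pos ξ).le (-s₀)
        have p2 := Real.rpow_nonneg (jb_pos η).le (-(1 + s₁))
        have p3 := Real.rpow_nonneg (jb_pos (ξ - η)).le (-1)
        rw [hKt, enorm_mul, ← ofReal_norm, Complex.norm_real, Real.norm_of_nonneg (by positivity),
          ENNReal.ofReal_mul (by positivity), ENNReal.ofReal_mul p1]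
        rfl
      rw [e1, mul_pow, mul_pow, mul_pow, jw_sq, jw_sq, jw_sq]
      refine (mul_le_mul_right (hK ξ η) _).trans (le_of_eq ?_)
      have e2 : jw (2 * -(1 + s₁)) η * jw 2 η = jw (-(2 * s₁)) η := by
        rw [← jw_add]; congr 1; ring
      have e3 : jw (2 * -1) (ξ - η) * jw 2 (ξ - η) = 1 := by
        rw [← jw_add]; norm_num
      have e4 : jw (2 * -s₀) ξ = jw (-(2 * s₀)) ξ := by congr 1; ring
      rw [e4, ← e2]
      calc _ = C₀ * (jw (-(2 * s₀)) ξ * (jw (2 * -(1 + s₁)) η * jw 2 η * (ENNReal.ofReal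
            (angleDefect σ σ' η (ξ - η)) + jw (-4) η + jw (-4) (ξ - η)))) *
            (jw (2 * -1) (ξ - η) * jw 2 (ξ - η)) := by ring
        _ = _ := by rw [e3, mul_one]
    · simp [hKt, hK0 ξ η hη]
  have main : ∀ ξ, ∫⁻ t, ‖∫ η, Kt ξ η * Complex.exp ((2 * Real.pi * t * f ξ η : ℝ) * Complex.I) *
      H ξ t η‖ₑ ^ 2 ≤ (C₀ * J + 1) * ∫⁻ η, ∫⁻ t, D ξ η t := by
    intro ξ
    have q1 : Measurable fun q : ℝ × Plane => Q q.1 (ξ - q.2) :=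
      measurable_comp₂ hQm (f := fun q : ℝ × Plane => q.1) (g := fun q => ξ - q.2)
        (by fun_prop) (by fun_prop)
    have hPm₁ : Measurable fun q : ℝ × Plane => P q.1 q.2 := hPm
    have hWm' := hWm ξ
    have hHm : Measurable (Function.uncurry (H ξ)) := by
      simp only [hH, Function.uncurry_def]; fun_prop
    have hprim : ∀ᵐ η, Prim univ (fun t => H ξ t η) (fun t => H' ξ t η) := by
      filter_upwards [hP, ae_comp_sub hQ ξ] with η h1 h2
      exact (hχ.mul_univ (h1.mul_univ h2)).const_mul (W ξ η)
    -- The summand 1 only keeps the constant nonzero, as `oscillatory_lintegral_le` demands.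
    have hJ' : ∀ l, ∫⁻ η, ‖Kt ξ η‖ₑ ^ 2 * ENNReal.ofReal (1 / (1 + ((l - f ξ η) /
        modScale κ p ξ) ^ 2)) ≤ C₀ * J + 1 := by
      intro l
      refine le_trans ?_ (le_trans (mul_le_mul_right (hJ σ σ' hσ hσ' ξ l) C₀) le_self_add)
      rw [← lintegral_const_mul' _ _ hC₀]
      refine lintegral_mono fun η => ?_
      rw [← mul_assoc]
      exact mul_le_mul_left (hKtn ξ η) _
    have hKt2 : ∫⁻ η, ‖Kt ξ η‖ₑ ^ 2 < ⊤ := by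
      have hj0 : ∀ {s : ℝ} (hs : 0 ≤ s) (η : Plane), jw (-s) η ≤ 1 := fun hs η => by
        simpa using jw_mono (show -_ ≤ (0 : ℝ) by linarith) η
      refine lt_of_le_of_lt (b := ∫⁻ η, (lowSet p ξ).indicator (fun _ => C₀ * 4) η)
        (lintegral_mono fun η => (hKtn ξ η).trans ?_) ?_
      · by_cases hη : η ∈ lowSet p ξ
        · rw [indicator_of_mem hη, indicator_of_mem hη]
          refine mul_le_mul_right ?_ _
          have hm : ENNReal.ofReal (angleDefect σ σ' η (ξ - η)) ≤ 2 := by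
            exact ENNReal.ofReal_le_of_le_toReal (by simpa using (angleDefect_mem hσ hσ' _ _).2)
          calc _ ≤ (1 : ℝ≥0∞) * (1 * (2 + 1 + 1)) := by
                refine mul_le_mul' (hj0 (by linarith) ξ) (mul_le_mul' (hj0 (by linarith) η)
                  (add_le_add (add_le_add hm (hj0 (by norm_num) η)) (hj0 (by norm_num) _)))
            _ = 4 := by norm_num
        · rw [indicator_of_notMem hη]; simp
      · rw [lintegral_indicator_const (measurableSet_lowSet p ξ)]
        exact ENNReal.mul_lt_top (by finiteness) (volume_jb_le_lt_top _)
    refine (oscillatory_lintegral_le (hKtm ξ) (f := f ξ) (by simp only [hf]; fun_prop) hKt2 hHm hT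
      (fun t ht η => by simp [hH, hχ0 t ht]) (fun t ht η => by simp [hH', hχ0 t ht, hχ0' t ht])
      hprim (L := modScale κ p ξ) (J := C₀ * J + 1) (by simp) (by finiteness) hJ').trans ?_
    refine mul_le_mul_right (lintegral_mono fun η => ?_) _
    have hHη : Measurable fun t => H ξ t η :=
      measurable_comp₂ hHm (f := fun t => t) (g := fun _ => η) (by fun_prop) (by fun_prop)
    rw [← lintegral_const_mul' _ _ ENNReal.ofReal_ne_top, ← lintegral_add_left (by fun_prop)]
    refine lintegral_mono fun t => ?_
    by_cases hη : η ∈ lowSet p ξ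
    swap
    · simp [hH, hH', hW0 ξ η hη]
    have hL0 := modScale_pos κ hp ξ
    set A := jw (1 + s₁) η * ‖P t η‖ₑ with hA
    set B := jw 1 (ξ - η) * ‖Q t (ξ - η)‖ₑ with hB
    set A' := jw (1 + s₁ - κ) η * ‖P' t η‖ₑ with hA'
    set B' := jw (1 - κ) (ξ - η) * ‖Q' t (ξ - η)‖ₑ with hB'
    set li := ENNReal.ofReal (modScale κ p ξ)⁻¹ with hli
    have l1 : li ≤ 1 := inv_modScale_le_one hκ hp ξ
    have l2 : li ≤ jw (-κ) η := inv_modScale_le hκ (by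
      have : jb η ≤ 8 * jb ξ ^ (1 / p) := hη
      linarith [jb_pos η])
    have l3 : li ≤ jw (-κ) (ξ - η) := inv_modScale_le hκ (jb_sub_le_of_low hp hp1 hη)
    have hc1 : ∀ {z : ℝ → ℂ}, (∀ t, t ∉ Ioc (-T) T → z t = 0) → (∀ t, ‖z t‖ₑ ≤ C) →
        ‖z t‖ₑ ^ 2 ≤ C ^ 2 * c t := by
      intro z h1 h2
      by_cases ht : t ∈ Ioc (-T) T
      · rw [hc, indicator_of_mem ht, mul_one]
        exact pow_le_pow_left' (h2 t) 2
      · simp [h1 t ht]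
    have g1 : ‖H ξ t η‖ₑ ^ 2 ≤ C ^ 2 * (c t * (A ^ 2 * B ^ 2)) := by
      have : ‖H ξ t η‖ₑ = ‖χ t‖ₑ * (A * B) := by
        simp only [hH, enorm_mul, hWn ξ η hη, hA, hB]; ring
      rw [this, mul_pow, mul_pow, ← mul_assoc (C ^ 2)]
      exact mul_le_mul_left (hc1 hχ0 hχb) _
    have g2 : ENNReal.ofReal ((modScale κ p ξ)⁻¹ ^ 2) * ‖H' ξ t η‖ₑ ^ 2 ≤
        4 * (C ^ 2 * (c t * (A ^ 2 * B ^ 2)) + C ^ 2 * (A' ^ 2 * B ^ 2) +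
          C ^ 2 * (A ^ 2 * B' ^ 2)) := by
      have e1 : li * ‖H' ξ t η‖ₑ ≤ ‖χ' t‖ₑ * (A * B) + C * (A' * B) + C * (A * B') := by
        have e2 : ‖H' ξ t η‖ₑ ≤ jw (1 + s₁) η * jw 1 (ξ - η) *
            (‖χ' t‖ₑ * (‖P t η‖ₑ * ‖Q t (ξ - η)‖ₑ) + C * (‖P' t η‖ₑ * ‖Q t (ξ - η)‖ₑ +
              ‖P t η‖ₑ * ‖Q' t (ξ - η)‖ₑ)) := by
          simp only [hH', enorm_mul, hWn ξ η hη]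
          refine mul_le_mul_right ((enorm_add_le _ _).trans ?_) _
          rw [enorm_mul, enorm_mul, enorm_mul]
          refine add_le_add le_rfl (mul_le_mul' (hχb t) ((enorm_add_le _ _).trans ?_))
          rw [enorm_mul, enorm_mul]
        have e3 : jw (-κ) η * jw (1 + s₁) η = jw (1 + s₁ - κ) η := by
          rw [← jw_add]; congr 1; ring
        have e4 : jw (-κ) (ξ - η) * jw 1 (ξ - η) = jw (1 - κ) (ξ - η) := by
          rw [← jw_add]; congr 1; ring
        calc li * ‖H' ξ t η‖ₑ ≤ li * (jw (1 + s₁) η * jw 1 (ξ - η) *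
            (‖χ' t‖ₑ * (‖P t η‖ₑ * ‖Q t (ξ - η)‖ₑ) + C * (‖P' t η‖ₑ * ‖Q t (ξ - η)‖ₑ +
              ‖P t η‖ₑ * ‖Q' t (ξ - η)‖ₑ))) := mul_le_mul_right e2 _
          _ = li * (‖χ' t‖ₑ * (A * B)) + li * (C * (jw (1 + s₁) η * ‖P' t η‖ₑ * B)) +
              li * (C * (A * (jw 1 (ξ - η) * ‖Q' t (ξ - η)‖ₑ))) := by
              simp only [hA, hB]; ring
          _ ≤ 1 * (‖χ' t‖ₑ * (A * B)) + jw (-κ) η * (C * (jw (1 + s₁) η * ‖P' t η‖ₑ * B)) +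
              jw (-κ) (ξ - η) * (C * (A * (jw 1 (ξ - η) * ‖Q' t (ξ - η)‖ₑ))) :=
              add_le_add (add_le_add (mul_le_mul_left l1 _) (mul_le_mul_left l2 _))
                (mul_le_mul_left l3 _)
          _ = _ := by
              rw [hA', hB', ← e3, ← e4]; ring
      rw [ENNReal.ofReal_pow (by positivity), ← mul_pow]
      refine (pow_le_pow_left' e1 2).trans ((add_three_sq_le _ _ _).trans ?_)
      refine mul_le_mul_right (add_le_add (add_le_add ?_ (le_of_eq (by ring)))
        (le_of_eq (by ring))) _
      rw [mul_pow, mul_pow, ← mul_assoc (C ^ 2)]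
      exact mul_le_mul_left (hc1 hχ0' hχb') _
    refine (add_le_add g1 g2).trans (le_of_eq ?_)
    simp only [hD, one_mul]
    ring
  -- Exchanging t and ξ lets `main` act at each fixed output frequency. On the interval the cutoff
  -- equals 1, so the profiles reproduce the original half-waves.
  calc ∫⁻ t in Ioo a b, energy (-s₀) (fun ξ => ‖bil K (u t) (v t) ξ‖ₑ)
      = ∫⁻ ξ, ∫⁻ t in Ioo a b, (jw (-s₀) ξ * ‖bil K (u t) (v t) ξ‖ₑ) ^ 2 := by
        refine lintegral_lintegral_swap (Measurable.aemeasurable ?_)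
        have : Measurable fun q : ℝ × Plane => bil K (u q.1) (v q.1) q.2 := hbm
        simp only [Function.uncurry_def]
        fun_prop
    _ ≤ ∫⁻ ξ, (C₀ * J + 1) * ∫⁻ η, ∫⁻ t, D ξ η t := by
        refine lintegral_mono fun ξ => le_trans ?_ (main ξ)
        refine le_trans (setLIntegral_mono_ae' measurableSet_Ioo (ae_of_all _ fun t ht => ?_))
          (setLIntegral_le_lintegral (Ioo a b) _)
        refine le_of_eq (congrArg (· ^ 2) ?_)
        have e1 : jw (-s₀) ξ = ‖((jb ξ ^ (-s₀) : ℝ) : ℂ)‖ₑ := by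
          rw [← ofReal_norm, Complex.norm_real, Real.norm_of_nonneg
            (Real.rpow_nonneg (jb_pos ξ).le _)]; rfl
        rw [e1, ← enorm_mul, bil, ← integral_const_mul]
        congr 1
        refine integral_congr_ae ?_
        filter_upwards [huP, ae_comp_sub hvQ ξ] with η h1 h2
        by_cases hη : η ∈ lowSet p ξ
        · rw [h1 t ht, h2 t ht]
          simp only [hKt, hH, hχ1 t ht, hW, indicator_of_mem hη, hf]
          have e2 : Complex.exp ((2 * Real.pi * t * (σ * ‖η‖ + σ' * ‖ξ - η‖) : ℝ) * Complex.I) =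
              Complex.exp ((2 * Real.pi * t * (σ * ‖η‖) : ℝ) * Complex.I) *
              Complex.exp ((2 * Real.pi * t * (σ' * ‖ξ - η‖) : ℝ) * Complex.I) := by
            rw [← Complex.exp_add]; congr 1; push_cast; ring
          have e3 : ((jb η ^ (-(1 + s₁)) : ℝ) : ℂ) * ((jb η ^ (1 + s₁) : ℝ) : ℂ) = 1 := by
            rw [← Complex.ofReal_mul, ← Real.rpow_add (jb_pos η)]; simp
          have e4 : ((jb (ξ - η) ^ (-1 : ℝ) : ℝ) : ℂ) * (jb (ξ - η) : ℂ) = 1 := by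
            rw [← Complex.ofReal_mul, Real.rpow_neg_one, inv_mul_cancel₀ (jb_pos _).ne']; simp
          rw [e2]
          simp only [Complex.ofReal_mul]
          rw [← one_mul ((jb ξ ^ (-s₀) : ℝ) : ℂ), ← one_mul (1 : ℂ)]
          nth_rw 1 [← e3]
          nth_rw 1 [← e4]
          ring
        · simp [hKt, hK0 ξ η hη]
    _ = (C₀ * J + 1) * ∫⁻ ξ, ∫⁻ η, ∫⁻ t, D ξ η t :=
        lintegral_const_mul' _ _ (by finiteness)
    _ < ⊤ := ENNReal.mul_lt_top (by finiteness) hDfin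

/-! ### General facts on bilinear operators -/

theorem jb_le_two_mul (ξ η : Plane) : jb η ≤ 2 * jb ξ * jb (ξ - η) := by
  have h1 := jb_le_add_sub' ξ η
  nlinarith [one_le_jb ξ, one_le_jb (ξ - η)]

theorem jb_sub_le_two_mul (ξ η : Plane) : jb (ξ - η) ≤ 2 * jb ξ * jb η := by
  have h1 := jb_sub_le ξ η
  nlinarith [one_le_jb ξ, one_le_jb η]

/-- For fixed ξ the brackets of η and ξ - η agree up to a factor 2⟨ξ⟩. The constant depends on ξ,
which is harmless: the purpose is absolute convergence of the bilinear integral at each ξ, under a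
weaker condition than the product law. -/
theorem exists_one_le_mul_jw {a b : ℝ} (hab : 0 ≤ a + b) (ξ : Plane) :
    ∃ c : ℝ≥0∞, c ≠ ⊤ ∧ ∀ η, 1 ≤ c * (jw a η * jw b (ξ - η)) := by
  have key : ∀ (x y z : ℝ) (a b : ℝ), 1 ≤ x → 1 ≤ y → 1 ≤ z → y ≤ 2 * x * z → 0 ≤ a + b →
      0 ≤ b → 1 ≤ (2 * x) ^ b * (y ^ a * z ^ b) := by
    intro x y z a b hx hy hz h hab hb
    have hy0 : 0 < y := by linarith
    calc (1 : ℝ) ≤ y ^ (a + b) := Real.one_le_rpow hy hab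
      _ = y ^ a * y ^ b := Real.rpow_add hy0 _ _
      _ ≤ y ^ a * (2 * x * z) ^ b := by gcongr
      _ = _ := by rw [Real.mul_rpow (by positivity) (by positivity)]; ring
  have conv : ∀ (c : ℝ) (η : Plane), 0 ≤ c → 1 ≤ c * (jb η ^ a * jb (ξ - η) ^ b) →
      1 ≤ ENNReal.ofReal c * (jw a η * jw b (ξ - η)) := by
    intro c η hc h
    rw [jw, jw, ← ENNReal.ofReal_mul (Real.rpow_nonneg (jb_pos _).le _), ← ENNReal.ofReal_mul hc,
      ← ENNReal.ofReal_one]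
    exact ENNReal.ofReal_le_ofReal h
  have hx := one_le_jb ξ
  rcases le_total 0 b with hb | hb
  · exact ⟨ENNReal.ofReal ((2 * jb ξ) ^ b), by simp, fun η => conv _ η (by positivity)
      (key _ _ _ a b hx (one_le_jb η) (one_le_jb _) (jb_le_two_mul ξ η) hab hb)⟩
  · refine ⟨ENNReal.ofReal ((2 * jb ξ) ^ a), by simp, fun η => conv _ η (by positivity) ?_⟩
    rw [mul_comm (jb η ^ a)]
    exact key _ _ _ b a hx (one_le_jb _) (one_le_jb η) (jb_sub_le_two_mul ξ η) (by linarith)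
      (by linarith)

theorem exists_lbil_sq_le {a b : ℝ} (hab : 0 ≤ a + b) (ξ : Plane) :
    ∃ c : ℝ≥0∞, c ≠ ⊤ ∧ ∀ (k : Plane → Plane → ℝ≥0∞) (f g : Plane → ℝ≥0∞), (∀ ξ η, k ξ η ≤ 1) →
      Measurable f → Measurable g → lbil k f g ξ ^ 2 ≤ c * (energy a f * energy b g) := by
  obtain ⟨c, hc, h⟩ := exists_one_le_mul_jw hab ξ
  refine ⟨c ^ 2, by finiteness, fun k f g hk hf hg => ?_⟩
  have h1 : lbil k f g ξ ≤ c * ∫⁻ η, (jw a η * f η) * (jw b (ξ - η) * g (ξ - η)) := by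
    rw [lbil, ← lintegral_const_mul' _ _ hc]
    refine lintegral_mono fun η => ?_
    calc k ξ η * f η * g (ξ - η) ≤ 1 * f η * g (ξ - η) := by gcongr; exact hk ξ η
      _ ≤ c * (jw a η * jw b (ξ - η)) * f η * g (ξ - η) := by gcongr; exact h η
      _ = _ := by ring
  refine (pow_le_pow_left' h1 2).trans ?_
  rw [mul_pow]
  refine mul_le_mul_right ((lintegral_mul_sq_le _ (by fun_prop) (by fun_prop)).trans ?_) _
  rw [lintegral_sub_left_eq_self (fun η => (jw b η * g η) ^ 2) ξ]
  rfl

theorem integrable_bil {a b : ℝ} (hab : 0 ≤ a + b) {K : Plane → Plane → ℂ}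
    (hKm : Measurable (Function.uncurry K)) (hK : ∀ ξ η, ‖K ξ η‖ₑ ≤ 1) {f g : Plane → ℂ}
    (hf : Measurable f) (hg : Measurable g) (hf' : energy a (fun η => ‖f η‖ₑ) ≠ ⊤)
    (hg' : energy b (fun η => ‖g η‖ₑ) ≠ ⊤) (ξ : Plane) :
    Integrable fun η => K ξ η * (f η * g (ξ - η)) := by
  have hKx : Measurable (K ξ) :=
    measurable_comp₂ hKm (f := fun _ => ξ) (g := fun η => η) (by fun_prop) (by fun_prop)
  refine ⟨by fun_prop, ?_⟩
  obtain ⟨c, hc, h⟩ := exists_lbil_sq_le hab ξ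
  have h1 := h (fun ξ η => ‖K ξ η‖ₑ) _ _ hK hf.enorm hg.enorm
  rw [hasFiniteIntegral_iff_enorm]
  have h2 : ∫⁻ η, ‖K ξ η * (f η * g (ξ - η))‖ₑ =
      lbil (fun ξ η => ‖K ξ η‖ₑ) (fun η => ‖f η‖ₑ) (fun η => ‖g η‖ₑ) ξ := by
    simp only [lbil, enorm_mul, mul_assoc]
  rw [h2]
  by_contra h3
  rw [not_lt, top_le_iff] at h3
  rw [h3] at h1
  exact absurd h1 (by simp; finiteness)

theorem EnSup.ne_top {I : Set ℝ} {s : ℝ} {F : ℝ → Plane → ℂ} (h : EnSup I s F) {t : ℝ}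
    (ht : t ∈ I) : energy s (fun η => ‖F t η‖ₑ) ≠ ⊤ := by
  obtain ⟨_, C, hC, h⟩ := h
  exact ne_top_of_le_ne_top hC (h t ht)

theorem EnSup.integrable_bil {I : Set ℝ} {a b : ℝ} (hab : 0 ≤ a + b) {K : Plane → Plane → ℂ}
    (hKm : Measurable (Function.uncurry K)) (hK : ∀ ξ η, ‖K ξ η‖ₑ ≤ 1) {u v : ℝ → Plane → ℂ}
    (hu : EnSup I a u) (hv : EnSup I b v) {t : ℝ} (ht : t ∈ I) (ξ : Plane) :
    Integrable fun η => K ξ η * (u t η * v t (ξ - η)) :=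
  ChernSimonsHiggs.integrable_bil hab hKm hK (measurable_slice hu.1 t) (measurable_slice hv.1 t)
    (hu.ne_top ht) (hv.ne_top ht) ξ

theorem lintegral_lbil_lt_top {I : Set ℝ} (hI : volume I < ⊤) (hIm : MeasurableSet I) {a b : ℝ}
    (hab : 0 ≤ a + b) {k : Plane → Plane → ℝ≥0∞} (hk : ∀ ξ η, k ξ η ≤ 1) {u v : ℝ → Plane → ℂ}
    (hu : EnInt I a u) (hv : EnSup I b v) (ξ : Plane) :
    ∫⁻ t in I, lbil k (fun η => ‖u t η‖ₑ) (fun η => ‖v t η‖ₑ) ξ < ⊤ := by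
  obtain ⟨c, hc, h⟩ := exists_lbil_sq_le hab ξ
  obtain ⟨hvm, C, hC, hv⟩ := hv
  have h1 : ∀ t ∈ I, lbil k (fun η => ‖u t η‖ₑ) (fun η => ‖v t η‖ₑ) ξ ≤
      1 + c * C * energy a (fun η => ‖u t η‖ₑ) := by
    intro t ht
    have h2 := h k _ _ hk (measurable_slice hu.1 t).enorm (measurable_slice hvm t).enorm
    set x := lbil k (fun η => ‖u t η‖ₑ) (fun η => ‖v t η‖ₑ) ξ
    have h3 : x ≤ 1 + x ^ 2 := by
      rcases le_total x 1 with h | h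
      · exact h.trans le_self_add
      · exact le_add_left (by rw [sq]; exact le_mul_of_one_le_left' h)
    refine h3.trans (add_le_add le_rfl (h2.trans ?_))
    rw [mul_assoc, mul_comm C]
    gcongr
    exact hv t ht
  refine lt_of_le_of_lt (setLIntegral_mono' hIm h1) ?_
  rw [lintegral_add_left measurable_const, lintegral_const_mul' _ _ (by finiteness),
    lintegral_const, Measure.restrict_apply_univ, one_mul]
  exact ENNReal.add_lt_top.2 ⟨hI, ENNReal.mul_lt_top (by finiteness) hu.2⟩

theorem lbil_swap (k : Plane → Plane → ℝ≥0∞) (f g : Plane → ℝ≥0∞) (ξ : Plane) :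
    lbil k f g ξ = lbil (fun ξ η => k ξ (ξ - η)) g f ξ := by
  unfold lbil
  rw [← lintegral_sub_left_eq_self _ ξ]
  refine lintegral_congr fun η => ?_
  rw [sub_sub_cancel]; ring

/-- The product rule for bilinear operators on the Fourier side. -/
theorem primAE_bil {a b : ℝ} {α α' β β' : ℝ} (h1 : 0 ≤ α + β) (h2 : 0 ≤ α' + β) (h3 : 0 ≤ α + β')
    {K : Plane → Plane → ℂ} (hKm : Measurable (Function.uncurry K)) (hK : ∀ ξ η, ‖K ξ η‖ₑ ≤ 1)
    {u u' v v' : ℝ → Plane → ℂ} (hu : EnSup (Ioo a b) α u) (hu' : EnInt (Ioo a b) α' u')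
    (hv : EnSup (Ioo a b) β v) (hv' : EnInt (Ioo a b) β' v') (hpu : PrimAE (Ioo a b) u u')
    (hpv : PrimAE (Ioo a b) v v') :
    PrimAE (Ioo a b) (fun t => bil K (u t) (v t))
      (fun t ξ => bil K (u' t) (v t) ξ + bil K (u t) (v' t) ξ) := by
  have hI : (Ioo a b).OrdConnected := ordConnected_Ioo
  have hIv : volume (Ioo a b) < ⊤ := by simp
  refine ae_of_all _ fun ξ => ?_
  have hKx : Measurable (K ξ) :=
    measurable_comp₂ hKm (f := fun _ => ξ) (g := fun η => η) (by fun_prop) (by fun_prop)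
  set μ := (volume : Measure ℝ).restrict (Ioo a b) with hμ
  have n1 : ∀ {f : ℝ → Plane → ℂ}, Measurable (Function.uncurry f) →
      Measurable fun q : ℝ × Plane => f q.1 q.2 := fun hf => hf
  have n2 : ∀ {f : ℝ → Plane → ℂ}, Measurable (Function.uncurry f) →
      Measurable fun q : ℝ × Plane => f q.1 (ξ - q.2) := fun hf =>
    measurable_comp₂ hf (f := fun q : ℝ × Plane => q.1) (g := fun q => ξ - q.2)
      (by fun_prop) (by fun_prop)
  -- The three exponent conditions make the integrals of uv, u'v and uv' converge at each ξ; this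
  -- one and the next are integrable also in time, which allows Fubini.
  have i1 : Integrable (fun q : ℝ × Plane => K ξ q.2 * (u' q.1 q.2 * v q.1 (ξ - q.2)))
      (μ.prod volume) := by
    have m3 : Measurable fun q : ℝ × Plane => K ξ q.2 * (u' q.1 q.2 * v q.1 (ξ - q.2)) :=
      (hKx.comp measurable_snd).mul ((n1 hu'.1).mul (n2 hv.1))
    refine ⟨m3.aestronglyMeasurable, ?_⟩
    rw [hasFiniteIntegral_iff_enorm, lintegral_prod _ m3.enorm.aemeasurable]
    refine lt_of_le_of_lt (le_of_eq ?_) (lintegral_lbil_lt_top hIv measurableSet_Ioo h2 hK hu' hv ξ)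
    simp only [lbil, enorm_mul, mul_assoc, hμ]
  have i2 : Integrable (fun q : ℝ × Plane => K ξ q.2 * (u q.1 q.2 * v' q.1 (ξ - q.2)))
      (μ.prod volume) := by
    have m3 : Measurable fun q : ℝ × Plane => K ξ q.2 * (u q.1 q.2 * v' q.1 (ξ - q.2)) :=
      (hKx.comp measurable_snd).mul ((n1 hu.1).mul (n2 hv'.1))
    refine ⟨m3.aestronglyMeasurable, ?_⟩
    rw [hasFiniteIntegral_iff_enorm, lintegral_prod _ m3.enorm.aemeasurable]
    -- Here the second factor carries the derivative, so the two inputs are interchanged by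
    -- `lbil_swap`.
    refine lt_of_le_of_lt (le_of_eq ?_) (lintegral_lbil_lt_top hIv measurableSet_Ioo
      (by linarith : 0 ≤ β' + α) (k := fun ξ η => ‖K ξ (ξ - η)‖ₑ) (fun ξ η => hK _ _) hv' hu ξ)
    refine lintegral_congr fun t => ?_
    rw [← lbil_swap (fun ξ η => ‖K ξ η‖ₑ)]
    simp only [lbil, enorm_mul, mul_assoc]
  have hsum : ∀ᵐ t ∂μ, ∫ η, (K ξ η * (u' t η * v t (ξ - η)) + K ξ η * (u t η * v' t (ξ - η))) =
      bil K (u' t) (v t) ξ + bil K (u t) (v' t) ξ := by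
    filter_upwards [i1.prod_right_ae, i2.prod_right_ae] with t e1 e2
    exact integral_add e1 e2
  refine ⟨(i1.integral_prod_left.add i2.integral_prod_left :), fun s hs t ht => ?_⟩
  have hst : uIoc s t ⊆ Ioo a b := uIoc_subset_uIcc.trans (hI.uIcc_subset hs ht)
  have hle : (volume : Measure ℝ).restrict (uIoc s t) ≤ μ := Measure.restrict_mono hst le_rfl
  have e1 : bil K (u t) (v t) ξ - bil K (u s) (v s) ξ =
      ∫ η, ∫ τ in s..t, (K ξ η * (u' τ η * v τ (ξ - η)) + K ξ η * (u τ η * v' τ (ξ - η))) := by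
    simp only [bil]
    rw [← integral_sub (hu.integrable_bil h1 hKm hK hv ht ξ) (hu.integrable_bil h1 hKm hK hv hs ξ)]
    refine integral_congr_ae ?_
    filter_upwards [hpu, ae_comp_sub hpv ξ] with η p1 p2
    have := (((p1.mul hI p2).const_mul (K ξ η)).2 s hs t ht)
    simp only [mul_add] at this
    exact this
  have e2 : ∫ τ in s..t, (bil K (u' τ) (v τ) ξ + bil K (u τ) (v' τ) ξ) = ∫ τ in s..t, ∫ η,
      (K ξ η * (u' τ η * v τ (ξ - η)) + K ξ η * (u τ η * v' τ (ξ - η))) := by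
    refine intervalIntegral.integral_congr_ae_restrict ?_
    exact Filter.EventuallyEq.symm (ae_mono hle hsum)
  simp only
  rw [e1, e2]
  have i3 : Integrable (Function.uncurry fun (τ : ℝ) (η : Plane) =>
      K ξ η * (u' τ η * v τ (ξ - η)) + K ξ η * (u τ η * v' τ (ξ - η)))
      (((volume : Measure ℝ).restrict (uIoc s t)).prod volume) :=
    (i1.add i2).mono_measure (Measure.prod_mono hle le_rfl)
  rcases le_total s t with h | h
  · rw [uIoc_of_le h] at i3
    simp only [intervalIntegral.integral_of_le h]
    rw [integral_integral_swap i3]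
  · rw [uIoc_of_ge h] at i3
    simp only [intervalIntegral.integral_of_ge h, integral_neg]
    rw [integral_integral_swap i3]

/-- Boundedness of the bilinear operator with kernel `K` between weighted spaces. -/
def BilBound (r α β : ℝ) (K : Plane → Plane → ℂ) : Prop :=
  ∃ C : ℝ≥0∞, C ≠ ⊤ ∧ ∀ f g : Plane → ℝ≥0∞, Measurable f → Measurable g →
    energy r (lbil (fun ξ η => ‖K ξ η‖ₑ) f g) ≤ C * energy α f * energy β g

theorem energy_bil_le {r α β : ℝ} {K : Plane → Plane → ℂ} {C : ℝ≥0∞}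
    (h : ∀ f g : Plane → ℝ≥0∞, Measurable f → Measurable g →
      energy r (lbil (fun ξ η => ‖K ξ η‖ₑ) f g) ≤ C * energy α f * energy β g) {f g : Plane → ℂ}
    (hf : Measurable f) (hg : Measurable g) :
    energy r (fun ξ => ‖bil K f g ξ‖ₑ) ≤
      C * energy α (fun η => ‖f η‖ₑ) * energy β (fun η => ‖g η‖ₑ) :=
  (energy_mono le_rfl fun ξ => enorm_bil_le K f g ξ).trans (h _ _ hf.enorm hg.enorm)

theorem EnSup.bil {I : Set ℝ} {r α β : ℝ} {K : Plane → Plane → ℂ}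
    (hKm : Measurable (Function.uncurry K)) (hK : BilBound r α β K) {u v : ℝ → Plane → ℂ}
    (hu : EnSup I α u) (hv : EnSup I β v) : EnSup I r (fun t => bil K (u t) (v t)) := by
  refine ⟨measurable_bil hKm hu.1 hv.1, ?_⟩
  obtain ⟨C, hC, h⟩ := hK
  obtain ⟨hum, C₁, hC₁, hu⟩ := hu
  obtain ⟨hvm, C₂, hC₂, hv⟩ := hv
  refine ⟨C * C₁ * C₂, by finiteness, fun t ht =>
    (energy_bil_le h (measurable_slice hum t) (measurable_slice hvm t)).trans ?_⟩
  gcongr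
  · exact hu t ht
  · exact hv t ht

theorem EnInt.bil_left {I : Set ℝ} (hI : MeasurableSet I) {r α β : ℝ} {K : Plane → Plane → ℂ}
    (hKm : Measurable (Function.uncurry K)) (hK : BilBound r α β K) {u v : ℝ → Plane → ℂ}
    (hu : EnInt I α u) (hv : EnSup I β v) : EnInt I r (fun t => bil K (u t) (v t)) := by
  refine ⟨measurable_bil hKm hu.1 hv.1, ?_⟩
  obtain ⟨C, hC, h⟩ := hK
  obtain ⟨hvm, C₂, hC₂, hv⟩ := hv
  refine lt_of_le_of_lt (b := ∫⁻ t in I, C * C₂ * energy α (fun η => ‖u t η‖ₑ))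
    (setLIntegral_mono' hI fun t ht =>
      (energy_bil_le h (measurable_slice hu.1 t) (measurable_slice hvm t)).trans ?_) ?_
  · rw [mul_right_comm]
    gcongr
    exact hv t ht
  · rw [lintegral_const_mul' _ _ (by finiteness)]
    exact ENNReal.mul_lt_top (by finiteness) hu.2

/-- Convolution, i.e. the product on the Fourier side. -/
abbrev conv (f g : Plane → ℂ) : Plane → ℂ := bil (fun _ _ => 1) f g

theorem bilBound_conv {r α β : ℝ} (h01 : 0 ≤ -r + α) (h02 : 0 ≤ -r + β) (h12 : 0 ≤ α + β)
    (h : 1 < -r + α + β) : BilBound r α β (fun _ _ => 1) := by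
  obtain ⟨C, hC, h⟩ := product_law h01 h02 h12 h
  refine ⟨C, hC, fun f g hf hg => ?_⟩
  have := h f g hf hg
  rw [neg_neg] at this
  simpa [lconv] using this

/-! ### The high frequency region -/

/-- The condition on the exponents for estimates in the high frequency region. -/
def HighCond (p m n : ℝ) : Prop :=
  (m < -2 ∧ 0 ≤ n) ∨ ∃ ν > 0, 0 ≤ 2 + m + ν ∧ p * (2 + m + ν) ≤ n

/-- Here the output is much smaller than one input, and the triangle inequality then forces the two
inputs to balance. The constant 8 leaves ample room for the factor 2. -/
theorem jb_of_notMem_lowSet {p : ℝ} (hp : 0 < p) (hp1 : p ≤ 1) {ξ η : Plane} (h : η ∉ lowSet p ξ) :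
    jb ξ ≤ jb η ^ p ∧ jb η ≤ 2 * jb (ξ - η) ∧ jb (ξ - η) ≤ 2 * jb η := by
  have h1 : 8 * jb ξ ^ (1 / p) < jb η := not_le.1 h
  have hx := one_le_jb ξ
  have h2 : jb ξ ≤ jb ξ ^ (1 / p) := by
    calc jb ξ = jb ξ ^ (1 : ℝ) := (Real.rpow_one _).symm
      _ ≤ _ := Real.rpow_le_rpow_of_exponent_le hx (by rw [le_div_iff₀ hp]; linarith)
  refine ⟨?_, ?_, ?_⟩
  · calc jb ξ = (jb ξ ^ (1 / p)) ^ p := by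
          rw [← Real.rpow_mul (jb_pos ξ).le, one_div_mul_cancel hp.ne', Real.rpow_one]
      _ ≤ jb η ^ p := Real.rpow_le_rpow (by positivity) (by linarith) hp.le
  · have := jb_le_add_sub' ξ η
    linarith
  · have := jb_sub_le ξ η
    linarith

theorem jw_neg_le_of_notMem_lowSet {p : ℝ} (hp : 0 < p) (hp1 : p ≤ 1) (b : ℝ) {ξ η : Plane}
    (h : η ∉ lowSet p ξ) : jw (-b) (ξ - η) ≤ ENNReal.ofReal (2 ^ |b|) * jw (-b) η := by
  obtain ⟨_, h2, h3⟩ := jb_of_notMem_lowSet hp hp1 h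
  rw [jw, jw, ← ENNReal.ofReal_mul (by positivity)]
  exact ENNReal.ofReal_le_ofReal
    (rpow_le_of_comparable (one_le_jb η) (one_le_jb _) h2 h3)

/-- As the inputs are comparable, all their weights merge into a power of ⟨η⟩. What remains is to
bound the integral of ⟨ξ⟩^m over ⟨ξ⟩ ≤ ⟨η⟩^p by ⟨η⟩^n. Either ⟨ξ⟩^m is integrable, or a factor
⟨ξ⟩^{-2-ν} is kept for integrability and the rest is at most ⟨η⟩^{p(2+m+ν)}. -/
theorem bilBound_high {p q e r a b : ℝ} (hp : 0 < p) (hp1 : p ≤ 1) {K : Plane → Plane → ℂ}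
    (hK0 : ∀ ξ η, η ∈ lowSet p ξ → K ξ η = 0) {c : ℝ≥0∞} (hc : c ≠ ⊤)
    (hK : ∀ ξ η, ‖K ξ η‖ₑ ≤ c * (jw q ξ * jw e η))
    (h : HighCond p (2 * (r + q)) (2 * (a + b - e))) : BilBound r a b K := by
  set m := 2 * (r + q) with hm
  set n := 2 * (a + b - e) with hn
  set c' : ℝ≥0∞ := c * ENNReal.ofReal (2 ^ |b|) with hc'
  set k' : Plane → Plane → ℝ≥0∞ := fun ξ η =>
    {q : Plane × Plane | q.2 ∉ lowSet p q.1}.indicator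
      (fun q => c' * (jw (m / 2) q.1 * jw (-n / 2) q.2)) (ξ, η) with hk'
  have hset : MeasurableSet {q : Plane × Plane | q.2 ∉ lowSet p q.1} := by
    have : {q : Plane × Plane | q.2 ∉ lowSet p q.1} =
        {q : Plane × Plane | jb q.2 ≤ 8 * jb q.1 ^ (1 / p)}ᶜ := rfl
    rw [this]
    exact (measurableSet_le (by fun_prop) (by fun_prop)).compl
  have hk'm : Measurable (Function.uncurry k') := by
    have : Function.uncurry k' = {q : Plane × Plane | q.2 ∉ lowSet p q.1}.indicator
      (fun q => c' * (jw (m / 2) q.1 * jw (-n / 2) q.2)) := rfl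
    rw [this]
    exact Measurable.indicator (by fun_prop) hset
  have hkk : ∀ ξ η, jw r ξ * ‖K ξ η‖ₑ ≤ k' ξ η * jw a η * jw b (ξ - η) := by
    intro ξ η
    by_cases hη : η ∈ lowSet p ξ
    · simp [hK0 ξ η hη]
    · have h1 : k' ξ η = c' * (jw (m / 2) ξ * jw (-n / 2) η) :=
        indicator_of_mem (show (ξ, η) ∈ {q : Plane × Plane | q.2 ∉ lowSet p q.1} from hη) _
      rw [h1]
      have e1 : jw (m / 2) ξ = jw r ξ * jw q ξ := by rw [← jw_add]; congr 1; rw [hm]; ring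
      have e2 : jw (-n / 2) η = jw (-a) η * jw (-b) η * jw e η := by
        rw [← jw_add, ← jw_add]; congr 1; rw [hn]; ring
      calc jw r ξ * ‖K ξ η‖ₑ ≤ jw r ξ * (c * (jw q ξ * jw e η)) := mul_le_mul_right (hK ξ η) _
        _ = c * (jw r ξ * jw q ξ) * (jw e η) * (jw (-a) η * jw a η) *
            (jw (-b) (ξ - η) * jw b (ξ - η)) := by
            rw [jw_neg_mul, jw_neg_mul]; ring
        _ ≤ c * (jw r ξ * jw q ξ) * (jw e η) * (jw (-a) η * jw a η) *
            ((ENNReal.ofReal (2 ^ |b|) * jw (-b) η) * jw b (ξ - η)) := by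
            gcongr
            exact jw_neg_le_of_notMem_lowSet hp hp1 b hη
        _ = _ := by rw [e1, e2, hc']; ring
  have hb : ∃ C : ℝ≥0∞, C ≠ ⊤ ∧ ∀ η, ∫⁻ ξ, k' ξ η ^ 2 ≤ C := by
    rcases h with ⟨hm2, hn0⟩ | ⟨ν, hν, hν0, hνn⟩
    · refine ⟨c' ^ 2 * ∫⁻ ξ, jw m ξ, ?_, fun η => ?_⟩
      · have := (lintegral_jw_lt_top hm2).ne
        finiteness
      · rw [← lintegral_const_mul' _ _ (by finiteness)]
        refine lintegral_mono fun ξ => ?_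
        refine (pow_le_pow_left' (indicator_le_self' (fun _ _ => bot_le) _) 2).trans ?_
        simp only
        rw [mul_pow c', mul_pow (jw (m / 2) ξ), jw_sq, jw_sq, mul_div_cancel₀ _ two_ne_zero,
          mul_div_cancel₀ _ two_ne_zero]
        have : jw (-n) η ≤ 1 := by simpa using jw_mono (show -n ≤ (0 : ℝ) by linarith) η
        exact mul_le_mul_right (mul_le_of_le_one_right' this) _
    · refine ⟨c' ^ 2 * ∫⁻ ξ, jw (-2 - ν) ξ, ?_, fun η => ?_⟩
      · have := (lintegral_jw_lt_top (show -2 - ν < -2 by linarith)).ne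
        finiteness
      · rw [← lintegral_const_mul' _ _ (by finiteness)]
        refine lintegral_mono fun ξ => ?_
        by_cases hη : η ∈ lowSet p ξ
        · have : k' ξ η = 0 := indicator_of_notMem
            (show (ξ, η) ∉ {q : Plane × Plane | q.2 ∉ lowSet p q.1} from fun h => h hη) _
          rw [this]; simp
        · have h1 : k' ξ η = c' * (jw (m / 2) ξ * jw (-n / 2) η) :=
            indicator_of_mem (show (ξ, η) ∈ {q : Plane × Plane | q.2 ∉ lowSet p q.1} from hη) _
          rw [h1, mul_pow c', mul_pow (jw (m / 2) ξ), jw_sq, jw_sq, mul_div_cancel₀ _ two_ne_zero,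
            mul_div_cancel₀ _ two_ne_zero]
          refine mul_le_mul_right ?_ _
          have e1 : jw m ξ = jw (-2 - ν) ξ * jw (2 + m + ν) ξ := by rw [← jw_add]; congr 1; ring
          have e2 : jw (2 + m + ν) ξ * jw (-n) η ≤ 1 := by
            rw [jw, jw, ← ENNReal.ofReal_mul (Real.rpow_nonneg (jb_pos _).le _),
              ← ENNReal.ofReal_one]
            refine ENNReal.ofReal_le_ofReal ?_
            calc jb ξ ^ (2 + m + ν) * jb η ^ (-n)
                ≤ (jb η ^ p) ^ (2 + m + ν) * jb η ^ (-n) := by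
                  have := (jb_of_notMem_lowSet hp hp1 hη).1
                  have h0 := jb_pos ξ
                  have h1 := jb_pos η
                  gcongr
              _ = jb η ^ (p * (2 + m + ν) - n) := by
                  rw [← Real.rpow_mul (jb_pos η).le, ← Real.rpow_add (jb_pos η)]; rfl
              _ ≤ 1 := Real.rpow_le_one_of_one_le_of_nonpos (one_le_jb η) (by linarith)
          rw [e1, mul_assoc]
          exact mul_le_of_le_one_right' e2
  obtain ⟨C, hC, hb⟩ := hb
  exact ⟨C, hC, fun f g hf hg => energy_lbil_le_of_snd hk'm hkk hb hf hg⟩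

/-! ### Null forms -/

/-- The real number `σ`. -/
def sgn (σ : ℤˣ) : ℝ := ((σ : ℤ) : ℝ)

theorem sgn_sq (σ : ℤˣ) : sgn σ ^ 2 = 1 := by
  rcases Int.units_eq_one_or σ with rfl | rfl <;> simp [sgn]

/-- The symbol of `∂_μ` on solutions of the half-wave equation with sign `σ`. -/
def dsym (σ : ℤˣ) (μ : Fin 3) (η : Plane) : ℂ :=
  ![Complex.I * sgn σ * jb η, derivSymbol 0 η, derivSymbol 1 η] μ

@[fun_prop] theorem measurable_derivSymbol (j : Fin 2) : Measurable (derivSymbol j) := by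
  unfold derivSymbol; fun_prop

@[fun_prop] theorem measurable_dsym (σ : ℤˣ) (μ : Fin 3) : Measurable (dsym σ μ) := by
  unfold dsym
  fin_cases μ <;> simp <;> fun_prop

theorem abs_coord_le (η : Plane) (j : Fin 2) : |η j| ≤ ‖η‖ := by
  simpa using PiLp.norm_apply_le η j

theorem norm_derivSymbol_le (j : Fin 2) (η : Plane) : ‖derivSymbol j η‖ ≤ 2 * Real.pi * ‖η‖ := by
  rw [derivSymbol, norm_mul, norm_mul, norm_mul, Complex.norm_I, Complex.norm_real,
    Complex.norm_real, Complex.norm_ofNat, Real.norm_eq_abs, Real.norm_eq_abs,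
    abs_of_pos Real.pi_pos, mul_one]
  exact mul_le_mul_of_nonneg_left (abs_coord_le η j) (by positivity)

theorem enorm_le_jw {z : ℂ} {r : ℝ} {η : Plane} (h : ‖z‖ ≤ jb η ^ r) : ‖z‖ₑ ≤ jw r η := by
  rw [← ofReal_norm]; exact ENNReal.ofReal_le_ofReal h

theorem enorm_jb_rpow (r : ℝ) (η : Plane) : ‖((jb η ^ r : ℝ) : ℂ)‖ₑ = jw r η := by
  rw [← ofReal_norm, Complex.norm_real, Real.norm_of_nonneg (Real.rpow_nonneg (jb_pos η).le _)]
  rfl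

theorem enorm_derivSymbol_le (j : Fin 2) (η : Plane) : ‖derivSymbol j η‖ₑ ≤ jw 1 η :=
  enorm_le_jw ((norm_derivSymbol_le j η).trans (by rw [Real.rpow_one]; exact two_pi_norm_le_jb η))

theorem abs_sgn (σ : ℤˣ) : |sgn σ| = 1 := by
  rw [← sq_eq_sq₀ (abs_nonneg _) zero_le_one, sq_abs, sgn_sq]; norm_num

theorem enorm_dsym_le (σ : ℤˣ) (μ : Fin 3) (η : Plane) : ‖dsym σ μ η‖ₑ ≤ jw 1 η := by
  have h0 : ‖Complex.I * sgn σ * jb η‖ₑ ≤ jw 1 η := by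
    refine enorm_le_jw ?_
    rw [norm_mul, norm_mul, Complex.norm_I, Complex.norm_real, Complex.norm_real,
      Real.norm_eq_abs, abs_sgn, Real.norm_of_nonneg (jb_pos η).le, Real.rpow_one]
    simp
  fin_cases μ
  · exact h0
  · exact enorm_derivSymbol_le 0 η
  · exact enorm_derivSymbol_le 1 η

/-- The symbol of the null form `Q_{μν}` on pairs of half-waves. -/
def nullSym (σ σ' : ℤˣ) (μ ν : Fin 3) (ξ η : Plane) : ℂ :=
  dsym σ μ η * dsym σ' ν (ξ - η) - dsym σ ν η * dsym σ' μ (ξ - η)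

theorem measurable_nullSym (σ σ' : ℤˣ) (μ ν : Fin 3) :
    Measurable (Function.uncurry (nullSym σ σ' μ ν)) := by
  unfold nullSym
  simp only [Function.uncurry_def]
  fun_prop

/-- The direction `(σ, 2πη/⟨η⟩)`. -/
def dvec (σ : ℤˣ) (μ : Fin 3) (η : Plane) : ℝ :=
  ![sgn σ, 2 * Real.pi * η 0 / jb η, 2 * Real.pi * η 1 / jb η] μ

theorem dsym_eq (σ : ℤˣ) (μ : Fin 3) (η : Plane) :
    dsym σ μ η = Complex.I * jb η * dvec σ μ η := by
  have h : (jb η : ℂ) ≠ 0 := by exact_mod_cast (jb_pos η).ne'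
  fin_cases μ <;> simp [dsym, dvec, derivSymbol] <;> field_simp

theorem dvec_sq_sum (η : Plane) :
    (2 * Real.pi * η 0 / jb η) ^ 2 + (2 * Real.pi * η 1 / jb η) ^ 2 =
      (2 * Real.pi * ‖η‖ / jb η) ^ 2 := by
  have h : ‖η‖ ^ 2 = η 0 ^ 2 + η 1 ^ 2 := by
    rw [EuclideanSpace.norm_sq_eq, Fin.sum_univ_two]; simp
  rw [div_pow, div_pow, div_pow, mul_pow _ ‖η‖, h]
  ring

/-- The speed x of the massive wave lies in [0, 1] and satisfies 1 - x² = ⟨η⟩⁻², while 1 - x ≤ 1 -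
x². Squared, this is the source of the error terms of exponent -4. -/
theorem one_sub_norm_div_jb (η : Plane) :
    0 ≤ 1 - 2 * Real.pi * ‖η‖ / jb η ∧ 1 - 2 * Real.pi * ‖η‖ / jb η ≤ (jb η ^ 2)⁻¹ := by
  have h0 := jb_pos η
  have h1 : 2 * Real.pi * ‖η‖ / jb η ≤ 1 := (div_le_one h0).2 (two_pi_norm_le_jb η)
  refine ⟨by linarith, ?_⟩
  have h2 : (2 * Real.pi * ‖η‖ / jb η) ^ 2 = 1 - (jb η ^ 2)⁻¹ := by
    rw [div_pow, eq_sub_iff_add_eq, inv_eq_one_div, ← add_div, div_eq_one_iff_eq (by positivity),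
      jb_sq]; ring
  have h3 : 0 ≤ 2 * Real.pi * ‖η‖ / jb η := by positivity
  nlinarith

/-- By the law of cosines the left side is (r - r')² + 2rr' times the angle defect, r and r' being
the two speeds. Both are within ⟨η⟩⁻² and ⟨ζ⟩⁻² of 1. -/
theorem norm_dvec_diff_le (σ σ' : ℤˣ) (η ζ : Plane) :
    (2 * Real.pi * ζ 0 / jb ζ - sgn σ * sgn σ' * (2 * Real.pi * η 0 / jb η)) ^ 2 +
      (2 * Real.pi * ζ 1 / jb ζ - sgn σ * sgn σ' * (2 * Real.pi * η 1 / jb η)) ^ 2 ≤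
      2 * (angleDefect (sgn σ) (sgn σ') η ζ + (jb η ^ 4)⁻¹ + (jb ζ ^ 4)⁻¹) := by
  set x0 := 2 * Real.pi * η 0 / jb η with hx0
  set x1 := 2 * Real.pi * η 1 / jb η with hx1
  set y0 := 2 * Real.pi * ζ 0 / jb ζ with hy0
  set y1 := 2 * Real.pi * ζ 1 / jb ζ with hy1
  set r := 2 * Real.pi * ‖η‖ / jb η with hr
  set r' := 2 * Real.pi * ‖ζ‖ / jb ζ with hr'
  set c := inner ℝ η ζ / (‖η‖ * ‖ζ‖) with hc
  set e := sgn σ * sgn σ' with he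
  have he2 : e ^ 2 = 1 := by rw [he, mul_pow, sgn_sq, sgn_sq, one_mul]
  have hxy : x0 * y0 + x1 * y1 = r * r' * c := by
    have hin : inner ℝ η ζ = η 0 * ζ 0 + η 1 * ζ 1 := by
      simp [PiLp.inner_apply, Fin.sum_univ_two, mul_comm]
    have h1 : x0 * y0 + x1 * y1 = (2 * Real.pi) ^ 2 / (jb η * jb ζ) * inner ℝ η ζ := by
      rw [hin, hx0, hx1, hy0, hy1]
      have := (jb_pos η).ne'
      have := (jb_pos ζ).ne'
      field_simp
    rw [h1, hr, hr', hc]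
    -- If a frequency vanishes the cosine is 0 by the convention for division, and so is the inner
    -- product.
    rcases eq_or_ne (‖η‖ * ‖ζ‖) 0 with h | h
    · have : inner ℝ η ζ = 0 := by
        have := abs_real_inner_le_norm η ζ
        rw [h] at this
        exact abs_eq_zero.1 (le_antisymm this (abs_nonneg _))
      rw [this]; simp
    · have := (jb_pos η).ne'
      have := (jb_pos ζ).ne'
      have h3 : ‖η‖ ≠ 0 := left_ne_zero_of_mul h
      have h4 : ‖ζ‖ ≠ 0 := right_ne_zero_of_mul h
      field_simp
  have hr2 : x0 ^ 2 + x1 ^ 2 = r ^ 2 := dvec_sq_sum η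
  have hr2' : y0 ^ 2 + y1 ^ 2 = r' ^ 2 := dvec_sq_sum ζ
  obtain ⟨a1, a2⟩ := one_sub_norm_div_jb η
  obtain ⟨b1, b2⟩ := one_sub_norm_div_jb ζ
  have hm := angleDefect_mem (sgn_sq σ) (sgn_sq σ') η ζ
  have hmd : angleDefect (sgn σ) (sgn σ') η ζ = 1 - e * c := rfl
  rw [hmd] at hm ⊢
  have k1 : (1 - r) ^ 2 ≤ (jb η ^ 4)⁻¹ := by
    calc (1 - r) ^ 2 ≤ ((jb η ^ 2)⁻¹) ^ 2 := pow_le_pow_left₀ a1 a2 2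
      _ = _ := by rw [inv_pow, ← pow_mul]
  have k2 : (1 - r') ^ 2 ≤ (jb ζ ^ 4)⁻¹ := by
    calc (1 - r') ^ 2 ≤ ((jb ζ ^ 2)⁻¹) ^ 2 := pow_le_pow_left₀ b1 b2 2
      _ = _ := by rw [inv_pow, ← pow_mul]
  have hr0 : 0 ≤ r := div_nonneg (by positivity) (jb_pos η).le
  have hr0' : 0 ≤ r' := div_nonneg (by positivity) (jb_pos ζ).le
  have e1 : (y0 - e * x0) ^ 2 + (y1 - e * x1) ^ 2 = (r - r') ^ 2 + 2 * (r * r') * (1 - e * c) := by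
    have : (y0 - e * x0) ^ 2 + (y1 - e * x1) ^ 2 = (y0 ^ 2 + y1 ^ 2) + e ^ 2 * (x0 ^ 2 + x1 ^ 2) -
      2 * e * (x0 * y0 + x1 * y1) := by ring
    rw [this, hr2, hr2', hxy, he2]; ring
  have e2 : (r - r') ^ 2 ≤ 2 * (1 - r) ^ 2 + 2 * (1 - r') ^ 2 := by
    nlinarith [sq_nonneg ((1 - r) + (1 - r'))]
  have e3 : r * r' * (1 - e * c) ≤ 1 * (1 - e * c) :=
    mul_le_mul_of_nonneg_right (mul_le_one₀ (by linarith) hr0' (by linarith)) hm.1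
  rw [e1]
  linarith

/-- The minors of the space-time vectors (s, x) and (s', y) vanish when these are parallel, that is
when y = ss'x; in general they are linear in the deviation y - ss'x, with bounded coefficients. -/
theorem cross_sq_le {s s' x0 x1 y0 y1 B : ℝ} (s1 : s ^ 2 = 1) (hx : x0 ^ 2 + x1 ^ 2 ≤ 1)
    (h : (y0 - s * s' * x0) ^ 2 + (y1 - s * s' * x1) ^ 2 ≤ 2 * B) (μ ν : Fin 3) :
    (![s, x0, x1] μ * ![s', y0, y1] ν - ![s, x0, x1] ν * ![s', y0, y1] μ) ^ 2 ≤ 4 * B := by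
  have n0 := sq_nonneg (y0 - s * s' * x0)
  have n1 := sq_nonneg (y1 - s * s' * x1)
  have t0 : (s * y0 - x0 * s') ^ 2 ≤ 2 * B := by
    have : s * y0 - x0 * s' = s * (y0 - s * s' * x0) := by linear_combination (x0 * s') * s1
    rw [this, mul_pow, s1, one_mul]; linarith
  have t1 : (s * y1 - x1 * s') ^ 2 ≤ 2 * B := by
    have : s * y1 - x1 * s' = s * (y1 - s * s' * x1) := by linear_combination (x1 * s') * s1
    rw [this, mul_pow, s1, one_mul]; linarith
  have t2 : (x0 * y1 - x1 * y0) ^ 2 ≤ 2 * B := by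
    have e1 : x0 * y1 - x1 * y0 = x0 * (y1 - s * s' * x1) - x1 * (y0 - s * s' * x0) := by ring
    rw [e1]
    generalize y1 - s * s' * x1 = w1 at *
    generalize y0 - s * s' * x0 = w0 at *
    calc (x0 * w1 - x1 * w0) ^ 2 ≤ (x0 ^ 2 + x1 ^ 2) * (w0 ^ 2 + w1 ^ 2) := by
          linarith [sq_nonneg (x0 * w0 + x1 * w1)]
      _ ≤ 1 * (w0 ^ 2 + w1 ^ 2) := mul_le_mul_of_nonneg_right hx (by positivity)
      _ ≤ 2 * B := by linarith
  have hB0 : 0 ≤ B := by linarith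
  fin_cases μ <;> fin_cases ν <;> simp <;> linarith

theorem dvec_cross_sq_le (σ σ' : ℤˣ) (μ ν : Fin 3) (η ζ : Plane) :
    (dvec σ μ η * dvec σ' ν ζ - dvec σ ν η * dvec σ' μ ζ) ^ 2 ≤
      4 * (angleDefect (sgn σ) (sgn σ') η ζ + (jb η ^ 4)⁻¹ + (jb ζ ^ 4)⁻¹) := by
  refine cross_sq_le (sgn_sq σ) ?_ (norm_dvec_diff_le σ σ' η ζ) μ ν
  rw [dvec_sq_sum η]
  have h1 := (one_sub_norm_div_jb η).1
  have h2 : 0 ≤ 2 * Real.pi * ‖η‖ / jb η := div_nonneg (by positivity) (jb_pos η).le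
  exact pow_le_one₀ h2 (by linarith)

/-- With i⟨η⟩ and i⟨ξ-η⟩ factored out, the null symbol is a minor of the two propagation directions,
which is small where the waves are nearly parallel, just where the phase degenerates. -/
theorem enorm_nullSym_sq_le (σ σ' : ℤˣ) (μ ν : Fin 3) (ξ η : Plane) :
    ‖nullSym σ σ' μ ν ξ η‖ₑ ^ 2 ≤ 4 * (jw 2 η * jw 2 (ξ - η) *
      (ENNReal.ofReal (angleDefect (sgn σ) (sgn σ') η (ξ - η)) + jw (-4) η + jw (-4) (ξ - η))) := by
  set ζ := ξ - η with hζ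
  have h1 : nullSym σ σ' μ ν ξ η = -((jb η * jb ζ *
      (dvec σ μ η * dvec σ' ν ζ - dvec σ ν η * dvec σ' μ ζ) : ℝ) : ℂ) := by
    rw [nullSym, dsym_eq, dsym_eq, dsym_eq, dsym_eq, ← hζ]
    push_cast
    linear_combination (jb η * jb ζ * (dvec σ μ η * dvec σ' ν ζ - dvec σ ν η * dvec σ' μ ζ) : ℂ) *
      Complex.I_sq
  have hm := (angleDefect_mem (sgn_sq σ) (sgn_sq σ') η ζ).1
  have hη := jb_pos η
  have hζ0 := jb_pos ζ
  have h4 : (4 : ℝ≥0∞) = ENNReal.ofReal 4 := by simp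
  rw [h1, enorm_neg, ← ofReal_norm, Complex.norm_real, ← ENNReal.ofReal_pow (norm_nonneg _),
    Real.norm_eq_abs, sq_abs, jw, jw, jw, jw, ← ENNReal.ofReal_add hm (by positivity),
    ← ENNReal.ofReal_add (by positivity) (by positivity), ← ENNReal.ofReal_mul (by positivity),
    ← ENNReal.ofReal_mul (by positivity), h4, ← ENNReal.ofReal_mul (by positivity)]
  refine ENNReal.ofReal_le_ofReal ?_
  have r1 : ∀ x : ℝ, 0 < x → x ^ (2 : ℝ) = x ^ 2 := fun x _ => by norm_cast
  have r2 : ∀ x : ℝ, 0 < x → x ^ (-4 : ℝ) = (x ^ 4)⁻¹ := fun x hx => by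
    rw [Real.rpow_neg hx.le]; norm_cast
  rw [r1 _ hη, r1 _ hζ0, r2 _ hη, r2 _ hζ0, mul_pow, mul_pow]
  have := dvec_cross_sq_le σ σ' μ ν η ζ
  calc _ ≤ jb η ^ 2 * jb ζ ^ 2 * (4 * (angleDefect (sgn σ) (sgn σ') η ζ + (jb η ^ 4)⁻¹ +
        (jb ζ ^ 4)⁻¹)) := mul_le_mul_of_nonneg_left this (by positivity)
    _ = _ := by ring

/-- A pair of half-waves `u_±` with forcing terms `E_±` that cancel in the sum. -/
structure HalfWave (a b α β : ℝ) (u E : ℤˣ → ℝ → Plane → ℂ) : Prop where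
  prim : ∀ σ, PrimAE (Ioo a b) (u σ)
    (fun t η => Complex.I * sgn σ * jb η * u σ t η + E σ t η)
  sup : ∀ σ, EnSup (Ioo a b) α (u σ)
  int : ∀ σ, EnInt (Ioo a b) β (E σ)
  cancel : ∀ t η, E 1 t η + E (-1) t η = 0

/-- The sum `u_+ + u_-`. -/
def tot (u : ℤˣ → ℝ → Plane → ℂ) (t : ℝ) (η : Plane) : ℂ := u 1 t η + u (-1) t η

/-- The derivative `∂_μ` of the sum of two half-waves. -/
def fd (u : ℤˣ → ℝ → Plane → ℂ) (μ : Fin 3) (t : ℝ) (η : Plane) : ℂ :=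
  dsym 1 μ η * u 1 t η + dsym (-1) μ η * u (-1) t η

theorem fd_zero (u : ℤˣ → ℝ → Plane → ℂ) (t : ℝ) (η : Plane) :
    fd u 0 t η = Complex.I * jb η * (u 1 t η - u (-1) t η) := by
  simp [fd, dsym, sgn]; ring

theorem fd_succ (u : ℤˣ → ℝ → Plane → ℂ) (j : Fin 2) (t : ℝ) (η : Plane) :
    fd u j.succ t η = derivSymbol j η * tot u t η := by
  fin_cases j <;> simp [fd, dsym, tot] <;> ring

theorem EnSup.dsym_mul {I : Set ℝ} {α : ℝ} {F : ℝ → Plane → ℂ} (h : EnSup I α F) (σ : ℤˣ)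
    (μ : Fin 3) : EnSup I (α - 1) (fun t η => dsym σ μ η * F t η) :=
  h.mul (measurable_dsym σ μ) ENNReal.one_ne_top fun η => by
    rw [one_mul]; exact enorm_dsym_le σ μ η

theorem EnSup.derivSymbol_mul {I : Set ℝ} {α : ℝ} {F : ℝ → Plane → ℂ} (h : EnSup I α F)
    (j : Fin 2) : EnSup I (α - 1) (fun t η => derivSymbol j η * F t η) :=
  h.mul (measurable_derivSymbol j) ENNReal.one_ne_top fun η => by
    rw [one_mul]; exact enorm_derivSymbol_le j η

theorem enSup_tot {I : Set ℝ} {α : ℝ} {u : ℤˣ → ℝ → Plane → ℂ} (h : ∀ σ, EnSup I α (u σ)) :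
    EnSup I α (tot u) := (h 1).add (h (-1))

theorem enSup_fd {I : Set ℝ} {α : ℝ} {u : ℤˣ → ℝ → Plane → ℂ} (h : ∀ σ, EnSup I α (u σ))
    (μ : Fin 3) : EnSup I (α - 1) (fd u μ) :=
  ((h 1).dsym_mul 1 μ).add ((h (-1)).dsym_mul (-1) μ)

/-- The forcing terms of the two signs cancel, so the time derivative of the total field is exact
and loses a single derivative, whatever the forcing. -/
theorem HalfWave.primAE_tot {a b α β : ℝ} {u E : ℤˣ → ℝ → Plane → ℂ}
    (h : HalfWave a b α β u E) : PrimAE (Ioo a b) (tot u) (fd u 0) := by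
  filter_upwards [(h.prim 1).add ordConnected_Ioo (h.prim (-1))] with η hη
  refine hη.congr ordConnected_Ioo (fun t _ => rfl) (ae_of_all _ fun t => ?_)
  have := h.cancel t η
  simp only [fd_zero, sgn, Units.val_one, Int.cast_one, Units.val_neg, Int.cast_neg]
  push_cast
  linear_combination this

theorem HalfWave.primAE_fd_succ {a b α β : ℝ} {u E : ℤˣ → ℝ → Plane → ℂ}
    (h : HalfWave a b α β u E) (j : Fin 2) :
    PrimAE (Ioo a b) (fd u j.succ) (fun t η => derivSymbol j η * fd u 0 t η) := by
  have := h.primAE_tot.mul (derivSymbol j)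
  simp only [← fd_succ] at this
  exact this

/-- `Q` is the sum of a function in `L²(I; H^{-s₀})` and of the time derivative of a function
in `L^∞(I; H^z)` with derivative in `L²(I; H^d)`. -/
def Splits (I : Set ℝ) (s₀ z d : ℝ) (Q : ℝ → Plane → ℂ) : Prop :=
  ∃ F Z D : ℝ → Plane → ℂ, EnInt I (-s₀) F ∧ EnSup I z Z ∧ PrimAE I Z D ∧ EnInt I d D ∧
    ∀ᵐ t ∂(volume.restrict I), ∀ᵐ η, Q t η = F t η + D t η

theorem Splits.add {I : Set ℝ} (hI : I.OrdConnected) {s₀ z d : ℝ} {Q Q' : ℝ → Plane → ℂ}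
    (h : Splits I s₀ z d Q) (h' : Splits I s₀ z d Q') :
    Splits I s₀ z d (fun t η => Q t η + Q' t η) := by
  obtain ⟨F, Z, D, h1, h2, h3, h4, h5⟩ := h
  obtain ⟨F', Z', D', h1', h2', h3', h4', h5'⟩ := h'
  refine ⟨_, _, _, h1.add h1', h2.add h2', h3.add hI h3', h4.add h4', ?_⟩
  filter_upwards [h5, h5'] with t e e'
  filter_upwards [e, e'] with η k k'
  rw [k, k']; ring

theorem Splits.const_mul {I : Set ℝ} {s₀ z d : ℝ} {Q : ℝ → Plane → ℂ}
    (h : Splits I s₀ z d Q) (c : ℂ) : Splits I s₀ z d (fun t η => c * Q t η) := by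
  obtain ⟨F, Z, D, h1, h2, h3, h4, h5⟩ := h
  refine ⟨_, _, _, h1.const_mul c, h2.const_mul c, h3.mul fun _ => c, h4.const_mul c, ?_⟩
  filter_upwards [h5] with t e
  filter_upwards [e] with η k
  rw [k]; ring

theorem enSup_zero (I : Set ℝ) (s : ℝ) : EnSup I s (fun _ _ => 0) :=
  ⟨measurable_const, 0, ENNReal.zero_ne_top, fun t _ => by simp [energy]⟩

theorem enInt_zero (I : Set ℝ) (s : ℝ) : EnInt I s (fun _ _ => 0) :=
  ⟨measurable_const, by simp [energy]⟩

theorem primAE_zero (I : Set ℝ) : PrimAE I (fun _ _ => 0) (fun _ _ => 0) :=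
  ae_of_all _ fun _ => ⟨by simp, by simp⟩

theorem EnInt.splits {I : Set ℝ} {s₀ z d : ℝ} {Q : ℝ → Plane → ℂ} (h : EnInt I (-s₀) Q) :
    Splits I s₀ z d Q :=
  ⟨Q, _, _, h, enSup_zero I z, primAE_zero I, enInt_zero I d,
    ae_of_all _ fun _ => ae_of_all _ fun _ => by simp⟩

theorem Splits.congr {I : Set ℝ} {s₀ z d : ℝ} {Q Q' : ℝ → Plane → ℂ} (h : Splits I s₀ z d Q)
    (hQ : ∀ᵐ t ∂(volume.restrict I), ∀ᵐ η, Q' t η = Q t η) : Splits I s₀ z d Q' := by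
  obtain ⟨F, Z, D, h1, h2, h3, h4, h5⟩ := h
  refine ⟨F, Z, D, h1, h2, h3, h4, ?_⟩
  filter_upwards [h5, hQ] with t e e'
  filter_upwards [e, e'] with η k k'
  rw [k', k]

theorem Splits.sum {I : Set ℝ} (hI : I.OrdConnected) {s₀ z d : ℝ} {ι : Type*} (s : Finset ι)
    {Q : ι → ℝ → Plane → ℂ} (h : ∀ i ∈ s, Splits I s₀ z d (Q i)) :
    Splits I s₀ z d (fun t η => ∑ i ∈ s, Q i t η) := by
  classical
  induction s using Finset.induction_on with
  | empty => simpa using (enInt_zero I (-s₀)).splits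
  | insert i s hi ih =>
    simp only [Finset.sum_insert hi]
    exact (h i (Finset.mem_insert_self i s)).add hI
      (ih fun j hj => h j (Finset.mem_insert_of_mem hj))

theorem Splits.enInt {I : Set ℝ} {s₀ z d r : ℝ} {Q : ℝ → Plane → ℂ}
    (h : Splits I s₀ z d Q) (hQ : Measurable (Function.uncurry Q)) (hr : r ≤ -s₀) (hr' : r ≤ d) :
    EnInt I r Q := by
  obtain ⟨F, Z, D, h1, _, _, h4, h5⟩ := h
  refine ((h1.mono_exp hr).add (h4.mono_exp hr')).congr hQ ?_
  filter_upwards [h5] with t e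
  filter_upwards [e] with η k
  rw [k]

/-- The kernel `K`, cut off to the low frequency region. -/
def lowPart (p : ℝ) (K : Plane → Plane → ℂ) (ξ η : Plane) : ℂ := (lowSet p ξ).indicator (K ξ) η

/-- The kernel `K`, cut off to the high frequency region. -/
def highPart (p : ℝ) (K : Plane → Plane → ℂ) (ξ η : Plane) : ℂ := (lowSet p ξ)ᶜ.indicator (K ξ) η

theorem lowPart_add_highPart (p : ℝ) (K : Plane → Plane → ℂ) (ξ η : Plane) :
    lowPart p K ξ η + highPart p K ξ η = K ξ η :=
  congrFun (indicator_self_add_compl (lowSet p ξ) (K ξ)) η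

theorem measurableSet_lowSet_prod (p : ℝ) :
    MeasurableSet {q : Plane × Plane | q.2 ∈ lowSet p q.1} := by
  have : {q : Plane × Plane | q.2 ∈ lowSet p q.1} =
      {q : Plane × Plane | jb q.2 ≤ 8 * jb q.1 ^ (1 / p)} := rfl
  rw [this]
  exact measurableSet_le (by fun_prop) (by fun_prop)

theorem measurable_lowPart (p : ℝ) {K : Plane → Plane → ℂ} (hK : Measurable (Function.uncurry K)) :
    Measurable (Function.uncurry (lowPart p K)) := by
  have : Function.uncurry (lowPart p K) =
      {q : Plane × Plane | q.2 ∈ lowSet p q.1}.indicator (Function.uncurry K) := by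
    funext ⟨ξ, η⟩; simp [lowPart, indicator]
  rw [this]
  exact hK.indicator (measurableSet_lowSet_prod p)

theorem measurable_highPart (p : ℝ) {K : Plane → Plane → ℂ}
    (hK : Measurable (Function.uncurry K)) : Measurable (Function.uncurry (highPart p K)) := by
  have : Function.uncurry (highPart p K) =
      {q : Plane × Plane | q.2 ∈ lowSet p q.1}ᶜ.indicator (Function.uncurry K) := by
    funext ⟨ξ, η⟩; simp only [highPart, indicator, Function.uncurry]; rfl
  rw [this]
  exact hK.indicator (measurableSet_lowSet_prod p).compl

theorem enorm_lowPart_le (p : ℝ) (K : Plane → Plane → ℂ) (ξ η : Plane) :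
    ‖lowPart p K ξ η‖ₑ ≤ ‖K ξ η‖ₑ := by
  unfold lowPart indicator; split_ifs <;> simp

theorem enorm_highPart_le (p : ℝ) (K : Plane → Plane → ℂ) (ξ η : Plane) :
    ‖highPart p K ξ η‖ₑ ≤ ‖K ξ η‖ₑ := by
  unfold highPart indicator; split_ifs <;> simp

theorem highPart_of_mem {p : ℝ} (K : Plane → Plane → ℂ) {ξ η : Plane} (h : η ∈ lowSet p ξ) :
    highPart p K ξ η = 0 :=
  indicator_of_notMem (fun h' : η ∈ (lowSet p ξ)ᶜ => h' h) _

theorem lowPart_of_notMem {p : ℝ} (K : Plane → Plane → ℂ) {ξ η : Plane} (h : η ∉ lowSet p ξ) :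
    lowPart p K ξ η = 0 := indicator_of_notMem h _

theorem lowPart_eq_mul (p : ℝ) (K : Plane → Plane → ℂ) (ξ η : Plane) :
    lowPart p K ξ η = lowPart p (fun _ _ => 1) ξ η * K ξ η := by
  unfold lowPart indicator; split_ifs <;> simp

theorem highPart_eq_mul (p : ℝ) (K : Plane → Plane → ℂ) (ξ η : Plane) :
    highPart p K ξ η = highPart p (fun _ _ => 1) ξ η * K ξ η := by
  unfold highPart indicator; split_ifs <;> simp

/-- The null form `Q_{μν}`, restricted by a kernel. -/
def nullBil (K : Plane → Plane → ℂ) (u v : ℤˣ → ℝ → Plane → ℂ) (μ ν : Fin 3) (t : ℝ) (ξ : Plane) :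
    ℂ :=
  bil K (fd u μ t) (fd v ν t) ξ - bil K (fd u ν t) (fd v μ t) ξ

/-! ### Null forms of half-waves, split by sign and by frequency region -/

section NullForm

variable {I : Set ℝ} {α β : ℝ} {u v : ℤˣ → ℝ → Plane → ℂ} {K : Plane → Plane → ℂ}

/-- Each pair of signs has its own phase and null symbol, and cancellation is visible only after
this expansion. The exponent condition makes every integral converge absolutely at each ξ. -/
theorem nullBil_eq_sum (hα : 0 ≤ α - 1 + (β - 1)) (hKm : Measurable (Function.uncurry K))
    (hK : ∀ ξ η, ‖K ξ η‖ₑ ≤ 1) (hu : ∀ σ, EnSup I α (u σ)) (hv : ∀ σ, EnSup I β (v σ))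
    (μ ν : Fin 3) {t : ℝ} (ht : t ∈ I) (ξ : Plane) :
    nullBil K u v μ ν t ξ =
      (bil (fun ξ η => K ξ η * nullSym 1 1 μ ν ξ η) (u 1 t) (v 1 t) ξ +
        bil (fun ξ η => K ξ η * nullSym 1 (-1) μ ν ξ η) (u 1 t) (v (-1) t) ξ) +
      (bil (fun ξ η => K ξ η * nullSym (-1) 1 μ ν ξ η) (u (-1) t) (v 1 t) ξ +
        bil (fun ξ η => K ξ η * nullSym (-1) (-1) μ ν ξ η) (u (-1) t) (v (-1) t) ξ) := by
  have hi : ∀ σ σ', Integrable fun η =>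
      K ξ η * nullSym σ σ' μ ν ξ η * (u σ t η * v σ' t (ξ - η)) := by
    intro σ σ'
    have h1 := ((hu σ).dsym_mul σ μ).integrable_bil hα hKm hK ((hv σ').dsym_mul σ' ν) ht ξ
    have h2 := ((hu σ).dsym_mul σ ν).integrable_bil hα hKm hK ((hv σ').dsym_mul σ' μ) ht ξ
    refine (h1.sub h2).congr (ae_of_all _ fun η => ?_)
    simp only [nullSym, Pi.sub_apply]; ring
  have h1 := (enSup_fd hu μ).integrable_bil hα hKm hK (enSup_fd hv ν) ht ξ
  have h2 := (enSup_fd hu ν).integrable_bil hα hKm hK (enSup_fd hv μ) ht ξ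
  have j : ∀ σ, Integrable fun η => K ξ η * nullSym σ 1 μ ν ξ η * (u σ t η * v 1 t (ξ - η)) +
      K ξ η * nullSym σ (-1) μ ν ξ η * (u σ t η * v (-1) t (ξ - η)) :=
    fun σ => (hi σ 1).add (hi σ (-1))
  simp only [nullBil, bil]
  rw [← integral_sub h1 h2, ← integral_add (hi _ _) (hi _ _), ← integral_add (hi _ _) (hi _ _),
    ← integral_add (j 1) (j (-1))]
  refine integral_congr_ae (ae_of_all _ fun η => ?_)
  simp only [fd, nullSym]; ring

theorem nullBil_low_add_high (hα : 0 ≤ α - 1 + (β - 1)) (hu : ∀ σ, EnSup I α (u σ))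
    (hv : ∀ σ, EnSup I β (v σ)) (p : ℝ) (μ ν : Fin 3) {t : ℝ} (ht : t ∈ I) (ξ : Plane) :
    nullBil (fun _ _ => 1) u v μ ν t ξ =
      nullBil (lowPart p fun _ _ => 1) u v μ ν t ξ +
        nullBil (highPart p fun _ _ => 1) u v μ ν t ξ := by
  have hl : ∀ ξ η, ‖lowPart p (fun _ _ => 1) ξ η‖ₑ ≤ 1 :=
    fun ξ η => (enorm_lowPart_le p (fun _ _ => 1) ξ η).trans (by simp)
  have hh : ∀ ξ η, ‖highPart p (fun _ _ => 1) ξ η‖ₑ ≤ 1 :=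
    fun ξ η => (enorm_highPart_le p (fun _ _ => 1) ξ η).trans (by simp)
  have hlm := measurable_lowPart p (K := fun _ _ => 1) measurable_const
  have hhm := measurable_highPart p (K := fun _ _ => 1) measurable_const
  have key : ∀ μ ν, bil (fun _ _ => 1) (fd u μ t) (fd v ν t) ξ =
      bil (lowPart p fun _ _ => 1) (fd u μ t) (fd v ν t) ξ +
        bil (highPart p fun _ _ => 1) (fd u μ t) (fd v ν t) ξ := by
    intro μ ν
    simp only [bil]
    rw [← integral_add ((enSup_fd hu μ).integrable_bil hα hlm hl (enSup_fd hv ν) ht ξ)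
      ((enSup_fd hu μ).integrable_bil hα hhm hh (enSup_fd hv ν) ht ξ)]
    refine integral_congr_ae (ae_of_all _ fun η => ?_)
    simp only
    rw [← add_mul, lowPart_add_highPart]
  rw [nullBil, key, key, nullBil, nullBil]; ring

theorem nullBil_antisymm (K : Plane → Plane → ℂ) (u v : ℤˣ → ℝ → Plane → ℂ) (μ ν : Fin 3) (t : ℝ)
    (ξ : Plane) : nullBil K u v ν μ t ξ = -1 * nullBil K u v μ ν t ξ := by
  simp only [nullBil]; ring

end NullForm

/-- The exponents for which null forms of half-waves split. -/
structure NullExp (s₁ κ s₀ p z d : ℝ) : Prop where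
  hs₁ : 0 ≤ s₁
  hs₁' : s₁ ≤ 1 / 2
  hs₀ : 0 ≤ s₀
  hκ : 0 ≤ κ
  hp : 0 < p
  hp1 : p ≤ 1
  low : (1 / p) * (1 - 2 * s₁ + κ) ≤ 2 * s₀
  force : HighCond p (2 * (-s₀ + 1)) (2 * (1 + s₁))
  prim : HighCond p (2 * z) (2 * (1 + s₁))
  deriv : HighCond p (2 * d) (2 * s₁)

theorem nullBil_low_enInt {a b : ℝ} (hab : a < b) {s₁ κ s₀ p z d : ℝ}
    (h : NullExp s₁ κ s₀ p z d) {u E v G : ℤˣ → ℝ → Plane → ℂ}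
    (hu : HalfWave a b (1 + s₁) (1 + s₁ - κ) u E) (hv : HalfWave a b 1 (1 - κ) v G)
    (μ ν : Fin 3) : EnInt (Ioo a b) (-s₀) (nullBil (lowPart p fun _ _ => 1) u v μ ν) := by
  have hlm := measurable_lowPart p (K := fun _ _ => 1) measurable_const
  have hterm : ∀ σ σ', EnInt (Ioo a b) (-s₀) (fun t =>
      bil (fun ξ η => lowPart p (fun _ _ => 1) ξ η * nullSym σ σ' μ ν ξ η) (u σ t) (v σ' t)) := by
    intro σ σ'
    have hm : Measurable (Function.uncurry fun ξ η =>
        lowPart p (fun _ _ => 1) ξ η * nullSym σ σ' μ ν ξ η) :=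
      hlm.mul (measurable_nullSym σ σ' μ ν)
    refine bilinear_low hab (sgn_sq σ) (sgn_sq σ') h.hs₁ h.hs₁' h.hs₀ h.hκ h.hp h.hp1 h.low
      hm (fun ξ η hη => ?_) (C₀ := 4) (by simp)
      (fun ξ η => ?_) (hu.prim σ) (hu.sup σ) (hu.int σ) (hv.prim σ') (hv.sup σ') (hv.int σ')
    · rw [lowPart_of_notMem _ hη, zero_mul]
    · refine le_trans (pow_le_pow_left' ?_ 2) (enorm_nullSym_sq_le σ σ' μ ν ξ η)
      rw [← lowPart_eq_mul]
      exact enorm_lowPart_le p _ ξ η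
  have hsum := ((hterm 1 1).add (hterm 1 (-1))).add ((hterm (-1) 1).add (hterm (-1) (-1)))
  refine hsum.congr ?_ ?_
  · exact (measurable_bil hlm (enSup_fd hu.sup μ).1 (enSup_fd hv.sup ν).1).sub
      (measurable_bil hlm (enSup_fd hu.sup ν).1 (enSup_fd hv.sup μ).1)
  · filter_upwards [ae_restrict_mem measurableSet_Ioo] with t ht
    refine ae_of_all _ fun ξ => ?_
    rw [nullBil_eq_sum (by linarith [h.hs₁]) hlm
      (fun ξ η => (enorm_lowPart_le p (fun _ _ => 1) ξ η).trans (by simp)) hu.sup hv.sup μ ν ht ξ]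

/-- In the determinant of η and ξ - η the part quadratic in η cancels, so one of the two derivatives
lands on the output frequency. -/
theorem enorm_nullSym_space_le (σ σ' : ℤˣ) (j k : Fin 2) (ξ η : Plane) :
    ‖nullSym σ σ' j.succ k.succ ξ η‖ₑ ≤ 2 * (jw 1 ξ * jw 1 η) := by
  have hs : ∀ (σ : ℤˣ) (j : Fin 2) (η : Plane), dsym σ j.succ η = derivSymbol j η := by
    intro σ j η; fin_cases j <;> rfl
  have hd : ∀ j, derivSymbol j (ξ - η) = derivSymbol j ξ - derivSymbol j η := by
    intro j; simp [derivSymbol]; ring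
  have : nullSym σ σ' j.succ k.succ ξ η =
      derivSymbol j η * derivSymbol k ξ - derivSymbol k η * derivSymbol j ξ := by
    rw [nullSym, hs, hs, hs, hs, hd, hd]; ring
  rw [this]
  refine (enorm_sub_le).trans ?_
  rw [enorm_mul, enorm_mul, two_mul]
  have h1 := fun j => enorm_derivSymbol_le j η
  have h2 := fun j => enorm_derivSymbol_le j ξ
  refine add_le_add ?_ ?_ <;>
  · rw [mul_comm]
    exact mul_le_mul' (h2 _) (h1 _)

theorem nullBil_high_space_enInt {a b : ℝ} {s₁ κ s₀ p z d β β' : ℝ}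
    (h : NullExp s₁ κ s₀ p z d) {u E v G : ℤˣ → ℝ → Plane → ℂ}
    (hu : HalfWave a b (1 + s₁) β u E) (hv : HalfWave a b 1 β' v G)
    (j k : Fin 2) :
    EnInt (Ioo a b) (-s₀) (nullBil (highPart p fun _ _ => 1) u v j.succ k.succ) := by
  have hhm := measurable_highPart p (K := fun _ _ => 1) measurable_const
  have hterm : ∀ σ σ', EnInt (Ioo a b) (-s₀) (fun t =>
      bil (fun ξ η => highPart p (fun _ _ => 1) ξ η * nullSym σ σ' j.succ k.succ ξ η)
        (u σ t) (v σ' t)) := by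
    intro σ σ'
    have hm : Measurable (Function.uncurry fun ξ η =>
        highPart p (fun _ _ => 1) ξ η * nullSym σ σ' j.succ k.succ ξ η) :=
      hhm.mul (measurable_nullSym σ σ' _ _)
    refine EnInt.bil_left measurableSet_Ioo hm
      (bilBound_high (q := 1) (e := 1) h.hp h.hp1 (fun ξ η hη => ?_) (c := 2) (by simp)
      (fun ξ η => ?_) ?_) ((hu.sup σ).enInt (by simp) measurableSet_Ioo) (hv.sup σ')
    · rw [highPart_of_mem _ hη, zero_mul]
    · rw [← highPart_eq_mul]
      exact (enorm_highPart_le p _ ξ η).trans (enorm_nullSym_space_le σ σ' j k ξ η)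
    · convert h.force using 1; ring
  have hsum := ((hterm 1 1).add (hterm 1 (-1))).add ((hterm (-1) 1).add (hterm (-1) (-1)))
  refine hsum.congr ?_ ?_
  · exact (measurable_bil hhm (enSup_fd hu.sup _).1 (enSup_fd hv.sup _).1).sub
      (measurable_bil hhm (enSup_fd hu.sup _).1 (enSup_fd hv.sup _).1)
  · filter_upwards [ae_restrict_mem measurableSet_Ioo] with t ht
    refine ae_of_all _ fun ξ => ?_
    rw [nullBil_eq_sum (by linarith [h.hs₁]) hhm
      (fun ξ η => (enorm_highPart_le p (fun _ _ => 1) ξ η).trans (by simp)) hu.sup hv.sup _ _ ht ξ]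

/-- Uses Q_{0k}(u,v) = ∂_t(u ∂_k v) - ∂_k(u ∂_t v). The second term has its derivative on the small
output frequency and counts as forcing; the first is a time derivative of Z = u ∂_k v. Expanding ∂_t
Z produces ∂_k ∂_t v but no second time derivative, so the equations are not used and only
cancellation of the forcing in the total fields matters. -/
theorem nullBil_high_time_splits {a b : ℝ} {s₁ κ s₀ p z d β β' : ℝ}
    (h : NullExp s₁ κ s₀ p z d) {u E v G : ℤˣ → ℝ → Plane → ℂ}
    (hu : HalfWave a b (1 + s₁) β u E) (hv : HalfWave a b 1 β' v G) (k : Fin 2) :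
    Splits (Ioo a b) s₀ z d (nullBil (highPart p fun _ _ => 1) u v 0 k.succ) := by
  set K := highPart p fun _ _ => 1 with hKd
  have hs₁ := h.hs₁
  have hKm : Measurable (Function.uncurry K) :=
    measurable_highPart p (K := fun _ _ => 1) measurable_const
  have hK : ∀ ξ η, ‖K ξ η‖ₑ ≤ 1 := fun ξ η =>
    (enorm_highPart_le p (fun _ _ => 1) ξ η).trans (by simp)
  have hK0 : ∀ ξ η, η ∈ lowSet p ξ → K ξ η = 0 := fun ξ η hη => highPart_of_mem _ hη
  have hU := enSup_tot hu.sup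
  have hU' : EnSup (Ioo a b) s₁ (fd u 0) := (enSup_fd hu.sup 0).mono_exp (by linarith)
  have hV : EnSup (Ioo a b) 0 (fd v k.succ) := (enSup_fd hv.sup k.succ).mono_exp (by linarith)
  have hV0 : EnSup (Ioo a b) 0 (fd v 0) := (enSup_fd hv.sup 0).mono_exp (by linarith)
  have hV' : EnSup (Ioo a b) (-1) (fun t η => derivSymbol k η * fd v 0 t η) :=
    (hV0.derivSymbol_mul k).mono_exp (by linarith)
  have hin : ∀ {F : ℝ → Plane → ℂ} {s : ℝ}, EnSup (Ioo a b) s F → EnInt (Ioo a b) s F :=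
    fun hF => hF.enInt (by simp) measurableSet_Ioo
  have hKb : ∀ {r α β : ℝ}, HighCond p (2 * r) (2 * (α + β)) → BilBound r α β K := by
    intro r α β hc
    refine bilBound_high (q := 0) (e := 0) h.hp h.hp1 hK0 (c := 1) (by simp)
      (fun ξ η => by simpa using hK ξ η) ?_
    convert hc using 2 <;> ring
  set K' : Plane → Plane → ℂ := fun ξ η => derivSymbol k ξ * K ξ η with hK'
  have hK'm : Measurable (Function.uncurry K') :=
    ((measurable_derivSymbol k).comp measurable_fst).mul hKm
  refine ⟨fun t ξ => -1 * bil K' (tot u t) (fd v 0 t) ξ,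
    fun t => bil K (tot u t) (fd v k.succ t),
    fun t ξ => bil K (fd u 0 t) (fd v k.succ t) ξ +
      bil K (tot u t) (fun η => derivSymbol k η * fd v 0 t η) ξ, ?_, ?_, ?_, ?_, ?_⟩
  · refine EnInt.const_mul (EnInt.bil_left measurableSet_Ioo hK'm (bilBound_high (q := 1) (e := 0)
      h.hp h.hp1 (fun ξ η hη => ?_) (c := 1) (by simp) (fun ξ η => ?_) ?_) (hin hU) hV0) _
    · simp [hK', hK0 ξ η hη]
    · rw [hK', enorm_mul, jw_zero, mul_one, one_mul]
      exact (mul_le_mul' (enorm_derivSymbol_le k ξ) (hK ξ η)).trans (by rw [mul_one])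
    · convert h.force using 2; ring
  · exact EnSup.bil hKm (hKb (by simpa using h.prim)) hU hV
  · exact primAE_bil (by linarith) (by linarith) (by linarith) hKm hK hU (hin hU') hV (hin hV')
      hu.primAE_tot (hv.primAE_fd_succ k)
  · refine EnInt.add (EnInt.bil_left measurableSet_Ioo hKm (hKb (by simpa using h.deriv)) (hin hU') hV)
      (EnInt.bil_left measurableSet_Ioo hKm (hKb ?_) (hin hU) hV')
    convert h.deriv using 2; ring
  · filter_upwards [ae_restrict_mem measurableSet_Ioo] with t ht
    refine ae_of_all _ fun ξ => ?_
    have i1 := (enSup_fd hu.sup k.succ).integrable_bil (by linarith) hKm hK hV0 ht ξ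
    have i2 := hU.integrable_bil (by linarith) hKm hK hV' ht ξ
    have e1 : bil K' (tot u t) (fd v 0 t) ξ = bil K (fd u k.succ t) (fd v 0 t) ξ +
        bil K (tot u t) (fun η => derivSymbol k η * fd v 0 t η) ξ := by
      simp only [bil]
      rw [← integral_add i1 i2]
      refine integral_congr_ae (ae_of_all _ fun η => ?_)
      simp only [hK', fd_succ]
      have : derivSymbol k (ξ - η) = derivSymbol k ξ - derivSymbol k η := by
        simp [derivSymbol]; ring
      rw [this]; ring
    rw [e1, nullBil]; ring

/-- Null forms of half-waves split into a forcing term and a time derivative. -/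
theorem nullBil_splits {a b : ℝ} (hab : a < b) {s₁ κ s₀ p z d : ℝ}
    (h : NullExp s₁ κ s₀ p z d) {u E v G : ℤˣ → ℝ → Plane → ℂ}
    (hu : HalfWave a b (1 + s₁) (1 + s₁ - κ) u E) (hv : HalfWave a b 1 (1 - κ) v G)
    (μ ν : Fin 3) : Splits (Ioo a b) s₀ z d (nullBil (fun _ _ => 1) u v μ ν) := by
  have hhigh : ∀ μ ν, Splits (Ioo a b) s₀ z d (nullBil (highPart p fun _ _ => 1) u v μ ν) := by
    intro μ ν
    cases μ using Fin.cases with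
    | zero =>
      cases ν using Fin.cases with
      | zero =>
        refine (enInt_zero (Ioo a b) (-s₀)).splits.congr (ae_of_all _ fun t => ae_of_all _ fun ξ => ?_)
        simp [nullBil]
      | succ k => exact nullBil_high_time_splits h hu hv k
    | succ j =>
      cases ν using Fin.cases with
      | zero =>
        refine ((nullBil_high_time_splits h hu hv j).const_mul (-1)).congr
          (ae_of_all _ fun t => ae_of_all _ fun ξ => ?_)
        exact nullBil_antisymm _ _ _ _ _ _ _
      | succ k => exact (nullBil_high_space_enInt h hu hv j k).splits
  refine ((nullBil_low_enInt hab h hu hv μ ν).splits.add ordConnected_Ioo (hhigh μ ν)).congr ?_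
  filter_upwards [ae_restrict_mem measurableSet_Ioo] with t ht
  refine ae_of_all _ fun ξ => ?_
  exact nullBil_low_add_high (by linarith [h.hs₁]) hu.sup hv.sup p μ ν ht ξ

/-! ### Space-time Schwartz functions -/

/-- `spacePart` as a continuous linear map. -/
def spacePartL : Spacetime →L[ℝ] Plane :=
  LinearMap.toContinuousLinearMap
    { toFun := spacePart
      map_add' := by intro a b; ext i; fin_cases i <;> simp [spacePart]
      map_smul' := by intro c a; ext i; fin_cases i <;> simp [spacePart] }

/-- The time coordinate as a continuous linear map. -/
def timePartL : Spacetime →L[ℝ] ℝ := EuclideanSpace.proj 0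

@[simp] theorem spacePartL_apply (y : Spacetime) : spacePartL y = spacePart y := rfl

@[simp] theorem timePartL_apply (y : Spacetime) : timePartL y = y 0 := rfl

@[simp] theorem spacePart_point (t : ℝ) (x : Plane) : spacePart (point t x) = x := by
  ext i; fin_cases i <;> simp [spacePart, point]

@[simp] theorem point_zero (t : ℝ) (x : Plane) : point t x 0 = t := by simp [point]

@[simp] theorem point_spacePart (y : Spacetime) : point (y 0) (spacePart y) = y := by
  ext i; fin_cases i <;> simp [spacePart, point]

theorem inner_spacetime (y z : Spacetime) :
    inner ℝ y z = y 0 * z 0 + inner ℝ (spacePart y) (spacePart z) := by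
  simp only [PiLp.inner_apply, Fin.sum_univ_succ, spacePart]
  simp [mul_comm]

theorem norm_sq_spacetime (y : Spacetime) : ‖y‖ ^ 2 = y 0 ^ 2 + ‖spacePart y‖ ^ 2 := by
  rw [← real_inner_self_eq_norm_sq, ← real_inner_self_eq_norm_sq, inner_spacetime]; ring

theorem norm_le_time_add_space (y : Spacetime) : ‖y‖ ≤ |y 0| + ‖spacePart y‖ := by
  refine abs_le_of_sq_le_sq' ?_ (by positivity) |>.2
  rw [norm_sq_spacetime, ← sq_abs (y 0)]
  nlinarith [mul_nonneg (abs_nonneg (y 0)) (norm_nonneg (spacePart y))]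

theorem norm_spacePart_le (y : Spacetime) : ‖spacePart y‖ ≤ ‖y‖ := by
  refine abs_le_of_sq_le_sq' ?_ (by positivity) |>.2
  rw [norm_sq_spacetime]; nlinarith [sq_nonneg (y 0)]

theorem measurePreserving_split :
    MeasurePreserving (fun y : Spacetime => (y 0, spacePart y)) volume (volume.prod volume) := by
  have h1 := EuclideanSpace.volume_preserving_symm_measurableEquiv_toLp (Fin 3)
  have h2 := volume_preserving_piFinSuccAbove (fun _ : Fin 3 => ℝ) 0
  have h3 := (EuclideanSpace.volume_preserving_symm_measurableEquiv_toLp (Fin 2)).symm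
  have h4 := (MeasurePreserving.id (volume : Measure ℝ)).prod h3
  have e : (fun y : Spacetime => (y 0, spacePart y)) =
      Prod.map id (MeasurableEquiv.toLp 2 (Fin 2 → ℝ)) ∘
        MeasurableEquiv.piFinSuccAbove (fun _ : Fin 3 => ℝ) 0 ∘
          (MeasurableEquiv.toLp 2 (Fin 3 → ℝ)).symm := by
    funext y
    refine Prod.ext rfl ?_
    ext i; fin_cases i <;> rfl
  rw [e]
  exact h4.comp (h2.comp h1)

/-- Space-time as the product of time and space. -/
def splitEquiv : Spacetime ≃ᵐ ℝ × Plane where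
  toFun y := (y 0, spacePart y)
  invFun p := point p.1 p.2
  left_inv y := point_spacePart y
  right_inv p := by simp
  measurable_toFun := measurePreserving_split.measurable
  measurable_invFun := by
    simp only [Equiv.coe_fn_symm_mk, point]
    fun_prop

theorem measurable_point : Measurable fun p : ℝ × Plane => point p.1 p.2 :=
  splitEquiv.symm.measurable

theorem measurePreserving_point :
    MeasurePreserving (fun p : ℝ × Plane => point p.1 p.2) (volume.prod volume) volume :=
  MeasurePreserving.symm splitEquiv measurePreserving_split

theorem integral_spacetime (F : Spacetime → ℂ) :
    ∫ y, F y = ∫ p : ℝ × Plane, F (point p.1 p.2) ∂(volume.prod volume) :=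
  (measurePreserving_point.integral_comp splitEquiv.symm.measurableEmbedding F).symm

theorem lintegral_spacetime {F : Spacetime → ℝ≥0∞} (hF : Measurable F) :
    ∫⁻ y, F y = ∫⁻ ξ, ∫⁻ τ, F (point τ ξ) := by
  rw [← measurePreserving_point.lintegral_comp hF]
  exact lintegral_prod_symm' _ (hF.comp measurable_point) 

theorem integrable_spacetime_iff {F : Spacetime → ℂ} :
    Integrable F ↔ Integrable (fun p : ℝ × Plane => F (point p.1 p.2)) (volume.prod volume) :=
  (measurePreserving_point.integrable_comp_emb splitEquiv.symm.measurableEmbedding).symm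

theorem norm_iteratedFDeriv_comp_le {E F : Type*} [NormedAddCommGroup E] [NormedSpace ℝ E]
    [NormedAddCommGroup F] [NormedSpace ℝ F] (L : E →L[ℝ] F) (f : 𝓢(F, ℂ)) (n : ℕ) (x : E) :
    ‖iteratedFDeriv ℝ n (f ∘ L) x‖ ≤ ‖L‖ ^ n * ‖iteratedFDeriv ℝ n f (L x)‖ := by
  rw [L.iteratedFDeriv_comp_right (f.smooth ⊤) x (by exact_mod_cast le_top)]
  refine (ContinuousMultilinearMap.norm_compContinuousLinearMap_le _ _).trans ?_
  simp [mul_comm]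

theorem exists_one_add_pow_bound {F : Type*} [NormedAddCommGroup F] [NormedSpace ℝ F]
    (f : 𝓢(F, ℂ)) (k n : ℕ) :
    ∃ C, 0 ≤ C ∧ ∀ x, (1 + ‖x‖) ^ k * ‖iteratedFDeriv ℝ n f x‖ ≤ C := by
  refine ⟨2 ^ k * (Finset.Iic (k, n)).sup (fun m => SchwartzMap.seminorm ℝ m.1 m.2) f,
    by positivity, fun x => ?_⟩
  exact SchwartzMap.one_add_le_sup_seminorm_apply (𝕜 := ℝ) (m := (k, n)) le_rfl le_rfl f x

/-- The function `χ(t) ψ(x)`. -/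
def tens (χ : 𝓢(ℝ, ℂ)) (ψ : 𝓢(Plane, ℂ)) : 𝓢(Spacetime, ℂ) where
  toFun y := χ (y 0) * ψ (spacePart y)
  smooth' := by
    have h1 : ContDiff ℝ ∞ (χ ∘ timePartL) := (χ.smooth ⊤).comp timePartL.contDiff
    have h2 : ContDiff ℝ ∞ (ψ ∘ spacePartL) := (ψ.smooth ⊤).comp spacePartL.contDiff
    exact h1.mul h2
  decay' := by
    intro k n
    have h1 : ContDiff ℝ ∞ (χ ∘ timePartL) := (χ.smooth ⊤).comp timePartL.contDiff
    have h2 : ContDiff ℝ ∞ (ψ ∘ spacePartL) := (ψ.smooth ⊤).comp spacePartL.contDiff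
    choose C hC0 hC using fun i => exists_one_add_pow_bound χ k i
    choose D hD0 hD using fun i => exists_one_add_pow_bound ψ k i
    refine ⟨∑ i ∈ Finset.range (n + 1), (n.choose i : ℝ) *
      ((‖timePartL‖ ^ i * C i) * (‖spacePartL‖ ^ (n - i) * D (n - i))), fun y => ?_⟩
    have h3 := norm_iteratedFDeriv_mul_le (n := n) h1 h2 y (by exact_mod_cast le_top)
    have hy : ‖y‖ ^ k ≤ (1 + ‖y 0‖) ^ k * (1 + ‖spacePart y‖) ^ k := by
      rw [← mul_pow]
      refine pow_le_pow_left₀ (norm_nonneg _) ((norm_le_time_add_space y).trans ?_) k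
      rw [Real.norm_eq_abs]
      nlinarith [mul_nonneg (abs_nonneg (y 0)) (norm_nonneg (spacePart y))]
    refine (mul_le_mul hy h3 (norm_nonneg _) (by positivity)).trans ?_
    rw [Finset.mul_sum]
    refine Finset.sum_le_sum fun i _ => ?_
    have e1 := norm_iteratedFDeriv_comp_le timePartL χ i y
    have e2 := norm_iteratedFDeriv_comp_le spacePartL ψ (n - i) y
    have c1 := hC i (y 0)
    have c2 := hD (n - i) (spacePart y)
    simp only [timePartL_apply, spacePartL_apply] at e1 e2
    calc (1 + ‖y 0‖) ^ k * (1 + ‖spacePart y‖) ^ k * ((n.choose i : ℝ) *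
          ‖iteratedFDeriv ℝ i (χ ∘ timePartL) y‖ * ‖iteratedFDeriv ℝ (n - i) (ψ ∘ spacePartL) y‖)
        ≤ (1 + ‖y 0‖) ^ k * (1 + ‖spacePart y‖) ^ k * ((n.choose i : ℝ) *
          (‖timePartL‖ ^ i * ‖iteratedFDeriv ℝ i χ (y 0)‖) *
            (‖spacePartL‖ ^ (n - i) * ‖iteratedFDeriv ℝ (n - i) ψ (spacePart y)‖)) := by gcongr
      _ = (n.choose i : ℝ) *
          ((‖timePartL‖ ^ i * ((1 + ‖y 0‖) ^ k * ‖iteratedFDeriv ℝ i χ (y 0)‖)) *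
            (‖spacePartL‖ ^ (n - i) *
              ((1 + ‖spacePart y‖) ^ k * ‖iteratedFDeriv ℝ (n - i) ψ (spacePart y)‖))) := by ring
      _ ≤ _ := by gcongr; exact mul_nonneg (by positivity) (hC0 i)

@[simp] theorem tens_apply (χ : 𝓢(ℝ, ℂ)) (ψ : 𝓢(Plane, ℂ)) (y : Spacetime) :
    tens χ ψ y = χ (y 0) * ψ (spacePart y) := rfl

theorem fourier_tens (χ : 𝓢(ℝ, ℂ)) (ψ : 𝓢(Plane, ℂ)) : 𝓕 (tens χ ψ) = tens (𝓕 χ) (𝓕 ψ) := by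
  ext z
  simp only [tens_apply, SchwartzMap.fourier_coe, Real.fourier_eq]
  rw [integral_spacetime, ← integral_prod_mul]
  refine integral_congr_ae (ae_of_all _ fun p => ?_)
  simp only [point_zero, spacePart_point, inner_spacetime, Circle.smul_def, smul_eq_mul,
    neg_add, AddChar.map_add_eq_mul, Circle.coe_mul]
  have e : inner ℝ p.1 (z 0) = p.1 * z 0 := by simp [mul_comm]
  rw [e]
  ring

theorem japaneseSymbol_hasTemperateGrowth (r : ℝ) : (japaneseSymbol r).HasTemperateGrowth := by
  let L : Plane →L[ℝ] Spacetime := LinearMap.toContinuousLinearMap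
    { toFun := point 0
      map_add' := by intro a b; ext i; fin_cases i <;> simp [point]
      map_smul' := by intro c a; ext i; fin_cases i <;> simp [point] }
  have h := (spacetimeSymbol_hasTemperateGrowth r).comp L.hasTemperateGrowth
  have : japaneseSymbol r = spacetimeSymbol r ∘ L := by
    funext ξ
    change _ = japaneseSymbol r (spacePart (point 0 ξ))
    rw [spacePart_point]
  rwa [this]

theorem derivSymbol_hasTemperateGrowth (j : Fin 2) : (derivSymbol j).HasTemperateGrowth := by
  let L : Plane →L[ℝ] ℂ := (2 * Real.pi * Complex.I : ℂ) • (Complex.ofRealCLM ∘L EuclideanSpace.proj j)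
  exact L.hasTemperateGrowth

/-- `ρ ↦ ⟨∇⟩^r`-symbol times `ρ`. -/
def jmul (r : ℝ) (ρ : 𝓢(Plane, ℂ)) : 𝓢(Plane, ℂ) := SchwartzMap.smulLeftCLM ℂ (japaneseSymbol r) ρ

@[simp] theorem jmul_apply (r : ℝ) (ρ : 𝓢(Plane, ℂ)) (η : Plane) :
    jmul r ρ η = japaneseSymbol r η * ρ η :=
  SchwartzMap.smulLeftCLM_apply_apply (japaneseSymbol_hasTemperateGrowth r) ρ η

/-- Multiplication by the symbol of `∂_j`. -/
def dmul (j : Fin 2) (ρ : 𝓢(Plane, ℂ)) : 𝓢(Plane, ℂ) := SchwartzMap.smulLeftCLM ℂ (derivSymbol j) ρ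

@[simp] theorem dmul_apply (j : Fin 2) (ρ : 𝓢(Plane, ℂ)) (η : Plane) :
    dmul j ρ η = derivSymbol j η * ρ η :=
  SchwartzMap.smulLeftCLM_apply_apply (derivSymbol_hasTemperateGrowth j) ρ η

theorem fourier_fourier_apply (ρ : 𝓢(Plane, ℂ)) (η : Plane) : 𝓕 (𝓕 ρ) η = ρ (-η) := by
  have h : 𝓕⁻ (𝓕 ρ) = ρ := FourierTransform.fourierInv_fourier_eq ρ
  have h2 : 𝓕⁻ (𝓕 ρ) (-η) = ρ (-η) := by rw [h]
  rw [← h2, SchwartzMap.fourierInv_coe, SchwartzMap.fourier_coe (𝓕 ρ), Real.fourierInv_eq_fourier_neg,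
    neg_neg]

/-- Test functions χ ⊗ 𝓕ρ turn spatial multipliers into multiplication of ρ. The double transform
reflects the frequency, and the symbol is even. -/
theorem japanese_tens (r : ℝ) (χ : 𝓢(ℝ, ℂ)) (ρ : 𝓢(Plane, ℂ)) :
    japanese r (tens χ (𝓕 ρ)) = tens χ (𝓕 (jmul r ρ)) := by
  have h : SchwartzMap.smulLeftCLM ℂ (spacetimeSymbol r) (𝓕 (tens χ (𝓕 ρ))) =
      𝓕 (tens χ (𝓕 (jmul r ρ))) := by
    ext y
    rw [SchwartzMap.smulLeftCLM_apply_apply (spacetimeSymbol_hasTemperateGrowth r), fourier_tens,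
      fourier_tens, tens_apply, tens_apply, fourier_fourier_apply, fourier_fourier_apply, jmul_apply]
    simp only [spacetimeSymbol, japaneseSymbol, norm_neg, smul_eq_mul]; ring
  rw [japanese, SchwartzMap.fourierMultiplierCLM_apply, h, FourierTransform.fourierInv_fourier_eq]

theorem hasFDerivAt_tens (χ : 𝓢(ℝ, ℂ)) (ψ : 𝓢(Plane, ℂ)) (y : Spacetime) :
    HasFDerivAt (tens χ ψ) (χ (y 0) • ((fderiv ℝ ψ (spacePart y)).comp spacePartL) +
      ψ (spacePart y) • ((fderiv ℝ χ (y 0)).comp timePartL)) y := by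
  have h1 : HasFDerivAt (fun y => χ (timePartL y)) ((fderiv ℝ χ (y 0)).comp timePartL) y :=
    (χ.hasFDerivAt _).comp y timePartL.hasFDerivAt
  have h2 : HasFDerivAt (fun y => ψ (spacePartL y)) ((fderiv ℝ ψ (spacePart y)).comp spacePartL) y :=
    (ψ.hasFDerivAt _).comp y spacePartL.hasFDerivAt
  exact h1.mul h2

theorem partialDeriv_zero_tens (χ : 𝓢(ℝ, ℂ)) (ψ : 𝓢(Plane, ℂ)) :
    partialDeriv 0 (tens χ ψ) = tens (SchwartzMap.derivCLM ℂ ℂ χ) ψ := by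
  ext y
  rw [partialDeriv, SchwartzMap.lineDerivOp_apply_eq_fderiv, (hasFDerivAt_tens χ ψ y).fderiv]
  have : spacePart (EuclideanSpace.single 0 1) = 0 := by
    ext i; fin_cases i <;> simp [spacePart]
  simp [this, mul_comm]

theorem partialDeriv_succ_tens (χ : 𝓢(ℝ, ℂ)) (ρ : 𝓢(Plane, ℂ)) (j : Fin 2) :
    partialDeriv j.succ (tens χ (𝓕 ρ)) = tens χ (𝓕 (-dmul j ρ)) := by
  have h : 𝓕 (-dmul j ρ) = ∂_{(EuclideanSpace.single j (1 : ℝ) : Plane)} (𝓕 ρ) := by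
    rw [SchwartzMap.lineDerivOp_fourier_eq]
    congr 1
    ext η
    rw [neg_apply, dmul_apply, smul_apply,
      SchwartzMap.smulLeftCLM_apply_apply (by fun_prop)]
    have e : inner ℝ η (EuclideanSpace.single j (1 : ℝ)) = η j := by
      rw [EuclideanSpace.inner_single_right]; simp
    rw [e]
    simp [derivSymbol]
    ring
  ext y
  rw [h, partialDeriv, SchwartzMap.lineDerivOp_apply_eq_fderiv, (hasFDerivAt_tens χ _ y).fderiv,
    tens_apply, SchwartzMap.lineDerivOp_apply_eq_fderiv]
  have : spacePart (EuclideanSpace.single j.succ 1) = EuclideanSpace.single j 1 := by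
    ext i; fin_cases i <;> fin_cases j <;> simp [spacePart]
  simp [this]

/-! ### Jointly measurable representatives -/

/-- A curve of L² classes has no preferred values at points. The first member of a dense sequence
within 2⁻ᵏ of f(t) depends measurably on t, and these approximations converge almost everywhere
because their squared errors are summable. -/
theorem exists_measurable_representative {J : Set ℝ} (hJ : IsOpen J) {f : ℝ → L2}
    (hf : ContinuousOn f J) :
    ∃ R : ℝ → Plane → ℂ, Measurable (Function.uncurry R) ∧ ∀ t ∈ J, R t =ᵐ[volume] f t := by
  classical
  have : Fact ((2 : ℝ≥0∞) ≠ ⊤) := ⟨by norm_num⟩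
  obtain ⟨e, he⟩ := TopologicalSpace.exists_dense_seq L2
  -- Outside J the requirement is void, so that a least index exists for every t.
  set p : ℕ → ℝ → ℕ → Prop := fun k t n => t ∈ J → ‖e n - f t‖ₑ < (2 : ℝ≥0∞)⁻¹ ^ k with hp
  have hpos : ∀ k : ℕ, (0 : ℝ≥0∞) < 2⁻¹ ^ k := fun k => ENNReal.pow_pos (by simp) k
  have hex : ∀ k t, ∃ n, p k t n := by
    intro k t
    obtain ⟨n, hn⟩ := he.exists_mem_open (Metric.isOpen_eball (x := f t) (ε := 2⁻¹ ^ k))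
      ⟨f t, Metric.mem_eball_self (hpos k)⟩
    refine ⟨n, fun _ => ?_⟩
    rwa [Metric.mem_eball, edist_eq_enorm_sub] at hn
  have hmeas : ∀ k n, MeasurableSet {t | p k t n} := by
    intro k n
    have h1 : IsOpen (J ∩ f ⁻¹' {g | ‖e n - g‖ₑ < 2⁻¹ ^ k}) :=
      hf.isOpen_inter_preimage hJ (isOpen_lt (by fun_prop) continuous_const)
    have : {t | p k t n} = Jᶜ ∪ (J ∩ f ⁻¹' {g | ‖e n - g‖ₑ < 2⁻¹ ^ k}) := by
      ext t
      simp only [hp, mem_ofPred_eq, mem_union, mem_compl_iff, mem_inter_iff, mem_preimage]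
      tauto
    rw [this]
    exact hJ.measurableSet.compl.union h1.measurableSet
  set N : ℕ → ℝ → ℕ := fun k t => Nat.find (hex k t) with hN
  have hNm : ∀ k, Measurable (N k) := fun k => measurable_find (hex k) (hmeas k)
  have hem : Measurable fun q : Plane × ℕ => e q.2 q.1 :=
    measurable_from_prod_countable_left fun n => (Lp.stronglyMeasurable (e n)).measurable
  have hGm : ∀ k, Measurable fun q : ℝ × Plane => e (N k q.1) q.2 := fun k =>
    hem.comp (measurable_snd.prodMk ((hNm k).comp measurable_fst))
  refine ⟨fun t η => limUnder atTop fun k => e (N k t) η, ?_, fun t ht => ?_⟩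
  · exact (StronglyMeasurable.limUnder (l := atTop) fun k => (hGm k).stronglyMeasurable).measurable
  · have hd : ∀ k, ∫⁻ η, ‖e (N k t) η - f t η‖ₑ ^ 2 ≤ (2⁻¹ ^ 2) ^ k := by
      intro k
      have h1 : ‖e (N k t) - f t‖ₑ < (2 : ℝ≥0∞)⁻¹ ^ k := Nat.find_spec (hex k t) ht
      calc _ = ∫⁻ η, ‖(e (N k t) - f t : L2) η‖ₑ ^ 2 := by
            refine lintegral_congr_ae ?_
            filter_upwards [Lp.coeFn_sub (e (N k t)) (f t)] with η hη
            rw [hη, Pi.sub_apply]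
        _ = ‖e (N k t) - f t‖ₑ ^ 2 := lintegral_enorm_sq_eq_norm_sq _
        _ ≤ (2⁻¹ ^ k) ^ 2 := by gcongr
        _ = _ := by rw [← pow_mul, ← pow_mul, mul_comm]
    have hm : ∀ k, Measurable fun η => ‖e (N k t) η - f t η‖ₑ ^ 2 := fun k =>
      (((Lp.stronglyMeasurable (e (N k t))).measurable.sub
        (Lp.stronglyMeasurable (f t)).measurable).enorm).pow_const 2
    have hs : ∫⁻ η, ∑' k, ‖e (N k t) η - f t η‖ₑ ^ 2 ≠ ⊤ := by
      rw [lintegral_tsum fun k => (hm k).aemeasurable]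
      refine ne_top_of_le_ne_top ?_ (ENNReal.tsum_le_tsum hd)
      rw [ENNReal.tsum_geometric]
      refine ENNReal.inv_ne_top.2 (tsub_pos_of_lt ?_).ne'
      rw [← ENNReal.inv_pow]
      exact ENNReal.inv_lt_one.2 (by norm_num)
    filter_upwards [ae_lt_top (Measurable.tsum hm) hs] with η hη
    have h0 := ENNReal.tendsto_atTop_zero_of_tsum_ne_top hη.ne
    refine Tendsto.limUnder_eq ?_
    rw [tendsto_iff_edist_tendsto_0]
    have h1 : Tendsto (fun k => (‖e (N k t) η - f t η‖ₑ ^ 2) ^ (1 / 2 : ℝ)) atTop (𝓝 0) := by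
      have := h0.ennrpow_const (1 / 2 : ℝ)
      rwa [ENNReal.zero_rpow_of_pos (by norm_num)] at this
    refine h1.congr fun k => ?_
    rw [edist_eq_enorm_sub, ← ENNReal.rpow_natCast, ← ENNReal.rpow_mul]
    norm_num

/-! ### Pairs of a function and its Fourier transform -/

/-- `u ∈ L²` has the Fourier transform `F`. -/
def IsFT (u F : Plane → ℂ) : Prop :=
  ∃ h : MemLp u 2, (𝓕 (h.toLp u) : L2) =ᵐ[volume] F

/-- `F` is the Fourier transform of `f`, tested with compactly supported functions of the
frequency. -/
def HasFT (f F : Plane → ℂ) : Prop :=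
  ∀ ρ : 𝓢(Plane, ℂ), HasCompactSupport ρ → Integrable (fun x => f x * (𝓕 ρ : 𝓢(Plane, ℂ)) x) ∧
    Integrable (fun η => F η * ρ η) ∧
    ∫ x, f x * (𝓕 ρ : 𝓢(Plane, ℂ)) x = ∫ η, F η * ρ η

theorem isFT_Lp (u : L2) : IsFT u (𝓕 u : L2) := by
  refine ⟨Lp.memLp u, ?_⟩
  rw [Lp.toLp_coeFn]

theorem IsFT.congr {u F G : Plane → ℂ} (h : IsFT u F) (hG : F =ᵐ[volume] G) : IsFT u G :=
  ⟨h.1, h.2.trans hG⟩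

theorem IsFT.congr_left {u v F : Plane → ℂ} (h : IsFT u F) (hv : u =ᵐ[volume] v) : IsFT v F := by
  obtain ⟨h1, h2⟩ := h
  refine ⟨(memLp_congr_ae hv).1 h1, ?_⟩
  rwa [MemLp.toLp_congr _ h1 hv.symm]

theorem IsFT.memLp {u F : Plane → ℂ} (h : IsFT u F) : MemLp F 2 :=
  (memLp_congr_ae h.2).1 (Lp.memLp _)

theorem IsFT.add {u v F G : Plane → ℂ} (h : IsFT u F) (h' : IsFT v G) :
    IsFT (fun x => u x + v x) (fun η => F η + G η) := by
  obtain ⟨h1, h2⟩ := h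
  obtain ⟨h1', h2'⟩ := h'
  refine ⟨h1.add h1', ?_⟩
  have e : (𝓕 ((h1.add h1').toLp _) : L2) = 𝓕 (h1.toLp u) + 𝓕 (h1'.toLp v) := by
    rw [← FourierTransform.fourier_add, ← MemLp.toLp_add]
  have e2 : (𝓕 ((h1.add h1').toLp _) : L2) =ᵐ[volume] fun η => F η + G η := by
    rw [e]
    filter_upwards [Lp.coeFn_add (𝓕 (h1.toLp u) : L2) (𝓕 (h1'.toLp v)), h2, h2'] with η k1 k2 k3
    rw [k1, Pi.add_apply, k2, k3]
  exact e2

theorem IsFT.const_mul {u F : Plane → ℂ} (h : IsFT u F) (c : ℂ) :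
    IsFT (fun x => c * u x) (fun η => c * F η) := by
  obtain ⟨h1, h2⟩ := h
  refine ⟨h1.const_mul c, ?_⟩
  have e : (𝓕 ((h1.const_mul c).toLp _) : L2) = c • 𝓕 (h1.toLp u) := by
    rw [← FourierTransform.fourier_smul, ← MemLp.toLp_const_smul]; rfl
  rw [e]
  filter_upwards [Lp.coeFn_smul c (𝓕 (h1.toLp u) : L2), h2] with η k1 k2
  rw [k1, Pi.smul_apply, k2, smul_eq_mul]

theorem integrable_mul_schwartz {u : Plane → ℂ} (h : MemLp u 2) (ψ : 𝓢(Plane, ℂ)) :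
    Integrable fun x => u x * ψ x := h.integrable_mul (ψ.memLp 2)

theorem IsFT.integral_mul {u F : Plane → ℂ} (h : IsFT u F) (ψ : 𝓢(Plane, ℂ)) :
    ∫ x, u x * (𝓕 ψ : 𝓢(Plane, ℂ)) x = ∫ η, F η * ψ η := by
  obtain ⟨h1, h2⟩ := h
  have := integral_fourier_Lp_mul (h1.toLp u) ψ
  rw [SchwartzMap.fourier_coe]
  rw [integral_congr_ae (g := fun η => F η * ψ η)
    (by filter_upwards [h2] with η hη; rw [hη])] at this
  rw [this]
  refine integral_congr_ae ?_
  filter_upwards [h1.coeFn_toLp] with x hx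
  rw [hx]

theorem IsFT.hasFT {u F : Plane → ℂ} (h : IsFT u F) : HasFT u F := fun ρ _ =>
  ⟨integrable_mul_schwartz h.1 _, integrable_mul_schwartz h.memLp ρ, h.integral_mul ρ⟩

theorem HasFT.add {f g F G : Plane → ℂ} (h : HasFT f F) (h' : HasFT g G) :
    HasFT (fun x => f x + g x) (fun η => F η + G η) := by
  intro ρ hρ
  obtain ⟨a1, a2, a3⟩ := h ρ hρ
  obtain ⟨b1, b2, b3⟩ := h' ρ hρ
  simp only [add_mul]
  exact ⟨a1.add b1, a2.add b2, by rw [integral_add a1 b1, integral_add a2 b2, a3, b3]⟩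

theorem HasFT.const_mul {f F : Plane → ℂ} (h : HasFT f F) (c : ℂ) :
    HasFT (fun x => c * f x) (fun η => c * F η) := by
  intro ρ hρ
  obtain ⟨a1, a2, a3⟩ := h ρ hρ
  simp only [mul_assoc]
  exact ⟨a1.const_mul c, a2.const_mul c, by rw [integral_const_mul, integral_const_mul, a3]⟩

theorem HasFT.zero : HasFT (fun _ => 0) (fun _ => 0) := fun ρ _ => by simp

theorem HasFT.sum {ι : Type*} (s : Finset ι) {f F : ι → Plane → ℂ} (h : ∀ i ∈ s, HasFT (f i) (F i)) :
    HasFT (fun x => ∑ i ∈ s, f i x) (fun η => ∑ i ∈ s, F i η) := by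
  classical
  induction s using Finset.induction_on with
  | empty => simpa using HasFT.zero
  | insert i s hi ih =>
    simp only [Finset.sum_insert hi]
    exact (h i (Finset.mem_insert_self i s)).add (ih fun j hj => h j (Finset.mem_insert_of_mem hj))

theorem HasFT.congr {f g F G : Plane → ℂ} (h : HasFT f F) (hf : f =ᵐ[volume] g)
    (hF : F =ᵐ[volume] G) : HasFT g G := by
  intro ρ hρ
  obtain ⟨a1, a2, a3⟩ := h ρ hρ
  have e1 : (fun x => f x * (𝓕 ρ : 𝓢(Plane, ℂ)) x) =ᵐ[volume]
      fun x => g x * (𝓕 ρ : 𝓢(Plane, ℂ)) x := by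
    filter_upwards [hf] with x hx
    rw [hx]
  have e2 : (fun η => F η * ρ η) =ᵐ[volume] fun η => G η * ρ η := by
    filter_upwards [hF] with η hη
    rw [hη]
  exact ⟨a1.congr e1, a2.congr e2, by rw [← integral_congr_ae e1, ← integral_congr_ae e2, a3]⟩

theorem IsFT.fourier_mul {u v F G : Plane → ℂ} (h : IsFT u F) (h' : IsFT v G) (ξ : Plane) :
    𝓕 (fun x => u x * v x) ξ = conv F G ξ := by
  obtain ⟨h1, h2⟩ := h
  obtain ⟨h1', h2'⟩ := h'
  have e1 : 𝓕 (fun x => u x * v x) ξ = 𝓕 (fun x => h1.toLp u x * h1'.toLp v x) ξ := by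
    rw [Real.fourier_eq, Real.fourier_eq]
    refine integral_congr_ae ?_
    filter_upwards [h1.coeFn_toLp, h1'.coeFn_toLp] with x k1 k2
    rw [k1, k2]
  rw [e1, fourier_mul_Lp]
  refine integral_congr_ae ?_
  filter_upwards [h2, ae_comp_sub h2' ξ] with η k1 k2
  rw [k1, k2, one_mul]

/-- A product of two square integrable functions is integrable and has a bounded transform, which
suffices for pairings. The product need not be in L², and for the derivative nonlinearities it is
not known to be. -/
theorem IsFT.mul_hasFT {u v F G : Plane → ℂ} (h : IsFT u F) (h' : IsFT v G) :
    HasFT (fun x => u x * v x) (conv F G) := by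
  intro ρ hρ
  have hi : Integrable fun x => u x * v x := h.1.integrable_mul h'.1
  have e : 𝓕 (fun x => u x * v x) = conv F G := funext (h.fourier_mul h')
  have hb := hi.mul_bdd (c := SchwartzMap.seminorm ℝ 0 0 (𝓕 ρ : 𝓢(Plane, ℂ)))
    (𝓕 ρ : 𝓢(Plane, ℂ)).continuous.aestronglyMeasurable
    (ae_of_all _ fun x => SchwartzMap.norm_le_seminorm ℝ (𝓕 ρ : 𝓢(Plane, ℂ)) x)
  have hc : Integrable fun η => 𝓕 (fun x => u x * v x) η * ρ η := by
    refine ρ.integrable.bdd_mul (c := ∫ x, ‖u x * v x‖) (Continuous.aestronglyMeasurable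
      (VectorFourier.fourierIntegral_continuous Real.continuous_fourierChar continuous_inner hi))
      (ae_of_all _ fun η => VectorFourier.norm_fourierIntegral_le_integral_norm _ _ _ _ _)
  refine ⟨hb, by rwa [e] at hc, ?_⟩
  rw [← e, integral_fourier_mul hi ρ.integrable, SchwartzMap.fourier_coe]

theorem IsFT.mul {u v F G : Plane → ℂ} (h : IsFT u F) (h' : IsFT v G) (hc : MemLp (conv F G) 2) :
    IsFT (fun x => u x * v x) (conv F G) := by
  have hi : Integrable fun x => u x * v x := h.1.integrable_mul h'.1
  have e : 𝓕 (fun x => u x * v x) = conv F G := funext (h.fourier_mul h')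
  have h2 := memLp_two_of_fourier hi (by rwa [e])
  exact ⟨h2, by rw [← e]; exact fourier_toLp_ae_eq hi h2⟩

theorem IsFT.multiplier {m : Plane → ℂ} {u : L2} {F : Plane → ℂ} (h : IsFT u F)
    (hm : MemLp (fun η => m η * F η) 2) : IsFT (multiplier m u) (fun η => m η * F η) := by
  have hF : (𝓕 u : L2) =ᵐ[volume] F := by
    obtain ⟨h1, h2⟩ := h
    rwa [Lp.toLp_coeFn] at h2
  have e : (fun ξ => m ξ * (𝓕 u : L2) ξ) =ᵐ[volume] fun η => m η * F η := by
    filter_upwards [hF] with η hη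
    rw [hη]
  have hd : InDomain m u := (memLp_congr_ae e).2 hm
  refine (isFT_Lp _).congr ?_
  rw [ChernSimonsHiggs.multiplier, dif_pos hd, FourierTransform.fourier_fourierInv_eq]
  exact hd.coeFn_toLp.trans e

/-- `F(-·)` conjugated. -/
def cneg (F : Plane → ℂ) (η : Plane) : ℂ := conj (F (-η))

theorem IsFT.conj {u F : Plane → ℂ} (h : IsFT u F) : IsFT (fun x => conj (u x)) (cneg F) := by
  have hu : MemLp (fun x => conj (u x)) 2 :=
    h.1.of_le (Complex.continuous_conj.comp_aestronglyMeasurable h.1.1) (by simp)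
  have hF : MemLp (cneg F) 2 := by
    have h1 := h.memLp.comp_measurePreserving (Measure.measurePreserving_neg volume)
    exact h1.of_le (Complex.continuous_conj.comp_aestronglyMeasurable h1.1) (by simp [cneg])
  refine ⟨hu, ?_⟩
  refine ae_eq_of_integral_mul_schwartz ((Lp.memLp _).locallyIntegrable (by norm_num))
    (hF.locallyIntegrable (by norm_num)) fun ψ _ => ?_
  set ψ' : 𝓢(Plane, ℂ) := SchwartzMap.postcompCLM (𝕜 := ℝ) (Complex.conjCLE : ℂ →L[ℝ] ℂ)
    (SchwartzMap.compCLMOfContinuousLinearEquiv ℝ (ContinuousLinearEquiv.neg ℝ) ψ) with hψ'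
  have hv : ∀ x, ψ' x = starRingEnd ℂ (ψ (-x)) := fun x => rfl
  have hv' : ∀ x, (𝓕 ψ' : 𝓢(Plane, ℂ)) x = starRingEnd ℂ ((𝓕 ψ : 𝓢(Plane, ℂ)) x) := by
    intro x
    rw [SchwartzMap.fourier_coe, SchwartzMap.fourier_coe, Real.fourier_eq, Real.fourier_eq,
      ← integral_conj, ← integral_neg_eq_self]
    refine integral_congr_ae (ae_of_all _ fun y => ?_)
    simp only [hv, neg_neg, inner_neg_left, Circle.smul_def, smul_eq_mul, map_mul]
    congr 1
    rw [← Circle.coe_inv_eq_conj, ← AddChar.map_neg_eq_inv, neg_neg]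
  have e1 := h.integral_mul ψ'
  have e2 := congrArg (starRingEnd ℂ) e1
  rw [← integral_conj, ← integral_conj] at e2
  simp only [map_mul, hv', hv, Complex.conj_conj] at e2
  rw [integral_fourier_Lp_mul, ← SchwartzMap.fourier_coe]
  have e3 : ∫ x, (hu.toLp _ : L2) x * (𝓕 ψ : 𝓢(Plane, ℂ)) x =
      ∫ x, starRingEnd ℂ (u x) * (𝓕 ψ : 𝓢(Plane, ℂ)) x := by
    refine integral_congr_ae ?_
    filter_upwards [hu.coeFn_toLp] with x hx
    rw [hx]
  rw [e3, e2, ← integral_neg_eq_self]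
  simp only [neg_neg, cneg]

/-! ### Weak time derivatives -/

/-- The primitive taken from the left of the support vanishes again to its right because the mean is
zero. -/
theorem exists_primitive_of_integral_zero {a b : ℝ} {ψ : ℝ → ℂ} (hψ : ContDiff ℝ ∞ ψ)
    (hc : HasCompactSupport ψ) (hs : tsupport ψ ⊆ Ioo a b) (h0 : ∫ t, ψ t = 0) :
    ∃ χ : 𝓢(ℝ, ℂ), HasCompactSupport χ ∧ tsupport χ ⊆ Ioo a b ∧ ∀ t, deriv χ t = ψ t := by
  obtain ⟨c, d, hcd, hK⟩ : ∃ c d, Icc c d ⊆ Ioo a b ∧ tsupport ψ ⊆ Icc c d := by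
    rcases (tsupport ψ).eq_empty_or_nonempty with h | h
    · exact ⟨1, 0, by simp, by simp [h]⟩
    · have hK : IsCompact (tsupport ψ) := hc
      refine ⟨sInf (tsupport ψ), sSup (tsupport ψ), ?_, fun t ht =>
        ⟨csInf_le hK.bddBelow ht, le_csSup hK.bddAbove ht⟩⟩
      intro t ht
      exact ⟨lt_of_lt_of_le (hs (hK.sInf_mem h)).1 ht.1, lt_of_le_of_lt ht.2 (hs (hK.sSup_mem h)).2⟩
  have hz : ∀ t, t ∉ Icc c d → ψ t = 0 := fun t ht =>
    image_eq_zero_of_notMem_tsupport fun h => ht (hK h)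
  set X : ℝ → ℂ := fun t => ∫ τ in c..t, ψ τ with hX
  have hd : ∀ t, HasDerivAt X (ψ t) t := fun t =>
    intervalIntegral.integral_hasDerivAt_right (hψ.continuous.intervalIntegrable _ _)
      (hψ.continuous.stronglyMeasurableAtFilter _ _) hψ.continuous.continuousAt
  have hX0 : ∀ t, t ∉ Icc c d → X t = 0 := by
    intro t ht
    by_cases h1 : t < c
    · refine intervalIntegral.integral_zero_ae ?_
      filter_upwards [compl_mem_ae_iff.2 (measure_singleton c)] with τ h2 h3
      rw [uIoc_of_ge h1.le] at h3
      exact hz τ fun h4 => h2 (le_antisymm h3.2 h4.1)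
    · have h2 : d < t := by
        by_contra h3
        exact ht ⟨not_lt.1 h1, not_lt.1 h3⟩
      rw [hX]
      simp only
      rw [intervalIntegral.integral_of_le (not_lt.1 h1), ← h0,
        ← integral_indicator measurableSet_Ioc]
      refine integral_congr_ae ?_
      filter_upwards [compl_mem_ae_iff.2 (measure_singleton c)] with τ h3
      by_cases h4 : τ ∈ Ioc c t
      · rw [indicator_of_mem h4]
      · rw [indicator_of_notMem h4, hz τ fun h5 => h4
          ⟨lt_of_le_of_ne h5.1 fun h => h3 h.symm, h5.2.trans h2.le⟩]
  have hdX : deriv X = ψ := funext fun t => (hd t).deriv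
  have hXs : ContDiff ℝ ∞ X := by
    rw [contDiff_infty_iff_deriv, hdX]
    exact ⟨fun t => (hd t).differentiableAt, hψ⟩
  have hXc : HasCompactSupport X := HasCompactSupport.intro isCompact_Icc hX0
  refine ⟨hXc.toSchwartzMap hXs, hXc, ?_, fun t => (hd t).deriv⟩
  refine (closure_minimal (fun t ht => ?_) isClosed_Icc).trans hcd
  by_contra h
  exact ht (hX0 t h)

/-- The lemma of du Bois-Reymond. -/
theorem eq_of_integral_deriv_mul_eq_zero {a b : ℝ} {A : ℝ → ℂ} (hA : ContinuousOn A (Ioo a b))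
    (h : ∀ χ : 𝓢(ℝ, ℂ), HasCompactSupport χ → tsupport χ ⊆ Ioo a b →
      ∫ t in Ioo a b, deriv χ t * A t = 0) {s t : ℝ} (hs : s ∈ Ioo a b) (ht : t ∈ Ioo a b) :
    A s = A t := by
  have hint : ∀ {g : ℝ → ℂ}, Continuous g → HasCompactSupport g → tsupport g ⊆ Ioo a b →
      Integrable fun t => g t * A t := by
    intro g hg hgc hgs
    have h1 : Continuous fun t => g t * A t := by
      rw [continuous_iff_continuousAt]
      intro t
      by_cases h : t ∈ Ioo a b
      · exact hg.continuousAt.mul (hA.continuousAt (Ioo_mem_nhds h.1 h.2))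
      · have h2 : (tsupport g)ᶜ ∈ 𝓝 t := (isClosed_tsupport g).isOpen_compl.mem_nhds fun h' => h (hgs h')
        refine ContinuousAt.congr (f := fun _ => (0 : ℂ)) continuousAt_const ?_
        filter_upwards [h2] with τ hτ
        rw [image_eq_zero_of_notMem_tsupport hτ, zero_mul]
    exact h1.integrable_of_hasCompactSupport hgc.mul_right
  obtain ⟨ε, hε, hball⟩ := Metric.isOpen_iff.1 isOpen_Ioo s hs
  let f : ContDiffBump s := ⟨ε / 4, ε / 2, by positivity, by linarith⟩
  set ψ₀ : ℝ → ℝ := f.normed volume with hψ₀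
  have h0c : HasCompactSupport ψ₀ := f.hasCompactSupport_normed
  have h0s : tsupport ψ₀ ⊆ Ioo a b := by
    rw [hψ₀, f.tsupport_normed_eq]
    exact (Metric.closedBall_subset_ball (by change ε / 2 < ε; linarith)).trans hball
  have h0d : ContDiff ℝ ∞ ψ₀ := f.contDiff_normed
  set k : ℂ := ∫ t, (ψ₀ t : ℂ) * A t with hk
  have key : ∀ᵐ t, t ∈ Ioo a b → A t - k = 0 := by
    refine isOpen_Ioo.ae_eq_zero_of_integral_contDiff_smul_eq_zero
      ((hA.sub continuousOn_const).locallyIntegrableOn measurableSet_Ioo) fun g g1 g2 g3 => ?_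
    set c : ℝ := ∫ t, g t with hc
    have gi : Integrable g := g1.continuous.integrable_of_hasCompactSupport g2
    have fi : Integrable ψ₀ := h0d.continuous.integrable_of_hasCompactSupport h0c
    -- Subtracting a multiple of a fixed bump of mass 1 makes the mean zero, so ψ is the derivative
    -- of an admissible test function. Hence A pairs with g as the constant `k` does.
    set ψ : ℝ → ℂ := fun t => (g t : ℂ) - c * ψ₀ t with hψ
    have hψd : ContDiff ℝ ∞ ψ := (Complex.ofRealCLM.contDiff.comp g1).sub
      (contDiff_const.mul (Complex.ofRealCLM.contDiff.comp h0d))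
    have gc : HasCompactSupport fun t => (g t : ℂ) := g2.comp_left (g := Complex.ofReal) rfl
    have fc : HasCompactSupport fun t => (ψ₀ t : ℂ) := h0c.comp_left (g := Complex.ofReal) rfl
    have hz : ∀ t, t ∉ tsupport g ∪ tsupport ψ₀ → ψ t = 0 := by
      intro t ht
      rw [mem_union, not_or] at ht
      simp [hψ, image_eq_zero_of_notMem_tsupport ht.1, image_eq_zero_of_notMem_tsupport ht.2]
    have hsub : tsupport ψ ⊆ tsupport g ∪ tsupport ψ₀ :=
      closure_minimal (fun t ht => by by_contra h; exact ht (hz t h))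
        ((isClosed_tsupport g).union (isClosed_tsupport ψ₀))
    have hψc : HasCompactSupport ψ := (IsCompact.union g2 h0c).of_isClosed_subset
      (isClosed_tsupport ψ) hsub
    have h0 : ∫ t, ψ t = 0 := by
      rw [hψ, integral_sub gi.ofReal (fi.ofReal.const_mul _), integral_const_mul,
        integral_complex_ofReal, integral_complex_ofReal, hψ₀, f.integral_normed]
      simp [hc]
    obtain ⟨χ, c1, c2, c3⟩ := exists_primitive_of_integral_zero hψd hψc
      (hsub.trans (union_subset g3 h0s)) h0
    have h1 := h χ c1 c2
    simp only [c3] at h1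
    have h2 : ∫ t in Ioo a b, ψ t * A t = ∫ t, ψ t * A t := by
      refine setIntegral_eq_integral_of_forall_compl_eq_zero fun t ht => ?_
      rw [hz t fun h' => ht ((union_subset g3 h0s) h'), zero_mul]
    have gA : Integrable fun t => (g t : ℂ) * A t :=
      hint (by fun_prop) gc ((tsupport_comp_subset (g := Complex.ofReal) rfl g).trans g3)
    have fA : Integrable fun t => (ψ₀ t : ℂ) * A t :=
      hint (by fun_prop) fc ((tsupport_comp_subset (g := Complex.ofReal) rfl ψ₀).trans h0s)
    have h3 : ∫ t, ψ t * A t = (∫ t, (g t : ℂ) * A t) - c * k := by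
      rw [hk, ← integral_const_mul, ← integral_sub gA (fA.const_mul _)]
      refine integral_congr_ae (ae_of_all _ fun t => ?_)
      simp only [hψ]; ring
    have h4 : ∫ t, g t • (A t - k) = (∫ t, (g t : ℂ) * A t) - c * k := by
      have gk : Integrable fun t => (g t : ℂ) * k := gi.ofReal.mul_const k
      rw [hc, ← integral_complex_ofReal, ← integral_mul_const, ← integral_sub gA gk]
      refine integral_congr_ae (ae_of_all _ fun t => ?_)
      simp only [Complex.real_smul]; ring
    rw [h4, ← h3, ← h2, h1]
  have he : EqOn A (fun _ => k) (Ioo a b) := by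
    refine Measure.eqOn_open_of_ae_eq (μ := volume) ?_ isOpen_Ioo hA continuousOn_const
    rw [Filter.EventuallyEq, ae_restrict_iff' measurableSet_Ioo]
    filter_upwards [key] with t ht h
    exact sub_eq_zero.1 (ht h)
  rw [he hs, he ht]

theorem EnInt.integrable_mul {a b e : ℝ} {d : ℝ → Plane → ℂ} (hd : EnInt (Ioo a b) e d)
    {m : Plane → ℂ} (hm : Measurable m) (hm' : energy (-e) (fun η => ‖m η‖ₑ) < ⊤) :
    Integrable (fun p : ℝ × Plane => d p.1 p.2 * m p.2)
      ((volume.restrict (Ioo a b)).prod volume) := by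
  obtain ⟨hdm, hd⟩ := hd
  have hdm' : Measurable fun p : ℝ × Plane => d p.1 p.2 := hdm
  refine ⟨(hdm'.mul (hm.comp measurable_snd)).aestronglyMeasurable, ?_⟩
  rw [HasFiniteIntegral, lintegral_prod _ (by fun_prop)]
  have hab : ∀ x y : ℝ≥0∞, x * y ≤ x ^ 2 + y ^ 2 := by
    intro x y
    rcases le_total x y with h | h
    · calc x * y ≤ y * y := by gcongr
        _ ≤ _ := by rw [sq y]; exact le_add_self
    · calc x * y ≤ x * x := by gcongr
        _ ≤ _ := by rw [sq x]; exact le_self_add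
  have h1 : ∀ t, ∫⁻ η, ‖d t η * m η‖ₑ ≤
      energy e (fun η => ‖d t η‖ₑ) + energy (-e) (fun η => ‖m η‖ₑ) := by
    intro t
    have := measurable_slice hdm t
    unfold energy
    rw [← lintegral_add_left (by fun_prop)]
    refine lintegral_mono fun η => ?_
    calc ‖d t η * m η‖ₑ = (jw e η * ‖d t η‖ₑ) * (jw (-e) η * ‖m η‖ₑ) := by
          rw [enorm_mul, mul_mul_mul_comm, jw_mul_neg, one_mul]
      _ ≤ _ := hab _ _
  refine lt_of_le_of_lt (lintegral_mono h1) ?_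
  rw [lintegral_add_right _ measurable_const, lintegral_const]
  refine ENNReal.add_lt_top.2 ⟨hd, ENNReal.mul_lt_top hm' ?_⟩
  simp

theorem japaneseSymbol_eq (r : ℝ) (η : Plane) : japaneseSymbol r η = ((jb η ^ r : ℝ) : ℂ) := by
  rw [japaneseSymbol, bracketPow_eq]

theorem enorm_japaneseSymbol (r : ℝ) (η : Plane) : ‖japaneseSymbol r η‖ₑ = jw r η := by
  rw [japaneseSymbol_eq, jw, ← ofReal_norm, Complex.norm_real,
    Real.norm_of_nonneg (Real.rpow_nonneg (jb_pos η).le _)]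

theorem energy_schwartz_lt_top (s : ℝ) (ρ : 𝓢(Plane, ℂ)) : energy s (fun η => ‖ρ η‖ₑ) < ⊤ := by
  have h := (memLp_two_iff_lintegral (jmul s ρ).continuous.aestronglyMeasurable).1
    ((jmul s ρ).memLp 2)
  simpa [energy, enorm_mul, enorm_japaneseSymbol] using h

theorem EnInt.integrable_mul_schwartz {a b e : ℝ} {d : ℝ → Plane → ℂ} (hd : EnInt (Ioo a b) e d)
    (ρ : 𝓢(Plane, ℂ)) :
    Integrable (fun p : ℝ × Plane => d p.1 p.2 * ρ p.2)
      ((volume.restrict (Ioo a b)).prod volume) :=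
  hd.integrable_mul ρ.continuous.measurable (energy_schwartz_lt_top _ ρ)

/-- The weight ⟨η⟩^{e-2} has finite energy of order -e, since ⟨η⟩^{-4} is integrable on the plane;
as it never vanishes, it can be divided out frequency by frequency. -/
theorem EnInt.ae_integrableOn {a b e : ℝ} {d : ℝ → Plane → ℂ} (hd : EnInt (Ioo a b) e d) :
    ∀ᵐ η, IntegrableOn (fun t => d t η) (Ioo a b) := by
  have h := hd.integrable_mul (m := japaneseSymbol (e - 2))
    (japaneseSymbol_hasTemperateGrowth _).1.continuous.measurable ?_
  · filter_upwards [h.prod_left_ae] with η hη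
    have h0 : japaneseSymbol (e - 2) η ≠ 0 := by
      rw [japaneseSymbol_eq]
      exact_mod_cast (Real.rpow_pos_of_pos (jb_pos η) _).ne'
    exact (integrable_mul_const_iff (IsUnit.mk0 _ h0) _).1 hη
  · simp only [energy, enorm_japaneseSymbol, ← jw_add, jw_sq]
    exact lintegral_jw_lt_top (by linarith)

theorem Prim.integral_deriv_mul {a b : ℝ} (hab : a < b) {A A' : ℝ → ℂ} (hA : Prim (Ioo a b) A A')
    (χ : 𝓢(ℝ, ℂ)) (hs : tsupport χ ⊆ Ioo a b) :
    ∫ t in Ioo a b, deriv χ t * A t = -∫ t in Ioo a b, χ t * A' t := by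
  have hI : (Ioo a b).OrdConnected := ordConnected_Ioo
  have h₀ : (a + b) / 2 ∈ Ioo a b := ⟨by linarith, by linarith⟩
  have hχ : Prim univ χ (deriv χ) := prim_of_hasDerivAt ordConnected_univ χ.hasDerivAt
    (SchwartzMap.derivCLM ℂ ℂ χ).integrable.integrableOn
  have hE := prim_univ_extension (hA.integrable_indicator hI) (A ((a + b) / 2)) ((a + b) / 2)
  have hm := hχ.mul_univ hE
  have h1 := hm.2 a (mem_univ _) b (mem_univ _)
  have hχa : χ a = 0 := image_eq_zero_of_notMem_tsupport fun h => lt_irrefl a (hs h).1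
  have hχb : χ b = 0 := image_eq_zero_of_notMem_tsupport fun h => lt_irrefl b (hs h).2
  simp only [hχa, hχb, zero_mul, sub_zero] at h1
  rw [intervalIntegral.integral_of_le hab.le,
    integral_Ioc_eq_integral_Ioo] at h1
  have i1 : IntegrableOn (fun t => deriv χ t * A t) (Ioo a b) := by
    obtain ⟨C, hC⟩ := hE.bounded
    have h2 : Integrable (fun t => deriv χ t *
        (A ((a + b) / 2) + ∫ τ in (a + b) / 2..t, (Ioo a b).indicator A' τ)) :=
      (SchwartzMap.derivCLM ℂ ℂ χ).integrable.mul_bdd hE.continuous.aestronglyMeasurable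
        (ae_of_all _ hC)
    refine h2.integrableOn.congr_fun (fun t ht => ?_) measurableSet_Ioo
    simp only
    rw [← hA.eq_extension hI h₀ ht]
  have i2 : IntegrableOn (fun t => χ t * A' t) (Ioo a b) := by
    have := hA.1.bdd_mul (c := SchwartzMap.seminorm ℝ 0 0 χ) χ.continuous.aestronglyMeasurable
      (ae_of_all _ fun x => SchwartzMap.norm_le_seminorm ℝ χ x)
    exact this
  rw [eq_neg_iff_add_eq_zero, ← integral_add i1 i2, h1]
  refine setIntegral_congr_fun measurableSet_Ioo fun t ht => ?_
  rw [← hA.eq_extension hI h₀ ht, indicator_of_mem ht]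

theorem setIntegral_integral_mul_swap {a b e : ℝ} {d : ℝ → Plane → ℂ} (hd : EnInt (Ioo a b) e d)
    (ρ : 𝓢(Plane, ℂ)) {s t : ℝ} (hs : s ∈ Ioo a b) (ht : t ∈ Ioo a b) :
    Integrable (fun η => (∫ τ in s..t, d τ η) * ρ η) ∧
    ∫ η, (∫ τ in s..t, d τ η) * ρ η = ∫ τ in s..t, ∫ η, d τ η * ρ η := by
  have main : ∀ {s t : ℝ}, s ≤ t → s ∈ Ioo a b → t ∈ Ioo a b →
      Integrable (fun η => (∫ τ in s..t, d τ η) * ρ η) ∧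
      ∫ η, (∫ τ in s..t, d τ η) * ρ η = ∫ τ in s..t, ∫ η, d τ η * ρ η := by
    intro s t hst hs ht
    have hsub : Ioc s t ⊆ Ioo a b := fun τ hτ =>
      ⟨lt_trans hs.1 hτ.1, lt_of_le_of_lt hτ.2 ht.2⟩
    have hi : Integrable (fun p : ℝ × Plane => d p.1 p.2 * ρ p.2)
        ((volume.restrict (Ioc s t)).prod volume) := by
      refine (hd.integrable_mul_schwartz ρ).mono_measure ?_
      exact Measure.prod_mono (Measure.restrict_mono hsub le_rfl) le_rfl
    simp only [intervalIntegral.integral_of_le hst, ← integral_mul_const]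
    exact ⟨hi.integral_prod_right, (integral_integral_swap hi).symm⟩
  rcases le_total s t with h | h
  · exact main h hs ht
  · obtain ⟨h1, h2⟩ := main h ht hs
    simp only [intervalIntegral.integral_symm t s, neg_mul]
    exact ⟨h1.neg, by rw [integral_neg, h2]⟩

theorem locallyIntegrable_of_integrable_mul_schwartz {f : Plane → ℂ}
    (hf : ∀ ρ : 𝓢(Plane, ℂ), HasCompactSupport ρ → Integrable fun η => f η * ρ η) :
    LocallyIntegrable f := by
  intro x
  let g : ContDiffBump x := ⟨1, 2, by norm_num, by norm_num⟩
  have g1 : HasCompactSupport fun η => ((g η : ℝ) : ℂ) :=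
    g.hasCompactSupport.comp_left (g := Complex.ofReal) rfl
  have g2 : ContDiff ℝ ∞ fun η => ((g η : ℝ) : ℂ) :=
    Complex.ofRealCLM.contDiff.comp g.contDiff
  have h1 := hf (g1.toSchwartzMap g2) g1
  refine ⟨Metric.closedBall x 1, Metric.closedBall_mem_nhds x one_pos, ?_⟩
  refine h1.integrableOn.congr_fun (fun η hη => ?_) measurableSet_closedBall
  have : (g1.toSchwartzMap g2) η = ((g η : ℝ) : ℂ) := rfl
  simp only [this, g.one_of_mem_closedBall hη, Complex.ofReal_one, mul_one]

/-- A weak solution of `∂_t r = d` on the Fourier side is a strong one. -/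
theorem exists_primAE_of_weak {a b : ℝ} (hab : a < b) {α e : ℝ} {r d : ℝ → Plane → ℂ}
    (hr : EnSup (Ioo a b) α r) (hd : EnInt (Ioo a b) e d)
    (hc : ∀ ρ : 𝓢(Plane, ℂ), HasCompactSupport ρ →
      ContinuousOn (fun t => ∫ η, r t η * ρ η) (Ioo a b))
    (hw : ∀ ρ : 𝓢(Plane, ℂ), HasCompactSupport ρ → ∀ χ : 𝓢(ℝ, ℂ), HasCompactSupport χ →
      tsupport χ ⊆ Ioo a b →
      ∫ t in Ioo a b, deriv χ t * ∫ η, r t η * ρ η = -∫ t in Ioo a b, χ t * ∫ η, d t η * ρ η) :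
    ∃ w, EnSup (Ioo a b) α w ∧ PrimAE (Ioo a b) w d ∧ ∀ t ∈ Ioo a b, w t =ᵐ[volume] r t := by
  have hI : (Ioo a b).OrdConnected := ordConnected_Ioo
  set t₀ := (a + b) / 2 with ht₀
  have h₀ : t₀ ∈ Ioo a b := ⟨by linarith, by linarith⟩
  -- The candidate is a primitive by construction. The lemma of du Bois-Reymond, applied to the
  -- pairings with each ρ, shows that it agrees with r at every time.
  set w : ℝ → Plane → ℂ := fun t η => r t₀ η + ∫ τ in t₀..t, d τ η with hwdef
  have hwm : Measurable (Function.uncurry w) :=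
    ((measurable_slice hr.1 t₀).comp measurable_snd).add (measurable_primitive hd.1 t₀)
  have hri : ∀ t ∈ Ioo a b, ∀ ρ : 𝓢(Plane, ℂ), Integrable fun η => r t η * ρ η := by
    intro t ht ρ
    have hrt : EnInt (Ioo a b) α (fun _ => r t) := by
      obtain ⟨hrm, C, hC, hrC⟩ := hr
      refine EnSup.enInt (by simp) measurableSet_Ioo
        ⟨(measurable_slice hrm t).comp measurable_snd, C, hC, fun _ _ => hrC t ht⟩
    -- For the family frozen at time t, integrability at almost every time of an interval of
    -- positive length is integrability outright.
    have h1 := (hrt.integrable_mul_schwartz ρ).prod_right_ae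
    rw [ae_iff] at h1
    by_contra h2
    have h3 : volume.restrict (Ioo a b) univ = 0 := by
      rw [← h1]; congr 1; ext x; simp [h2]
    rw [Measure.restrict_apply_univ, Real.volume_Ioo, ENNReal.ofReal_eq_zero] at h3
    linarith
  have heq : ∀ t ∈ Ioo a b, w t =ᵐ[volume] r t := by
    intro t ht
    have hpair : ∀ ρ : 𝓢(Plane, ℂ), HasCompactSupport ρ →
        Integrable (fun η => w t η * ρ η) ∧ ∫ η, w t η * ρ η = ∫ η, r t η * ρ η := by
      intro ρ hρ
      obtain ⟨i1, e1⟩ := setIntegral_integral_mul_swap hd ρ h₀ ht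
      have i2 := hri t₀ h₀ ρ
      have hw' : (fun η => w t η * ρ η) =
          fun η => r t₀ η * ρ η + (∫ τ in t₀..t, d τ η) * ρ η := by
        funext η; simp only [hwdef]; ring
      rw [hw']
      refine ⟨i2.add i1, ?_⟩
      rw [integral_add i2 i1, e1]
      set c : ℝ → ℂ := fun τ => ∫ η, d τ η * ρ η with hcdef
      have hci : IntegrableOn c (Ioo a b) := (hd.integrable_mul_schwartz ρ).integral_prod_left
      have hP : Prim (Ioo a b) (fun t => ∫ τ in t₀..t, c τ) c := by
        refine ⟨hci, fun s hs t ht => ?_⟩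
        rw [intervalIntegral.integral_interval_sub_left
          (IntegrableOn.intervalIntegrable_of_mem hI hci h₀ ht)
          (IntegrableOn.intervalIntegrable_of_mem hI hci h₀ hs)]
      have hPc : ContinuousOn (fun t => ∫ τ in t₀..t, c τ) (Ioo a b) := by
        have h1 := prim_univ_extension (hci.integrable_indicator measurableSet_Ioo) 0 t₀
        refine h1.continuous.continuousOn.congr fun t ht => ?_
        simp only [zero_add]
        rw [intervalIntegral_indicator hI c h₀ ht]
      have hdu : ∀ χ : 𝓢(ℝ, ℂ), HasCompactSupport χ → tsupport χ ⊆ Ioo a b →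
          ∫ t in Ioo a b, deriv χ t * ((∫ η, r t η * ρ η) - ∫ τ in t₀..t, c τ) = 0 := by
        intro χ h1 h2
        have hint : ∀ {A : ℝ → ℂ}, ContinuousOn A (Ioo a b) →
            IntegrableOn (fun t => deriv χ t * A t) (Ioo a b) := by
          intro A hA
          have hK : IsCompact (tsupport χ) := h1
          have hg : Continuous (deriv χ) := (SchwartzMap.derivCLM ℂ ℂ χ).continuous
          have h3 : IntegrableOn (fun t => deriv χ t * A t) (tsupport χ) :=
            (hg.continuousOn.mul (hA.mono h2)).integrableOn_compact hK
          refine (integrableOn_iff_integrable_of_support_subset fun t ht => ?_).1 h3 |>.integrableOn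
          by_contra h4
          refine ht ?_
          simp only
          rw [image_eq_zero_of_notMem_tsupport fun h5 => h4 (tsupport_deriv_subset h5), zero_mul]
        simp only [mul_sub]
        rw [integral_sub (hint (hc ρ hρ)) (hint hPc), hw ρ hρ χ h1 h2, hP.integral_deriv_mul hab χ h2,
          sub_self]
      have : (∫ η, r t η * ρ η) - ∫ τ in t₀..t, c τ = (∫ η, r t₀ η * ρ η) - ∫ τ in t₀..t₀, c τ :=
        eq_of_integral_deriv_mul_eq_zero ((hc ρ hρ).sub hPc) hdu ht h₀
      rw [intervalIntegral.integral_same, sub_zero] at this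
      rw [← this]; ring
    exact ae_eq_of_integral_mul_schwartz (locallyIntegrable_of_integrable_mul_schwartz fun ρ hρ => (hpair ρ hρ).1)
      (locallyIntegrable_of_integrable_mul_schwartz fun ρ hρ => hri t ht ρ) fun ρ hρ => (hpair ρ hρ).2
  refine ⟨w, hr.congr hwm fun t ht => (heq t ht).symm, ?_, heq⟩
  filter_upwards [hd.ae_integrableOn] with η hη
  refine ⟨hη, fun s hs t ht => ?_⟩
  simp only [hwdef]
  rw [add_sub_add_left_eq_sub, intervalIntegral.integral_interval_sub_left
    (IntegrableOn.intervalIntegrable_of_mem hI hη h₀ ht)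
    (IntegrableOn.intervalIntegrable_of_mem hI hη h₀ hs)]

/-! ### Membership in Bourgain spaces -/

/-- `point` as a continuous linear map. -/
def pointL : ℝ × Plane →L[ℝ] Spacetime :=
  LinearMap.toContinuousLinearMap
    { toFun := fun p => point p.1 p.2
      map_add' := by intro a b; ext i; fin_cases i <;> simp [point]
      map_smul' := by intro c a; ext i; fin_cases i <;> simp [point] }

@[fun_prop] theorem continuous_point : Continuous fun p : ℝ × Plane => point p.1 p.2 :=
  pointL.continuous

theorem point_eq (t : ℝ) (x : Plane) : point t x = pointL (t, 0) + pointL (0, x) := by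
  rw [← map_add]; simp [pointL]

theorem abs_le_norm_point (t : ℝ) (x : Plane) : |t| ≤ ‖point t x‖ := by
  have := norm_sq_spacetime (point t x)
  rw [point_zero] at this
  refine abs_le_of_sq_le_sq ?_ (norm_nonneg _) |> fun h => h
  nlinarith [sq_nonneg ‖spacePart (point t x)‖]

theorem norm_le_norm_point (t : ℝ) (x : Plane) : ‖x‖ ≤ ‖point t x‖ := by
  simpa using norm_spacePart_le (point t x)

/-- The restriction of a Schwartz function to the time `t`. -/
def slice (θ : 𝓢(Spacetime, ℂ)) (t : ℝ) : 𝓢(Plane, ℂ) :=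
  SchwartzMap.compCLM ℂ (g := fun x => point t x)
    (by
      simp_rw [point_eq t]
      exact (Function.HasTemperateGrowth.const _).add
        (pointL.comp (ContinuousLinearMap.inr ℝ ℝ Plane)).hasTemperateGrowth)
    ⟨1, 1, fun x => by
      rw [pow_one, one_mul]; linarith [norm_le_norm_point t x]⟩ θ

@[simp] theorem slice_apply (θ : 𝓢(Spacetime, ℂ)) (t : ℝ) (x : Plane) :
    slice θ t x = θ (point t x) := rfl

/-- The restriction of a Schwartz function to the point `x` of space. -/
def timeSlice (θ : 𝓢(Spacetime, ℂ)) (x : Plane) : 𝓢(ℝ, ℂ) :=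
  SchwartzMap.compCLM ℂ (g := fun t => point t x)
    (by
      simp_rw [point_eq _ x]
      exact ((pointL.comp (ContinuousLinearMap.inl ℝ ℝ Plane)).hasTemperateGrowth).add
        (Function.HasTemperateGrowth.const _))
    ⟨1, 1, fun t => by
      rw [pow_one, one_mul, Real.norm_eq_abs]; linarith [abs_le_norm_point t x]⟩ θ

@[simp] theorem timeSlice_apply (θ : 𝓢(Spacetime, ℂ)) (t : ℝ) (x : Plane) :
    timeSlice θ x t = θ (point t x) := rfl

/-- The inverse Fourier transform in space at the time `t`. -/
def spaceInv (θ : 𝓢(Spacetime, ℂ)) (t : ℝ) : 𝓢(Plane, ℂ) := 𝓕⁻ (slice θ t)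

theorem spaceInv_apply (θ : 𝓢(Spacetime, ℂ)) (t : ℝ) (ξ : Plane) :
    spaceInv θ t ξ = ∫ x, 𝐞 (inner ℝ x ξ) • θ (point t x) := by
  rw [spaceInv, SchwartzMap.fourierInv_coe, Real.fourierInv_eq]
  rfl

theorem fourier_spaceInv (θ : 𝓢(Spacetime, ℂ)) (t : ℝ) : 𝓕 (spaceInv θ t) = slice θ t :=
  FourierTransform.fourier_fourierInv_eq _

theorem continuous_spaceInv (θ : 𝓢(Spacetime, ℂ)) :
    Continuous fun p : ℝ × Plane => spaceInv θ p.1 p.2 := by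
  obtain ⟨C, hC0, hC⟩ := exists_one_add_pow_bound θ 3 0
  simp_rw [spaceInv_apply]
  refine continuous_of_dominated (bound := fun x => C * (1 + ‖x‖) ^ (-(3 : ℝ)))
    (fun p => ?_) (fun p => ae_of_all _ fun x => ?_)
    ((integrable_one_add_norm (by simp; norm_num)).const_mul C) (ae_of_all _ fun x => ?_)
  · refine Continuous.aestronglyMeasurable ?_
    have h1 : Continuous fun x : Plane => 𝐞 (inner ℝ x p.2) :=
      Real.continuous_fourierChar.comp (by fun_prop)
    have h2 : Continuous fun x : Plane => θ (point p.1 x) := θ.continuous.comp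
      (continuous_point.comp (by fun_prop : Continuous fun x : Plane => (p.1, x)))
    exact h1.smul h2
  · rw [Circle.smul_def, norm_smul, Circle.norm_coe, one_mul, Real.rpow_neg (by positivity),
      ← div_eq_mul_inv, le_div_iff₀ (by positivity), mul_comm]
    refine le_trans ?_ (hC (point p.1 x))
    rw [norm_iteratedFDeriv_zero, show (3 : ℝ) = (3 : ℕ) by norm_num, Real.rpow_natCast]
    gcongr
    exact norm_le_norm_point p.1 x
  · have h1 : Continuous fun p : ℝ × Plane => 𝐞 (inner ℝ x p.2) :=
      Real.continuous_fourierChar.comp (by fun_prop)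
    have h2 : Continuous fun p : ℝ × Plane => θ (point p.1 x) := θ.continuous.comp
      (continuous_point.comp (by fun_prop : Continuous fun p : ℝ × Plane => (p.1, x)))
    exact h1.smul h2

theorem fourierInv_point (θ : 𝓢(Spacetime, ℂ)) (τ : ℝ) (ξ : Plane) :
    (𝓕⁻ θ : 𝓢(Spacetime, ℂ)) (point τ ξ) = 𝓕⁻ (fun t => spaceInv θ t ξ) τ := by
  rw [SchwartzMap.fourierInv_coe, Real.fourierInv_eq, Real.fourierInv_eq, integral_spacetime]
  have hi : Integrable (fun p : ℝ × Plane =>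
      𝐞 (inner ℝ (point p.1 p.2) (point τ ξ)) • θ (point p.1 p.2)) (volume.prod volume) := by
    have h1 : Integrable fun y => 𝐞 (inner ℝ y (point τ ξ)) • θ y := by
      refine θ.integrable.norm.mono' ?_ (ae_of_all _ fun y => ?_)
      · exact ((Real.continuous_fourierChar.comp (by fun_prop)).smul
          θ.continuous).aestronglyMeasurable
      · rw [Circle.smul_def, norm_smul, Circle.norm_coe, one_mul]
    exact integrable_spacetime_iff.1 h1
  rw [integral_prod _ hi]
  refine integral_congr_ae (ae_of_all _ fun t => ?_)
  simp only [spaceInv_apply]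
  rw [Circle.smul_def, ← integral_smul]
  refine integral_congr_ae (ae_of_all _ fun x => ?_)
  have e : inner ℝ t τ = t * τ := by simp [mul_comm]
  simp only [inner_spacetime, point_zero, spacePart_point, AddChar.map_add_eq_mul,
    Circle.smul_def, Circle.coe_mul, smul_eq_mul, e]
  ring

theorem spaceInv_eq_zero {θ : 𝓢(Spacetime, ℂ)} {t : ℝ} (h : ∀ y : Spacetime, y 0 = t → θ y = 0)
    (ξ : Plane) : spaceInv θ t ξ = 0 := by
  rw [spaceInv_apply]
  simp [h (point t _) (point_zero _ _)]

theorem IsTest.eq_zero {I : Set ℝ} {θ : 𝓢(Spacetime, ℂ)} (hθ : IsTest I θ) {t : ℝ} (ht : t ∉ I)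
    (y : Spacetime) (hy : y 0 = t) : θ y = 0 := by
  obtain ⟨K, _, hK, h⟩ := hθ
  exact h y fun h' => ht (hy ▸ interior_subset (hK h'))

theorem fourier_eq_of_eq_fourierInv {h k : ℝ → ℂ} (hc : Continuous h) (hi : Integrable h)
    (hk : Integrable k) (e : k = 𝓕⁻ h) : 𝓕 k = h := by
  subst e
  refine hc.fourier_fourierInv_eq hi (hk.comp_neg.congr (ae_of_all _ fun x => ?_))
  simp only [Real.fourierInv_eq_fourier_neg, neg_neg]

/-- Undoes the time part of the space-time transform. Compact support of θ in time makes its spatial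
inverse transform integrable in t, so that Fourier inversion applies. -/
theorem fourier_timeSlice {I : Set ℝ} {θ : 𝓢(Spacetime, ℂ)} (hθ : IsTest I θ) (ξ : Plane) :
    𝓕 (fun τ => (𝓕⁻ θ : 𝓢(Spacetime, ℂ)) (point τ ξ)) = fun t => spaceInv θ t ξ := by
  obtain ⟨K, hK, -, h⟩ := hθ
  have hc : Continuous fun t => spaceInv θ t ξ := by
    have hp : Continuous fun t : ℝ => (t, ξ) := by fun_prop
    have := (continuous_spaceInv θ).comp hp
    simpa only [Function.comp_def] using this
  have hs : HasCompactSupport fun t => spaceInv θ t ξ :=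
    HasCompactSupport.intro hK fun t ht => spaceInv_eq_zero (fun y hy => h y (by rwa [hy])) ξ
  have hi := hc.integrable_of_hasCompactSupport (μ := volume) hs
  have hk : Integrable (fun τ => (𝓕⁻ θ : 𝓢(Spacetime, ℂ)) (point τ ξ)) :=
    (timeSlice (𝓕⁻ θ : 𝓢(Spacetime, ℂ)) ξ).integrable
  have e : (fun τ => (𝓕⁻ θ : 𝓢(Spacetime, ℂ)) (point τ ξ)) = 𝓕⁻ (fun t => spaceInv θ t ξ) :=
    funext fun τ => fourierInv_point θ τ ξ
  exact fourier_eq_of_eq_fourierInv hc hi hk e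

theorem lintegral_spaceInv_sq (θ : 𝓢(Spacetime, ℂ)) (t : ℝ) :
    energy 0 (fun ξ => ‖spaceInv θ t ξ‖ₑ) = ∫⁻ x, ‖θ (point t x)‖ₑ ^ 2 := by
  rw [energy_zero, ← lintegral_fourier_sq (spaceInv θ t).integrable ((spaceInv θ t).memLp 2),
    ← SchwartzMap.fourier_coe, fourier_spaceInv]
  rfl

theorem enInt_spaceInv (θ : 𝓢(Spacetime, ℂ)) : EnInt univ 0 (fun t => spaceInv θ t) := by
  refine ⟨(continuous_spaceInv θ).measurable, ?_⟩
  simp_rw [lintegral_spaceInv_sq]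
  have h := (memLp_two_iff_lintegral θ.continuous.aestronglyMeasurable).1 (θ.memLp 2)
  have hm : Measurable fun y : Spacetime => ‖θ y‖ₑ ^ 2 := θ.continuous.measurable.enorm.pow_const 2
  rw [← measurePreserving_point.lintegral_comp hm,
    lintegral_prod (fun a : ℝ × Plane => ‖θ (point a.1 a.2)‖ₑ ^ 2)
      (hm.comp measurable_point).aemeasurable] at h
  simpa using h

theorem EnInt.integrable_mul_of_enInt {I : Set ℝ} {f g : ℝ → Plane → ℂ} (hf : EnInt I 0 f)
    (hg : EnInt I 0 g) :
    Integrable (fun p : ℝ × Plane => f p.1 p.2 * g p.1 p.2) ((volume.restrict I).prod volume) := by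
  have h : ∀ {f : ℝ → Plane → ℂ}, EnInt I 0 f →
      MemLp (fun p : ℝ × Plane => f p.1 p.2) 2 ((volume.restrict I).prod volume) := by
    intro f ⟨hm, hf⟩
    have hm' : Measurable fun p : ℝ × Plane => f p.1 p.2 := hm
    refine ⟨hm'.aestronglyMeasurable, ?_⟩
    rw [eLpNorm_eq_lintegral_rpow_enorm_toReal (by norm_num) (by norm_num)]
    simp only [ENNReal.toReal_ofNat, ENNReal.rpow_ofNat]
    rw [ENNReal.rpow_lt_top_iff_of_pos (by norm_num), lintegral_prod _ (by fun_prop)]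
    simpa only [energy_zero] using hf
  exact (h hf).integrable_mul (h hg)

/-- `f` is, on the Fourier side, the restriction to `I` of an element of `X_σ^{s,b}`. -/
def IsBourgain (σ : ℤˣ) (s b : ℝ) (I : Set ℝ) (f : ℝ → Plane → ℂ) : Prop :=
  ∃ g : Spacetime → ℂ, Measurable g ∧ MemLp (fun y => (bourgainWeight σ s b y : ℂ) * g y) 2 ∧
    ∀ θ : 𝓢(Spacetime, ℂ), IsTest I θ →
      Integrable (fun y => g y * (𝓕⁻ θ : 𝓢(Spacetime, ℂ)) y) ∧
      Integrable (fun p : ℝ × Plane => f p.1 p.2 * spaceInv θ p.1 p.2)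
        ((volume.restrict I).prod volume) ∧
      ∫ y, g y * (𝓕⁻ θ : 𝓢(Spacetime, ℂ)) y =
        ∫ p : ℝ × Plane, f p.1 p.2 * spaceInv θ p.1 p.2 ∂((volume.restrict I).prod volume)

theorem IsBourgain.add {σ : ℤˣ} {s b : ℝ} {I : Set ℝ} {f f' : ℝ → Plane → ℂ}
    (h : IsBourgain σ s b I f) (h' : IsBourgain σ s b I f') :
    IsBourgain σ s b I (fun t η => f t η + f' t η) := by
  obtain ⟨g, m, w, h⟩ := h
  obtain ⟨g', m', w', h'⟩ := h'
  refine ⟨fun y => g y + g' y, m.add m', ?_, fun θ hθ => ?_⟩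
  · simp only [mul_add]; exact w.add w'
  · obtain ⟨i1, i2, e⟩ := h θ hθ
    obtain ⟨i1', i2', e'⟩ := h' θ hθ
    simp only [add_mul]
    exact ⟨i1.add i1', i2.add i2', by rw [integral_add i1 i1', integral_add i2 i2', e, e']⟩

theorem one_le_bracketPow (a : ℝ) {r : ℝ} (hr : 0 ≤ r) : 1 ≤ bracketPow a r :=
  Real.one_le_rpow (by nlinarith [sq_nonneg a]) (by linarith)

theorem IsBourgain.memBourgainOn {σ : ℤˣ} {s b : ℝ} (hs : 0 ≤ s) (hb : 0 ≤ b) {I : Set ℝ}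
    {f : ℝ → Plane → ℂ} (h : IsBourgain σ s b I f) {u : ℝ → L2}
    (hu : ∀ᵐ t ∂(volume.restrict I), (𝓕 (u t) : L2) =ᵐ[volume] f t) :
    MemBourgainOn σ s b I u := by
  obtain ⟨g, m, w, h⟩ := h
  have hg : MemLp g 2 := by
    refine w.of_le m.aestronglyMeasurable (ae_of_all _ fun y => ?_)
    rw [norm_mul, Complex.norm_real]
    refine le_mul_of_one_le_left (norm_nonneg _) (le_trans ?_ (le_abs_self _))
    exact one_le_mul_of_one_le_of_one_le (one_le_bracketPow _ hs) (one_le_bracketPow _ hb)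
  set G : 𝓢'(Spacetime, ℂ) := Lp.toTemperedDistribution (hg.toLp g) with hG
  have hGa : ∀ ψ : 𝓢(Spacetime, ℂ), G ψ = ∫ y, g y * ψ y := by
    intro ψ
    rw [hG, Lp.toTemperedDistribution_apply]
    refine integral_congr_ae ?_
    filter_upwards [hg.coeFn_toLp] with y hy
    rw [hy, smul_eq_mul, mul_comm]
  refine ⟨𝓕⁻ G, ⟨g, w, fun ψ => ?_⟩, fun θ hθ => ?_⟩
  · rw [FourierTransform.fourier_fourierInv_eq, hGa]
  · obtain ⟨-, i2, e⟩ := h θ hθ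
    rw [TemperedDistribution.fourierInv_apply, hGa, e, integral_prod _ i2, pairing]
    refine integral_congr_ae ?_
    filter_upwards [hu] with t ht
    have h1 := integral_fourier_Lp_mul (u t) (spaceInv θ t)
    rw [← SchwartzMap.fourier_coe, fourier_spaceInv] at h1
    simp only [slice_apply] at h1
    rw [← h1]
    refine integral_congr_ae ?_
    filter_upwards [ht] with η hη
    rw [hη]

/-- The inequality of weighted means between x^{2α} and x^{2β}z: the pointwise form of interpolation
between X^{α,0} and X^{β,1}, with y the squared modulation. The summand 1 in z costs x^{2β} ≤
x^{2α}, hence the factor 2. -/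
theorem rpow_interpolation {x y z b s α β : ℝ} (hx : 1 ≤ x) (hy : 0 ≤ y) (hb : 0 ≤ b) (hb1 : b ≤ 1)
    (hβ : β ≤ α) (hs : s ≤ (1 - b) * α + b * β) (hz : z = 1 + y) :
    x ^ (2 * s) * z ^ b ≤ 2 * x ^ (2 * α) + x ^ (2 * β) * y := by
  have hx0 : 0 < x := by linarith
  have hz0 : 0 < z := by linarith
  have h1 : x ^ (2 * s) * z ^ b ≤ (x ^ (2 * α)) ^ (1 - b) * (x ^ (2 * β) * z) ^ b := by
    rw [Real.mul_rpow (by positivity) hz0.le, ← Real.rpow_mul hx0.le, ← Real.rpow_mul hx0.le,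
      ← mul_assoc, ← Real.rpow_add hx0]
    gcongr
    linarith
  have h2 := Real.geom_mean_le_arith_mean2_weighted (w₁ := 1 - b) (w₂ := b) (p₁ := x ^ (2 * α))
    (p₂ := x ^ (2 * β) * z) (by linarith) hb (by positivity) (by positivity) (by ring)
  have h3 : x ^ (2 * β) ≤ x ^ (2 * α) := Real.rpow_le_rpow_of_exponent_le hx (by linarith)
  have h4 : 0 < x ^ (2 * β) := by positivity
  have h5 : 0 < x ^ (2 * α) := by positivity
  refine (h1.trans h2).trans ?_
  rw [hz]
  nlinarith [mul_le_mul_of_nonneg_right hb1 (mul_nonneg h4.le hy), mul_nonneg hb h5.le,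
    mul_le_mul_of_nonneg_right hb1 h4.le]

/-- A modulated profile is the restriction of an element of a Bourgain space. -/
theorem isBourgain_of_profile {σ : ℤˣ} {s b α β : ℝ} (hb : 0 ≤ b) (hb1 : b ≤ 1) (hα : 0 ≤ α)
    (hβ : β ≤ α) (hs : s ≤ (1 - b) * α + b * β) (hs0 : 0 ≤ s)
    {p p' : ℝ → Plane → ℂ} (hp : PrimAE univ p p')
    {T : ℝ} (hT : 0 ≤ T) (hz : ∀ t, t ∉ Ioc (-T) T → ∀ η, p t η = 0)
    (hz' : ∀ t, t ∉ Ioc (-T) T → ∀ η, p' t η = 0) (hpα : EnInt univ α p) (hpβ : EnInt univ β p')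
    {I : Set ℝ} (hI : MeasurableSet I) {f : ℝ → Plane → ℂ} (hfm : Measurable (Function.uncurry f))
    (hf : ∀ᵐ η, ∀ t ∈ I,
      f t η = Complex.exp ((2 * Real.pi * t * (sgn σ * ‖η‖) : ℝ) * Complex.I) * p t η) :
    IsBourgain σ s b I f := by
  obtain ⟨hpm, hpα⟩ := hpα
  obtain ⟨hpm', hpβ⟩ := hpβ
  have pm : Measurable fun q : ℝ × Plane => p q.1 q.2 := hpm
  have pm' : Measurable fun q : ℝ × Plane => p' q.1 q.2 := hpm'
  set V : ℝ → Plane → ℂ := fun t η =>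
    Complex.exp ((2 * Real.pi * t * (sgn σ * ‖η‖) : ℝ) * Complex.I) * p t η with hV
  have Vm : Measurable fun q : ℝ × Plane => V q.1 q.2 := by
    simp only [hV]; fun_prop
  have Ve : ∀ t η, ‖V t η‖ₑ = ‖p t η‖ₑ := by
    intro t η; rw [hV]; simp only; rw [enorm_mul, enorm_exp_mul_I, one_mul]
  -- The space-time transform of the modulated profile. For fixed spatial frequency it is the time
  -- transform of the profile shifted by σ|ξ|, so the modulation weight becomes a weight centred at
  -- 0.
  set g : Spacetime → ℂ := fun y => 𝓕 (fun t => V t (spacePart y)) (y 0) with hg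
  have gp : ∀ τ ξ, g (point τ ξ) = 𝓕 (fun t => V t ξ) τ := by
    intro τ ξ; simp only [hg, spacePart_point, point_zero]
  have gs : ∀ τ ξ, g (point τ ξ) = 𝓕 (fun t => p t ξ) (τ - sgn σ * ‖ξ‖) := by
    intro τ ξ
    rw [gp, Real.fourier_eq, Real.fourier_eq]
    refine integral_congr_ae (ae_of_all _ fun t => ?_)
    simp only [hV, Circle.smul_def, smul_eq_mul, Real.fourierChar_apply]
    rw [← mul_assoc, ← Complex.exp_add]
    congr 2
    simp
    ring
  have gm : Measurable g := by
    have h1 : Measurable (Function.uncurry fun (y : Spacetime) (t : ℝ) =>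
        Complex.exp ((2 * Real.pi * (-(t * y 0)) : ℝ) * Complex.I) * V t (spacePart y)) := by
      have h2 : Measurable fun q : Spacetime × ℝ => V q.2 (spacePart q.1) :=
        Vm.comp (measurable_snd.prodMk (spacePartL.continuous.measurable.comp measurable_fst))
      have h3 : Continuous fun q : Spacetime × ℝ =>
        Complex.exp ((2 * Real.pi * (-(q.2 * q.1 0)) : ℝ) * Complex.I) := by fun_prop
      exact h3.measurable.mul h2
    have h4 := h1.stronglyMeasurable.integral_prod_right (ν := volume)
    have h5 : g = fun y => ∫ t, Complex.exp ((2 * Real.pi * (-(t * y 0)) : ℝ) * Complex.I) *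
        V t (spacePart y) := by
      funext y
      simp only [hg, Real.fourier_eq]
      refine integral_congr_ae (ae_of_all _ fun t => ?_)
      have e : inner ℝ t (y 0) = t * y 0 := by simp [mul_comm]
      simp only [e, Circle.smul_def, Real.fourierChar_apply, smul_eq_mul]
    rw [h5]
    exact h4.measurable
  have wm : Measurable (bourgainWeight σ s b) := by
    have := spacePartL.continuous.measurable
    have h1 : Measurable fun y => spacePart y := this
    unfold bourgainWeight bracketPow
    fun_prop
  have hw : MemLp (fun y => (bourgainWeight σ s b y : ℂ) * g y) 2 := by
    have wgm : Measurable fun y => (bourgainWeight σ s b y : ℂ) * g y :=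
      (Complex.measurable_ofReal.comp wm).mul gm
    rw [memLp_two_iff_lintegral wgm.aestronglyMeasurable,
      lintegral_spacetime (by fun_prop)]
    have hslice : ∀ᵐ ξ, ∫⁻ τ, ‖(bourgainWeight σ s b (point τ ξ) : ℂ) * g (point τ ξ)‖ₑ ^ 2 ≤
        2 * (jw (2 * α) ξ * ∫⁻ t, ‖p t ξ‖ₑ ^ 2) + ENNReal.ofReal ((2 * Real.pi) ^ 2) *
          (jw (2 * β) ξ * ∫⁻ t, ‖p' t ξ‖ₑ ^ 2) := by
      filter_upwards [hp] with ξ hξ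
      obtain ⟨w1, w2⟩ := lintegral_fourier_weight_le hξ hT (fun t ht => hz t ht ξ)
        (fun t ht => hz' t ht ξ)
      have hb : ∀ τ, ‖(bourgainWeight σ s b (point τ ξ) : ℂ)‖ₑ ^ 2 ≤ 2 * jw (2 * α) ξ +
          ENNReal.ofReal ((2 * Real.pi) ^ 2) * (jw (2 * β) ξ *
            ENNReal.ofReal ((τ - sgn σ * ‖ξ‖) ^ 2)) := by
        intro τ
        set y := (2 * Real.pi * (τ - sgn σ * ‖ξ‖)) ^ 2 with hy
        have h1 := rpow_interpolation (one_le_jb ξ) (sq_nonneg (2 * Real.pi * (τ - sgn σ * ‖ξ‖)))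
          hb hb1 hβ hs rfl
        have h2 : bourgainWeight σ s b (point τ ξ) ^ 2 = jb ξ ^ (2 * s) * (1 + y) ^ b := by
          rw [bourgainWeight, spacePart_point, point_zero, bracketPow_eq, mul_pow, bracketPow]
          have e1 : (-(2 * Real.pi * τ) + ((σ : ℤ) : ℝ) * (2 * Real.pi * ‖ξ‖)) ^ 2 = y := by
            rw [hy, sgn]; ring
          rw [e1, ← Real.rpow_natCast, ← Real.rpow_natCast, ← Real.rpow_mul (jb_pos ξ).le,
            ← Real.rpow_mul (by positivity)]
          congr 2 <;> push_cast <;> ring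
        have h3 : ‖(bourgainWeight σ s b (point τ ξ) : ℂ)‖ₑ ^ 2 =
            ENNReal.ofReal (bourgainWeight σ s b (point τ ξ) ^ 2) := by
          rw [← ofReal_norm, Complex.norm_real, ← ENNReal.ofReal_pow (norm_nonneg _),
            Real.norm_eq_abs, sq_abs]
        rw [h3, h2]
        refine (ENNReal.ofReal_le_ofReal h1).trans ?_
        have j0 : ∀ r : ℝ, 0 ≤ jb ξ ^ r := fun r => Real.rpow_nonneg (jb_pos ξ).le r
        rw [ENNReal.ofReal_add (by have := j0 (2 * α); positivity)
          (mul_nonneg (j0 _) (sq_nonneg _)), ENNReal.ofReal_mul (by norm_num), mul_pow,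
          mul_left_comm, ENNReal.ofReal_mul (by positivity), ENNReal.ofReal_mul (j0 _)]
        simp [jw]
      calc ∫⁻ τ, ‖(bourgainWeight σ s b (point τ ξ) : ℂ) * g (point τ ξ)‖ₑ ^ 2
          ≤ ∫⁻ τ, (2 * jw (2 * α) ξ + ENNReal.ofReal ((2 * Real.pi) ^ 2) * (jw (2 * β) ξ *
            ENNReal.ofReal ((τ - sgn σ * ‖ξ‖) ^ 2))) *
              ‖𝓕 (fun t => p t ξ) (τ - sgn σ * ‖ξ‖)‖ₑ ^ 2 := by
            refine lintegral_mono fun τ => ?_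
            rw [enorm_mul, mul_pow, gs]
            exact mul_le_mul' (hb τ) le_rfl
        _ = ∫⁻ l, (2 * jw (2 * α) ξ + ENNReal.ofReal ((2 * Real.pi) ^ 2) * (jw (2 * β) ξ *
            ENNReal.ofReal (l ^ 2))) * ‖𝓕 (fun t => p t ξ) l‖ₑ ^ 2 :=
            lintegral_sub_right_eq_self (μ := volume) (fun l => (2 * jw (2 * α) ξ +
              ENNReal.ofReal ((2 * Real.pi) ^ 2) * (jw (2 * β) ξ *
              ENNReal.ofReal (l ^ 2))) * ‖𝓕 (fun t => p t ξ) l‖ₑ ^ 2) (sgn σ * ‖ξ‖)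
        _ = ∫⁻ l, (2 * jw (2 * α) ξ * ‖𝓕 (fun t => p t ξ) l‖ₑ ^ 2 +
            ENNReal.ofReal ((2 * Real.pi) ^ 2) * jw (2 * β) ξ *
            (ENNReal.ofReal (l ^ 2) * ‖𝓕 (fun t => p t ξ) l‖ₑ ^ 2)) := by
            refine lintegral_congr fun l => ?_
            ring
        _ ≤ 2 * jw (2 * α) ξ * (∫⁻ l, ‖𝓕 (fun t => p t ξ) l‖ₑ ^ 2) +
            ENNReal.ofReal ((2 * Real.pi) ^ 2) * jw (2 * β) ξ *
            ∫⁻ l, (ENNReal.ofReal (l ^ 2) * ‖𝓕 (fun t => p t ξ) l‖ₑ ^ 2) := by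
            have hpc : Integrable fun t => p t ξ := by
              refine hξ.continuous.integrable_of_hasCompactSupport
                (HasCompactSupport.intro (isCompact_Icc (a := -T) (b := T)) fun t ht => ?_)
              exact hz t (fun h => ht (Ioc_subset_Icc_self h)) ξ
            have hFm : Measurable (𝓕 (fun t => p t ξ)) :=
              (VectorFourier.fourierIntegral_continuous Real.continuous_fourierChar
                continuous_inner hpc).measurable
            rw [lintegral_add_left (by fun_prop), lintegral_const_mul _ (by fun_prop),
              lintegral_const_mul _ (by fun_prop)]
        _ ≤ _ := by
            rw [← mul_assoc, ← mul_assoc]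
            gcongr
    refine lt_of_le_of_lt (lintegral_mono_ae hslice) ?_
    have hen : ∀ {q : ℝ → Plane → ℂ} {r : ℝ}, Measurable (fun z : ℝ × Plane => q z.1 z.2) →
        ∫⁻ ξ, jw (2 * r) ξ * ∫⁻ t, ‖q t ξ‖ₑ ^ 2 =
          ∫⁻ t, energy r (fun η => ‖q t η‖ₑ) := by
      intro q r hq
      simp only [energy]
      rw [lintegral_lintegral_swap (by fun_prop)]
      refine lintegral_congr fun ξ => ?_
      have : Measurable fun t => q t ξ := hq.comp (measurable_id.prodMk measurable_const)
      rw [← lintegral_const_mul _ (by fun_prop)]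
      refine lintegral_congr fun t => ?_
      rw [mul_pow, jw_sq]
    have m1 : Measurable fun ξ => ∫⁻ t, ‖p t ξ‖ₑ ^ 2 :=
      Measurable.lintegral_prod_left' (f := fun z : ℝ × Plane => ‖p z.1 z.2‖ₑ ^ 2) (by fun_prop)
    have m2 : Measurable fun ξ => ∫⁻ t, ‖p' t ξ‖ₑ ^ 2 :=
      Measurable.lintegral_prod_left' (f := fun z : ℝ × Plane => ‖p' z.1 z.2‖ₑ ^ 2) (by fun_prop)
    rw [lintegral_add_left (by fun_prop), lintegral_const_mul _ (by fun_prop),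
      lintegral_const_mul _ (by fun_prop), hen pm, hen pm']
    rw [Measure.restrict_univ] at hpα hpβ
    exact ENNReal.add_lt_top.2 ⟨ENNReal.mul_lt_top (by simp) hpα,
      ENNReal.mul_lt_top (by simp) hpβ⟩
  have hgL : MemLp g 2 := by
    refine hw.of_le gm.aestronglyMeasurable (ae_of_all _ fun y => ?_)
    rw [norm_mul, Complex.norm_real]
    refine le_mul_of_one_le_left (norm_nonneg _) (le_trans ?_ (le_abs_self _))
    exact one_le_mul_of_one_le_of_one_le (one_le_bracketPow _ hs0) (one_le_bracketPow _ hb)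
  refine ⟨g, gm, hw, fun θ hθ => ?_⟩
  have i1 : Integrable (fun y => g y * (𝓕⁻ θ : 𝓢(Spacetime, ℂ)) y) :=
    hgL.integrable_mul ((𝓕⁻ θ : 𝓢(Spacetime, ℂ)).memLp 2)
  have hV0 : EnInt univ 0 V := by
    refine ⟨Vm, lt_of_le_of_lt (lintegral_mono fun t => ?_) hpα⟩
    exact energy_mono hα fun η => (Ve t η).le
  have iV := hV0.integrable_mul_of_enInt (enInt_spaceInv θ)
  rw [Measure.restrict_univ] at iV
  have fm : Measurable fun q : ℝ × Plane => f q.1 q.2 := hfm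
  have hfV : ∀ᵐ q ∂((volume.restrict I).prod (volume : Measure Plane)), f q.1 q.2 = V q.1 q.2 := by
    rw [Measure.ae_prod_iff_ae_ae (measurableSet_eq_fun fm Vm)]
    have h1 : ∀ᵐ η, ∀ᵐ t ∂(volume.restrict I), f t η = V t η := by
      filter_upwards [hf] with η hη
      filter_upwards [ae_restrict_mem hI] with t ht
      exact hη t ht
    exact (Measure.ae_ae_comm (p := fun t η => f t η = V t η) (measurableSet_eq_fun fm Vm)).2 h1
  have hprod : (volume.restrict I).prod (volume : Measure Plane) =
      (volume.prod volume).restrict (I ×ˢ univ) := by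
    rw [← Measure.prod_restrict, Measure.restrict_univ]
  have e0 : (fun q : ℝ × Plane => f q.1 q.2 * spaceInv θ q.1 q.2)
      =ᵐ[(volume.restrict I).prod (volume : Measure Plane)]
      fun q => V q.1 q.2 * spaceInv θ q.1 q.2 := by
    filter_upwards [hfV] with q hq
    rw [hq]
  refine ⟨i1, ?_, ?_⟩
  · refine Integrable.congr ?_ e0.symm
    rw [hprod]
    exact iV.integrableOn
  · rw [integral_congr_ae e0, hprod, setIntegral_eq_integral_of_forall_compl_eq_zero]
    · rw [integral_spacetime, integral_prod_symm _ (integrable_spacetime_iff.1 i1),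
        integral_prod_symm _ iV]
      refine integral_congr_ae ?_
      filter_upwards [hp] with ξ hξ
      have hpc : Integrable fun t => p t ξ := by
        refine hξ.continuous.integrable_of_hasCompactSupport
          (HasCompactSupport.intro (isCompact_Icc (a := -T) (b := T)) fun t ht => ?_)
        exact hz t (fun h => ht (Ioc_subset_Icc_self h)) ξ
      have hVi : Integrable fun t => V t ξ := by
        refine hpc.norm.mono' (Vm.comp (measurable_id.prodMk
          measurable_const)).aestronglyMeasurable (ae_of_all _ fun t => ?_)
        have := Ve t ξ
        rw [← ofReal_norm, ← ofReal_norm, ENNReal.ofReal_eq_ofReal_iff (norm_nonneg _)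
          (norm_nonneg _)] at this
        exact this.le
      have h1 : ∫ τ, 𝓕 (fun t => V t ξ) τ * (𝓕⁻ θ : 𝓢(Spacetime, ℂ)) (point τ ξ) =
          ∫ t, V t ξ * 𝓕 (fun τ => (𝓕⁻ θ : 𝓢(Spacetime, ℂ)) (point τ ξ)) t :=
        integral_fourier_mul hVi (timeSlice (𝓕⁻ θ : 𝓢(Spacetime, ℂ)) ξ).integrable
      rw [fourier_timeSlice hθ] at h1
      rw [← h1]
      refine integral_congr_ae (ae_of_all _ fun τ => ?_)
      simp only [gp]
    · intro q hq
      rw [spaceInv_eq_zero (fun y hy => hθ.eq_zero (t := q.1) (fun h => hq ⟨h, mem_univ _⟩) y hy),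
        mul_zero]

/-! ### Half-waves belong to Bourgain spaces -/

theorem EnSup.cutoff {α : ℝ} {P : ℝ → Plane → ℂ} (h : EnSup univ α P) {χ : ℝ → ℂ}
    (hχ : Measurable χ) {T : ℝ} {C : ℝ≥0∞} (hC : C ≠ ⊤) (hz : ∀ t, t ∉ Ioc (-T) T → χ t = 0)
    (hb : ∀ t, ‖χ t‖ₑ ≤ C) : EnInt univ α (fun t η => χ t * P t η) := by
  obtain ⟨hm, D, hD, h⟩ := h
  refine ⟨(hχ.comp measurable_fst).mul hm, ?_⟩
  rw [Measure.restrict_univ]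
  have h1 : ∀ t, energy α (fun η => ‖χ t * P t η‖ₑ) ≤
      (Ioc (-T) T).indicator (fun _ => C ^ 2 * D) t := by
    intro t
    by_cases ht : t ∈ Ioc (-T) T
    · rw [indicator_of_mem ht]
      simp only [enorm_mul]
      rw [energy_const_mul α enorm_ne_top]
      gcongr
      · exact hb t
      · exact h t (mem_univ t)
    · rw [indicator_of_notMem ht]
      simp [hz t ht, energy]
  refine lt_of_le_of_lt (lintegral_mono h1) ?_
  rw [lintegral_indicator measurableSet_Ioc, lintegral_const, Measure.restrict_apply_univ]
  exact ENNReal.mul_lt_top (by finiteness) (by simp)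

theorem EnInt.bounded_mul {α : ℝ} {I : Set ℝ} {P : ℝ → Plane → ℂ} (h : EnInt I α P) {χ : ℝ → ℂ}
    (hχ : Measurable χ) {C : ℝ≥0∞} (hC : C ≠ ⊤) (hb : ∀ t, ‖χ t‖ₑ ≤ C) :
    EnInt I α (fun t η => χ t * P t η) := by
  refine ⟨(hχ.comp measurable_fst).mul h.1, lt_of_le_of_lt (lintegral_mono (g := fun t =>
    C ^ 2 * energy α (fun η => ‖P t η‖ₑ)) fun t => ?_) ?_⟩
  · simp only [enorm_mul]
    rw [energy_const_mul α enorm_ne_top]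
    gcongr
    exact hb t
  · rw [lintegral_const_mul' _ _ (by finiteness)]
    exact ENNReal.mul_lt_top (by finiteness) h.2

/-- A solution of a half-wave equation on a bounded interval belongs to a Bourgain space. -/
theorem isBourgain_of_halfWave {a b : ℝ} (hab : a < b) {σ : ℤˣ} {s r α β : ℝ} (hr : 0 ≤ r)
    (hr1 : r ≤ 1) (hα : 0 ≤ α) (hβ : β ≤ α) (hs : s ≤ (1 - r) * α + r * β) (hs0 : 0 ≤ s)
    {w E : ℝ → Plane → ℂ}
    (hP : PrimAE (Ioo a b) w (fun t η => Complex.I * sgn σ * jb η * w t η + E t η))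
    (hw : EnSup (Ioo a b) α w) (hE : EnInt (Ioo a b) β E) :
    IsBourgain σ s r (Ioo a b) w := by
  obtain ⟨P, P', hPP, hPα, hPβ, he⟩ := exists_profile hab (sgn_sq σ) hβ hP hw hE
  obtain ⟨T, χ, χ', C, hT, hC, hχ, hχc, hχc', hχ1, hz, hz', hbd, hbd'⟩ := exists_cutoff a b
  refine isBourgain_of_profile (p := fun t η => χ t * P t η)
    (p' := fun t η => χ' t * P t η + χ t * P' t η) hr hr1 hα hβ hs hs0 ?_ hT ?_ ?_ ?_ ?_
    measurableSet_Ioo hw.1 ?_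
  · filter_upwards [hPP] with η hη
    exact hχ.mul ordConnected_univ hη
  · intro t ht η; simp only [hz t ht, zero_mul]
  · intro t ht η; simp only [hz t ht, hz' t ht, zero_mul, add_zero]
  · exact hPα.cutoff hχc.measurable hC hz hbd
  · exact ((hPα.cutoff hχc'.measurable hC hz' hbd').mono_exp hβ).add
      (hPβ.bounded_mul hχc.measurable hC hbd)
  · filter_upwards [he] with η hη t ht
    rw [hη t ht, hχ1 t ht, one_mul]

theorem PrimAE.congr_deriv {I : Set ℝ} (hI : I.OrdConnected) {u d d' : ℝ → Plane → ℂ}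
    (h : PrimAE I u d) (hd : Measurable (Function.uncurry d))
    (hd' : Measurable (Function.uncurry d'))
    (e : ∀ᵐ t ∂(volume.restrict I), ∀ᵐ η, d t η = d' t η) : PrimAE I u d' := by
  have hs : MeasurableSet {p : ℝ × Plane | d p.1 p.2 = d' p.1 p.2} := measurableSet_eq_fun hd hd'
  have h1 := (Measure.ae_ae_comm (p := fun t η => d t η = d' t η) hs).1 e
  filter_upwards [h, h1] with η hη k
  exact hη.congr hI (fun _ _ => rfl) k

theorem PrimAE.congr_ae {I : Set ℝ} {u d d' : ℝ → Plane → ℂ}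
    (h : PrimAE I u d) (e : ∀ t η, d t η = d' t η) : PrimAE I u d' := by
  have : d = d' := funext fun t => funext fun η => e t η
  exact this ▸ h

theorem enorm_jb_inv (c : ℂ) (η : Plane) : ‖c * ((jb η)⁻¹ : ℂ)‖ₑ = ‖c‖ₑ * jw (-1) η := by
  rw [enorm_mul, ← enorm_jb_rpow, Real.rpow_neg_one, Complex.ofReal_inv]

theorem EnInt.jb_inv_mul {I : Set ℝ} {s : ℝ} {F : ℝ → Plane → ℂ} (h : EnInt I s F) (c : ℂ) :
    EnInt I (1 + s) (fun t η => c * ((jb η)⁻¹ : ℂ) * F t η) := by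
  have := h.mul (r := -1) (m := fun η => c * ((jb η)⁻¹ : ℂ)) (by fun_prop) (c := ‖c‖ₑ)
    enorm_ne_top fun η => (enorm_jb_inv c η).le
  rwa [sub_neg_eq_add, add_comm] at this

theorem EnSup.jb_inv_mul {I : Set ℝ} {s : ℝ} {F : ℝ → Plane → ℂ} (h : EnSup I s F) (c : ℂ) :
    EnSup I (1 + s) (fun t η => c * ((jb η)⁻¹ : ℂ) * F t η) := by
  have := h.mul (r := -1) (m := fun η => c * ((jb η)⁻¹ : ℂ)) (by fun_prop) (c := ‖c‖ₑ)
    enorm_ne_top fun η => (enorm_jb_inv c η).le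
  rwa [sub_neg_eq_add, add_comm] at this

/-- The conditions under which `L^∞ H^α` half-waves with forcing `⟨∇⟩⁻¹(F + ∂_t Z)` belong to
`X^{s,r}`. -/
structure SplitExp (s r α α₁ β₁ β₂ s₀ z d : ℝ) : Prop where
  nonneg_r : 0 ≤ r
  le_one : r ≤ 1
  nonneg_s : 0 ≤ s
  le_alpha : α₁ ≤ α
  le_gain : α₁ ≤ 1 + z
  nonneg : 0 ≤ α₁
  first_le : β₁ ≤ z
  first_le' : β₁ ≤ 1 - s₀
  first_le_alpha : β₁ ≤ α₁
  first : s ≤ (1 - r) * α₁ + r * β₁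
  second_le : β₂ ≤ 1 + d
  second_le' : β₂ ≤ z
  second : s ≤ (1 - r) * (1 + z) + r * β₂

/-- Put Y = c⟨∇⟩⁻¹Z. Then w - Y solves the half-wave equation with forcing c⟨∇⟩⁻¹F + iσcZ, from
which the time derivative of Z has disappeared. The correction Y is bounded in H^{1+z} and is itself
a half-wave with forcing ∂_t Y - iσ⟨∇⟩Y. Each part has its own exponents for the interpolation. -/
theorem isBourgain_of_splits {a b : ℝ} (hab : a < b) {σ : ℤˣ}
    {s r α α₁ β₁ β₂ s₀ z d : ℝ} (h : SplitExp s r α α₁ β₁ β₂ s₀ z d)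
    {w Q : ℝ → Plane → ℂ} {c : ℂ}
    (hP : PrimAE (Ioo a b) w
      (fun t η => Complex.I * sgn σ * jb η * w t η + c * ((jb η)⁻¹ : ℂ) * Q t η))
    (hw : EnSup (Ioo a b) α w) (hQm : Measurable (Function.uncurry Q))
    (hQ : Splits (Ioo a b) s₀ z d Q) :
    IsBourgain σ s r (Ioo a b) w := by
  obtain ⟨F, Z, D, hF, hZ, hZD, hD, e⟩ := hQ
  have hI : (Ioo a b).OrdConnected := ordConnected_Ioo
  have hjb : ∀ η, (jb η : ℂ) ≠ 0 := fun η => Complex.ofReal_ne_zero.2 (jb_pos η).ne'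
  set Y : ℝ → Plane → ℂ := fun t η => c * ((jb η)⁻¹ : ℂ) * Z t η with hY
  have hYs : EnSup (Ioo a b) (1 + z) Y := hZ.jb_inv_mul c
  have hZi : EnInt (Ioo a b) z Z := hZ.enInt (by simp) measurableSet_Ioo
  have hYP : PrimAE (Ioo a b) Y (fun t η => c * ((jb η)⁻¹ : ℂ) * D t η) :=
    hZD.mul fun η => c * ((jb η)⁻¹ : ℂ)
  have hYb : IsBourgain σ s r (Ioo a b) Y := by
    refine isBourgain_of_halfWave hab (α := 1 + z) (β := β₂)
      (E := fun t η => c * ((jb η)⁻¹ : ℂ) * D t η + -(Complex.I * sgn σ * c) * Z t η)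
      h.nonneg_r h.le_one (h.nonneg.trans h.le_gain) (by linarith [h.second_le']) h.second
      h.nonneg_s (hYP.congr_ae fun t η => ?_) hYs ?_
    · simp only [hY]; field_simp [hjb η]; ring
    · exact ((hD.jb_inv_mul c).mono_exp h.second_le).add
        ((hZi.const_mul _).mono_exp h.second_le')
  have hwY : IsBourgain σ s r (Ioo a b) (fun t η => w t η + -1 * Y t η) := by
    refine isBourgain_of_halfWave hab (α := α₁) (β := β₁)
      (E := fun t η => c * ((jb η)⁻¹ : ℂ) * F t η + (Complex.I * sgn σ * c) * Z t η)
      h.nonneg_r h.le_one h.nonneg h.first_le_alpha h.first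
      h.nonneg_s ?_ ((hw.mono_exp h.le_alpha).add ((hYs.mono_exp h.le_gain).const_mul (-1))) ?_
    · have h1 := hP.congr_deriv hI
        (d' := fun t η => Complex.I * sgn σ * jb η * w t η + c * ((jb η)⁻¹ : ℂ) * (F t η + D t η))
        ?_ ?_ ?_
      · refine (h1.add hI (hYP.mul fun _ => -1)).congr_ae fun t η => ?_
        simp only [hY]; field_simp [hjb η]; ring
      · have := hw.1
        have m1 : Measurable fun p : ℝ × Plane => w p.1 p.2 := hw.1
        have m2 : Measurable fun p : ℝ × Plane => Q p.1 p.2 := hQm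
        simp only [Function.uncurry_def]; fun_prop
      · have m1 : Measurable fun p : ℝ × Plane => w p.1 p.2 := hw.1
        have m2 : Measurable fun p : ℝ × Plane => F p.1 p.2 := hF.1
        have m3 : Measurable fun p : ℝ × Plane => D p.1 p.2 := hD.1
        simp only [Function.uncurry_def]; fun_prop
      · filter_upwards [e] with t ht
        filter_upwards [ht] with η hη
        rw [hη]
    · refine EnInt.add ((hF.jb_inv_mul c).mono_exp ?_) ((hZi.const_mul _).mono_exp h.first_le)
      linarith [h.first_le']
  have := hwY.add hYb
  simpa only [neg_one_mul, neg_add_cancel_right] using this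

/-! ### Fourier representatives of the fields -/

theorem HasFT.unique {f F G : Plane → ℂ} (h : HasFT f F) (h' : HasFT f G) : F =ᵐ[volume] G :=
  ae_eq_of_integral_mul_schwartz
    (locallyIntegrable_of_integrable_mul_schwartz fun ρ hρ => (h ρ hρ).2.1)
    (locallyIntegrable_of_integrable_mul_schwartz fun ρ hρ => (h' ρ hρ).2.1)
    fun ρ hρ => by rw [← (h ρ hρ).2.2, ← (h' ρ hρ).2.2]

/-- `r` represents the Fourier transform of the field `u ∈ C(I; H^α)`. -/
structure FieldRep (I : Set ℝ) (α : ℝ) (u : ℝ → L2) (r : ℝ → Plane → ℂ) : Prop where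
  sup : EnSup I α r
  isFT : ∀ t ∈ I, IsFT (u t) (r t)
  cont : ∀ ρ : 𝓢(Plane, ℂ), ContinuousOn (fun t => ∫ η, r t η * ρ η) I

theorem FieldRep.congr {I : Set ℝ} {α : ℝ} {u : ℝ → L2} {r w : ℝ → Plane → ℂ}
    (h : FieldRep I α u r) (hw : EnSup I α w) (e : ∀ t ∈ I, w t =ᵐ[volume] r t) :
    FieldRep I α u w := by
  refine ⟨hw, fun t ht => (h.isFT t ht).congr (e t ht).symm, fun ρ => (h.cont ρ).congr ?_⟩
  intro t ht
  refine integral_congr_ae ?_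
  filter_upwards [e t ht] with η hη
  rw [hη]

/-- A representative is chosen for the transform of ⟨∇⟩^s u, which is continuous in L², and the
weight is then divided out. The energy bound and the continuity of pairings are inherited. -/
theorem exists_fieldRep {s : ℝ} {I J : Set ℝ} (hJ : IsOpen J) (hJI : J ⊆ I)
    {u : ℝ → L2} (h : IsContSobolev s I u) : ∃ r, FieldRep J s u r := by
  obtain ⟨h1, h2, C, h3⟩ := h
  set v : ℝ → L2 := fun t => 𝓕 (multiplier (japaneseSymbol s) (u t)) with hv
  have hvc : ContinuousOn v J :=
    (FourierTransform.continuous_fourier (E := L2)).comp_continuousOn (h2.mono hJI)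
  obtain ⟨R, hRm, hR⟩ := exists_measurable_representative hJ hvc
  have hjs : ∀ η, japaneseSymbol s η ≠ 0 := fun η => by
    rw [japaneseSymbol_eq, Complex.ofReal_ne_zero]
    exact (Real.rpow_pos_of_pos (jb_pos η) s).ne'
  have hvu : ∀ t ∈ J, v t =ᵐ[volume] fun η => japaneseSymbol s η * (𝓕 (u t) : L2) η := by
    intro t ht
    simp only [hv]
    rw [multiplier, dif_pos (h1 t (hJI ht)), FourierTransform.fourier_fourierInv_eq]
    exact (h1 t (hJI ht)).coeFn_toLp
  have e : ∀ t ∈ J, (fun η => japaneseSymbol (-s) η * R t η) =ᵐ[volume] (𝓕 (u t) : L2) := by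
    intro t ht
    filter_upwards [hR t ht, hvu t ht] with η k1 k2
    rw [k1, k2, ← mul_assoc, japaneseSymbol_eq, japaneseSymbol_eq, ← Complex.ofReal_mul,
      ← Real.rpow_add (jb_pos η), neg_add_cancel, Real.rpow_zero, Complex.ofReal_one, one_mul]
  have hjm : ∀ r, Measurable (japaneseSymbol r) := fun r =>
    (japaneseSymbol_hasTemperateGrowth r).1.continuous.measurable
  refine ⟨fun t η => japaneseSymbol (-s) η * R t η, ⟨((hjm _).comp measurable_snd).mul hRm,
    ENNReal.ofReal (C ^ 2), ENNReal.ofReal_ne_top, fun t ht => ?_⟩, fun t ht => ?_, fun ρ => ?_⟩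
  · have : energy s (fun η => ‖japaneseSymbol (-s) η * R t η‖ₑ) = ∫⁻ η, ‖v t η‖ₑ ^ 2 := by
      refine lintegral_congr_ae ?_
      filter_upwards [hR t ht] with η k
      rw [enorm_mul, enorm_japaneseSymbol, ← mul_assoc, jw_mul_neg, one_mul, k]
    rw [this, hv, lintegral_fourier_Lp_sq, lintegral_enorm_sq_eq_norm_sq]
    have := h3 t (hJI ht)
    first
    | exact ENNReal.ofReal_le_ofReal (pow_le_pow_left₀ (norm_nonneg _) this 2)
    | (rw [← ofReal_norm, ← ENNReal.ofReal_pow (norm_nonneg _)]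
       exact ENNReal.ofReal_le_ofReal (pow_le_pow_left₀ (norm_nonneg _) this 2))
  · exact (isFT_Lp (u t)).congr (e t ht).symm
  · have hφ : MemLp (fun η => japaneseSymbol (-s) η * ρ η) 2 := by
      have := (jmul (-s) ρ).memLp 2 (μ := volume)
      exact (memLp_congr_ae (ae_of_all _ fun η => jmul_apply (-s) ρ η)).1 this
    have := (continuous_integral_mul_Lp (hφ.toLp _)).comp_continuousOn hvc
    refine this.congr fun t ht => ?_
    refine integral_congr_ae ?_
    filter_upwards [hR t ht, hφ.coeFn_toLp] with η k1 k2
    simp only [k1, k2]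
    ring

/-! ### Testing with tensor products -/

theorem isTest_tens {a b : ℝ} {χ : 𝓢(ℝ, ℂ)} (hχ : HasCompactSupport χ)
    (hs : tsupport χ ⊆ Ioo a b) (ψ : 𝓢(Plane, ℂ)) : IsTest (Ioo a b) (tens χ ψ) :=
  ⟨tsupport χ, hχ, by rwa [interior_Ioo], fun y hy => by
    rw [tens_apply, image_eq_zero_of_notMem_tsupport hy, zero_mul]⟩

theorem pairing_tens {I : Set ℝ} (hI : MeasurableSet I) {f F : ℝ → Plane → ℂ}
    (h : ∀ t ∈ I, HasFT (f t) (F t)) (χ : 𝓢(ℝ, ℂ)) {ρ : 𝓢(Plane, ℂ)} (hρ : HasCompactSupport ρ) :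
    pairing I f (tens χ (𝓕 ρ)) = ∫ t in I, χ t * ∫ η, F t η * ρ η := by
  refine setIntegral_congr_fun hI fun t ht => ?_
  simp only [tens_apply, point_zero, spacePart_point]
  rw [← (h t ht ρ hρ).2.2, ← integral_const_mul]
  refine integral_congr_ae (ae_of_all _ fun x => ?_)
  simp only
  ring

theorem hasCompactSupport_jmul {ρ : 𝓢(Plane, ℂ)} (hρ : HasCompactSupport ρ) (r : ℝ) :
    HasCompactSupport (jmul r ρ) := by
  have : (jmul r ρ : Plane → ℂ) = fun η => japaneseSymbol r η * ρ η :=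
    funext fun η => jmul_apply r ρ η
  rw [this]
  exact hρ.mul_left

theorem hasCompactSupport_neg_dmul {ρ : 𝓢(Plane, ℂ)} (hρ : HasCompactSupport ρ) (j : Fin 2) :
    HasCompactSupport (-dmul j ρ : 𝓢(Plane, ℂ)) := by
  have : ((-dmul j ρ : 𝓢(Plane, ℂ)) : Plane → ℂ) = fun η => -derivSymbol j η * ρ η := by
    funext η
    rw [neg_apply, dmul_apply, neg_mul]
  rw [this]
  exact hρ.mul_left

/-- The pairing of a function of time and frequency with a tensor product. -/
def freqPair (a b : ℝ) (χ : ℝ → ℂ) (F : ℝ → Plane → ℂ) (ρ : Plane → ℂ) : ℂ :=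
  ∫ t in Ioo a b, χ t * ∫ η, F t η * ρ η

section FreqPair

variable {a b e e' : ℝ} {F G : ℝ → Plane → ℂ}

theorem EnInt.integrable_freq (hF : EnInt (Ioo a b) e F) (χ : 𝓢(ℝ, ℂ)) (ρ : 𝓢(Plane, ℂ)) :
    Integrable (fun t => χ t * ∫ η, F t η * ρ η) (volume.restrict (Ioo a b)) :=
  (hF.integrable_mul_schwartz ρ).integral_prod_left.bdd_mul
    (c := SchwartzMap.seminorm ℝ 0 0 χ) χ.continuous.aestronglyMeasurable
    (ae_of_all _ fun x => SchwartzMap.norm_le_seminorm ℝ χ x)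

theorem freqPair_add (hF : EnInt (Ioo a b) e F) (hG : EnInt (Ioo a b) e' G) (χ : 𝓢(ℝ, ℂ))
    (ρ : 𝓢(Plane, ℂ)) :
    freqPair a b χ (fun t η => F t η + G t η) ρ = freqPair a b χ F ρ + freqPair a b χ G ρ := by
  rw [freqPair, freqPair, freqPair, ← integral_add (hF.integrable_freq χ ρ)
    (hG.integrable_freq χ ρ)]
  refine integral_congr_ae ?_
  filter_upwards [(hF.integrable_mul_schwartz ρ).prod_right_ae,
    (hG.integrable_mul_schwartz ρ).prod_right_ae] with t h1 h2
  simp only [add_mul]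
  rw [integral_add h1 h2, mul_add]

theorem freqPair_const_mul (c : ℂ) (χ : ℝ → ℂ) (ρ : Plane → ℂ) :
    freqPair a b χ (fun t η => c * F t η) ρ = c * freqPair a b χ F ρ := by
  simp only [freqPair]
  rw [← integral_const_mul]
  refine integral_congr_ae (ae_of_all _ fun t => ?_)
  simp only [mul_assoc]
  rw [integral_const_mul]; ring

theorem freqPair_sum {ι : Type*} (s : Finset ι) {F : ι → ℝ → Plane → ℂ}
    (hF : ∀ i ∈ s, EnInt (Ioo a b) e (F i)) (χ : 𝓢(ℝ, ℂ)) (ρ : 𝓢(Plane, ℂ)) :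
    freqPair a b χ (fun t η => ∑ i ∈ s, F i t η) ρ = ∑ i ∈ s, freqPair a b χ (F i) ρ := by
  have key : EnInt (Ioo a b) e (fun t η => ∑ i ∈ s, F i t η) ∧
      freqPair a b χ (fun t η => ∑ i ∈ s, F i t η) ρ = ∑ i ∈ s, freqPair a b χ (F i) ρ := by
    classical
    induction s using Finset.induction_on with
    | empty => simpa [freqPair] using enInt_zero (Ioo a b) e
    | insert i s hi ih =>
      obtain ⟨h1, h2⟩ := ih fun j hj => hF j (Finset.mem_insert_of_mem hj)
      have h3 := hF i (Finset.mem_insert_self i s)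
      simp only [Finset.sum_insert hi]
      exact ⟨h3.add h1, by rw [freqPair_add h3 h1, h2]⟩
  exact key.2

theorem freqPair_deriv (hab : a < b) (hF : EnInt (Ioo a b) e F) (hG : EnInt (Ioo a b) e' G)
    (h : PrimAE (Ioo a b) F G) {χ : 𝓢(ℝ, ℂ)} (hs : tsupport χ ⊆ Ioo a b) (ρ : 𝓢(Plane, ℂ)) :
    freqPair a b (SchwartzMap.derivCLM ℂ ℂ χ) F ρ = -freqPair a b χ G ρ := by
  have swap : ∀ {H : ℝ → Plane → ℂ} {r : ℝ} (χ : 𝓢(ℝ, ℂ)), EnInt (Ioo a b) r H →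
      freqPair a b χ H ρ = ∫ η, ρ η * ∫ t in Ioo a b, χ t * H t η := by
    intro H r χ hH
    have hi : Integrable (fun p : ℝ × Plane => χ p.1 * (H p.1 p.2 * ρ p.2))
        ((volume.restrict (Ioo a b)).prod volume) :=
      (hH.integrable_mul_schwartz ρ).bdd_mul (c := SchwartzMap.seminorm ℝ 0 0 χ)
        (χ.continuous.comp continuous_fst).aestronglyMeasurable
        (ae_of_all _ fun x => SchwartzMap.norm_le_seminorm ℝ χ x.1)
    simp only [freqPair, ← integral_const_mul]
    rw [integral_integral_swap hi]
    refine integral_congr_ae (ae_of_all _ fun η => ?_)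
    refine integral_congr_ae (ae_of_all _ fun t => ?_)
    simp only
    ring
  rw [swap _ hF, swap _ hG, ← integral_neg]
  refine integral_congr_ae ?_
  filter_upwards [h] with η hη
  rw [← mul_neg, ← hη.integral_deriv_mul hab χ hs]
  rfl

end FreqPair

theorem pairing_tens_freqPair {a b : ℝ} {f F : ℝ → Plane → ℂ}
    (h : ∀ t ∈ Ioo a b, HasFT (f t) (F t)) (χ : 𝓢(ℝ, ℂ)) {ρ : 𝓢(Plane, ℂ)}
    (hρ : HasCompactSupport ρ) :
    pairing (Ioo a b) f (tens χ (𝓕 ρ)) = freqPair a b χ F ρ :=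
  pairing_tens measurableSet_Ioo h χ hρ

theorem freqPair_jmul {a b : ℝ} (χ : ℝ → ℂ) (F : ℝ → Plane → ℂ) (r : ℝ) (ρ : 𝓢(Plane, ℂ)) :
    freqPair a b χ F (jmul r ρ) = freqPair a b χ (fun t η => ((jb η ^ r : ℝ) : ℂ) * F t η) ρ := by
  simp only [freqPair, jmul_apply, japaneseSymbol_eq]
  congr 1; funext t; congr 2; funext η; ring

theorem EnInt.jb_mul {I : Set ℝ} {s : ℝ} {F : ℝ → Plane → ℂ} (h : EnInt I s F) (r : ℝ) :
    EnInt I (s - r) (fun t η => ((jb η ^ r : ℝ) : ℂ) * F t η) :=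
  h.mul (by fun_prop) ENNReal.one_ne_top fun η => by rw [one_mul, enorm_jb_rpow]

theorem EnSup.jb_mul {I : Set ℝ} {s : ℝ} {F : ℝ → Plane → ℂ} (h : EnSup I s F) (r : ℝ) :
    EnSup I (s - r) (fun t η => ((jb η ^ r : ℝ) : ℂ) * F t η) :=
  h.mul (by fun_prop) ENNReal.one_ne_top fun η => by rw [one_mul, enorm_jb_rpow]

theorem FieldRep.enInt {a b α : ℝ} {u : ℝ → L2} {r : ℝ → Plane → ℂ}
    (h : FieldRep (Ioo a b) α u r) : EnInt (Ioo a b) α r :=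
  h.sup.enInt (by simp) measurableSet_Ioo

theorem FieldRep.pairHalfWave_tens {a b α : ℝ} {u : ℝ → L2} {r : ℝ → Plane → ℂ}
    (h : FieldRep (Ioo a b) α u r) (σ : ℤˣ) (χ : 𝓢(ℝ, ℂ)) {ρ : 𝓢(Plane, ℂ)}
    (hρ : HasCompactSupport ρ) :
    pairHalfWave σ (Ioo a b) u (tens χ (𝓕 ρ)) =
      -Complex.I * freqPair a b (SchwartzMap.derivCLM ℂ ℂ χ) r ρ +
        sgn σ * freqPair a b χ (fun t η => jb η * r t η) ρ := by
  have e : (fun t η => (jb η : ℂ) * r t η) = fun t η => ((jb η ^ (1 : ℝ) : ℝ) : ℂ) * r t η := by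
    simp only [Real.rpow_one]
  rw [e, ← freqPair_jmul, pairHalfWave, partialDeriv_zero_tens, japanese_tens]
  simp only [freqPair]
  rw [← integral_const_mul, ← integral_const_mul,
    ← integral_add ((h.enInt.integrable_freq _ ρ).const_mul _)
    ((h.enInt.integrable_freq χ (jmul 1 ρ)).const_mul _)]
  refine setIntegral_congr_fun measurableSet_Ioo fun t ht => ?_
  have h1 := (h.isFT t ht).hasFT ρ hρ
  have h2 := (h.isFT t ht).hasFT _ (hasCompactSupport_jmul hρ 1)
  simp only
  rw [← h1.2.2, ← h2.2.2, ← integral_const_mul, ← integral_const_mul, ← integral_const_mul,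
    ← integral_const_mul, ← integral_add ((h1.1.const_mul _).const_mul _)
      ((h2.1.const_mul _).const_mul _)]
  refine integral_congr_ae (ae_of_all _ fun x => ?_)
  simp only [add_apply, neg_apply, smul_apply, tens_apply, point_zero, spacePart_point, sgn,
    smul_eq_mul, Complex.ofReal_intCast]
  ring

/-- The half-wave equation on the Fourier side. -/
theorem FieldRep.exists_primAE {a b : ℝ} (hab : a < b) {α e : ℝ} {u : ℝ → L2}
    {r G : ℝ → Plane → ℂ} {σ : ℤˣ} (h : FieldRep (Ioo a b) α u r) (hG : EnInt (Ioo a b) e G)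
    (hw : ∀ ρ : 𝓢(Plane, ℂ), HasCompactSupport ρ → ∀ χ : 𝓢(ℝ, ℂ), HasCompactSupport χ →
      tsupport χ ⊆ Ioo a b →
      pairHalfWave σ (Ioo a b) u (tens χ (𝓕 ρ)) = freqPair a b χ G ρ) :
    ∃ w, FieldRep (Ioo a b) α u w ∧ PrimAE (Ioo a b) w
      (fun t η => Complex.I * sgn σ * jb η * w t η + -Complex.I * G t η) ∧
      ∀ t ∈ Ioo a b, w t =ᵐ[volume] r t := by
  have hI : (Ioo a b).OrdConnected := ordConnected_Ioo
  have hjr : EnInt (Ioo a b) (α - 1) (fun t η => (jb η : ℂ) * r t η) := by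
    simpa only [Real.rpow_one] using h.enInt.jb_mul 1
  set d : ℝ → Plane → ℂ :=
    fun t η => (Complex.I * sgn σ) * (jb η * r t η) + -Complex.I * G t η with hd
  have hdi : EnInt (Ioo a b) (min (α - 1) e) d :=
    ((hjr.const_mul _).mono_exp (min_le_left _ _)).add
      ((hG.const_mul _).mono_exp (min_le_right _ _))
  refine (exists_primAE_of_weak hab h.sup hdi (fun ρ _ => h.cont ρ) ?_).elim fun w hw' => ?_
  swap
  · obtain ⟨w1, w2, w3⟩ := hw'
    refine ⟨w, h.congr w1 w3, w2.congr_deriv hI hdi.1 ?_ ?_, w3⟩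
    · have m1 : Measurable fun p : ℝ × Plane => w p.1 p.2 := w1.1
      have m2 : Measurable fun p : ℝ × Plane => G p.1 p.2 := hG.1
      simp only [Function.uncurry_def]; fun_prop
    · filter_upwards [ae_restrict_mem measurableSet_Ioo] with t ht
      filter_upwards [w3 t ht] with η hη
      simp only [hd, hη]; ring
  · intro ρ hρ χ hχ hs
    have h1 := hw ρ hρ χ hχ hs
    rw [h.pairHalfWave_tens σ χ hρ] at h1
    have h2 : freqPair a b χ d ρ = (Complex.I * sgn σ) * freqPair a b χ (fun t η => jb η * r t η) ρ
        + -Complex.I * freqPair a b χ G ρ := by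
      rw [hd, freqPair_add (hjr.const_mul _) (hG.const_mul _), freqPair_const_mul,
        freqPair_const_mul]
    change freqPair a b (SchwartzMap.derivCLM ℂ ℂ χ) r ρ = -freqPair a b χ d ρ
    rw [h2]
    linear_combination Complex.I * h1 +
      freqPair a b (SchwartzMap.derivCLM ℂ ℂ χ) r ρ * Complex.I_sq

/-- Representatives of a pair of half-waves whose sum is differentiable in time. -/
theorem exists_fieldRep_pair {a b : ℝ} (hab : a < b) {s : ℝ} {u : ℤˣ → ℝ → L2}
    (h : ∀ σ, IsContSobolev s (Ioo a b) (u σ))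
    (hw : ∀ θ : 𝓢(Spacetime, ℂ), IsTest (Ioo a b) θ →
      pairHalfWave 1 (Ioo a b) (u 1) θ + pairHalfWave (-1) (Ioo a b) (u (-1)) θ = 0) :
    ∃ r : ℤˣ → ℝ → Plane → ℂ, (∀ σ, FieldRep (Ioo a b) s (u σ) (r σ)) ∧
      PrimAE (Ioo a b) (tot r) (fd r 0) := by
  choose q hq using fun σ => exists_fieldRep isOpen_Ioo Subset.rfl (h σ)
  have hS : EnSup (Ioo a b) s (tot q) := enSup_tot fun σ => (hq σ).sup
  have hd : EnInt (Ioo a b) (s - 1) (fd q 0) :=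
    (enSup_fd (fun σ => (hq σ).sup) 0).enInt (by simp) measurableSet_Ioo
  refine (exists_primAE_of_weak hab hS hd (fun ρ hρ => ?_) ?_).elim fun w hw' => ?_
  rotate_left 2
  · obtain ⟨w1, w2, w3⟩ := hw'
    -- Half of the correction goes to each sign: the sum becomes the primitive w, while the
    -- difference, and with it the time derivative, is unchanged.
    set r : ℤˣ → ℝ → Plane → ℂ :=
      fun σ t η => q σ t η + ((1 / 2 : ℂ) * w t η + (-1 / 2 : ℂ) * tot q t η) with hr
    have e1 : tot r = w := by funext t η; simp only [hr, tot]; ring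
    have e2 : fd r 0 = fd q 0 := by funext t η; simp only [fd_zero, hr]; ring
    refine ⟨r, fun σ => (hq σ).congr ((hq σ).sup.add ((w1.const_mul _).add (hS.const_mul _)))
      fun t ht => ?_, by rw [e1, e2]; exact w2⟩
    filter_upwards [w3 t ht] with η hη
    simp only [hr, hη]; ring
  · have := ((hq 1).cont ρ).add ((hq (-1)).cont ρ)
    refine this.congr fun t ht => ?_
    have i1 := ((hq 1).isFT t ht).hasFT ρ hρ
    have i2 := ((hq (-1)).isFT t ht).hasFT ρ hρ
    simp only [tot, add_mul, Pi.add_apply]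
    rw [integral_add i1.2.1 i2.2.1]
  · intro ρ hρ χ hχ hχs
    have h1 := hw _ (isTest_tens hχ hχs (𝓕 ρ))
    rw [(hq 1).pairHalfWave_tens 1 χ hρ, (hq (-1)).pairHalfWave_tens (-1) χ hρ] at h1
    have hj : ∀ σ, EnInt (Ioo a b) (s - 1) (fun t η => (jb η : ℂ) * q σ t η) := fun σ => by
      simpa only [Real.rpow_one] using (hq σ).enInt.jb_mul 1
    have e1 : freqPair a b (SchwartzMap.derivCLM ℂ ℂ χ) (tot q) ρ =
        freqPair a b (SchwartzMap.derivCLM ℂ ℂ χ) (q 1) ρ +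
        freqPair a b (SchwartzMap.derivCLM ℂ ℂ χ) (q (-1)) ρ :=
      freqPair_add (hq 1).enInt (hq (-1)).enInt _ ρ
    have e2 : fd q 0 = fun t η => Complex.I * (jb η * q 1 t η) +
        -Complex.I * (jb η * q (-1) t η) := by
      funext t η; rw [fd_zero]; ring
    change freqPair a b (SchwartzMap.derivCLM ℂ ℂ χ) (tot q) ρ = -freqPair a b χ (fd q 0) ρ
    rw [e1, e2, freqPair_add ((hj 1).const_mul _) ((hj (-1)).const_mul _), freqPair_const_mul,
      freqPair_const_mul]
    simp only [sgn, Units.val_one, Int.cast_one, Units.val_neg, Int.cast_neg] at h1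
    push_cast at h1
    linear_combination Complex.I * h1 +
      (freqPair a b (SchwartzMap.derivCLM ℂ ℂ χ) (q 1) ρ +
        freqPair a b (SchwartzMap.derivCLM ℂ ℂ χ) (q (-1)) ρ) * Complex.I_sq

/-! ### Conjugation -/

theorem measurable_cneg {F : ℝ → Plane → ℂ} (h : Measurable (Function.uncurry F)) :
    Measurable (Function.uncurry fun t => cneg (F t)) :=
  Complex.continuous_conj.measurable.comp (measurable_comp₂ h (f := fun p : ℝ × Plane => p.1)
    (g := fun p => -p.2) (by fun_prop) (by fun_prop))

theorem energy_cneg (s : ℝ) (F : Plane → ℂ) :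
    energy s (fun η => ‖cneg F η‖ₑ) = energy s (fun η => ‖F η‖ₑ) := by
  have h := (Measure.measurePreserving_neg (volume : Measure Plane)).lintegral_comp_emb
    (MeasurableEquiv.neg Plane).measurableEmbedding (fun η => (jw s η * ‖F η‖ₑ) ^ 2)
  rw [energy, energy, ← h]
  refine lintegral_congr fun η => ?_
  have e : ‖cneg F η‖ₑ = ‖F (-η)‖ₑ := by
    rw [cneg, ← ofReal_norm, ← ofReal_norm, RCLike.norm_conj]
  rw [e]
  simp only [jw, jb_neg]

theorem EnSup.cneg {I : Set ℝ} {s : ℝ} {F : ℝ → Plane → ℂ} (h : EnSup I s F) :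
    EnSup I s (fun t => cneg (F t)) := by
  obtain ⟨m, C, hC, h⟩ := h
  exact ⟨measurable_cneg m, C, hC, fun t ht => by rw [energy_cneg]; exact h t ht⟩

theorem EnInt.cneg {I : Set ℝ} {s : ℝ} {F : ℝ → Plane → ℂ} (h : EnInt I s F) :
    EnInt I s (fun t => cneg (F t)) := by
  refine ⟨measurable_cneg h.1, ?_⟩
  simp only [energy_cneg]
  exact h.2

theorem PrimAE.cneg {I : Set ℝ} {u d : ℝ → Plane → ℂ} (h : PrimAE I u d) :
    PrimAE I (fun t => cneg (u t)) (fun t => cneg (d t)) := by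
  have h' := (Measure.measurePreserving_neg (volume : Measure Plane)).quasiMeasurePreserving.ae h
  filter_upwards [h'] with η hη
  refine ⟨Complex.conjCLE.toContinuousLinearMap.integrable_comp hη.1, fun s hs t ht => ?_⟩
  have e := congrArg (starRingEnd ℂ) (hη.2 s hs t ht)
  rw [map_sub, intervalIntegral.intervalIntegral_eq_integral_uIoc, Complex.real_smul, map_mul,
    Complex.conj_ofReal, ← integral_conj] at e
  rw [intervalIntegral.intervalIntegral_eq_integral_uIoc, Complex.real_smul]
  exact e

/-- The conjugate of a pair of half-waves. -/
def bar (u : ℤˣ → ℝ → Plane → ℂ) (σ : ℤˣ) (t : ℝ) : Plane → ℂ := cneg (u (-σ) t)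

theorem sgn_neg (σ : ℤˣ) : sgn (-σ) = -sgn σ := by simp [sgn]

theorem conj_dsym_neg (σ : ℤˣ) (μ : Fin 3) (η : Plane) :
    starRingEnd ℂ (dsym σ μ (-η)) = dsym (-σ) μ η := by
  fin_cases μ <;> simp [dsym, sgn_neg, derivSymbol] <;> exact Or.inl (map_ofNat _ 2)

theorem cneg_fd (u : ℤˣ → ℝ → Plane → ℂ) (μ : Fin 3) (t : ℝ) :
    cneg (fd u μ t) = fd (bar u) μ t := by
  funext η
  simp only [cneg, fd, bar, map_add, map_mul, conj_dsym_neg, neg_neg]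
  ring

/-- Conjugation reverses the direction of propagation; hence the interchange of signs in `bar`,
which makes null forms of the pair (φ̄, φ) null forms of half-waves. -/
theorem HalfWave.bar {a b α β : ℝ} {u E : ℤˣ → ℝ → Plane → ℂ} (h : HalfWave a b α β u E) :
    HalfWave a b α β (bar u) (bar E) := by
  refine ⟨fun σ => ?_, fun σ => (h.sup (-σ)).cneg, fun σ => (h.int (-σ)).cneg, fun t η => ?_⟩
  · refine (h.prim (-σ)).cneg.congr_ae fun t η => ?_
    simp only [cneg, ChernSimonsHiggs.bar, map_add, map_mul, Complex.conj_I, Complex.conj_ofReal,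
      sgn_neg, jb_neg]
    push_cast
    ring
  · have := congrArg (starRingEnd ℂ) (h.cancel t (-η))
    simp only [ChernSimonsHiggs.bar, cneg, neg_neg]
    rw [map_add, map_zero] at this
    rw [add_comm, this]

/-! ### Products on the Fourier side -/

theorem conv_congr {F F' G G' : Plane → ℂ} (hF : F =ᵐ[volume] F') (hG : G =ᵐ[volume] G') :
    conv F G = conv F' G' := by
  funext ξ
  refine integral_congr_ae ?_
  filter_upwards [hF, ae_comp_sub hG ξ] with η h1 h2
  rw [h1, h2]

theorem cneg_congr {F G : Plane → ℂ} (h : F =ᵐ[volume] G) : cneg F =ᵐ[volume] cneg G := by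
  filter_upwards [(Measure.measurePreserving_neg
    (volume : Measure Plane)).quasiMeasurePreserving.ae h] with η hη
  rw [cneg, cneg, hη]

theorem EnSup.memLp {I : Set ℝ} {s : ℝ} (hs : 0 ≤ s) {F : ℝ → Plane → ℂ} (h : EnSup I s F) {t : ℝ}
    (ht : t ∈ I) : MemLp (F t) 2 := by
  rw [memLp_two_iff_lintegral (measurable_slice h.1 t).aestronglyMeasurable, ← energy_zero]
  exact lt_of_le_of_lt (energy_mono hs fun _ => le_rfl) (h.ne_top ht).lt_top

/-- `F` represents the Fourier transform of the bounded family `f` in `H^s`. -/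
structure IsRep (I : Set ℝ) (s : ℝ) (f F : ℝ → Plane → ℂ) : Prop where
  sup : EnSup I s F
  isFT : ∀ t ∈ I, IsFT (f t) (F t)

theorem EnSup.conv {I : Set ℝ} {r α β : ℝ} {F G : ℝ → Plane → ℂ} (h01 : 0 ≤ -r + α)
    (h02 : 0 ≤ -r + β) (h12 : 0 ≤ α + β) (h : 1 < -r + α + β) (hF : EnSup I α F)
    (hG : EnSup I β G) : EnSup I r (fun t => conv (F t) (G t)) :=
  EnSup.bil measurable_const (bilBound_conv h01 h02 h12 h) hF hG

theorem IsRep.mul {I : Set ℝ} {r α β : ℝ} {f g F G : ℝ → Plane → ℂ} (hr : 0 ≤ r)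
    (h01 : r ≤ α) (h02 : r ≤ β) (h : 1 < -r + α + β) (hF : IsRep I α f F) (hG : IsRep I β g G) :
    IsRep I r (fun t x => f t x * g t x) (fun t => conv (F t) (G t)) := by
  have hs := hF.sup.conv (r := r) (by linarith) (by linarith) (by linarith) h hG.sup
  exact ⟨hs, fun t ht => (hF.isFT t ht).mul (hG.isFT t ht) (hs.memLp hr ht)⟩

theorem IsRep.conj {I : Set ℝ} {s : ℝ} {f F : ℝ → Plane → ℂ} (h : IsRep I s f F) :
    IsRep I s (fun t x => conj (f t x)) (fun t => cneg (F t)) :=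
  ⟨h.sup.cneg, fun t ht => (h.isFT t ht).conj⟩

theorem isRep_total {I : Set ℝ} {s : ℝ} {u : ℤˣ → ℝ → L2} {r : ℤˣ → ℝ → Plane → ℂ}
    (h : ∀ σ, FieldRep I s (u σ) (r σ)) : IsRep I s (fun t x => total u t x) (tot r) := by
  refine ⟨enSup_tot fun σ => (h σ).sup, fun t ht => ?_⟩
  refine (((h 1).isFT t ht).add ((h (-1)).isFT t ht)).congr_left ?_
  exact (Lp.coeFn_add _ _).symm

theorem isRep_fieldDeriv {I : Set ℝ} {s : ℝ} (hs : 1 ≤ s) {u : ℤˣ → ℝ → L2}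
    {r : ℤˣ → ℝ → Plane → ℂ} (h : ∀ σ, FieldRep I s (u σ) (r σ)) (μ : Fin 3) :
    IsRep I (s - 1) (fun t x => fieldDeriv u μ t x) (fd r μ) := by
  have hS := enSup_fd (fun σ => (h σ).sup) μ
  refine ⟨hS, fun t ht => ?_⟩
  have hspace : ∀ j : Fin 2, fd r j.succ t = fun η => derivSymbol j η * tot r t η := fun j =>
    funext fun η => fd_succ r j t η
  have htot := (isRep_total h).isFT t ht
  have hm : ∀ j : Fin 2, IsFT (multiplier (derivSymbol j) (total u t)) (fd r j.succ t) := by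
    intro j
    rw [hspace]
    refine htot.multiplier ?_
    rw [← hspace]
    exact (enSup_fd (fun σ => (h σ).sup) j.succ).memLp (by linarith) ht
  fin_cases μ
  · have hd : IsFT (fun x => (u 1 t - u (-1) t : L2) x) (fun η => r 1 t η + -1 * r (-1) t η) := by
      refine (((h 1).isFT t ht).add (((h (-1)).isFT t ht).const_mul (-1))).congr_left ?_
      filter_upwards [Lp.coeFn_sub (u 1 t) (u (-1) t)] with x hx
      rw [hx, Pi.sub_apply]; ring
    have hsup : EnSup I (s - 1) (fun t η => ((jb η ^ (1 : ℝ) : ℝ) : ℂ) *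
        (r 1 t η + -1 * r (-1) t η)) := ((h 1).sup.add ((h (-1)).sup.const_mul (-1))).jb_mul 1
    have h1 := hd.multiplier (m := japaneseSymbol 1) (by
      simp only [japaneseSymbol_eq]; exact hsup.memLp (by linarith) ht)
    refine ((h1.const_mul Complex.I).congr_left (Lp.coeFn_smul Complex.I
      (multiplier (japaneseSymbol 1) (u 1 t - u (-1) t))).symm).congr
      (ae_of_all _ fun η => ?_)
    simp only [Fin.zero_eta, fd_zero, japaneseSymbol_eq, Real.rpow_one]
    ring
  · exact hm 0
  · exact hm 1

theorem EnInt.finset_sum {I : Set ℝ} {s : ℝ} {ι : Type*} (S : Finset ι) {F : ι → ℝ → Plane → ℂ}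
    (h : ∀ i ∈ S, EnInt I s (F i)) : EnInt I s (fun t η => ∑ i ∈ S, F i t η) := by
  classical
  induction S using Finset.induction_on with
  | empty => simpa using enInt_zero I s
  | insert i S hi ih =>
    simp only [Finset.sum_insert hi]
    exact (h i (Finset.mem_insert_self i S)).add (ih fun j hj => h j (Finset.mem_insert_of_mem hj))

theorem EnSup.finset_sum {I : Set ℝ} {s : ℝ} {ι : Type*} (S : Finset ι) {F : ι → ℝ → Plane → ℂ}
    (h : ∀ i ∈ S, EnSup I s (F i)) : EnSup I s (fun t η => ∑ i ∈ S, F i t η) := by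
  classical
  induction S using Finset.induction_on with
  | empty => simpa using enSup_zero I s
  | insert i S hi ih =>
    simp only [Finset.sum_insert hi]
    exact (h i (Finset.mem_insert_self i S)).add (ih fun j hj => h j (Finset.mem_insert_of_mem hj))

/-! ### The source term of the Higgs field -/

/-- The Fourier transform of `φ |φ|^{2k}`. -/
def powHat (r : ℤˣ → ℝ → Plane → ℂ) : ℕ → ℝ → Plane → ℂ
  | 0, t => tot r t
  | k + 1, t => conv (conv (powHat r k t) (tot r t)) (cneg (tot r t))

/-- Multiplication by a function of H^1 on the plane loses an arbitrarily small amount of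
regularity. The induction therefore treats all s < 1 at once and descends from (s+2)/3 through
(2s+1)/3 to s. -/
theorem isRep_pow {I : Set ℝ} {u : ℤˣ → ℝ → L2} {r : ℤˣ → ℝ → Plane → ℂ}
    (h : ∀ σ, FieldRep I 1 (u σ) (r σ)) (k : ℕ) : ∀ s : ℝ, 0 ≤ s → s < 1 →
    IsRep I s (fun t x => total u t x * (‖total u t x‖ ^ 2 : ℝ) ^ k) (powHat r k) := by
  have h1 := isRep_total h
  induction k with
  | zero =>
    intro s _ hs
    exact ⟨h1.sup.mono_exp hs.le, fun t ht => by simpa [powHat] using h1.isFT t ht⟩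
  | succ k ih =>
    intro s hs0 hs1
    have h2 := (ih ((s + 2) / 3) (by linarith) (by linarith)).mul (r := (2 * s + 1) / 3)
      (by linarith) (by linarith) (by linarith) (by linarith) h1
    have h3 := h2.mul (r := s) hs0 (by linarith) (by linarith) (by linarith) h1.conj
    refine ⟨h3.sup, fun t ht => (h3.isFT t ht).congr_left (ae_of_all _ fun x => ?_)⟩
    have e : (total u t x) * conj (total u t x) = ((‖total u t x‖ ^ 2 : ℝ) : ℂ) := by
      rw [Complex.mul_conj, Complex.normSq_eq_norm_sq]
    simp only
    rw [mul_assoc, e, pow_succ]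
    ring

/-- The part of the Fourier transform of `N` that is not a derivative nonlinearity. -/
def lowerN (V : Polynomial ℝ) (r : ℤˣ → ℝ → Plane → ℂ) (q : Fin 3 → ℤˣ → ℝ → Plane → ℂ) (t : ℝ)
    (η : Plane) : ℂ :=
  ∑ μ, (metric μ : ℂ) * conv (tot (q μ) t) (conv (tot (q μ) t) (tot r t)) η +
    -1 * ∑ k ∈ Finset.range (V.derivative.natDegree + 1),
      (V.derivative.coeff k : ℂ) * powHat r k t η + tot r t η

/-- The Fourier transform of `A_μ ∂^μ φ`. -/
def derivN (r : ℤˣ → ℝ → Plane → ℂ) (q : Fin 3 → ℤˣ → ℝ → Plane → ℂ) (t : ℝ)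
    (η : Plane) : ℂ :=
  ∑ μ, (metric μ : ℂ) * conv (tot (q μ) t) (fd r μ t) η

/-- The Fourier transform of `N`. -/
def sourceHat (V : Polynomial ℝ) (r : ℤˣ → ℝ → Plane → ℂ) (q : Fin 3 → ℤˣ → ℝ → Plane → ℂ) (t : ℝ)
    (η : Plane) : ℂ :=
  2 * Complex.I * derivN r q t η + lowerN V r q t η

section SourceN

variable {I : Set ℝ} {φ : ℤˣ → ℝ → L2} {A : Fin 3 → ℤˣ → ℝ → L2} {r : ℤˣ → ℝ → Plane → ℂ}
  {q : Fin 3 → ℤˣ → ℝ → Plane → ℂ}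

theorem enSup_lowerN (V : Polynomial ℝ) (hr : ∀ σ, FieldRep I 1 (φ σ) (r σ))
    (hq : ∀ μ σ, FieldRep I (1 / 2) (A μ σ) (q μ σ)) : EnSup I (-(1 / 50)) (lowerN V r q) := by
  have h1 := isRep_total hr
  refine ((EnSup.finset_sum _ fun μ _ => ?_).add ((EnSup.finset_sum _ fun k _ => ?_).const_mul _)).add
    (h1.sup.mono_exp (by norm_num))
  · have h2 := isRep_total (hq μ)
    -- One multiplication by A takes φ from order 1 to 49/100, a second one to any order below
    -- -1/100.
    exact (h2.sup.conv (α := 1 / 2) (β := 49 / 100) (by norm_num) (by norm_num) (by norm_num)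
      (by norm_num) (h2.sup.conv (β := 1) (by norm_num) (by norm_num) (by norm_num) (by norm_num)
      h1.sup)).const_mul _
  · exact (((isRep_pow hr k 0 le_rfl one_pos).sup).mono_exp (by norm_num)).const_mul _

/-- The product law for H^{1/2} times L², without null structure. It is the starting point of the
bootstrap. -/
theorem enSup_derivN (hr : ∀ σ, EnSup I 1 (r σ)) (hq : ∀ μ σ, EnSup I (1 / 2) (q μ σ)) :
    EnSup I (-(51 / 100)) (derivN r q) := by
  refine EnSup.finset_sum _ fun μ _ => ?_
  have h3 : EnSup I 0 (fd r μ) := by simpa using enSup_fd hr μ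
  exact ((enSup_tot (hq μ)).conv (by norm_num) (by norm_num) (by norm_num) (by norm_num)
    h3).const_mul _

theorem enSup_sourceHat (V : Polynomial ℝ) (hr : ∀ σ, FieldRep I 1 (φ σ) (r σ))
    (hq : ∀ μ σ, FieldRep I (1 / 2) (A μ σ) (q μ σ)) :
    EnSup I (-(51 / 100)) (sourceHat V r q) :=
  ((enSup_derivN (fun σ => (hr σ).sup) fun μ σ => (hq μ σ).sup).const_mul _).add
    ((enSup_lowerN V hr hq).mono_exp (by norm_num))

theorem hasFT_sourceN (V : Polynomial ℝ) (hr : ∀ σ, FieldRep I 1 (φ σ) (r σ))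
    (hq : ∀ μ σ, FieldRep I (1 / 2) (A μ σ) (q μ σ)) {t : ℝ} (ht : t ∈ I) :
    HasFT (sourceN V φ A t) (sourceHat V r q t) := by
  have h1 := isRep_total hr
  have hA := fun μ => isRep_total (hq μ)
  have hD := fun μ => isRep_fieldDeriv le_rfl hr μ
  have t1 := (HasFT.sum Finset.univ fun μ _ =>
    (((hA μ).isFT t ht).mul_hasFT ((hD μ).isFT t ht)).const_mul (metric μ : ℂ)).const_mul
      (2 * Complex.I)
  have t2 := HasFT.sum Finset.univ fun μ _ => (((hA μ).isFT t ht).mul_hasFT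
    (((hA μ).mul (r := 49 / 100) (by norm_num) (by norm_num) (by norm_num) (by norm_num) h1).isFT
      t ht)).const_mul (metric μ : ℂ)
  have t3 := (HasFT.sum (Finset.range (V.derivative.natDegree + 1)) fun k _ =>
    ((isRep_pow hr k 0 le_rfl one_pos).isFT t ht).hasFT.const_mul
      (V.derivative.coeff k : ℂ)).const_mul (-1)
  have t4 := (h1.isFT t ht).hasFT
  refine (t1.add ((t2.add t3).add t4)).congr (ae_of_all _ fun x => ?_) (ae_of_all _ fun η => ?_)
  · simp only [sourceN]
    rw [Polynomial.eval_eq_sum_range]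
    push_cast
    have e : ∀ p : ℂ, ∑ k ∈ Finset.range (V.derivative.natDegree + 1),
        (V.derivative.coeff k : ℂ) * (p * ((‖p‖ : ℂ) ^ 2) ^ k) =
        p * ∑ k ∈ Finset.range (V.derivative.natDegree + 1),
          (V.derivative.coeff k : ℂ) * ((‖p‖ : ℂ) ^ 2) ^ k := fun p => by
      rw [Finset.mul_sum]
      exact Finset.sum_congr rfl fun k _ => by ring
    rw [e, Fin.sum_univ_three, Fin.sum_univ_three, Fin.sum_univ_three, Fin.sum_univ_three]
    ring
  · simp only [sourceHat, derivN, lowerN]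

end SourceN

/-! ### Half-waves with a given source -/

theorem exists_halfWave {a b : ℝ} (hab : a < b) {α e : ℝ} {u : ℤˣ → ℝ → L2}
    {r : ℤˣ → ℝ → Plane → ℂ} (h : ∀ σ, FieldRep (Ioo a b) α (u σ) (r σ)) {S : ℝ → Plane → ℂ}
    (hS : EnInt (Ioo a b) e S)
    (hw : ∀ ρ : 𝓢(Plane, ℂ), HasCompactSupport ρ → ∀ χ : 𝓢(ℝ, ℂ), HasCompactSupport χ →
      tsupport χ ⊆ Ioo a b → ∀ σ, pairHalfWave σ (Ioo a b) (u σ) (tens χ (𝓕 ρ)) =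
        sgn σ * (1 / 2) * freqPair a b χ S (jmul (-1) ρ)) :
    ∃ w : ℤˣ → ℝ → Plane → ℂ, (∀ σ, FieldRep (Ioo a b) α (u σ) (w σ)) ∧
      (∀ σ, ∀ t ∈ Ioo a b, w σ t =ᵐ[volume] r σ t) ∧
      ∀ σ, PrimAE (Ioo a b) (w σ) (fun t η => Complex.I * sgn σ * jb η * w σ t η +
        -Complex.I * (sgn σ / 2) * ((jb η)⁻¹ : ℂ) * S t η) := by
  have key : ∀ σ, ∃ w, FieldRep (Ioo a b) α (u σ) w ∧ PrimAE (Ioo a b) w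
      (fun t η => Complex.I * sgn σ * jb η * w t η +
        -Complex.I * (sgn σ / 2) * ((jb η)⁻¹ : ℂ) * S t η) ∧
      ∀ t ∈ Ioo a b, w t =ᵐ[volume] r σ t := by
    intro σ
    obtain ⟨w, h1, h2, h3⟩ := (h σ).exists_primAE hab (σ := σ)
      (hS.jb_inv_mul (sgn σ * (1 / 2) : ℂ)) fun ρ hρ χ hχ hs => by
        rw [hw ρ hρ χ hχ hs σ, freqPair_jmul, ← freqPair_const_mul]
        simp only [Real.rpow_neg_one, Complex.ofReal_inv, mul_assoc]
    refine ⟨w, h1, h2.congr_ae fun t η => ?_, h3⟩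
    ring
  choose w h1 h2 h3 using key
  exact ⟨w, h1, h3, h2⟩

theorem halfWave_of_source {a b α e : ℝ} {w : ℤˣ → ℝ → Plane → ℂ} {S : ℝ → Plane → ℂ}
    (hw : ∀ σ, EnSup (Ioo a b) α (w σ)) (hS : EnInt (Ioo a b) e S)
    (h : ∀ σ, PrimAE (Ioo a b) (w σ) (fun t η => Complex.I * sgn σ * jb η * w σ t η +
        -Complex.I * (sgn σ / 2) * ((jb η)⁻¹ : ℂ) * S t η)) :
    HalfWave a b α (1 + e) w
      (fun σ t η => -Complex.I * (sgn σ / 2) * ((jb η)⁻¹ : ℂ) * S t η) :=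
  ⟨h, hw, fun σ => hS.jb_inv_mul _, fun t η => by simp [sgn]; ring⟩

theorem primAE_congr_source {a b α e e' : ℝ} {w : ℝ → Plane → ℂ} {c : Plane → ℂ} {c' : ℂ}
    {S S' : ℝ → Plane → ℂ} (hw : EnSup (Ioo a b) α w) (hc : Measurable c)
    (hS : EnInt (Ioo a b) e S) (hS' : EnInt (Ioo a b) e' S')
    (h : PrimAE (Ioo a b) w (fun t η => c η * w t η + c' * ((jb η)⁻¹ : ℂ) * S t η))
    (e : ∀ t ∈ Ioo a b, S t =ᵐ[volume] S' t) :
    PrimAE (Ioo a b) w (fun t η => c η * w t η + c' * ((jb η)⁻¹ : ℂ) * S' t η) := by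
  have m0 : Measurable fun p : ℝ × Plane => w p.1 p.2 := hw.1
  have m1 : Measurable fun p : ℝ × Plane => S p.1 p.2 := hS.1
  have m2 : Measurable fun p : ℝ × Plane => S' p.1 p.2 := hS'.1
  refine h.congr_deriv ordConnected_Ioo ?_ ?_ ?_
  · simp only [Function.uncurry_def]; fun_prop
  · simp only [Function.uncurry_def]; fun_prop
  · filter_upwards [ae_restrict_mem measurableSet_Ioo] with t ht
    filter_upwards [e t ht] with η hη
    rw [hη]

/-! ### The source term of the potential -/

/-- The terms of M are tested against different derivatives of one test function, hence the tensor
that varies with the index. Integrability of every summand lets the sum leave both integrals. -/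
theorem integral_sum_tens {a b : ℝ} {ι : Type*} (s : Finset ι) (c : ι → ℂ)
    {f F : ι → ℝ → Plane → ℂ} {χ : ι → 𝓢(ℝ, ℂ)} {ρ : ι → 𝓢(Plane, ℂ)} {e : ι → ℝ}
    (hρ : ∀ i, HasCompactSupport (ρ i)) (hF : ∀ i, EnInt (Ioo a b) (e i) (F i))
    (h : ∀ i, ∀ t ∈ Ioo a b, HasFT (f i t) (F i t)) :
    ∫ t in Ioo a b, ∫ x, ∑ i ∈ s, c i * (f i t x * tens (χ i) (𝓕 (ρ i)) (point t x)) =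
      ∑ i ∈ s, c i * freqPair a b (χ i) (F i) (ρ i) := by
  simp only [freqPair, ← integral_const_mul]
  rw [← integral_finsetSum _ fun i _ => by
    have := ((hF i).integrable_freq (χ i) (ρ i)).const_mul (c i)
    simpa only [← integral_const_mul] using this]
  refine setIntegral_congr_fun measurableSet_Ioo fun t ht => ?_
  simp only [tens_apply, point_zero, spacePart_point]
  rw [integral_finsetSum]
  · refine Finset.sum_congr rfl fun i _ => ?_
    rw [integral_const_mul, integral_const_mul, integral_const_mul, ← (h i t ht _ (hρ i)).2.2,
      ← integral_const_mul, ← integral_const_mul, ← integral_const_mul]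
    refine integral_congr_ae (ae_of_all _ fun x => ?_)
    simp only
    ring
  · intro i _
    refine (((h i t ht _ (hρ i)).1.const_mul (χ i t)).const_mul (c i)).congr
      (ae_of_all _ fun x => ?_)
    simp only
    ring

/-- The time factor of `∂_ν (χ ⊗ ψ)`. -/
def timeFactor (ν : Fin 3) (χ : 𝓢(ℝ, ℂ)) : 𝓢(ℝ, ℂ) :=
  Fin.cases (SchwartzMap.derivCLM ℂ ℂ χ) (fun _ => χ) ν

/-- The frequency factor of `∂_ν (χ ⊗ 𝓕 ρ)`. -/
def freqFactor (ν : Fin 3) (ρ : 𝓢(Plane, ℂ)) : 𝓢(Plane, ℂ) :=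
  Fin.cases ρ (fun j => -dmul j ρ) ν

theorem partialDeriv_tens (ν : Fin 3) (χ : 𝓢(ℝ, ℂ)) (ρ : 𝓢(Plane, ℂ)) :
    partialDeriv ν (tens χ (𝓕 ρ)) = tens (timeFactor ν χ) (𝓕 (freqFactor ν ρ)) := by
  refine Fin.cases ?_ (fun j => ?_) ν
  · exact partialDeriv_zero_tens χ _
  · exact partialDeriv_succ_tens χ ρ j

theorem hasCompactSupport_freqFactor {ρ : 𝓢(Plane, ℂ)} (hρ : HasCompactSupport ρ) (ν : Fin 3) :
    HasCompactSupport (freqFactor ν ρ) := by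
  refine Fin.cases ?_ (fun j => ?_) ν
  · exact hρ
  · exact hasCompactSupport_neg_dmul hρ j

/-- The derivative `∂_ν` of a function of time and frequency with time derivative `G'`. -/
def freqDeriv (G G' : ℝ → Plane → ℂ) (ν : Fin 3) (t : ℝ) (η : Plane) : ℂ :=
  Fin.cases (G' t η) (fun j => derivSymbol j η * G t η) ν

theorem freqPair_freqDeriv {a b : ℝ} (hab : a < b) {e e' : ℝ} {G G' : ℝ → Plane → ℂ}
    (hG : EnInt (Ioo a b) e G) (hG' : EnInt (Ioo a b) e' G') (h : PrimAE (Ioo a b) G G')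
    {χ : 𝓢(ℝ, ℂ)} (hs : tsupport χ ⊆ Ioo a b) (ρ : 𝓢(Plane, ℂ)) (ν : Fin 3) :
    freqPair a b (timeFactor ν χ) G (freqFactor ν ρ) = -freqPair a b χ (freqDeriv G G' ν) ρ := by
  refine Fin.cases ?_ (fun j => ?_) ν
  · exact freqPair_deriv hab hG hG' h hs ρ
  · simp only [freqPair, timeFactor, freqFactor, freqDeriv, Fin.cases_succ, ← integral_neg]
    congr 1; funext t
    rw [← mul_neg, ← integral_neg]
    congr 2; funext η
    rw [neg_apply, dmul_apply]
    ring

/-- The Fourier transform of `A |φ|²`. -/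
def cubicHat (r q : ℤˣ → ℝ → Plane → ℂ) (t : ℝ) : Plane → ℂ :=
  conv (conv (tot q t) (tot r t)) (cneg (tot r t))

/-- The Fourier transform of `∂_t (A |φ|²)`. -/
def cubicHat' (r q : ℤˣ → ℝ → Plane → ℂ) (t : ℝ) (η : Plane) : ℂ :=
  conv (fun η => conv (fd q 0 t) (tot r t) η + conv (tot q t) (fd r 0 t) η) (cneg (tot r t)) η +
    conv (conv (tot q t) (tot r t)) (cneg (fd r 0 t)) η

/-- The Fourier transform of the terms of `M_μ` other than the null forms. -/
def lowerM (κ : ℝ) (r : ℤˣ → ℝ → Plane → ℂ) (q : Fin 3 → ℤˣ → ℝ → Plane → ℂ) (μ : Fin 3) (t : ℝ)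
    (η : Plane) : ℂ :=
  ∑ ν, ∑ ρ, (2 * (κ⁻¹ : ℝ) * leviCivita μ ν ρ * metric ρ * metric ν : ℂ) *
      freqDeriv (cubicHat r (q ρ)) (cubicHat' r (q ρ)) ν t η + tot (q μ) t η

/-- The Fourier transform of the null forms of `M_μ`. -/
def nullM (κ : ℝ) (r : ℤˣ → ℝ → Plane → ℂ) (μ : Fin 3) (t : ℝ) (η : Plane) : ℂ :=
  ∑ ν, ∑ ρ, (Complex.I * (κ⁻¹ : ℝ) * leviCivita μ ν ρ * metric ν * metric ρ : ℂ) *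
    nullBil (fun _ _ => 1) (bar r) r ν ρ t η

/-- The Fourier transform of `M_μ`. -/
def currentHat (κ : ℝ) (r : ℤˣ → ℝ → Plane → ℂ) (q : Fin 3 → ℤˣ → ℝ → Plane → ℂ) (μ : Fin 3) (t : ℝ)
    (η : Plane) : ℂ :=
  nullM κ r μ t η + lowerM κ r q μ t η

section Current

variable {a b : ℝ} {φ : ℤˣ → ℝ → L2} {A : Fin 3 → ℤˣ → ℝ → L2} {r : ℤˣ → ℝ → Plane → ℂ}
  {q : Fin 3 → ℤˣ → ℝ → Plane → ℂ}

theorem enSup_cubicHat {I : Set ℝ} {q : ℤˣ → ℝ → Plane → ℂ} (hr : ∀ σ, EnSup I 1 (r σ))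
    (hq : ∀ σ, EnSup I (1 / 2) (q σ)) : EnSup I (49 / 100) (cubicHat r q) :=
  ((enSup_tot hq).conv (r := 99 / 200) (by norm_num) (by norm_num) (by norm_num) (by norm_num)
    (enSup_tot hr)).conv (by norm_num) (by norm_num) (by norm_num) (by norm_num)
    (enSup_tot hr).cneg

theorem enSup_cubicHat' {I : Set ℝ} {q : ℤˣ → ℝ → Plane → ℂ} (hr : ∀ σ, EnSup I 1 (r σ))
    (hq : ∀ σ, EnSup I (1 / 2) (q σ)) : EnSup I (-(51 / 100)) (cubicHat' r q) := by
  have h1 : EnSup I 0 (fd r 0) := by simpa using enSup_fd hr 0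
  have h2 : EnSup I (-(1 / 2)) (fd q 0) := by
    have := enSup_fd hq 0
    norm_num at this ⊢
    exact this
  have h3 := enSup_tot hr
  have h4 := enSup_tot hq
  have h5 := ((h2.conv (r := -(101 / 200)) (by norm_num) (by norm_num) (by norm_num) (by norm_num)
    h3).add (h4.conv (r := -(101 / 200)) (by norm_num) (by norm_num) (by norm_num) (by norm_num)
    h1)).conv (r := -(51 / 100)) (by norm_num) (by norm_num) (by norm_num) (by norm_num) h3.cneg
  exact h5.add ((h4.conv (r := 99 / 200) (by norm_num) (by norm_num) (by norm_num) (by norm_num)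
    h3).conv (by norm_num) (by norm_num) (by norm_num) (by norm_num) h1.cneg)

/-- The product rule, twice. Only total fields occur, and their time derivatives are known without
the sources, so this is available before M is identified. -/
theorem primAE_cubicHat {q : ℤˣ → ℝ → Plane → ℂ} (hr : ∀ σ, EnSup (Ioo a b) 1 (r σ))
    (hq : ∀ σ, EnSup (Ioo a b) (1 / 2) (q σ)) (hrp : PrimAE (Ioo a b) (tot r) (fd r 0))
    (hqp : PrimAE (Ioo a b) (tot q) (fd q 0)) :
    PrimAE (Ioo a b) (cubicHat r q) (cubicHat' r q) := by
  have h1 : EnSup (Ioo a b) 0 (fd r 0) := by simpa using enSup_fd hr 0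
  have h2 : EnSup (Ioo a b) (-(1 / 2)) (fd q 0) := by
    have := enSup_fd hq 0
    norm_num at this ⊢
    exact this
  have h3 := enSup_tot hr
  have h4 := enSup_tot hq
  have fin : ∀ {s : ℝ} {F : ℝ → Plane → ℂ}, EnSup (Ioo a b) s F → EnInt (Ioo a b) s F :=
    fun h => h.enInt (by simp) measurableSet_Ioo
  have k1 := primAE_bil (K := fun _ _ => 1) (by norm_num) (by norm_num) (by norm_num)
    measurable_const (by simp) h4 (fin h2) h3 (fin h1) hqp hrp
  have h5 := (h2.conv (r := -(101 / 200)) (by norm_num) (by norm_num) (by norm_num) (by norm_num)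
    h3).add (h4.conv (r := -(101 / 200)) (by norm_num) (by norm_num) (by norm_num) (by norm_num)
    h1)
  have h6 := h4.conv (r := 99 / 200) (by norm_num) (by norm_num) (by norm_num) (by norm_num) h3
  exact primAE_bil (K := fun _ _ => 1) (by norm_num) (by norm_num) (by norm_num)
    measurable_const (by simp) h6 (fin h5) h3.cneg (fin h1.cneg) k1 hrp.cneg

theorem enSup_freqDeriv {I : Set ℝ} {q : ℤˣ → ℝ → Plane → ℂ} (hr : ∀ σ, EnSup I 1 (r σ))
    (hq : ∀ σ, EnSup I (1 / 2) (q σ)) (ν : Fin 3) :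
    EnSup I (-(51 / 100)) (freqDeriv (cubicHat r q) (cubicHat' r q) ν) := by
  refine Fin.cases ?_ (fun j => ?_) ν
  · exact enSup_cubicHat' hr hq
  · have := (enSup_cubicHat hr hq).derivSymbol_mul j
    norm_num at this ⊢
    exact this

theorem enSup_lowerM {I : Set ℝ} (κ : ℝ) (hr : ∀ σ, EnSup I 1 (r σ))
    (hq : ∀ μ σ, EnSup I (1 / 2) (q μ σ)) (μ : Fin 3) : EnSup I (-(51 / 100)) (lowerM κ r q μ) :=
  (EnSup.finset_sum _ fun ν _ => EnSup.finset_sum _ fun ρ _ =>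
    (enSup_freqDeriv hr (hq ρ) ν).const_mul _).add ((enSup_tot (hq μ)).mono_exp (by norm_num))

theorem enSup_bar {I : Set ℝ} {s : ℝ} {u : ℤˣ → ℝ → Plane → ℂ} (h : ∀ σ, EnSup I s (u σ)) (σ : ℤˣ) :
    EnSup I s (bar u σ) := (h (-σ)).cneg

/-- Products of two L² functions lie in every H^s with s < -1; cancellation in the null form is not
yet used. -/
theorem enSup_nullM {I : Set ℝ} (κ : ℝ) (hr : ∀ σ, EnSup I 1 (r σ)) (μ : Fin 3) :
    EnSup I (-(101 / 100)) (nullM κ r μ) := by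
  refine EnSup.finset_sum _ fun ν _ => EnSup.finset_sum _ fun ρ _ => EnSup.const_mul ?_ _
  have h1 : ∀ μ, EnSup I 0 (fd r μ) := fun μ => by simpa using enSup_fd hr μ
  have h2 : ∀ μ, EnSup I 0 (fd (bar r) μ) := fun μ => by simpa using enSup_fd (enSup_bar hr) μ
  have h3 : ∀ μ ν, EnSup I (-(101 / 100)) fun t => conv (fd (bar r) μ t) (fd r ν t) := fun μ ν =>
    (h2 μ).conv (by norm_num) (by norm_num) (by norm_num) (by norm_num) (h1 ν)
  have h4 := (h3 ν ρ).add ((h3 ρ ν).const_mul (-1))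
  refine h4.congr ?_ fun t _ => ae_of_all _ fun η => ?_
  · have m1 : Measurable fun p : ℝ × Plane => conv (fd (bar r) ν p.1) (fd r ρ p.1) p.2 := (h3 ν ρ).1
    have m2 : Measurable fun p : ℝ × Plane => conv (fd (bar r) ρ p.1) (fd r ν p.1) p.2 := (h3 ρ ν).1
    exact m1.sub m2
  · simp only [nullBil]; ring

theorem enSup_currentHat {I : Set ℝ} (κ : ℝ) (hr : ∀ σ, EnSup I 1 (r σ))
    (hq : ∀ μ σ, EnSup I (1 / 2) (q μ σ)) (μ : Fin 3) :
    EnSup I (-(101 / 100)) (currentHat κ r q μ) :=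
  (enSup_nullM κ hr μ).add ((enSup_lowerM κ hr hq μ).mono_exp (by norm_num))

/-- The null form of φ̄ and φ is the difference of a number and its conjugate, hence purely
imaginary; its imaginary part is -i times itself and remains bilinear. -/
theorem hasFT_nullForm_im {I : Set ℝ} (hr : ∀ σ, FieldRep I 1 (φ σ) (r σ)) (ν ρ : Fin 3) {t : ℝ}
    (ht : t ∈ I) :
    HasFT (fun x => ((nullForm φ ν ρ t x).im : ℂ))
      (fun η => (-Complex.I * metric ν * metric ρ) * nullBil (fun _ _ => 1) (bar r) r ν ρ t η) := by
  have hD := fun μ => (isRep_fieldDeriv le_rfl hr μ).isFT t ht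
  have h1 := ((hD ν).conj.mul_hasFT (hD ρ)).add (((hD ρ).conj.mul_hasFT (hD ν)).const_mul (-1))
  refine (h1.const_mul (-Complex.I * metric ν * metric ρ)).congr (ae_of_all _ fun x => ?_)
    (ae_of_all _ fun η => ?_)
  · simp only [nullForm]
    set X := (fieldDeriv φ ν t : Plane → ℂ) x
    set Y := (fieldDeriv φ ρ t : Plane → ℂ) x
    apply Complex.ext <;> simp <;> first | (left; ring1) | (right; ring1)
  · simp only [nullBil, cneg_fd]; ring

theorem hasFT_cubic {I : Set ℝ} (hr : ∀ σ, FieldRep I 1 (φ σ) (r σ))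
    {B : ℤˣ → ℝ → L2} {q : ℤˣ → ℝ → Plane → ℂ}
    (hq : ∀ σ, FieldRep I (1 / 2) (B σ) (q σ)) {t : ℝ} (ht : t ∈ I) :
    HasFT (fun x => total B t x * (‖total φ t x‖ ^ 2 : ℝ)) (cubicHat r q t) := by
  have h1 := isRep_total hr
  have h2 := (isRep_total hq).mul (r := 99 / 200) (by norm_num) (by norm_num) (by norm_num)
    (by norm_num) h1
  refine ((h2.isFT t ht).mul_hasFT (h1.conj.isFT t ht)).congr (ae_of_all _ fun x => ?_)
    EventuallyEq.rfl
  simp only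
  rw [mul_assoc, Complex.mul_conj, Complex.normSq_eq_norm_sq]

theorem pairM_tens (hab : a < b) (κ : ℝ) (hr : ∀ σ, FieldRep (Ioo a b) 1 (φ σ) (r σ))
    (hq : ∀ μ σ, FieldRep (Ioo a b) (1 / 2) (A μ σ) (q μ σ))
    (hrp : PrimAE (Ioo a b) (tot r) (fd r 0)) (hqp : ∀ μ, PrimAE (Ioo a b) (tot (q μ)) (fd (q μ) 0))
    (μ : Fin 3) {χ : 𝓢(ℝ, ℂ)} (hs : tsupport χ ⊆ Ioo a b) {ρ : 𝓢(Plane, ℂ)}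
    (hρ : HasCompactSupport ρ) :
    pairM κ (Ioo a b) φ A μ (tens χ (𝓕 ρ)) = freqPair a b χ (currentHat κ r q μ) ρ := by
  have fin : ∀ {s : ℝ} {F : ℝ → Plane → ℂ}, EnSup (Ioo a b) s F → EnInt (Ioo a b) s F :=
    fun h => h.enInt (by simp) measurableSet_Ioo
  have hrs := fun σ => (hr σ).sup
  have hqs := fun μ σ => (hq μ σ).sup
  -- The index `none` collects what is tested against θ itself, an index (ν, ρ) the cubic term
  -- tested against a derivative of θ.
  set c : Option (Fin 3 × Fin 3) → ℂ := fun i => i.elim 1 fun p =>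
    -(2 * (κ⁻¹ : ℝ) * leviCivita μ p.1 p.2 * metric p.2 * metric p.1 : ℂ) with hc
  set f : Option (Fin 3 × Fin 3) → ℝ → Plane → ℂ := fun i => i.elim
    (fun t x => ∑ ν, ∑ ρ, (-(κ⁻¹ : ℝ) * leviCivita μ ν ρ : ℂ) * ((nullForm φ ν ρ t x).im : ℂ) +
      total (A μ) t x)
    fun p t x => total (A p.2) t x * (‖total φ t x‖ ^ 2 : ℝ) with hf
  set F : Option (Fin 3 × Fin 3) → ℝ → Plane → ℂ := fun i => i.elim
    (fun t η => nullM κ r μ t η + tot (q μ) t η) fun p => cubicHat r (q p.2) with hF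
  set X : Option (Fin 3 × Fin 3) → 𝓢(ℝ, ℂ) := fun i => i.elim χ fun p => timeFactor p.1 χ with hX
  set R : Option (Fin 3 × Fin 3) → 𝓢(Plane, ℂ) := fun i => i.elim ρ fun p => freqFactor p.1 ρ with hR
  set e : Option (Fin 3 × Fin 3) → ℝ := fun i => i.elim (-(101 / 100)) fun _ => 49 / 100 with he
  have h0 : EnSup (Ioo a b) (-(101 / 100)) (fun t η => nullM κ r μ t η + tot (q μ) t η) :=
    (enSup_nullM κ hrs μ).add ((enSup_tot (hqs μ)).mono_exp (by norm_num))
  have key := integral_sum_tens (a := a) (b := b) Finset.univ c (f := f) (F := F) (χ := X) (ρ := R)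
    (e := e) ?_ ?_ ?_
  · have l : pairM κ (Ioo a b) φ A μ (tens χ (𝓕 ρ)) =
        ∫ t in Ioo a b, ∫ x, ∑ i, c i * (f i t x * tens (X i) (𝓕 (R i)) (point t x)) := by
      simp only [pairM]
      congr 1; funext t; congr 1; funext x
      rw [Fintype.sum_option]
      simp only [hc, hf, hX, hR, Option.elim, Fintype.sum_prod_type, partialDeriv_tens]
      simp only [Fin.sum_univ_three]
      ring
    rw [l, key, Fintype.sum_option, Fintype.sum_prod_type]
    simp only [hc, hF, hX, hR, Option.elim]
    have hG := fun p => fin (enSup_cubicHat hrs (hqs p))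
    have hG' := fun p => fin (enSup_cubicHat' hrs (hqs p))
    simp only [freqPair_freqDeriv hab (hG _) (hG' _) (primAE_cubicHat hrs (hqs _) hrp (hqp _)) hs]
    have hD := fun ν p => fin (enSup_freqDeriv hrs (hqs p) ν)
    have e1 : currentHat κ r q μ = fun t η => (nullM κ r μ t η + tot (q μ) t η) +
        ∑ ν, ∑ ρ, (2 * (κ⁻¹ : ℝ) * leviCivita μ ν ρ * metric ρ * metric ν : ℂ) *
          freqDeriv (cubicHat r (q ρ)) (cubicHat' r (q ρ)) ν t η := by
      funext t η; simp only [currentHat, lowerM]; ring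
    have hS : ∀ ν, EnInt (Ioo a b) (-(51 / 100)) (fun t η => ∑ ρ,
        (2 * (κ⁻¹ : ℝ) * leviCivita μ ν ρ * metric ρ * metric ν : ℂ) *
          freqDeriv (cubicHat r (q ρ)) (cubicHat' r (q ρ)) ν t η) := fun ν =>
      EnInt.finset_sum _ fun p _ => (hD ν p).const_mul _
    rw [e1, freqPair_add (fin h0) (EnInt.finset_sum _ fun ν _ => hS ν),
      freqPair_sum _ fun ν _ => hS ν]
    congr 1
    · rw [one_mul]
    · refine Finset.sum_congr rfl fun ν _ => ?_
      rw [freqPair_sum _ fun p _ => (hD ν p).const_mul _]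
      refine Finset.sum_congr rfl fun p _ => ?_
      rw [freqPair_const_mul]; ring
  · rintro (_ | p)
    · exact hρ
    · exact hasCompactSupport_freqFactor hρ _
  · rintro (_ | p)
    · exact fin h0
    · exact fin (enSup_cubicHat hrs (hqs _))
  · rintro (_ | p) t ht
    · refine HasFT.congr ((HasFT.sum Finset.univ fun ν _ => HasFT.sum Finset.univ fun p _ =>
        (hasFT_nullForm_im hr ν p ht).const_mul (-(κ⁻¹ : ℝ) * leviCivita μ ν p : ℂ)).add
        ((isRep_total (hq μ)).isFT t ht).hasFT) EventuallyEq.rfl (ae_of_all _ fun η => ?_)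
      simp only [hF, Option.elim, nullM]
      congr 1
      refine Finset.sum_congr rfl fun ν _ => Finset.sum_congr rfl fun p _ => ?_
      ring
    · exact hasFT_cubic hr (hq _) ht

theorem tot_congr {u v : ℤˣ → ℝ → Plane → ℂ} {t : ℝ} (h : ∀ σ, u σ t =ᵐ[volume] v σ t) :
    tot u t =ᵐ[volume] tot v t := (h 1).add (h (-1))

theorem fd_congr {u v : ℤˣ → ℝ → Plane → ℂ} {t : ℝ} (h : ∀ σ, u σ t =ᵐ[volume] v σ t) (μ : Fin 3) :
    fd u μ t =ᵐ[volume] fd v μ t := by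
  filter_upwards [h 1, h (-1)] with η h1 h2
  rw [fd, fd, h1, h2]

theorem currentHat_congr (κ : ℝ) {r' : ℤˣ → ℝ → Plane → ℂ} {q' : Fin 3 → ℤˣ → ℝ → Plane → ℂ} {t : ℝ}
    (hr : ∀ σ, r σ t =ᵐ[volume] r' σ t) (hq : ∀ μ σ, q μ σ t =ᵐ[volume] q' μ σ t) (μ : Fin 3) :
    currentHat κ r q μ t =ᵐ[volume] currentHat κ r' q' μ t := by
  have hb : ∀ σ, bar r σ t =ᵐ[volume] bar r' σ t := fun σ => cneg_congr (hr (-σ))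
  have e1 : ∀ ν ρ η, nullBil (fun _ _ => 1) (bar r) r ν ρ t η =
      nullBil (fun _ _ => 1) (bar r') r' ν ρ t η := by
    intro ν ρ η
    exact congrArg₂ (· - ·) (congrFun (conv_congr (fd_congr hb ν) (fd_congr hr ρ)) η)
      (congrFun (conv_congr (fd_congr hb ρ) (fd_congr hr ν)) η)
  have e0 : ∀ ρ, conv (tot (q ρ) t) (tot r t) = conv (tot (q' ρ) t) (tot r' t) := fun ρ =>
    conv_congr (tot_congr (hq ρ)) (tot_congr hr)
  have e2 : ∀ ρ, cubicHat r (q ρ) t = cubicHat r' (q' ρ) t := fun ρ => by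
    rw [cubicHat, cubicHat, e0, conv_congr EventuallyEq.rfl (cneg_congr (tot_congr hr))]
  have e3 : ∀ ρ η, cubicHat' r (q ρ) t η = cubicHat' r' (q' ρ) t η := fun ρ η => by
    rw [cubicHat', cubicHat', e0, conv_congr (fd_congr (hq ρ) 0) (tot_congr hr),
      conv_congr (tot_congr (hq ρ)) (fd_congr hr 0),
      conv_congr EventuallyEq.rfl (cneg_congr (tot_congr hr)),
      conv_congr EventuallyEq.rfl (cneg_congr (fd_congr hr 0))]
  filter_upwards [tot_congr (hq μ)] with η hη
  simp only [currentHat, nullM, lowerM, freqDeriv, e1, e2, e3, hη]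

end Current

/-! ### The Lorenz gauge and the null structure of the Higgs equation -/

theorem ae_eq_zero_of_prim {a b : ℝ} (hab : a < b) {w d : ℝ → ℂ} (h : Prim (Ioo a b) w d)
    (hw : ∀ᵐ t ∂(volume.restrict (Ioo a b)), w t = 0) :
    ∀ᵐ t ∂(volume.restrict (Ioo a b)), d t = 0 := by
  rw [ae_restrict_iff' measurableSet_Ioo]
  refine isOpen_Ioo.ae_eq_zero_of_integral_contDiff_smul_eq_zero
    h.1.locallyIntegrableOn fun g hg hgc hgs => ?_
  have g1 : HasCompactSupport fun t => ((g t : ℝ) : ℂ) := hgc.comp_left (g := Complex.ofReal) rfl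
  have g2 : ContDiff ℝ ∞ fun t => ((g t : ℝ) : ℂ) := Complex.ofRealCLM.contDiff.comp hg
  have hs : tsupport (g1.toSchwartzMap g2) ⊆ Ioo a b := by
    refine Subset.trans (closure_mono fun t ht => ?_) hgs
    intro h0
    exact ht (by change ((g t : ℝ) : ℂ) = 0; rw [h0]; rfl)
  have h1 := h.integral_deriv_mul hab (g1.toSchwartzMap g2) hs
  have h2 : ∫ t in Ioo a b, deriv (g1.toSchwartzMap g2) t * w t = 0 := by
    refine integral_eq_zero_of_ae ?_
    filter_upwards [hw] with t ht
    rw [ht, mul_zero]; rfl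
  rw [h2] at h1
  have h3 : ∫ t, g t • d t = ∫ t in Ioo a b, (g1.toSchwartzMap g2) t * d t := by
    rw [← setIntegral_eq_integral_of_forall_compl_eq_zero (s := Ioo a b)]
    · rfl
    · intro t ht
      rw [image_eq_zero_of_notMem_tsupport fun h' => ht (hgs h'), zero_smul]
  rw [h3, ← neg_eq_zero, ← h1]

/-- The hypothesis is read as the weak equation ∂_t 0 = L. The strong form of that equation exhibits
L as the derivative of a function that vanishes almost everywhere. -/
theorem ae_eq_zero_of_freqPair {a b : ℝ} (hab : a < b) {e : ℝ} {L : ℝ → Plane → ℂ}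
    (hL : EnInt (Ioo a b) e L)
    (h : ∀ ρ : 𝓢(Plane, ℂ), HasCompactSupport ρ → ∀ χ : 𝓢(ℝ, ℂ), HasCompactSupport χ →
      tsupport χ ⊆ Ioo a b → freqPair a b χ L ρ = 0) :
    ∀ᵐ t ∂(volume.restrict (Ioo a b)), ∀ᵐ η, L t η = 0 := by
  obtain ⟨w, w1, w2, w3⟩ := exists_primAE_of_weak hab (enSup_zero (Ioo a b) e) hL
    (fun ρ _ => by simpa using continuousOn_const) fun ρ hρ χ hχ hs => by
      have := h ρ hρ χ hχ hs
      rw [freqPair] at this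
      rw [this]
      simp
  have m1 : MeasurableSet {p : ℝ × Plane | w p.1 p.2 = 0} :=
    measurableSet_eq_fun w1.1 measurable_const
  have m2 : MeasurableSet {p : ℝ × Plane | L p.1 p.2 = 0} :=
    measurableSet_eq_fun hL.1 measurable_const
  have h1 : ∀ᵐ t ∂(volume.restrict (Ioo a b)), ∀ᵐ η, w t η = 0 := by
    filter_upwards [ae_restrict_mem measurableSet_Ioo] with t ht using w3 t ht
  refine (Measure.ae_ae_comm (p := fun t η => L t η = 0) m2).2 ?_
  filter_upwards [w2, (Measure.ae_ae_comm (p := fun t η => w t η = 0) m1).1 h1] with η k1 k2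
  exact ae_eq_zero_of_prim hab k1 k2

/-- The Lorenz gauge condition on the Fourier side. -/
theorem lorenz_ae {a b : ℝ} (hab : a < b) {A : Fin 3 → ℤˣ → ℝ → L2}
    {q : Fin 3 → ℤˣ → ℝ → Plane → ℂ} (hq : ∀ μ σ, FieldRep (Ioo a b) (1 / 2) (A μ σ) (q μ σ))
    (hqp : ∀ μ, PrimAE (Ioo a b) (tot (q μ)) (fd (q μ) 0))
    (h : ∀ θ : 𝓢(Spacetime, ℂ), IsTest (Ioo a b) θ →
      ∑ μ, (metric μ : ℂ) * pairing (Ioo a b) (fun t x => total (A μ) t x) (partialDeriv μ θ) = 0) :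
    ∀ᵐ t ∂(volume.restrict (Ioo a b)), ∀ᵐ η, ∑ μ, (metric μ : ℂ) * fd (q μ) μ t η = 0 := by
  have fin : ∀ {s : ℝ} {F : ℝ → Plane → ℂ}, EnSup (Ioo a b) s F → EnInt (Ioo a b) s F :=
    fun h => h.enInt (by simp) measurableSet_Ioo
  have hqs := fun μ σ => (hq μ σ).sup
  have hd := fun μ ν => fin (enSup_fd (hqs μ) ν)
  refine ae_eq_zero_of_freqPair hab (EnInt.finset_sum _ fun μ _ => (hd μ μ).const_mul _)
    fun ρ hρ χ hχ hs => ?_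
  have h1 := h _ (isTest_tens hχ hs (𝓕 ρ))
  rw [freqPair_sum _ fun μ _ => (hd μ μ).const_mul _, ← neg_eq_zero, ← h1, ← Finset.sum_neg_distrib]
  refine Finset.sum_congr rfl fun μ _ => ?_
  rw [freqPair_const_mul, partialDeriv_tens, pairing_tens_freqPair
    (fun t ht => ((isRep_total (hq μ)).isFT t ht).hasFT) _ (hasCompactSupport_freqFactor hρ μ),
    freqPair_freqDeriv hab (fin (enSup_tot (hqs μ))) (hd μ 0) (hqp μ) hs, mul_neg]
  congr 3
  funext t η
  refine Fin.cases ?_ (fun j => ?_) μ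
  · rfl
  · rw [fd_succ]; rfl

/-- The symbol of `⟨∇⟩⁻² ∂_j`. -/
def smoothSymbol (j : Fin 2) (η : Plane) : ℂ := (((jb η ^ 2)⁻¹ : ℝ) : ℂ) * derivSymbol j η

@[fun_prop] theorem measurable_smoothSymbol (j : Fin 2) : Measurable (smoothSymbol j) := by
  unfold smoothSymbol; fun_prop

theorem enorm_smoothSymbol_le (j : Fin 2) (η : Plane) : ‖smoothSymbol j η‖ₑ ≤ 1 * jw (-1) η := by
  have e : (((jb η ^ 2)⁻¹ : ℝ) : ℂ) = ((jb η ^ (-2 : ℝ) : ℝ) : ℂ) := by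
    rw [Real.rpow_neg (jb_pos η).le, Real.rpow_two]
  rw [smoothSymbol, e, enorm_mul, enorm_jb_rpow, one_mul, show (-1 : ℝ) = -2 + 1 by norm_num, jw_add]
  gcongr
  exact enorm_derivSymbol_le j η

theorem HalfWave.symbol_mul {a b α β r : ℝ} {u E : ℤˣ → ℝ → Plane → ℂ} (h : HalfWave a b α β u E)
    {m : Plane → ℂ} (hm : Measurable m) {c : ℝ≥0∞} (hc : c ≠ ⊤) (hb : ∀ η, ‖m η‖ₑ ≤ c * jw r η) :
    HalfWave a b (α - r) (β - r) (fun σ t η => m η * u σ t η) (fun σ t η => m η * E σ t η) := by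
  refine ⟨fun σ => ((h.prim σ).mul m).congr_ae fun t η => ?_,
    fun σ => (h.sup σ).mul hm hc hb, fun σ => (h.int σ).mul hm hc hb, fun t η => ?_⟩
  · ring
  · rw [← mul_add, h.cancel, mul_zero]

/-- The smoothed derivative `⟨∇⟩⁻² ∂_j A`. -/
def smoothField (j : Fin 2) (u : ℤˣ → ℝ → Plane → ℂ) (σ : ℤˣ) (t : ℝ) (η : Plane) : ℂ :=
  smoothSymbol j η * u σ t η

theorem fd_smoothField (j : Fin 2) (u : ℤˣ → ℝ → Plane → ℂ) (μ : Fin 3) (t : ℝ) (η : Plane) :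
    fd (smoothField j u) μ t η = smoothSymbol j η * fd u μ t η := by
  simp only [fd, smoothField]; ring

/-- This is 1 = ⟨∇⟩⁻²(1 - Δ) with Δ written as a sum of squares of derivatives, one of them kept
inside the smoothed field. -/
theorem tot_eq_sub_fd_smoothField (u : ℤˣ → ℝ → Plane → ℂ) (t : ℝ) (η : Plane) :
    tot u t η = ((jb η ^ 2)⁻¹ : ℝ) * tot u t η - ∑ j : Fin 2, fd (smoothField j u) j.succ t η := by
  have hn : ‖η‖ ^ 2 = η 0 ^ 2 + η 1 ^ 2 := by
    rw [EuclideanSpace.norm_sq_eq, Fin.sum_univ_two, Real.norm_eq_abs, Real.norm_eq_abs, sq_abs,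
      sq_abs]
  have h : ((jb η : ℂ)) ^ 2 = 1 + (2 * Real.pi) ^ 2 * ((η 0 : ℂ) ^ 2 + (η 1 : ℂ) ^ 2) := by
    rw [← Complex.ofReal_pow, jb_sq, mul_pow, hn]
    push_cast
    ring
  have hjb : (jb η : ℂ) ≠ 0 := Complex.ofReal_ne_zero.2 (jb_pos η).ne'
  simp only [Fin.sum_univ_two, fd_smoothField]
  simp only [fd_succ, smoothSymbol, derivSymbol]
  push_cast
  field_simp
  rw [h]
  linear_combination ((2 * Real.pi) ^ 2 * ((η 0 : ℂ) ^ 2 + (η 1 : ℂ) ^ 2) * tot u t η) *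
    Complex.I_sq

/-! ### The null structure of A_μ ∂^μ φ -/

section DerivN

variable {I : Set ℝ} {r : ℤˣ → ℝ → Plane → ℂ} {q : Fin 3 → ℤˣ → ℝ → Plane → ℂ}

theorem conv_sum_left {ι : Type*} (s : Finset ι) {F : ι → Plane → ℂ} {G : Plane → ℂ} {ξ : Plane}
    (h : ∀ i ∈ s, Integrable fun η => 1 * (F i η * G (ξ - η))) :
    conv (fun η => ∑ i ∈ s, F i η) G ξ = ∑ i ∈ s, conv (F i) G ξ := by
  simp only [conv, bil]
  rw [← integral_finsetSum _ h]
  simp only [Finset.sum_mul, Finset.mul_sum]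

theorem conv_const_mul_left (c : ℂ) (F G : Plane → ℂ) (ξ : Plane) :
    conv (fun η => c * F η) G ξ = c * conv F G ξ := by
  simp only [conv, bil]
  rw [← integral_const_mul]
  congr 1; funext η; ring

/-- After `tot_eq_sub_fd_smoothField`, the products ∂_j B_{jμ} ∂_μ φ differ from null forms by ∂_μ
B_{jμ} ∂_j φ. Summed with the metric, ∂_μ B_{jμ} is ⟨∇⟩⁻²∂_j of the gauge condition, so these
differences vanish. -/
theorem derivN_eq (hr : ∀ σ, EnSup I 1 (r σ)) (hq : ∀ μ σ, EnSup I (1 / 2) (q μ σ)) {t : ℝ}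
    (ht : t ∈ I) (hL : ∀ᵐ η, ∑ μ, (metric μ : ℂ) * fd (q μ) μ t η = 0) (ξ : Plane) :
    derivN r q t ξ =
      ∑ μ, (metric μ : ℂ) * conv (fun η => ((jb η ^ 2)⁻¹ : ℝ) * tot (q μ) t η) (fd r μ t) ξ +
        ∑ μ, ∑ j : Fin 2, (-metric μ : ℂ) *
          nullBil (fun _ _ => 1) (smoothField j (q μ)) r j.succ μ t ξ := by
  have h0 : ∀ μ, EnSup I 0 (fd r μ) := fun μ => by simpa using enSup_fd hr μ
  have h1 : ∀ j μ σ, EnSup I (3 / 2) (smoothField j (q μ) σ) := fun j μ σ => by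
    have := (hq μ σ).mul (measurable_smoothSymbol j) ENNReal.one_ne_top (enorm_smoothSymbol_le j)
    norm_num at this ⊢
    exact this
  have h2 : ∀ j μ ν, EnSup I (1 / 2) (fd (smoothField j (q μ)) ν) := fun j μ ν => by
    have := enSup_fd (h1 j μ) ν
    norm_num at this ⊢
    exact this
  have h3 : ∀ μ, EnSup I (1 / 2) (fun t η => (((jb η ^ 2)⁻¹ : ℝ) : ℂ) * tot (q μ) t η) := fun μ => by
    have h := (enSup_tot (hq μ)).jb_mul (-2)
    have e : ∀ η, jb η ^ (-2 : ℝ) = (jb η ^ 2)⁻¹ := fun η => by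
      rw [Real.rpow_neg (jb_pos η).le, Real.rpow_two]
    simp only [e] at h
    exact h.mono_exp (by norm_num)
  have int : ∀ {F G : ℝ → Plane → ℂ}, EnSup I (1 / 2) F → EnSup I 0 G →
      Integrable fun η => 1 * (F t η * G t (ξ - η)) := fun hF hG =>
    hF.integrable_bil (K := fun _ _ => 1) (by norm_num) measurable_const (by simp) hG ht ξ
  have e1 : ∀ μ, conv (tot (q μ) t) (fd r μ t) ξ =
      conv (fun η => ((jb η ^ 2)⁻¹ : ℝ) * tot (q μ) t η) (fd r μ t) ξ -
        ∑ j : Fin 2, conv (fd (smoothField j (q μ)) j.succ t) (fd r μ t) ξ := by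
    intro μ
    rw [← conv_sum_left _ fun j _ => int (h2 j μ j.succ) (h0 μ)]
    simp only [conv, bil]
    rw [← integral_sub (int (h3 μ) (h0 μ))
      (int (EnSup.finset_sum _ fun j _ => h2 j μ j.succ) (h0 μ))]
    refine integral_congr_ae (ae_of_all _ fun η => ?_)
    simp only
    linear_combination fd r μ t (ξ - η) * tot_eq_sub_fd_smoothField (q μ) t η
  have e2 : ∀ j : Fin 2, ∑ μ, (metric μ : ℂ) * conv (fd (smoothField j (q μ)) μ t)
      (fd r j.succ t) ξ = 0 := by
    intro j
    simp only [← conv_const_mul_left]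
    rw [← conv_sum_left _ fun μ _ => int ((h2 j μ μ).const_mul _) (h0 j.succ)]
    simp only [conv, bil]
    refine integral_eq_zero_of_ae ?_
    filter_upwards [hL] with η hη
    have : ∑ μ, (metric μ : ℂ) * fd (smoothField j (q μ)) μ t η = 0 := by
      have e := congrArg (smoothSymbol j η * ·) hη
      simp only [Finset.mul_sum, mul_zero] at e
      rw [← e]
      refine Finset.sum_congr rfl fun μ _ => ?_
      rw [fd_smoothField]; ring
    rw [this, zero_mul, mul_zero]; rfl
  simp only [derivN, e1, nullBil]
  have e3 := e2 0
  have e4 := e2 1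
  simp only [Fin.sum_univ_three, Fin.sum_univ_two] at e3 e4 ⊢
  linear_combination -e3 - e4

theorem derivN_splits {a b : ℝ} (hab : a < b) {s₀ κ p z d : ℝ} {G : ℤˣ → ℝ → Plane → ℂ}
    {E : Fin 3 → ℤˣ → ℝ → Plane → ℂ}
    (hN : NullExp (1 / 2) κ s₀ p z d) (hs₀ : 1 / 50 ≤ s₀)
    (hr : HalfWave a b 1 (1 - κ) r G) (hq : ∀ μ, HalfWave a b (1 / 2) (1 / 2 - κ) (q μ) (E μ))
    (hL : ∀ᵐ t ∂(volume.restrict (Ioo a b)), ∀ᵐ η, ∑ μ, (metric μ : ℂ) * fd (q μ) μ t η = 0) :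
    Splits (Ioo a b) s₀ z d (derivN r q) := by
  have hI : (Ioo a b).OrdConnected := ordConnected_Ioo
  have fin : ∀ {s : ℝ} {F : ℝ → Plane → ℂ}, EnSup (Ioo a b) s F → EnInt (Ioo a b) s F :=
    fun h => h.enInt (by simp) measurableSet_Ioo
  have h0 : ∀ μ, EnSup (Ioo a b) 0 (fd r μ) := fun μ => by simpa using enSup_fd hr.sup μ
  have h3 : ∀ μ, EnSup (Ioo a b) (5 / 2) (fun t η => (((jb η ^ 2)⁻¹ : ℝ) : ℂ) * tot (q μ) t η) := by
    intro μ
    have h := (enSup_tot (hq μ).sup).jb_mul (-2)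
    have e : ∀ η, jb η ^ (-2 : ℝ) = (jb η ^ 2)⁻¹ := fun η => by
      rw [Real.rpow_neg (jb_pos η).le, Real.rpow_two]
    simp only [e] at h
    exact h.mono_exp (by norm_num)
  have hB : ∀ j μ, HalfWave a b (1 + 1 / 2) (1 + 1 / 2 - κ) (smoothField j (q μ))
      (fun σ t η => smoothSymbol j η * E μ σ t η) := fun j μ => by
    have h := (hq μ).symbol_mul (measurable_smoothSymbol j) ENNReal.one_ne_top
      (enorm_smoothSymbol_le j)
    rwa [show (1 : ℝ) / 2 - -1 = 1 + 1 / 2 by norm_num,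
      show 1 / 2 - κ - -1 = 1 + 1 / 2 - κ by ring] at h
  have s1 : Splits (Ioo a b) s₀ z d (fun t ξ => ∑ μ, (metric μ : ℂ) *
      conv (fun η => ((jb η ^ 2)⁻¹ : ℝ) * tot (q μ) t η) (fd r μ t) ξ) :=
    (EnInt.finset_sum _ fun μ _ => (fin (((h3 μ).conv (r := -(1 / 50)) (by norm_num) (by norm_num)
      (by norm_num) (by norm_num) (h0 μ)).mono_exp (by linarith))).const_mul _).splits
  have s2 := Splits.sum hI Finset.univ fun μ _ => Splits.sum hI Finset.univ fun j _ =>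
    (nullBil_splits hab hN (hB j μ) hr j.succ μ).const_mul (-metric μ : ℂ)
  refine (s1.add hI s2).congr ?_
  filter_upwards [hL, ae_restrict_mem measurableSet_Ioo] with t h1 ht
  refine ae_of_all _ fun ξ => ?_
  exact derivN_eq hr.sup (fun μ => (hq μ).sup) ht h1 ξ

end DerivN

/-! ### The regularity of solutions -/

/-- The value s₁ = 1/2 is the regularity of B above H^1, κ = 51/100 the crude loss, and s₀ lies just
below 1/3. Then `low` asks for p ≥ 51/65 and `deriv` for p < 4/5, which leaves 79/100. -/
theorem nullExp_higgs : NullExp (1 / 2) (51 / 100) (325 / 1000) (79 / 100) (4 / 5) (-(3 / 8)) := by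
  constructor <;> norm_num [HighCond] <;> exact ⟨1 / 100, by norm_num⟩

/-- Now s₁ = 0, so `deriv` forces d < -1, and s₀ lies just below 5/6. The condition `low` asks for p
≥ 5/6 and `force` for p < 40/47. With the crude loss κ = 51/100 `low` would ask for p ≥ 151/165,
which is incompatible; hence the prior improvement for φ. -/
theorem nullExp_current : NullExp 0 (3 / 8) (825 / 1000) (84 / 100) (17 / 100) (-(21 / 20)) := by
  constructor <;> norm_num [HighCond] <;> exact ⟨1 / 100, by norm_num⟩

theorem splitExp_higgs {ε : ℝ} (h0 : 0 < ε) (h1 : ε < 1 / 400) :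
    SplitExp (3 / 4 + ε) (3 / 4 - ε) 1 1 (675 / 1000) (5 / 8) (325 / 1000) (4 / 5) (-(3 / 8)) := by
  constructor <;> linarith

/-- The tightest condition is `first`, which reads 1/4 + ε ≤ 0.2525 + 0.33ε; the bound 1/400 on ε
leaves a margin. -/
theorem splitExp_potential {ε : ℝ} (h0 : 0 < ε) (h1 : ε < 1 / 400) :
    SplitExp (1 / 4 + ε) (3 / 4 - ε) (1 / 2) (1 / 2) (17 / 100) (-(1 / 20)) (825 / 1000) (17 / 100)
      (-(21 / 20)) := by
  constructor <;> linarith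

theorem IsFT.fourier_ae_eq {u : L2} {F : Plane → ℂ} (h : IsFT u F) :
    (𝓕 u : L2) =ᵐ[volume] F := by
  obtain ⟨h1, h2⟩ := h
  rwa [Lp.toLp_coeFn] at h2

theorem memBourgainOn_Ioo {a b : ℝ} (hab : a < b) {κ : ℝ} {V : Polynomial ℝ}
    {φ : ℤˣ → ℝ → L2} {A : Fin 3 → ℤˣ → ℝ → L2} (hφ : ∀ σ, IsContSobolev 1 (Ioo a b) (φ σ))
    (hA : ∀ μ σ, IsContSobolev (1 / 2) (Ioo a b) (A μ σ))
    (hsol : IsSolution κ V (Ioo a b) φ A) {ε : ℝ} (hε : 0 < ε) (hε' : ε < 1 / 400) :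
    (∀ σ, MemBourgainOn σ (3 / 4 + ε) (3 / 4 - ε) (Ioo a b) (φ σ)) ∧
      ∀ μ σ, MemBourgainOn σ (1 / 4 + ε) (3 / 4 - ε) (Ioo a b) (A μ σ) := by
  have fin : ∀ {s : ℝ} {F : ℝ → Plane → ℂ}, EnSup (Ioo a b) s F → EnInt (Ioo a b) s F :=
    fun h => h.enInt (by simp) measurableSet_Ioo
  have hI : (Ioo a b).OrdConnected := ordConnected_Ioo
  -- Adding the equations of the two signs cancels the sources, so the time derivative of the total
  -- field is known before any source is computed.
  obtain ⟨r, hr, hrp⟩ := exists_fieldRep_pair hab hφ fun θ hθ => by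
    rw [hsol.higgs_eq 1 θ hθ, hsol.higgs_eq (-1) θ hθ]
    push_cast
    ring
  have hq0 : ∀ μ, ∃ r : ℤˣ → ℝ → Plane → ℂ, (∀ σ, FieldRep (Ioo a b) (1 / 2) (A μ σ) (r σ)) ∧
      PrimAE (Ioo a b) (tot r) (fd r 0) := fun μ =>
    exists_fieldRep_pair hab (hA μ) fun θ hθ => by
      rw [hsol.potential_eq μ 1 θ hθ, hsol.potential_eq μ (-1) θ hθ]
      push_cast
      ring
  choose q hq hqp using hq0
  have hN : EnInt (Ioo a b) (-(51 / 100)) (sourceHat V r q) := fin (enSup_sourceHat V hr hq)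
  have hM : ∀ μ, EnInt (Ioo a b) (-(101 / 100)) (currentHat κ r q μ) := fun μ =>
    fin (enSup_currentHat κ (fun σ => (hr σ).sup) (fun μ σ => (hq μ σ).sup) μ)
  -- With the crude bound on the source, the weak equation is upgraded to an equation for almost
  -- every frequency, for new representatives equal to the old ones at each time.
  obtain ⟨w, hw, hwr, hwp⟩ := exists_halfWave hab hr hN fun ρ hρ χ hχ hs σ => by
    rw [hsol.higgs_eq σ _ (isTest_tens hχ hs _), japanese_tens,
      pairing_tens_freqPair (fun t ht => hasFT_sourceN V hr hq ht) χ (hasCompactSupport_jmul hρ _),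
      sgn, Complex.ofReal_intCast]
  have hv0 := fun μ => exists_halfWave hab (hq μ) (hM μ) fun ρ hρ χ hχ hs σ => by
    rw [hsol.potential_eq μ σ _ (isTest_tens hχ hs _), japanese_tens,
      pairM_tens hab κ hr hq hrp hqp μ hs (hasCompactSupport_jmul hρ _), sgn,
      Complex.ofReal_intCast]
  choose v hv hvq hvp using hv0
  have hws := fun σ => (hw σ).sup
  have hvs := fun μ σ => (hv μ σ).sup
  have hc : ∀ σ, Measurable fun η => Complex.I * sgn σ * jb η := fun σ => by fun_prop
  -- The sources are recomputed from the new representatives, so that fields and sources are built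
  -- from the same functions.
  have hNw : EnInt (Ioo a b) (-(51 / 100)) (sourceHat V w v) := fin (enSup_sourceHat V hw hv)
  have hMw : ∀ μ, EnInt (Ioo a b) (-(101 / 100)) (currentHat κ w v μ) := fun μ =>
    fin (enSup_currentHat κ hws hvs μ)
  have hwN : ∀ σ, PrimAE (Ioo a b) (w σ) (fun t η => Complex.I * sgn σ * jb η * w σ t η +
      -Complex.I * (sgn σ / 2) * ((jb η)⁻¹ : ℂ) * sourceHat V w v t η) := fun σ =>
    primAE_congr_source (hws σ) (hc σ) hN hNw (hwp σ) fun t ht =>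
      (hasFT_sourceN V hr hq ht).unique (hasFT_sourceN V hw hv ht)
  have hvM : ∀ μ σ, PrimAE (Ioo a b) (v μ σ) (fun t η => Complex.I * sgn σ * jb η * v μ σ t η +
      -Complex.I * (sgn σ / 2) * ((jb η)⁻¹ : ℂ) * currentHat κ w v μ t η) := fun μ σ =>
    primAE_congr_source (hvs μ σ) (hc σ) (hM μ) (hMw μ) (hvp μ σ) fun t ht =>
      currentHat_congr κ (fun σ => (hwr σ t ht).symm) (fun μ σ => (hvq μ σ t ht).symm) μ
  have hφ1 := halfWave_of_source hws hNw hwN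
  have hA1 := fun μ => halfWave_of_source (hvs μ) (hMw μ) (hvM μ)
  have hL := lorenz_ae hab hv (fun μ => (hA1 μ).primAE_tot) hsol.lorenz
  rw [show (1 : ℝ) + -(51 / 100) = 1 - 51 / 100 by norm_num] at hφ1
  rw [show (1 : ℝ) + -(101 / 100) = 1 / 2 - 51 / 100 by norm_num] at hA1
  -- First pass: the null structure of N, with the crude loss 51/100 for both φ and A.
  have hNS : Splits (Ioo a b) (325 / 1000) (4 / 5) (-(3 / 8)) (sourceHat V w v) :=
    ((derivN_splits hab nullExp_higgs (by norm_num) hφ1 hA1 hL).const_mul _).add hI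
      ((fin (enSup_lowerN V hw hv)).mono_exp (by norm_num)).splits
  -- Second pass: the splitting places N in L²H^{-3/8}, and the loss of φ improves to 3/8 before the
  -- null forms in M are treated.
  have hφ2 := halfWave_of_source hws (hNS.enInt (r := -(3 / 8)) hNw.1 (by norm_num) le_rfl) hwN
  rw [show (1 : ℝ) + -(3 / 8) = 1 - 3 / 8 by norm_num] at hφ2
  have hφ3 := hφ2.bar
  rw [← add_zero (1 : ℝ)] at hφ3
  have hMS : ∀ μ, Splits (Ioo a b) (825 / 1000) (17 / 100) (-(21 / 20)) (currentHat κ w v μ) :=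
    fun μ => (Splits.sum hI _ fun ν _ => Splits.sum hI _ fun ρ _ =>
      (nullBil_splits hab nullExp_current hφ3 hφ2 ν ρ).const_mul _).add hI
      ((fin (enSup_lowerM κ hws hvs μ)).mono_exp (by norm_num)).splits
  refine ⟨fun σ => ?_, fun μ σ => ?_⟩
  · refine (isBourgain_of_splits hab (splitExp_higgs hε hε') (hwN σ) (hws σ) hNw.1
      hNS).memBourgainOn (by linarith) (by linarith) ?_
    filter_upwards [ae_restrict_mem measurableSet_Ioo] with t ht
    exact ((hw σ).isFT t ht).fourier_ae_eq
  · refine (isBourgain_of_splits hab (splitExp_potential hε hε') (hvM μ σ) (hvs μ σ) (hMw μ).1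
      (hMS μ)).memBourgainOn (by linarith) (by linarith) ?_
    filter_upwards [ae_restrict_mem measurableSet_Ioo] with t ht
    exact ((hv μ σ).isFT t ht).fourier_ae_eq

/-! ### Reduction to open intervals -/

/-- An order-connected set is convex and so has a null frontier: endpoints affect neither test
functions nor integrals. -/
theorem interior_eq_Ioo {I : Set ℝ} (hI : I.OrdConnected) (hb : Bornology.IsBounded I)
    (hne : (interior I).Nonempty) : ∃ a b, a < b ∧ interior I = Ioo a b ∧
      volume.restrict I = volume.restrict (Ioo a b) := by
  have hc : Convex ℝ I := convex_iff_ordConnected.2 hI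
  have hbi := hb.subset interior_subset
  have hconn : IsConnected (interior I) := ⟨hne, hc.interior.isPreconnected⟩
  have hsub := hconn.Ioo_csInf_csSup_subset hbi.bddBelow hbi.bddAbove
  have hsub' := subset_Icc_csInf_csSup hbi.bddBelow hbi.bddAbove
  have heq : interior I = Ioo (sInf (interior I)) (sSup (interior I)) := by
    refine Subset.antisymm ?_ hsub
    rw [← interior_Icc]
    exact interior_maximal hsub' isOpen_interior
  refine ⟨sInf (interior I), sSup (interior I), ?_, heq, ?_⟩
  · obtain ⟨x, hx⟩ := hne
    rw [heq] at hx
    exact hx.1.trans hx.2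
  · rw [← heq]
    exact Measure.restrict_congr_set
      (interior_ae_eq_of_null_frontier (hc.addHaar_frontier volume)).symm

theorem IsContSobolev.mono {s : ℝ} {I J : Set ℝ} {u : ℝ → L2} (h : IsContSobolev s I u)
    (hJ : J ⊆ I) : IsContSobolev s J u := by
  obtain ⟨h1, h2, C, h3⟩ := h
  exact ⟨fun t ht => h1 t (hJ ht), h2.mono hJ, C, fun t ht => h3 t (hJ ht)⟩

/-- On an interval without interior the only test function is zero, so the zero distribution
represents every u. -/
theorem memBourgainOn_of_interior_eq_empty {σ : ℤˣ} {s b : ℝ} {I : Set ℝ} (h : interior I = ∅)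
    (u : ℝ → L2) : MemBourgainOn σ s b I u := by
  refine ⟨0, ⟨fun _ => 0, by simp, fun ψ => ?_⟩, fun θ hθ => ?_⟩
  · rw [FourierTransform.fourier_zero]; simp
  · obtain ⟨K, -, hK, hθ⟩ := hθ
    have h0 : ∀ y, θ y = 0 := fun y => hθ y fun hy => by
      have := hK hy
      rw [h] at this
      exact this
    simp [pairing, h0]

end ChernSimonsHiggs

end

/-! ### The proposition on a general bounded interval -/

theorem proposition2p3 :
    ∃ ε₀ : ℝ, 0 < ε₀ ∧
      ∀ (κ : ℝ), κ ≠ 0 → ∀ (V : Polynomial ℝ) (I : Set ℝ), I.OrdConnected → Bornology.IsBounded I →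
      ∀ (φ : ℤˣ → ℝ → ChernSimonsHiggs.L2) (A : Fin 3 → ℤˣ → ℝ → ChernSimonsHiggs.L2),
        (∀ σ, ChernSimonsHiggs.IsContSobolev 1 I (φ σ)) →
        (∀ μ σ, ChernSimonsHiggs.IsContSobolev (1 / 2) I (A μ σ)) →
        ChernSimonsHiggs.IsSolution κ V I φ A →
        ∀ ε : ℝ, 0 < ε → ε < ε₀ →
          (∀ σ, ChernSimonsHiggs.MemBourgainOn σ (3 / 4 + ε) (3 / 4 - ε) I (φ σ)) ∧
          (∀ μ σ, ChernSimonsHiggs.MemBourgainOn σ (1 / 4 + ε) (3 / 4 - ε) I (A μ σ)) := by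
  refine ⟨1 / 400, by norm_num, fun κ _ V I hI hb φ A hφ hA hsol ε hε hε' => ?_⟩
  rcases (interior I).eq_empty_or_nonempty with h | h
  · exact ⟨fun σ => ChernSimonsHiggs.memBourgainOn_of_interior_eq_empty h _,
      fun μ σ => ChernSimonsHiggs.memBourgainOn_of_interior_eq_empty h _⟩
  obtain ⟨a, b, hab, hab', hr⟩ := ChernSimonsHiggs.interior_eq_Ioo hI hb h
  have hsub : Set.Ioo a b ⊆ I := hab' ▸ interior_subset
  -- Hypotheses and conclusion see I only through its interior and the restricted measure, so the
  -- open interval may replace it.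
  have hT : ∀ θ, ChernSimonsHiggs.IsTest (Set.Ioo a b) θ ↔ ChernSimonsHiggs.IsTest I θ := fun θ => by
    rw [ChernSimonsHiggs.IsTest, ChernSimonsHiggs.IsTest, interior_Ioo, hab']
  have hp : ∀ u θ, ChernSimonsHiggs.pairing (Set.Ioo a b) u θ = ChernSimonsHiggs.pairing I u θ :=
    fun u θ => by rw [ChernSimonsHiggs.pairing, ChernSimonsHiggs.pairing, hr]
  have hpM : ∀ μ θ, ChernSimonsHiggs.pairM κ (Set.Ioo a b) φ A μ θ =
      ChernSimonsHiggs.pairM κ I φ A μ θ := fun μ θ => by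
    rw [ChernSimonsHiggs.pairM, ChernSimonsHiggs.pairM, hr]
  have hsol' : ChernSimonsHiggs.IsSolution κ V (Set.Ioo a b) φ A := by
    refine ⟨fun μ σ θ hθ => ?_, fun σ θ hθ => ?_, fun θ hθ => ?_⟩
    · rw [ChernSimonsHiggs.pairHalfWave, hp, hpM]
      exact hsol.potential_eq μ σ θ ((hT θ).1 hθ)
    · rw [ChernSimonsHiggs.pairHalfWave, hp, hp]
      exact hsol.higgs_eq σ θ ((hT θ).1 hθ)
    · simp only [hp]
      exact hsol.lorenz θ ((hT θ).1 hθ)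
  have hm : ∀ {σ s b'} {u : ℝ → ChernSimonsHiggs.L2},
      ChernSimonsHiggs.MemBourgainOn σ s b' (Set.Ioo a b) u →
        ChernSimonsHiggs.MemBourgainOn σ s b' I u := by
    rintro σ s b' u ⟨f, hf, h⟩
    exact ⟨f, hf, fun θ hθ => by rw [h θ ((hT θ).2 hθ), hp]⟩
  obtain ⟨h1, h2⟩ := ChernSimonsHiggs.memBourgainOn_Ioo hab (fun σ => (hφ σ).mono hsub)
    (fun μ σ => (hA μ σ).mono hsub) hsol' hε hε'
  exact ⟨fun σ => hm (h1 σ), fun μ σ => hm (h2 μ σ)⟩
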